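/- **Theorem.** Let $0<n<m$ be integers. All crystals are crystals for $U_q(\widehat{sl}_2)$ with weights in the principal gradation (both simple roots have degree $1$): $\tilde f_i$ lowers and $\tilde e_i$ raises the degree by $1$. Call $(a,b)\in\mathbb Z^2$ with $0\le a\le m-n$, $0\le b\le n$ a *domain*. **Paths.** Put $\bar p(k;a,b)=n-b$ for $k$ odd, $a+b$ for $k\equiv 0$, and $m-n-a+b$ for $k\equiv 2 \pmod 4$. $\mathcal P$ is the set of sequences $(p(k))_{k\in\mathbb Z}$, written $\cdots p(1)\,p(0)\,p(-1)\cdots$, with $p(k)\in\{0,\dots,n\}$ for odd $k$, $p(k)\in\{0,\dots,m\}$ for even $k$, and $p(k)=\bar p(k;a,b)$ for $k\gg0$, $p(k)=\bar p(k;a',b')$ for $k\ll0$, for some domains $(a,b)$, $(a',b')$. The action of $\tilde e_i,\tilde f_i$ is the signature rule: with $c_k=n$ ($k$ odd), $c_k=m$ ($k$ even), replace $p(k)$ by $1^{p(k)}0^{c_k-p(k)}$ if $i=1$ and by $1^{c_k-p(k)}0^{p(k)}$ if $i=0$, cancel all adjacent pairs $01$; then $\tilde f_i$ turns the leftmost remaining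 $0$ into $1$ and $\tilde e_i$ the rightmost remaining $1$ into $0$ (the result is $0$ if there is none); $\varphi_i,\varepsilon_i$ are the numbers of remaining $0$s and $1$s, and the classical weight is $\sum_i(\varphi_i-\varepsilon_i)\Lambda_i$. **Domain walls.** $\mathcal D$ is the set of maps $k\mapsto(a(k),b(k))$ from $\mathbb Z$ to the domains with finitely many walls (a wall at $k$ means that the domains $(a_2,b_2)$ at $k+1$ and $(a_1,b_1)$ at $k$ differ), where a wall at $k\equiv1\pmod 4$ requires $a_1=a_2=0,\ b_2>b_1$ or $a_1=a_2=m-n,\ b_2<b_1$, and a wall at $k\equiv3\pmod 4$ requires $a_1=a_2=0,\ b_2<b_1$ or $a_1=a_2=m-n,\ b_2>b_1$. The map $M_2:\mathcal D\to\mathcal P$ is $p(k)=\bar p(k;a(k),b(k))$. The map $M_1:\mathcal P\to\mathcal D$ is given, for each odd $k$, by: if $n\le p(k)+p(k+1)\le m$, then $b(k)=b(k+1)=n-p(k)$ and $a(k)=a(k+1)$ equals $m-p(k)-p(k+1)$ if $k\equiv1$, $p(k)+p(k+1)-n$ if $k\equiv3\pmod4$; if $p(k)+p(k+1)>m$, then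 $b(k+1)=p(k+1)-m+n$, $b(k)=n-p(k)$ and $a(k)=a(k+1)$ equals $0$ if $k\equiv1$, $m-n$ if $k\equiv3$; if $p(k)+p(k+1)<n$, then $b(k+1)=p(k+1)$, $b(k)=n-p(k)$ and $a(k)=a(k+1)$ equals $m-n$ if $k\equiv1$, $0$ if $k\equiv3$. $\mathcal D$ carries the action induced from $\mathcal P$ by these maps. Every wall $(a_2,b_2)(a_1,b_1)$ at $k$ is decomposed into an ordered word of elementary walls $|^{s}_{j}$ (for $(a+s,b)(a,b)$), $\lfloor^{t}_{j}$ (for $(0,b+t)(0,b)$), $\lceil^{t}_{j}$ (for $(m-n,b+t)(m-n,b)$), $\bullet^{s,t}$ (for $(a+s,b+t)(a,b)$), with $s,t=\pm$, $j\in\{0,1\}$. For $k\equiv 0$ the word is $(|^+_0)^{a_2}(\lfloor^+_0)^{b_2-b_1-a_1}(\bullet^{-+})^{a_1}$ if $b_2-b_1>a_1$; $(|^-_1)^{m-n-a_2}(\lceil^-_1)^{a_1+b_1-b_2-m+n}(\bullet^{+-})^{m-n-a_1}$ if $b_1-b_2>m-n-a_1$; otherwise $(|^+_0)^{a_2+b_2-a_1-b_1}$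 or $(|^-_1)^{a_1+b_1-a_2-b_2}$ (whichever exponent is nonnegative) followed by $(\bullet^{-+})^{b_2-b_1}$ or $(\bullet^{+-})^{b_1-b_2}$. For $k\equiv2$ it is $(|^+_1)^{a_2}(\lfloor^-_1)^{b_1-b_2-a_1}(\bullet^{--})^{a_1}$ if $b_1-b_2>a_1$; $(|^-_0)^{m-n-a_2}(\lceil^+_0)^{b_2-b_1+a_1-m+n}(\bullet^{++})^{m-n-a_1}$ if $b_2-b_1>m-n-a_1$; otherwise $(|^+_1)^{b_1-a_1-b_2+a_2}$ or $(|^-_0)^{b_2-a_2-b_1+a_1}$ followed by $(\bullet^{--})^{b_1-b_2}$ or $(\bullet^{++})^{b_2-b_1}$. For $k\equiv1$ it is $(\lfloor^+_1)^{b_2-b_1}$ if $a_1=0$ and $(\lceil^-_0)^{b_1-b_2}$ if $a_1=m-n$; for $k\equiv3$ it is $(\lfloor^-_0)^{b_1-b_2}$ if $a_1=0$ and $(\lceil^+_1)^{b_2-b_1}$ if $a_1=m-n$. The principal degree of an element of $\mathcal D$, and of the corresponding path, is the sum over its elementary walls of $-k/2$ for $|,\bullet$ and $-k$ for $\lfloor,\lceil$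 at $k$. **Particles.** Spin-$\frac12$ creation operators are $\psi^{(1/2)s}_{j,l}$ with $s\in\{\pm1\}$, $j\in\{0,1\}$, $l\in\mathbb Z$, $s(-1)^j=(-1)^l$; they map the domain $(a,b)$ to $(a+s,b)$. Spin-$0$ creation operators are $\psi^{(0)s,t}_{l}$ with $-st=(-1)^l$; they map $(a,b)$ to $(a+s,b+t)$. Let $\mathcal A$ be the complex vector space with basis the finite products of such operators, acting on a given initial domain, all of whose intermediate pairs are domains. Identifying $\psi^{(1/2)s}_{j,l}$ with $[j]\otimes[l]\in\mathrm{Aff}(B^{(1)})$ and $\psi^{(0)s,t}_l$ with $[0]\otimes[l]\in\mathrm{Aff}(B^{(0)})$ (affinizations in the principal gradation, $\tilde f_i([j]\otimes[l])=\tilde f_i[j]\otimes[l-1]$), this basis is a crystal by the tensor product rule. Let $\mathcal R\subset\mathcal A$ be spanned by the following relations for adjacent operators acting on a domain $(a,b)$: $$\psi^{(1/2)s}_{j,k}\psi^{(1/2)s'}_{j',l}=-\psi^{(1/2)s}_{j,l+\nu}\psi^{(1/2)s'}_{j',k-\nu},\quad \nu=\delta_{s,s'}+\delta_{j,j'};$$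 $$\psi^{(0)s,t}_{k}\psi^{(0)s',t'}_{l}=-\psi^{(0)s,t}_{l+\nu}\psi^{(0)s',t'}_{k-\nu},\quad \nu=\delta_{s,s'}+\delta_{t,t'};$$ $$\psi^{(0)s,t}_k\psi^{(1/2)s'}_{j,l}=\psi^{(1/2)s'}_{j,l}\psi^{(0)s,t}_k$$ if $s'=s$, or if $(s,s')=(+,-)$ and $a\ne m-n$, or if $(s,s')=(-,+)$ and $a\neq0$; and $$\psi^{(0)s,t}_k\psi^{(1/2)-s}_{j,l}=\psi^{(1/2)s}_{j,l+1}\psi^{(0)-s,t}_{k-1}$$ if $s=+$, $a=m-n$, or $s=-$, $a=0$. $\mathcal N$ is the set of *separately ordered* products: all $\psi^{(1/2)}$ stand to the left of all $\psi^{(0)}$, and two neighbours of the same kind either have strictly increasing lower index $l$ or are equal. $\mathcal N_o$ is the set of *normally ordered* products: every two neighbours are either of the same kind, with strictly increasing $l$ or equal; or $\psi^{(1/2)}_{j,k}\psi^{(0)}_l$ with $k\le l$; or $\psi^{(0)}_l\psi^{(1/2)}_{j,k}$ with $l<k$; or a *boundary pair* $\psi^{(1/2)-s}_{j,k}\psi^{(0)s,t}_{k-1}$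 or $\psi^{(0)-s,t}_{k}\psi^{(1/2)s}_{j,k}$ acting on a domain with $a=0$ (for $s=+$) or $a=m-n$ (for $s=-$); and no operator belongs to two boundary pairs (which is automatic if $m-n\ge2$). The action on $\mathcal N_o$ is: act as on $\mathcal A$, then replace the result by the normally ordered product equal to it up to sign in $\mathcal A/\mathcal R$. Weights, $\varepsilon_i$ and $\varphi_i$ on $\mathcal N_o$ are those of $\mathcal A$. **Claim.** 1. $\mathcal P$, $\mathcal D$, $\mathcal N_o$, the monomial basis of $\mathcal A$ and $\mathcal N$ are crystals; $\mathcal N$ is a subcrystal of the monomial basis of $\mathcal A$; and both $\mathcal N$ and $\mathcal N_o$ are bases of $\mathcal A/\mathcal R$. 2. $M_1:\mathcal P\to\mathcal D$ is an isomorphism of crystals with inverse $M_2$. 3. The following map is an isomorphism of crystals $\mathcal D\to\mathcal N_o$: list the elementary walls from left to right (positions $k$ decreasing) and replace $|^s_j\mapsto\psi^{(1/2)s}_{j,-k/2}$, $\bullet^{s,t}\mapsto\psi^{(0)s,t}_{-k/2}$; for even $k$, $\lfloor^t_j\mapsto\psi^{(0)-,t}_{-k/2}\psi^{(1/2)+}_{j,-k/2}$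 and $\lceil^t_j\mapsto\psi^{(0)+,t}_{-k/2}\psi^{(1/2)-}_{j,-k/2}$; for odd $k$, $\lfloor^t_j\mapsto\psi^{(1/2)-}_{j,-(k-1)/2}\psi^{(0)+,t}_{-(k+1)/2}$ and $\lceil^t_j\mapsto\psi^{(1/2)+}_{j,-(k-1)/2}\psi^{(0)-,t}_{-(k+1)/2}$; the initial domain is the domain at $k\ll0$. 4. There is an isomorphism of crystals $\mathcal N_o\to\mathcal N$ that sends each normally ordered product to a separately ordered product equal to it up to sign in $\mathcal A/\mathcal R$. 5. Consequently, $\mathcal P$ is the disjoint union, over the initial domains and over the sequences of superscripts of the $M$ spin-$\frac12$ and $N$ spin-$0$ operators of the corresponding elements of $\mathcal N$ ($M,N\ge0$), of subsets stable under $\tilde e_i,\tilde f_i$, each of which is isomorphic, by reading off the indices $(j,l)$ and $l$ of the operators, to a subcrystal of $\mathrm{Aff}(B^{(1)})^{\otimes M}\otimes\mathrm{Aff}(B^{(0)})^{\otimes N}$. Here each factor $\mathrm{Aff}(B^{(1)})$ is one of the two connected diagrams of elements $[j]\otimes[l]$ with $j+l$ of fixed parity, and in each factor $\mathrm{Aff}(B^{(0)})$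 the degree $l$ has fixed parity. -/

import Mathlib

open Filter

noncomputable section

namespace AltSpin

/-! ## Crystals for the affine algebra of type `A₁⁽¹⁾` -/

/-- A weight, given by its coefficients on the fundamental weights `Λ₀`, `Λ₁` and by its degree in
the principal gradation, in which both simple roots have degree `1`. -/
abbrev Weight : Type := ℤ × ℤ × ℤ

/-- `α₀ = 2Λ₀ - 2Λ₁ + δ` and `α₁ = 2Λ₁ - 2Λ₀`; both have principal degree `1`. -/
def simpleRoot (i : Fin 2) : Weight := if i = 0 then (2, -2, 1) else (-2, 2, 1)

/-- The pairing `⟨h_i, w⟩`. -/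
def pairing (i : Fin 2) (w : Weight) : ℤ := if i = 0 then w.1 else w.2.1

/-- The data of a crystal: the weight, the functions `ε_i`, `φ_i` and the Kashiwara operators; the
element `0` outside the crystal is `none`. The axioms are in `CrystalData.IsCrystal`. -/
structure CrystalData (B : Type) where
  wt : B → Weight
  ε : Fin 2 → B → ℕ
  φ : Fin 2 → B → ℕ
  e : Fin 2 → B → Option B
  f : Fin 2 → B → Option B

namespace CrystalData

variable {B B₁ B₂ : Type}

/-- The axioms of a (seminormal) crystal. The last four say that `ε_i` and `φ_i` are the lengths of
the `i`-string through `b` on either side of `b`. -/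
structure IsCrystal (C : CrystalData B) : Prop where
  e_iff_f : ∀ i b b', C.e i b = some b' ↔ C.f i b' = some b
  wt_f : ∀ i b b', C.f i b = some b' → C.wt b' = C.wt b - simpleRoot i
  pairing_wt : ∀ i b, pairing i (C.wt b) = (C.φ i b : ℤ) - C.ε i b
  ε_f : ∀ i b b', C.f i b = some b' → C.ε i b' = C.ε i b + 1
  φ_f : ∀ i b b', C.f i b = some b' → C.φ i b = C.φ i b' + 1
  e_eq_none : ∀ i b, C.e i b = none ↔ C.ε i b = 0
  f_eq_none : ∀ i b, C.f i b = none ↔ C.φ i b = 0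

/-- A bijection is an isomorphism of crystals if it respects all the structure. -/
structure IsIso (C₁ : CrystalData B₁) (C₂ : CrystalData B₂) (g : B₁ ≃ B₂) : Prop where
  wt : ∀ b, C₂.wt (g b) = C₁.wt b
  ε : ∀ i b, C₂.ε i (g b) = C₁.ε i b
  φ : ∀ i b, C₂.φ i (g b) = C₁.φ i b
  e : ∀ i b, C₂.e i (g b) = (C₁.e i b).map g
  f : ∀ i b, C₂.f i (g b) = (C₁.f i b).map g

/-- `S ∪ {0}` is closed under the Kashiwara operators, so that `S` is a subcrystal. -/
def Stable (C : CrystalData B) (S : Set B) : Prop :=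
  ∀ i, ∀ b ∈ S, ∀ b', (C.e i b = some b' → b' ∈ S) ∧ (C.f i b = some b' → b' ∈ S)

open Classical in
/-- The structure on a subset `S` obtained by restriction. -/
def restrict (C : CrystalData B) (S : Set B) : CrystalData S where
  wt b := C.wt b
  ε i b := C.ε i b
  φ i b := C.φ i b
  e i b := (C.e i b).bind fun b' => if h : b' ∈ S then some ⟨b', h⟩ else none
  f i b := (C.f i b).bind fun b' => if h : b' ∈ S then some ⟨b', h⟩ else none

end CrystalData

/-- If two words in `0`, `1` reduce to `1^x 0^y` and `1^x' 0^y'` on cancelling all adjacent pairs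
`01`, then their concatenation reduces to `1^X 0^Y` with `(X, Y) = cancel (x, y) (x', y')`. -/
def cancel (u v : ℕ × ℕ) : ℕ × ℕ := (u.1 + (v.1 - u.2), v.2 + (u.2 - v.1))

/-- The reduced form of a product `1^{x₁} 0^{y₁} 1^{x₂} 0^{y₂} ⋯`. -/
def reduce (l : List (ℕ × ℕ)) : ℕ × ℕ := l.foldr cancel (0, 0)

namespace CrystalData

variable {B B₁ B₂ : Type}

/-- The tensor product rule: `b` contributes the word `1^{ε_i(b)} 0^{φ_i(b)}`; after all adjacent
`01` are removed, `f_i` turns the leftmost `0` into `1` and `e_i` the rightmost `1` into `0`. -/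
def tensor (C₁ : CrystalData B₁) (C₂ : CrystalData B₂) : CrystalData (B₁ × B₂) where
  wt b := C₁.wt b.1 + C₂.wt b.2
  ε i b := (cancel (C₁.ε i b.1, C₁.φ i b.1) (C₂.ε i b.2, C₂.φ i b.2)).1
  φ i b := (cancel (C₁.ε i b.1, C₁.φ i b.1) (C₂.ε i b.2, C₂.φ i b.2)).2
  e i b := if C₂.ε i b.2 ≤ C₁.φ i b.1 then (C₁.e i b.1).map fun c => (c, b.2)
    else (C₂.e i b.2).map fun c => (b.1, c)
  f i b := if C₂.ε i b.2 < C₁.φ i b.1 then (C₁.f i b.1).map fun c => (c, b.2)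
    else (C₂.f i b.2).map fun c => (b.1, c)

/-- The pair `(ε_i, φ_i)` of `b₁ ⊗ ⋯ ⊗ b_M`. -/
def sig (C : CrystalData B) (i : Fin 2) (l : List B) : ℕ × ℕ :=
  reduce (l.map fun b => (C.ε i b, C.φ i b))

def listE (C : CrystalData B) (i : Fin 2) : List B → Option (List B)
  | [] => none
  | b :: l => if (C.sig i l).1 ≤ C.φ i b then (C.e i b).map fun c => c :: l
      else (listE C i l).map fun l' => b :: l'

def listF (C : CrystalData B) (i : Fin 2) : List B → Option (List B)
  | [] => none
  | b :: l => if (C.sig i l).1 < C.φ i b then (C.f i b).map fun c => c :: l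
      else (listF C i l).map fun l' => b :: l'

/-- The disjoint union over `M` of the tensor powers `B^{⊗M}`; the element `b₁ ⊗ ⋯ ⊗ b_M` is the
list `[b₁, …, b_M]`. -/
def tensorPowers (C : CrystalData B) : CrystalData (List B) where
  wt l := (l.map C.wt).sum
  ε i l := (C.sig i l).1
  φ i l := (C.sig i l).2
  e := C.listE
  f := C.listF

/-- The affinization in the principal gradation: `b ⊗ [k]` is `(b, k)`. -/
def aff (C : CrystalData B) : CrystalData (B × ℤ) where
  wt x := ((C.wt x.1).1, (C.wt x.1).2.1, x.2)
  ε i x := C.ε i x.1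
  φ i x := C.φ i x.1
  e i x := (C.e i x.1).map fun b => (b, x.2 + 1)
  f i x := (C.f i x.1).map fun b => (b, x.2 - 1)

end CrystalData

def stepUp (l : ℕ) (j : Fin (l + 1)) : Option (Fin (l + 1)) :=
  if h : j.val + 1 < l + 1 then some ⟨j.val + 1, h⟩ else none

def stepDown (l : ℕ) (j : Fin (l + 1)) : Option (Fin (l + 1)) :=
  if 0 < j.val then some ⟨j.val - 1, lt_of_le_of_lt (Nat.sub_le _ _) j.isLt⟩ else none

/-- The classical crystal `B^{(l)}` of the `(l+1)`-dimensional module: `f₁` and `e₀` send `[j]` to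
`[j+1]`, while `f₀` and `e₁` send `[j]` to `[j-1]`. The degree of a classical weight is a dummy. -/
def finCrystal (l : ℕ) : CrystalData (Fin (l + 1)) where
  wt j := (2 * (j.val : ℤ) - l, l - 2 * (j.val : ℤ), 0)
  ε i j := if i = 1 then j.val else l - j.val
  φ i j := if i = 1 then l - j.val else j.val
  e i j := if i = 1 then stepDown l j else stepUp l j
  f i j := if i = 1 then stepUp l j else stepDown l j

/-- `Aff(B^{(1)})`, as the disjoint union of the two connected diagrams, in which `j + k` is even
and odd, respectively. -/
def affHalf : CrystalData (Fin 2 × ℤ) := (finCrystal 1).aff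

/-- `Aff(B^{(0)})`. -/
def affZero : CrystalData (Fin 1 × ℤ) := (finCrystal 0).aff

/-! ## Double-infinite paths -/

/-- The pair `(a, b)` labels a ground state. -/
def InRange (m n : ℤ) (x : ℤ × ℤ) : Prop := 0 ≤ x.1 ∧ x.1 ≤ m - n ∧ 0 ≤ x.2 ∧ x.2 ≤ n

/-- The largest value of the spin variable at `k`. -/
def cap (m n k : ℤ) : ℤ := if k % 2 = 1 then n else m

/-- The ground state path `p̄(k; a, b)`. -/
def ground (m n k : ℤ) (x : ℤ × ℤ) : ℤ :=
  if k % 2 = 1 then n - x.2 else if k % 4 = 0 then x.1 + x.2 else m - n - x.1 + x.2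

/-- `p` lies in one of the sets `P_{a,b;a',b'}`. -/
structure IsPath (m n : ℤ) (p : ℤ → ℤ) : Prop where
  bounds : ∀ k, 0 ≤ p k ∧ p k ≤ cap m n k
  left : ∃ x, InRange m n x ∧ ∀ᶠ k in atTop, p k = ground m n k x
  right : ∃ x, InRange m n x ∧ ∀ᶠ k in atBot, p k = ground m n k x

/-- The set `𝒫` of double-infinite paths `⋯ p(2) p(1) p(0) p(-1) ⋯`. -/
abbrev SpinPath (m n : ℤ) : Type := {p : ℤ → ℤ // IsPath m n p}

/-- The word `1^x 0^y` at the position `k`, as the pair `(x, y)`. -/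
def letters (m n : ℤ) (p : ℤ → ℤ) (i : Fin 2) (k : ℤ) : ℕ × ℕ :=
  if i = 1 then ((p k).toNat, (cap m n k - p k).toNat) else ((cap m n k - p k).toNat, (p k).toNat)

/-- The number of `0`s that survive the cancellation within the half-infinite word
`⋯ p(k+2) p(k+1)`; the number for `p(k+r) ⋯ p(k+1)` increases with `r` and is eventually constant
for a path in `𝒫`. -/
def zerosLeft (m n : ℤ) (p : ℤ → ℤ) (i : Fin 2) (k : ℤ) : ℕ :=
  ⨆ r : ℕ, (reduce (((List.range r).reverse).map fun t => letters m n p i (k + 1 + t))).2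

/-- The number of `1`s that survive the cancellation within `p(k-1) p(k-2) ⋯`. -/
def onesRight (m n : ℤ) (p : ℤ → ℤ) (i : Fin 2) (k : ℤ) : ℕ :=
  ⨆ r : ℕ, (reduce ((List.range r).map fun t => letters m n p i (k - 1 - t))).1

/-- The number of `1`s at the position `k` that survive the cancellation in the whole path. -/
def freeOnes (m n : ℤ) (p : ℤ → ℤ) (i : Fin 2) (k : ℤ) : ℕ :=
  (letters m n p i k).1 - zerosLeft m n p i k

/-- The number of `0`s at the position `k` that survive the cancellation in the whole path. -/
def freeZeros (m n : ℤ) (p : ℤ → ℤ) (i : Fin 2) (k : ℤ) : ℕ :=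
  (letters m n p i k).2 - onesRight m n p i k

/-- The change of `p(k)` when a `0` of the word at `k` is turned into `1`. -/
def change (i : Fin 2) : ℤ := if i = 1 then 1 else -1

theorem IsPath.update {m n : ℤ} {p : ℤ → ℤ} (hp : IsPath m n p) (k v : ℤ) (h0 : 0 ≤ v)
    (h1 : v ≤ cap m n k) : IsPath m n (Function.update p k v) := by
  obtain ⟨hb, ⟨x, hx, hl⟩, ⟨y, hy, hr⟩⟩ := hp
  refine ⟨fun j => ?_, ⟨x, hx, ?_⟩, ⟨y, hy, ?_⟩⟩
  · by_cases hj : j = k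
    · subst hj; simpa using ⟨h0, h1⟩
    · simpa [Function.update_of_ne hj] using hb j
  · filter_upwards [hl, eventually_ne_atTop k] with j h1 h2
    rw [Function.update_of_ne h2, h1]
  · filter_upwards [hr, eventually_ne_atBot k] with j h1 h2
    rw [Function.update_of_ne h2, h1]

theorem isPath_f {m n : ℤ} {p : ℤ → ℤ} (hp : IsPath m n p) {i : Fin 2} {k : ℤ}
    (h : 0 < freeZeros m n p i k) : IsPath m n (Function.update p k (p k + change i)) := by
  have hb := hp.bounds k
  apply hp.update <;> unfold freeZeros letters at h <;> unfold change <;> split_ifs at h ⊢ <;>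
    simp only at h <;> omega

theorem isPath_e {m n : ℤ} {p : ℤ → ℤ} (hp : IsPath m n p) {i : Fin 2} {k : ℤ}
    (h : 0 < freeOnes m n p i k) : IsPath m n (Function.update p k (p k - change i)) := by
  have hb := hp.bounds k
  apply hp.update <;> unfold freeOnes letters at h <;> unfold change <;> split_ifs at h ⊢ <;>
    simp only at h <;> omega

open Classical in
/-- `f_i` turns the leftmost surviving `0` into `1`; positions decrease from left to right. -/
def pathF (m n : ℤ) (i : Fin 2) (p : SpinPath m n) : Option (SpinPath m n) :=
  if h : ∃ k, IsGreatest {k | 0 < freeZeros m n p.1 i k} k then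
    some ⟨Function.update p.1 h.choose (p.1 h.choose + change i), isPath_f p.2 h.choose_spec.1⟩
  else none

open Classical in
/-- `e_i` turns the rightmost surviving `1` into `0`. -/
def pathE (m n : ℤ) (i : Fin 2) (p : SpinPath m n) : Option (SpinPath m n) :=
  if h : ∃ k, IsLeast {k | 0 < freeOnes m n p.1 i k} k then
    some ⟨Function.update p.1 h.choose (p.1 h.choose - change i), isPath_e p.2 h.choose_spec.1⟩
  else none

def pathε (m n : ℤ) (i : Fin 2) (p : SpinPath m n) : ℕ := ∑ᶠ k, freeOnes m n p.1 i k

def pathφ (m n : ℤ) (i : Fin 2) (p : SpinPath m n) : ℕ := ∑ᶠ k, freeZeros m n p.1 i k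

/-! ## Domain walls -/

/-- The condition on a wall at `k` with the domain `y` on its left and `x` on its right. -/
def WallAllowed (m n k : ℤ) (y x : ℤ × ℤ) : Prop :=
  k % 2 = 0 ∨
  (k % 4 = 1 ∧ ((y.1 = 0 ∧ x.1 = 0 ∧ x.2 < y.2) ∨ (y.1 = m - n ∧ x.1 = m - n ∧ y.2 < x.2))) ∨
  (k % 4 = 3 ∧ ((y.1 = 0 ∧ x.1 = 0 ∧ y.2 < x.2) ∨ (y.1 = m - n ∧ x.1 = m - n ∧ x.2 < y.2)))

/-- The positions `k` of the domain walls: the domains at `k + 1` and at `k` differ. -/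
def walls (d : ℤ → ℤ × ℤ) : Set ℤ := {k | d (k + 1) ≠ d k}

/-- A sequence of domains with finitely many walls, written as the function that assigns to each
position `k` its domain `(a(k), b(k))`. -/
structure IsDomainSeq (m n : ℤ) (d : ℤ → ℤ × ℤ) : Prop where
  inRange : ∀ k, InRange m n (d k)
  finite : (walls d).Finite
  allowed : ∀ k ∈ walls d, WallAllowed m n k (d (k + 1)) (d k)

/-- The set `𝒟`. -/
abbrev DomainSeq (m n : ℤ) : Type := {d : ℤ → ℤ × ℤ // IsDomainSeq m n d}

/-- For odd `k`, the domains at `k + 1` and at `k` (in this order) of a path with values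
`P = p(k+1)` and `Q = p(k)`. -/
def domainPair (m n k P Q : ℤ) : (ℤ × ℤ) × (ℤ × ℤ) :=
  if n ≤ P + Q ∧ P + Q ≤ m then
    ((if k % 4 = 1 then m - Q - P else Q + P - n, n - Q),
     (if k % 4 = 1 then m - Q - P else Q + P - n, n - Q))
  else if m < P + Q then
    ((if k % 4 = 1 then 0 else m - n, P - m + n), (if k % 4 = 1 then 0 else m - n, n - Q))
  else ((if k % 4 = 1 then m - n else 0, P), (if k % 4 = 1 then m - n else 0, n - Q))

/-- The domain associated with the position `k` of a path. -/
def domainAt (m n : ℤ) (p : ℤ → ℤ) (k : ℤ) : ℤ × ℤ :=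
  if k % 2 = 1 then (domainPair m n k (p (k + 1)) (p k)).2
  else (domainPair m n (k - 1) (p k) (p (k - 1))).1

theorem domainAt_ground {m n : ℤ} {p : ℤ → ℤ} {k : ℤ} {x : ℤ × ℤ} (hx : InRange m n x)
    (h0 : p (k - 1) = ground m n (k - 1) x) (h1 : p k = ground m n k x)
    (h2 : p (k + 1) = ground m n (k + 1) x) : domainAt m n p k = x := by
  obtain ⟨a, b⟩ := x
  unfold InRange at hx
  unfold ground at h0 h1 h2
  unfold domainAt domainPair
  simp only at *
  split_ifs at h0 h1 h2 ⊢ <;> simp only [Prod.mk.injEq] <;> omega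

theorem isDomainSeq_domainAt {m n : ℤ} (h : 0 < n ∧ n < m) {p : ℤ → ℤ} (hp : IsPath m n p) :
    IsDomainSeq m n (domainAt m n p) := by
  obtain ⟨hb, ⟨x, hx, hl⟩, ⟨y, hy, hr⟩⟩ := hp
  refine ⟨fun k => ?_, ?_, fun k hk => ?_⟩
  · have h1 := hb k
    have h2 := hb (k + 1)
    have h3 := hb (k - 1)
    unfold cap at h1 h2 h3
    unfold InRange domainAt domainPair
    split_ifs at h1 h2 h3 ⊢ <;> simp only <;> omega
  · obtain ⟨K, hK⟩ := eventually_atTop.1 hl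
    obtain ⟨J, hJ⟩ := eventually_atBot.1 hr
    refine (Set.finite_Icc (J - 3) (K + 3)).subset fun k hk => ?_
    by_contra hc
    apply hk
    rcases lt_or_ge k (J - 3) with hlt | hge
    · rw [domainAt_ground hy (hJ _ (by omega)) (hJ _ (by omega)) (hJ _ (by omega)),
        domainAt_ground hy (hJ _ (by omega)) (hJ _ (by omega)) (hJ _ (by omega))]
    · have : K + 3 < k := by
        by_contra h'
        exact hc ⟨hge, by omega⟩
      rw [domainAt_ground hx (hK _ (by omega)) (hK _ (by omega)) (hK _ (by omega)),
        domainAt_ground hx (hK _ (by omega)) (hK _ (by omega)) (hK _ (by omega))]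
  · by_cases he : k % 2 = 0
    · exact Or.inl he
    · have hk' : domainAt m n p (k + 1) ≠ domainAt m n p k := hk
      have e1 : k % 2 = 1 := by omega
      have e2 : ¬ (k + 1) % 2 = 1 := by omega
      have h1 := hb k
      have h2 := hb (k + 1)
      simp only [cap, e1, e2, if_true, if_false] at h1 h2
      simp only [domainAt, e1, e2, if_true, if_false, add_sub_cancel_right] at hk' ⊢
      unfold WallAllowed
      unfold domainPair at hk' ⊢
      split_ifs at hk' ⊢ <;> simp only [ne_eq, not_true_eq_false] at hk' ⊢ <;>
        simp only [Prod.mk.injEq, not_and, true_implies] at hk' <;> simp only [true_and] <;> omega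

/-- The map `M₁` from paths to sequences of domains. -/
def toDomains {m n : ℤ} (h : 0 < n ∧ n < m) (p : SpinPath m n) : DomainSeq m n :=
  ⟨domainAt m n p.1, isDomainSeq_domainAt h p.2⟩

theorem isPath_ground {m n : ℤ} {d : ℤ → ℤ × ℤ} (hd : IsDomainSeq m n d) :
    IsPath m n fun k => ground m n k (d k) := by
  obtain ⟨hr, hf, -⟩ := hd
  refine ⟨fun k => ?_, ?_, ?_⟩
  · have := hr k
    unfold InRange at this
    unfold ground cap
    split_ifs <;> omega
  · obtain ⟨K, hK⟩ := hf.bddAbove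
    have key : ∀ k, K + 1 ≤ k → d k = d (K + 1) := by
      intro k hk
      induction k, hk using Int.leInduction with
      | base => rfl
      | succ k hk ih =>
        by_contra hc
        have : k ∈ walls d := fun h' => hc (h'.trans ih)
        have := hK this
        omega
    refine ⟨d (K + 1), hr _, ?_⟩
    filter_upwards [eventually_ge_atTop (K + 1)] with k hk
    rw [key k hk]
  · obtain ⟨K, hK⟩ := hf.bddBelow
    have key : ∀ k, k ≤ K → d k = d K := by
      intro k hk
      induction k, hk using Int.leInductionDown with
      | base => rfl
      | pred k hk ih =>
        by_contra hc
        have : k - 1 ∈ walls d := fun h' => hc (by rw [← h', sub_add_cancel, ih])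
        have := hK this
        omega
    refine ⟨d K, hr _, ?_⟩
    filter_upwards [eventually_le_atBot K] with k hk
    rw [key k hk]

/-- The map `M₂` from sequences of domains to paths. -/
def toPath {m n : ℤ} (d : DomainSeq m n) : SpinPath m n :=
  ⟨fun k => ground m n k (d.1 k), isPath_ground d.2⟩

/-- Elementary domain walls. The index `j` is `0` or `1`, and the superscripts are signs.
* `line s j` is the spin-1/2 wall `(a+s, b)(a, b)`;
* `bottom t j` is the spin-1/2 wall `(0, b+t)(0, b)`;
* `top t j` is the spin-1/2 wall `(m-n, b+t)(m-n, b)`;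
* `bullet s t` is the spin-0 wall `(a+s, b+t)(a, b)`. -/
inductive Elem : Type
  | line (s : ℤˣ) (j : Fin 2)
  | bottom (t : ℤˣ) (j : Fin 2)
  | top (t : ℤˣ) (j : Fin 2)
  | bullet (s t : ℤˣ)

/-- `c` copies of the wall `w`, none if `c` is negative. -/
def copies (c : ℤ) (w : Elem) : List Elem := List.replicate c.toNat w

open Elem in
/-- The ordered decomposition, from left to right, of the wall at `k` with the domain `y` on its
left and `x` on its right into elementary walls. -/
def wallWord (m n k : ℤ) (y x : ℤ × ℤ) : List Elem :=
  if k % 4 = 0 then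
    if x.1 < y.2 - x.2 then
      copies y.1 (line 1 0) ++ copies (y.2 - x.2 - x.1) (bottom 1 0) ++ copies x.1 (bullet (-1) 1)
    else if m - n - x.1 < x.2 - y.2 then
      copies (m - n - y.1) (line (-1) 1) ++ copies (x.1 + x.2 - y.2 - m + n) (top (-1) 1) ++
        copies (m - n - x.1) (bullet 1 (-1))
    else
      copies (y.1 + y.2 - x.1 - x.2) (line 1 0) ++ copies (x.1 + x.2 - y.1 - y.2) (line (-1) 1) ++
        copies (y.2 - x.2) (bullet (-1) 1) ++ copies (x.2 - y.2) (bullet 1 (-1))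
  else if k % 4 = 1 then
    if x.1 = 0 then copies (y.2 - x.2) (bottom 1 1) else copies (x.2 - y.2) (top (-1) 0)
  else if k % 4 = 2 then
    if x.1 < x.2 - y.2 then
      copies y.1 (line 1 1) ++ copies (x.2 - y.2 - x.1) (bottom (-1) 1) ++
        copies x.1 (bullet (-1) (-1))
    else if m - n - x.1 < y.2 - x.2 then
      copies (m - n - y.1) (line (-1) 0) ++ copies (y.2 - x.2 + x.1 - m + n) (top 1 0) ++
        copies (m - n - x.1) (bullet 1 1)
    else
      copies (x.2 - x.1 - y.2 + y.1) (line 1 1) ++ copies (y.2 - y.1 - x.2 + x.1) (line (-1) 0) ++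
        copies (x.2 - y.2) (bullet (-1) (-1)) ++ copies (y.2 - x.2) (bullet 1 1)
  else
    if x.1 = 0 then copies (x.2 - y.2) (bottom (-1) 0) else copies (y.2 - x.2) (top 1 1)

/-- The principal degree of an elementary wall at `k`. -/
def Elem.degree (k : ℤ) : Elem → ℤ
  | line _ _ => -(k / 2)
  | bottom _ _ => -k
  | top _ _ => -k
  | bullet _ _ => -(k / 2)

/-- The principal degree of a sequence of domains; trivial walls have an empty decomposition. -/
def domainDegree (m n : ℤ) (d : ℤ → ℤ × ℤ) : ℤ :=
  ∑ᶠ k, ((wallWord m n k (d (k + 1)) (d k)).map (Elem.degree k)).sum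

/-- The crystal `𝒫`. -/
def pathCrystal (m n : ℤ) : CrystalData (SpinPath m n) where
  wt p := ((pathφ m n 0 p : ℤ) - pathε m n 0 p, (pathφ m n 1 p : ℤ) - pathε m n 1 p,
    domainDegree m n (domainAt m n p.1))
  ε := pathε m n
  φ := pathφ m n
  e := pathE m n
  f := pathF m n

/-- The crystal `𝒟`, with the crystal action induced from `𝒫`. -/
def domainCrystal {m n : ℤ} (h : 0 < n ∧ n < m) : CrystalData (DomainSeq m n) where
  wt d := (((pathCrystal m n).wt (toPath d)).1, ((pathCrystal m n).wt (toPath d)).2.1,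
    domainDegree m n d.1)
  ε i d := pathε m n i (toPath d)
  φ i d := pathφ m n i (toPath d)
  e i d := (pathE m n i (toPath d)).map (toDomains h)
  f i d := (pathF m n i (toPath d)).map (toDomains h)

/-! ## Particles -/

/-- `half s j l` is the creation operator `ψ^{(1/2)s}_{j,l}`, and `zero s t l` is
`ψ^{(0)s,t}_l`. -/
inductive Particle : Type
  | half (s : ℤˣ) (j : Fin 2) (l : ℤ)
  | zero (s t : ℤˣ) (l : ℤ)

namespace Particle

/-- The index conditions under which the operators are defined. -/
def Meaningful : Particle → Prop
  | half s j l => s * (-1) ^ j.val = (-1) ^ l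
  | zero s t l => -(s * t) = (-1) ^ l

/-- The change of the highest weight `(a, b)`. -/
def act : Particle → ℤ × ℤ → ℤ × ℤ
  | half s _ _, x => (x.1 + s, x.2)
  | zero s t _, x => (x.1 + s, x.2 + t)

end Particle

open Particle

/-- The crystal structure on particles: `half s j l` is the element `[j] ⊗ [l]` of `Aff(B^{(1)})`
and `zero s t l` is the element `[0] ⊗ [l]` of `Aff(B^{(0)})`. -/
def particleCrystal : CrystalData Particle where
  wt
    | half _ j l => affHalf.wt (j, l)
    | zero _ _ l => affZero.wt (0, l)
  ε i
    | half _ j l => affHalf.ε i (j, l)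
    | zero _ _ l => affZero.ε i (0, l)
  φ i
    | half _ j l => affHalf.φ i (j, l)
    | zero _ _ l => affZero.φ i (0, l)
  e i
    | half s j l => (affHalf.e i (j, l)).map fun x => half s x.1 x.2
    | zero s t l => (affZero.e i (0, l)).map fun x => zero s t x.2
  f i
    | half s j l => (affHalf.f i (j, l)).map fun x => half s x.1 x.2
    | zero s t l => (affZero.f i (0, l)).map fun x => zero s t x.2

/-- A product of particles (written from left to right) together with the domain on which it
acts. -/
abbrev State : Type := (ℤ × ℤ) × List Particle

/-- The domain that results when the particles in the list act, from right to left, on `x`. -/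
def target (x : ℤ × ℤ) (l : List Particle) : ℤ × ℤ := l.foldr act x

/-- All indices are meaningful and all domains that occur are in the allowed range. -/
structure Valid (m n : ℤ) (z : State) : Prop where
  meaningful : ∀ A ∈ z.2, A.Meaningful
  inRange : ∀ v, v <:+ z.2 → InRange m n (target z.1 v)

/-- The monomial basis of `𝒜`, for all numbers of particles and all domains at once. -/
abbrev Mono (m n : ℤ) : Type := {z : State // z ∈ {z : State | Valid m n z}}

/-- The tensor product crystal structure on sequences of particles with a fixed domain. -/
def stateCrystal : CrystalData State where
  wt z := particleCrystal.tensorPowers.wt z.2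
  ε i z := particleCrystal.tensorPowers.ε i z.2
  φ i z := particleCrystal.tensorPowers.φ i z.2
  e i z := (particleCrystal.tensorPowers.e i z.2).map fun l => (z.1, l)
  f i z := (particleCrystal.tensorPowers.f i z.2).map fun l => (z.1, l)

/-- The crystal part of `𝒜`. -/
def monoCrystal (m n : ℤ) : CrystalData (Mono m n) :=
  stateCrystal.restrict {z | Valid m n z}

/-- `Exchange m n a A B c C D` is the commutation relation `A B = c · C D` of particles acting on a
domain `(a, b)`. -/
inductive Exchange (m n a : ℤ) : Particle → Particle → ℤ → Particle → Particle → Prop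
  | half_half (s s' : ℤˣ) (j j' : Fin 2) (k l ν : ℤ)
      (hν : ν = (if s = s' then 1 else 0) + (if j = j' then 1 else 0)) :
      Exchange m n a (half s j k) (half s' j' l) (-1) (half s j (l + ν)) (half s' j' (k - ν))
  | zero_zero (s s' t t' : ℤˣ) (k l ν : ℤ)
      (hν : ν = (if s = s' then 1 else 0) + (if t = t' then 1 else 0)) :
      Exchange m n a (zero s t k) (zero s' t' l) (-1) (zero s t (l + ν)) (zero s' t' (k - ν))
  | same (s t : ℤˣ) (j : Fin 2) (k l : ℤ) :
      Exchange m n a (zero s t k) (half s j l) 1 (half s j l) (zero s t k)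
  | plus_minus (t : ℤˣ) (j : Fin 2) (k l : ℤ) (ha : a ≠ m - n) :
      Exchange m n a (zero 1 t k) (half (-1) j l) 1 (half (-1) j l) (zero 1 t k)
  | plus_minus_boundary (t : ℤˣ) (j : Fin 2) (k l : ℤ) (ha : a = m - n) :
      Exchange m n a (zero 1 t k) (half (-1) j l) 1 (half 1 j (l + 1)) (zero (-1) t (k - 1))
  | minus_plus (t : ℤˣ) (j : Fin 2) (k l : ℤ) (ha : a ≠ 0) :
      Exchange m n a (zero (-1) t k) (half 1 j l) 1 (half 1 j l) (zero (-1) t k)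
  | minus_plus_boundary (t : ℤˣ) (j : Fin 2) (k l : ℤ) (ha : a = 0) :
      Exchange m n a (zero (-1) t k) (half 1 j l) 1 (half (-1) j (l + 1)) (zero 1 t (k - 1))

/-- The subspace `ℛ` of the space `𝒜` with basis `Mono m n` spanned by the commutation relations
applied to adjacent particles. -/
def relations (m n : ℤ) : Submodule ℂ (Mono m n →₀ ℂ) :=
  Submodule.span ℂ {w | ∃ (y z : Mono m n) (x : ℤ × ℤ) (u v : List Particle) (A B C D : Particle)
    (c : ℤ), y.1 = (x, u ++ A :: B :: v) ∧ z.1 = (x, u ++ C :: D :: v) ∧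
      Exchange m n (target x v).1 A B c C D ∧
      w = Finsupp.single y 1 - Finsupp.single z (c : ℂ)}

/-- The class in `𝒜/ℛ` of a product of particles. -/
def vec {m n : ℤ} (z : Mono m n) : (Mono m n →₀ ℂ) ⧸ relations m n :=
  (relations m n).mkQ (Finsupp.single z 1)

/-- The order condition on two successive particles in a separately ordered sequence. -/
def SepPair : Particle → Particle → Prop
  | half s j k, half s' j' k' => k < k' ∨ (k = k' ∧ s = s' ∧ j = j')
  | zero s t k, zero s' t' k' => k < k' ∨ (k = k' ∧ s = s' ∧ t = t')
  | half _ _ _, zero _ _ _ => True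
  | zero _ _ _, half _ _ _ => False

/-- The set `𝒩` of separately ordered sequences: all spin-1/2 particles are on the left of all
spin-0 particles, and both groups are ordered. -/
def separatelyOrdered (m n : ℤ) : Set (Mono m n) := {z | z.1.2.IsChain SepPair}

/-- The crystal `𝒩`. -/
def sepCrystal (m n : ℤ) : CrystalData (separatelyOrdered m n) :=
  (monoCrystal m n).restrict (separatelyOrdered m n)

/-- A pair of particles placed at the boundary `a = 0` or `a = m - n` of the range of the domain
`(a, b)` on which it acts, whose two particles belong together. -/
def BoundaryPair (m n a : ℤ) : Particle → Particle → Prop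
  | half s' _ k, zero s _ l =>
      s' = -s ∧ l = k - 1 ∧ ((s = 1 ∧ a = 0) ∨ (s = -1 ∧ a = m - n))
  | zero s' _ l, half s _ k =>
      s' = -s ∧ l = k ∧ ((s = 1 ∧ a = 0) ∨ (s = -1 ∧ a = m - n))
  | _, _ => False

/-- The order condition on two successive particles in a normally ordered sequence. -/
def NormPair (m n a : ℤ) : Particle → Particle → Prop
  | zero s t k, zero s' t' k' => k < k' ∨ (k = k' ∧ s = s' ∧ t = t')
  | half s j k, half s' j' k' => k < k' ∨ (k = k' ∧ s = s' ∧ j = j')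
  | half s j k, zero s' t l => k ≤ l ∨ BoundaryPair m n a (half s j k) (zero s' t l)
  | zero s t l, half s' j k => l < k ∨ BoundaryPair m n a (zero s t l) (half s' j k)

/-- The set `𝒩_o` of normally ordered sequences. The second condition, that no particle belongs to
two boundary pairs, can fail only for `m - n = 1`, and then the product is zero in `𝒜/ℛ`. -/
def normallyOrdered (m n : ℤ) : Set (Mono m n) :=
  {z | (∀ u v A B, z.1.2 = u ++ A :: B :: v → NormPair m n (target z.1.1 v).1 A B) ∧
    ∀ u v A B C, z.1.2 = u ++ A :: B :: C :: v →
      ¬ (BoundaryPair m n (target z.1.1 (C :: v)).1 A B ∧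
        BoundaryPair m n (target z.1.1 v).1 B C)}

/-- Two products of particles agree in `𝒜/ℛ` up to a sign. -/
def SameUpToSign {m n : ℤ} (y z : Mono m n) : Prop := vec y = vec z ∨ vec y = -vec z

open Classical in
/-- Normal ordering modulo sign by means of the commutation relations. -/
def normalOrder {m n : ℤ} (z : Mono m n) : Option (normallyOrdered m n) :=
  if h : ∃ y : normallyOrdered m n, SameUpToSign z y.1 then some h.choose else none

/-- The crystal `𝒩_o`: first act as on an element of `𝒜`, then normally order. -/
def normCrystal (m n : ℤ) : CrystalData (normallyOrdered m n) where
  wt y := (monoCrystal m n).wt y.1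
  ε i y := (monoCrystal m n).ε i y.1
  φ i y := (monoCrystal m n).φ i y.1
  e i y := ((monoCrystal m n).e i y.1).bind normalOrder
  f i y := ((monoCrystal m n).f i y.1).bind normalOrder

/-! ## From domain walls to particles -/

/-- The particles that correspond to an elementary wall at the position `k`. -/
def Elem.particles (k : ℤ) : Elem → List Particle
  | line s j => [half s j (-(k / 2))]
  | bullet s t => [zero s t (-(k / 2))]
  | bottom t j =>
      if k % 2 = 0 then [zero (-1) t (-(k / 2)), half 1 j (-(k / 2))]
      else [half (-1) j (-((k - 1) / 2)), zero 1 t (-((k + 1) / 2))]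
  | top t j =>
      if k % 2 = 0 then [zero 1 t (-(k / 2)), half (-1) j (-(k / 2))]
      else [half 1 j (-((k - 1) / 2)), zero (-1) t (-((k + 1) / 2))]

/-- The domain of `d` on the far right. -/
def rightDomain {m n : ℤ} (d : DomainSeq m n) : ℤ × ℤ :=
  d.1 ((insert 0 d.2.finite.toFinset).min' (Finset.insert_nonempty _ _))

/-- The sequence of particles of a sequence of domains: decompose every wall, from left to right,
that is, in the order of decreasing positions, into its ordered elementary walls. -/
def toState {m n : ℤ} (d : DomainSeq m n) : State :=
  (rightDomain d, (d.2.finite.toFinset.sort (· ≥ ·)).flatMap fun k =>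
    (wallWord m n k (d.1 (k + 1)) (d.1 k)).flatMap (Elem.particles k))

/-! ## Tensor products of affine crystals -/

/-- The initial domain and the superscripts of the spin-1/2 and of the spin-0 particles. -/
abbrev Label : Type := (ℤ × ℤ) × List ℤˣ × List (ℤˣ × ℤˣ)

def label (z : State) : Label :=
  (z.1, z.2.filterMap fun | half s _ _ => some s | zero _ _ _ => none,
    z.2.filterMap fun | half _ _ _ => none | zero s t _ => some (s, t))

/-- The disjoint union over `M` and `N` of the crystals
`Aff(B^{(1)})^{⊗M} ⊗ Aff(B^{(0)})^{⊗N}`. -/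
def affTensor : CrystalData (List (Fin 2 × ℤ) × List (Fin 1 × ℤ)) :=
  affHalf.tensorPowers.tensor affZero.tensorPowers

/-- The element of `Aff(B^{(1)})^{⊗M} ⊗ Aff(B^{(0)})^{⊗N}` given by `M` spin-1/2 and `N` spin-0
particles. -/
def coordinates (z : State) : List (Fin 2 × ℤ) × List (Fin 1 × ℤ) :=
  (z.2.filterMap fun | half _ j l => some (j, l) | zero _ _ _ => none,
    z.2.filterMap fun | half _ _ _ => none | zero _ _ l => some (0, l))

/-- The part `Aff(B^{(1)})^{⊗M} ⊗ Aff(B^{(0)})^{⊗N}` of `affTensor`, where `M` and `N` are the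
lengths of the two lists in the label; the degrees in each factor have the parity prescribed by the
superscripts, so that each factor `Aff(B^{(1)})` is one of the two connected diagrams. -/
def tensorPart (c : Label) : Set (List (Fin 2 × ℤ) × List (Fin 1 × ℤ)) :=
  {w | List.Forall₂ (fun s x => s * (-1) ^ x.1.val = (-1) ^ x.2) c.2.1 w.1 ∧
    List.Forall₂ (fun r x => -(r.1 * r.2) = (-1) ^ x.2) c.2.2 w.2}

end AltSpin

end

/-!
# Crystals of domain walls and of spin-1/2 and spin-0 particles

*Relations between particles.* A relation between particles of different spin replaces the
neighbours `A B` by an exchanged pair `xch`: the particles only change places, except that at the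
boundary of the range of domains they also invert their superscripts and change their modes by `1`
and `-1`. Exchanges are involutive (`xch_xch`). Moving all particles of one spin to the left gives
the separated form `sep` of a product, which does not depend on the exchanges that were applied
before (`MEq.sep_eq`). A relation between particles `A`, `B` of the same spin reads `A B = -A' B'`,
where `A'` and `B'` arise by shifting the modes by `gap A B` and `-gap A B`. The gap is preserved
when the two particles pass a particle of the other spin (`gap_xch`, `gap_xch'`). Hence the separated
form turns this relation into a relation between two neighbours on one of its sides, and in the
coordinates `kcoord`, whose successive differences are the gaps, it becomes a transposition with the
sign `-1`. So a product is the same as a pair of exterior monomials, one for each spin. The products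
of two determinants in these coordinates (`coefDual`) are functionals dual to the separately ordered
products, which proves their linear independence; sorting the coordinates proves that they span.

*Normal order.* Normal order is an order of neighbours with respect to `key`, the mode in a scale in
which the two spins never tie. Of a pair of different spin and its exchange exactly one is ordered
(`nrm_xch_iff`), so every product can be brought into normal order by exchanges, and the result is
unique (`mixedNormal_unique`). The conditions of the definition amount to this order together with
the order of both sides of the separated form (`normalList_iff`); therefore separation is a
bijection `normEquivSep` between normally and separately ordered products. Spin-0 particles are
trivial for the crystal structure and exchanges do not change the indices `j`, so exchanges commute
with signatures and with the operators (`MEq.sig_eq`, `MEq.listF`), and the bijection is an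
isomorphism of crystals.

*Domain walls.* A wall at an even position consists of `α` spin-1/2 and `β` spin-0 particles of the
same kind each (`evenWord`), a wall at an odd position of equal boundary pairs (`block_odd`). The
words of successive walls form a normally ordered product. The value of a path at a position is a
sum of contributions of the particles (`ground_eq_toState`), so the particles determine the path;
conversely every normally ordered product arises, because a further particle on the left extends the
leftmost wall or begins a new one (`exists_toState`).

*Comparison of the operators.* The signature of a path to the left and to the right of an even
position equals that of the particles there up to a term that depends only on the domain
(`onesRight_toPath`, `zerosLeft_toPath`). When `f_i` changes the path at `q`, the spin-1/2 particle
on which it acts belongs to the wall at `q - 1` or `q - 2`, and it moves in one of three ways: from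
one even position to the next (`actsAt_of_half`), out of a boundary pair at an odd position
(`actsAt_of_pair`), or into such a pair (`actsAt_of_boundary`). In each case the word of the new
walls arises from the word with the shifted particle by exchanges, so it is its normally ordered
form. Since `e_i` inverts `f_i`, this gives the isomorphism `domainsEquivNorm_isIso`, and the axioms
of a crystal are transported from particles to paths.

*Tensor products.* Reading off the indices of a separately ordered product is a morphism of crystals,
since the trivial spin-0 factors can be split off (`coordinates_isMorphism`). It is injective on
products with the same initial domain and superscripts, and therefore an isomorphism onto its image.
-/

open Filter

noncomputable section

namespace AltSpin

open Particle

section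
/-! ### The tensor product rule -/

theorem cancel_assoc (u v w : ℕ × ℕ) : cancel (cancel u v) w = cancel u (cancel v w) := by
  unfold cancel; ext <;> simp only <;> omega

theorem cancel_zero_left (u : ℕ × ℕ) : cancel (0, 0) u = u := by
  unfold cancel; ext <;> simp

theorem cancel_zero_right (u : ℕ × ℕ) : cancel u (0, 0) = u := by
  unfold cancel; ext <;> simp

theorem reduce_nil : reduce [] = (0, 0) := rfl

theorem reduce_cons (a : ℕ × ℕ) (l : List (ℕ × ℕ)) : reduce (a :: l) = cancel a (reduce l) := rfl

theorem reduce_append (l l' : List (ℕ × ℕ)) :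
    reduce (l ++ l') = cancel (reduce l) (reduce l') := by
  induction l with
  | nil => rw [List.nil_append, reduce_nil, cancel_zero_left]
  | cons a l ih => rw [List.cons_append, reduce_cons, reduce_cons, ih, cancel_assoc]

theorem pairing_add (i : Fin 2) (v w : Weight) : pairing i (v + w) = pairing i v + pairing i w := by
  unfold pairing; split_ifs <;> rfl

namespace CrystalData

variable {B B₁ B₂ : Type}

theorem sig_nil (C : CrystalData B) (i : Fin 2) : C.sig i [] = (0, 0) := rfl

theorem sig_cons (C : CrystalData B) (i : Fin 2) (b : B) (l : List B) :
    C.sig i (b :: l) = cancel (C.ε i b, C.φ i b) (C.sig i l) := rfl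

theorem sig_append (C : CrystalData B) (i : Fin 2) (l l' : List B) :
    C.sig i (l ++ l') = cancel (C.sig i l) (C.sig i l') := by
  unfold sig; rw [List.map_append, reduce_append]

/-- The tensor product rule for two factors. -/
theorem listF_append (C : CrystalData B) (i : Fin 2) (l l' : List B) :
    C.listF i (l ++ l') = if (C.sig i l').1 < (C.sig i l).2 then (C.listF i l).map (· ++ l')
      else (C.listF i l').map (l ++ ·) := by
  induction l with
  | nil => simp [sig_nil]
  | cons b l ih =>
    have h3 : (C.sig i (l ++ l')).1 = (C.sig i l).1 + ((C.sig i l').1 - (C.sig i l).2) := by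
      rw [sig_append]; rfl
    have h4 : (C.sig i (b :: l)).2 = (C.sig i l).2 + (C.φ i b - (C.sig i l).1) := rfl
    simp only [List.cons_append, listF, ih]
    by_cases h1 : (C.sig i (l ++ l')).1 < C.φ i b
    · rw [if_pos h1, if_pos (by omega), if_pos (by omega), Option.map_map]; rfl
    · by_cases h2 : (C.sig i l').1 < (C.sig i l).2
      · rw [if_neg h1, if_pos h2, if_pos (by omega), if_neg (by omega), Option.map_map,
          Option.map_map]; rfl
      · rw [if_neg h1, if_neg h2, if_neg (by omega), Option.map_map]; rfl

theorem sig_listF {C : CrystalData B} (hC : C.IsCrystal) (i : Fin 2) :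
    ∀ l l' : List B, C.listF i l = some l' →
      (C.sig i l').1 = (C.sig i l).1 + 1 ∧ (C.sig i l).2 = (C.sig i l').2 + 1 := by
  intro l
  induction l with
  | nil => intro l' h; simp [listF] at h
  | cons b l ih =>
    intro l' h
    simp only [listF] at h
    split_ifs at h with hc
    · obtain ⟨b', hb, rfl⟩ := Option.map_eq_some_iff.1 h
      have h1 := hC.ε_f i b b' hb
      have h2 := hC.φ_f i b b' hb
      simp only [sig_cons, cancel]
      omega
    · obtain ⟨l1, hl, rfl⟩ := Option.map_eq_some_iff.1 h
      have := ih l1 hl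
      simp only [sig_cons, cancel]
      omega

theorem listF_eq_none {C : CrystalData B} (hC : C.IsCrystal) (i : Fin 2) (l : List B) :
    C.listF i l = none ↔ (C.sig i l).2 = 0 := by
  induction l with
  | nil => simp [listF, sig_nil]
  | cons b l ih =>
    have h1 := hC.f_eq_none i b
    simp only [listF, sig_cons, cancel]
    split_ifs with hc
    · rw [Option.map_eq_none_iff, h1]; omega
    · rw [Option.map_eq_none_iff, ih]; omega

theorem listE_eq_none {C : CrystalData B} (hC : C.IsCrystal) (i : Fin 2) (l : List B) :
    C.listE i l = none ↔ (C.sig i l).1 = 0 := by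
  induction l with
  | nil => simp [listE, sig_nil]
  | cons b l ih =>
    have h1 := hC.e_eq_none i b
    simp only [listE, sig_cons, cancel]
    split_ifs with hc
    · rw [Option.map_eq_none_iff, h1]; omega
    · rw [Option.map_eq_none_iff, ih]; omega

theorem listE_iff_listF {C : CrystalData B} (hC : C.IsCrystal) (i : Fin 2) :
    ∀ l l' : List B, C.listE i l = some l' ↔ C.listF i l' = some l := by
  intro l
  induction l with
  | nil =>
    intro l'
    constructor
    · intro h; simp [listE] at h
    · intro h
      have := sig_listF hC i _ _ h
      simp [sig_nil] at this
  | cons b l ih =>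
    intro l'
    constructor
    · intro h
      simp only [listE] at h
      split_ifs at h with hc
      · obtain ⟨b', hb, rfl⟩ := Option.map_eq_some_iff.1 h
        have hf := (hC.e_iff_f i b b').1 hb
        have h2 := hC.φ_f i _ _ hf
        simp only [listF]
        rw [if_pos (by omega), hf]; rfl
      · obtain ⟨l1, hl, rfl⟩ := Option.map_eq_some_iff.1 h
        have hf := (ih l1).1 hl
        have h2 := sig_listF hC i _ _ hf
        simp only [listF]
        rw [if_neg (by omega), hf]; rfl
    · intro h
      cases l' with
      | nil => simp [listF] at h
      | cons b' l1 =>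
        simp only [listF] at h
        split_ifs at h with hc
        · obtain ⟨b'', hb, he⟩ := Option.map_eq_some_iff.1 h
          obtain ⟨rfl, rfl⟩ := List.cons.inj he
          have h2 := hC.φ_f i _ _ hb
          simp only [listE]
          rw [if_pos (by omega), (hC.e_iff_f i _ _).2 hb]; rfl
        · obtain ⟨l2, hb, he⟩ := Option.map_eq_some_iff.1 h
          obtain ⟨rfl, rfl⟩ := List.cons.inj he
          have h2 := sig_listF hC i _ _ hb
          simp only [listE]
          rw [if_neg (by omega), (ih _).2 hb]; rfl

theorem IsCrystal.tensorPowers {C : CrystalData B} (hC : C.IsCrystal) :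
    C.tensorPowers.IsCrystal where
  e_iff_f := listE_iff_listF hC
  wt_f i l := by
    show ∀ l', C.listF i l = some l' → (l'.map C.wt).sum = (l.map C.wt).sum - simpleRoot i
    induction l with
    | nil => intro l' h; simp [listF] at h
    | cons b l ih =>
      intro l' h
      simp only [listF] at h
      split_ifs at h with hc
      · obtain ⟨b', hb, rfl⟩ := Option.map_eq_some_iff.1 h
        simp only [List.map_cons, List.sum_cons, hC.wt_f i _ _ hb]
        abel
      · obtain ⟨l1, hb, rfl⟩ := Option.map_eq_some_iff.1 h
        simp only [List.map_cons, List.sum_cons, ih _ hb]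
        abel
  pairing_wt i l := by
    show pairing i ((l.map C.wt).sum) = ((C.sig i l).2 : ℤ) - (C.sig i l).1
    induction l with
    | nil => unfold pairing; split_ifs <;> simp [sig_nil]
    | cons b l ih =>
      rw [List.map_cons, List.sum_cons, pairing_add, ih, hC.pairing_wt i b, sig_cons]
      unfold cancel
      simp only
      omega
  ε_f i l l' h := (sig_listF hC i l l' h).1
  φ_f i l l' h := (sig_listF hC i l l' h).2
  e_eq_none := listE_eq_none hC
  f_eq_none := listF_eq_none hC

theorem restrict_e_eq_some {C : CrystalData B} {S : Set B} {i : Fin 2} {b b' : S} :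
    (C.restrict S).e i b = some b' ↔ C.e i b = some b'.1 := by
  simp only [restrict, Option.bind_eq_some_iff]
  constructor
  · rintro ⟨c, hc, h⟩
    split_ifs at h with hS
    rw [hc, ← Option.some.inj h]
  · intro h
    exact ⟨_, h, by simp⟩

theorem restrict_f_eq_some {C : CrystalData B} {S : Set B} {i : Fin 2} {b b' : S} :
    (C.restrict S).f i b = some b' ↔ C.f i b = some b'.1 := by
  simp only [restrict, Option.bind_eq_some_iff]
  constructor
  · rintro ⟨c, hc, h⟩
    split_ifs at h with hS
    rw [hc, ← Option.some.inj h]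
  · intro h
    exact ⟨_, h, by simp⟩

theorem Stable.restrict_e {C : CrystalData B} {S : Set B} (hS : C.Stable S) (i : Fin 2) (b : S) :
    ((C.restrict S).e i b).map Subtype.val = C.e i b := by
  cases h : C.e i b with
  | none => simp [restrict, h]
  | some b' =>
    have hb' := (hS i b b.2 b').1 h
    rw [(restrict_e_eq_some (b' := ⟨b', hb'⟩)).2 h]; rfl

/-- On a stable set the restricted operator never drops a value. -/
theorem Stable.restrict_f {C : CrystalData B} {S : Set B} (hS : C.Stable S) (i : Fin 2) (b : S) :
    ((C.restrict S).f i b).map Subtype.val = C.f i b := by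
  cases h : C.f i b with
  | none => simp [restrict, h]
  | some b' =>
    have hb' := (hS i b b.2 b').2 h
    rw [(restrict_f_eq_some (b' := ⟨b', hb'⟩)).2 h]; rfl

theorem IsCrystal.restrict {C : CrystalData B} (hC : C.IsCrystal) {S : Set B} (hS : C.Stable S) :
    (C.restrict S).IsCrystal where
  e_iff_f i b b' := by rw [restrict_e_eq_some, restrict_f_eq_some]; exact hC.e_iff_f i b b'
  wt_f i b b' h := hC.wt_f i _ _ (restrict_f_eq_some.1 h)
  pairing_wt i b := hC.pairing_wt i b
  ε_f i b b' h := hC.ε_f i _ _ (restrict_f_eq_some.1 h)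
  φ_f i b b' h := hC.φ_f i _ _ (restrict_f_eq_some.1 h)
  e_eq_none i b := by
    rw [← Option.map_eq_none_iff (f := Subtype.val), hS.restrict_e i b]; exact hC.e_eq_none i b
  f_eq_none i b := by
    rw [← Option.map_eq_none_iff (f := Subtype.val), hS.restrict_f i b]; exact hC.f_eq_none i b

theorem IsIso.e_eq_some {C₁ : CrystalData B₁} {C₂ : CrystalData B₂} {g : B₁ ≃ B₂}
    (h : C₁.IsIso C₂ g) {i : Fin 2} {b b' : B₁} :
    C₁.e i b = some b' ↔ C₂.e i (g b) = some (g b') := by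
  rw [h.e, Option.map_eq_some_iff]
  constructor
  · intro h; exact ⟨_, h, rfl⟩
  · rintro ⟨c, hc, h⟩; rw [hc, g.injective h]

theorem IsIso.f_eq_some {C₁ : CrystalData B₁} {C₂ : CrystalData B₂} {g : B₁ ≃ B₂}
    (h : C₁.IsIso C₂ g) {i : Fin 2} {b b' : B₁} :
    C₁.f i b = some b' ↔ C₂.f i (g b) = some (g b') := by
  rw [h.f, Option.map_eq_some_iff]
  constructor
  · intro h; exact ⟨_, h, rfl⟩
  · rintro ⟨c, hc, h⟩; rw [hc, g.injective h]

/-- The axioms of a crystal are transported along isomorphisms. -/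
theorem IsIso.isCrystal {C₁ : CrystalData B₁} {C₂ : CrystalData B₂} {g : B₁ ≃ B₂}
    (h : C₁.IsIso C₂ g) (h₂ : C₂.IsCrystal) : C₁.IsCrystal where
  e_iff_f i b b' := by rw [h.e_eq_some, h.f_eq_some]; exact h₂.e_iff_f i _ _
  wt_f i b b' hb := by rw [← h.wt, ← h.wt]; exact h₂.wt_f i _ _ (h.f_eq_some.1 hb)
  pairing_wt i b := by rw [← h.wt, ← h.ε, ← h.φ]; exact h₂.pairing_wt i _
  ε_f i b b' hb := by rw [← h.ε, ← h.ε]; exact h₂.ε_f i _ _ (h.f_eq_some.1 hb)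
  φ_f i b b' hb := by rw [← h.φ, ← h.φ]; exact h₂.φ_f i _ _ (h.f_eq_some.1 hb)
  e_eq_none i b := by
    rw [← h.ε, ← h₂.e_eq_none i, h.e, Option.map_eq_none_iff]
  f_eq_none i b := by
    rw [← h.φ, ← h₂.f_eq_none i, h.f, Option.map_eq_none_iff]

/-- A bijection between crystals that commutes with the `f_i` also commutes with the `e_i`. -/
theorem IsIso.of_f {C₁ : CrystalData B₁} {C₂ : CrystalData B₂} {g : B₁ ≃ B₂}
    (h₁ : ∀ i b b', C₁.e i b = some b' ↔ C₁.f i b' = some b)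
    (h₂ : ∀ i b b', C₂.e i b = some b' ↔ C₂.f i b' = some b)
    (wt : ∀ b, C₂.wt (g b) = C₁.wt b) (ε : ∀ i b, C₂.ε i (g b) = C₁.ε i b)
    (φ : ∀ i b, C₂.φ i (g b) = C₁.φ i b) (f : ∀ i b, C₂.f i (g b) = (C₁.f i b).map g) :
    C₁.IsIso C₂ g where
  wt := wt
  ε := ε
  φ := φ
  f := f
  e i b := by
    ext c
    obtain ⟨c, rfl⟩ := g.surjective c
    rw [h₂, f, Option.map_eq_some_iff, Option.map_eq_some_iff]
    constructor
    · rintro ⟨b', hb, hb'⟩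
      exact ⟨c, (h₁ i b c).2 (by rw [hb, g.injective hb']), rfl⟩
    · rintro ⟨b', hb, hb'⟩
      rw [← g.injective hb']
      exact ⟨b, (h₁ i b b').1 hb, rfl⟩

end CrystalData

/-! ### Particles as a crystal -/

theorem particleCrystal_f_half (i : Fin 2) (s : ℤˣ) (j : Fin 2) (l : ℤ) :
    particleCrystal.f i (half s j l) = if j = i then none else some (half s i (l - 1)) := by
  fin_cases i <;> fin_cases j <;>
    simp [particleCrystal, affHalf, CrystalData.aff, finCrystal, stepUp, stepDown]

theorem particleCrystal_e_half (i : Fin 2) (s : ℤˣ) (j : Fin 2) (l : ℤ) :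
    particleCrystal.e i (half s j l) = if j = i then some (half s (i + 1) (l + 1)) else none := by
  fin_cases i <;> fin_cases j <;>
    simp [particleCrystal, affHalf, CrystalData.aff, finCrystal, stepUp, stepDown]

theorem particleCrystal_ε_half (i : Fin 2) (s : ℤˣ) (j : Fin 2) (l : ℤ) :
    particleCrystal.ε i (half s j l) = if j = i then 1 else 0 := by
  fin_cases i <;> fin_cases j <;> simp [particleCrystal, affHalf, CrystalData.aff, finCrystal]

theorem particleCrystal_φ_half (i : Fin 2) (s : ℤˣ) (j : Fin 2) (l : ℤ) :
    particleCrystal.φ i (half s j l) = if j = i then 0 else 1 := by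
  fin_cases i <;> fin_cases j <;> simp [particleCrystal, affHalf, CrystalData.aff, finCrystal]

theorem particleCrystal_wt_half (s : ℤˣ) (j : Fin 2) (l : ℤ) :
    particleCrystal.wt (half s j l) = (2 * (j.val : ℤ) - 1, 1 - 2 * (j.val : ℤ), l) := by
  simp [particleCrystal, affHalf, CrystalData.aff, finCrystal]

theorem particleCrystal_f_zero (i : Fin 2) (s t : ℤˣ) (l : ℤ) :
    particleCrystal.f i (zero s t l) = none := by
  fin_cases i <;> simp [particleCrystal, affZero, CrystalData.aff, finCrystal, stepUp, stepDown]

theorem particleCrystal_e_zero (i : Fin 2) (s t : ℤˣ) (l : ℤ) :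
    particleCrystal.e i (zero s t l) = none := by
  fin_cases i <;> simp [particleCrystal, affZero, CrystalData.aff, finCrystal, stepUp, stepDown]

theorem particleCrystal_ε_zero (i : Fin 2) (s t : ℤˣ) (l : ℤ) :
    particleCrystal.ε i (zero s t l) = 0 := by
  fin_cases i <;> simp [particleCrystal, affZero, CrystalData.aff, finCrystal]

theorem particleCrystal_φ_zero (i : Fin 2) (s t : ℤˣ) (l : ℤ) :
    particleCrystal.φ i (zero s t l) = 0 := by
  fin_cases i <;> simp [particleCrystal, affZero, CrystalData.aff, finCrystal]

theorem particleCrystal_wt_zero (s t : ℤˣ) (l : ℤ) :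
    particleCrystal.wt (zero s t l) = (0, 0, l) := by
  simp [particleCrystal, affZero, CrystalData.aff, finCrystal]

theorem fin_two_add_one_ne (i : Fin 2) : i + 1 ≠ i := by fin_cases i <;> decide

theorem fin_two_eq_add_one {i j : Fin 2} (h : j ≠ i) : j = i + 1 := by
  fin_cases i <;> fin_cases j <;> first | rfl | exact absurd rfl h

theorem particleCrystal_isCrystal : particleCrystal.IsCrystal where
  e_iff_f i b b' := by
    cases b with
    | zero s t l =>
      cases b' with
      | zero => simp [particleCrystal_e_zero, particleCrystal_f_zero]
      | half s' j' l' => simp [particleCrystal_e_zero, particleCrystal_f_half]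
    | half s j l =>
      cases b' with
      | zero => simp [particleCrystal_e_half, particleCrystal_f_zero]
      | half s' j' l' =>
        rw [particleCrystal_e_half, particleCrystal_f_half]
        by_cases h : j = i <;> by_cases h' : j' = i
        · subst h; subst h'; simp
        · subst h
          rw [if_pos rfl, if_neg h', fin_two_eq_add_one h']
          simp only [Option.some.injEq, half.injEq, true_and]
          constructor <;> rintro ⟨rfl, rfl⟩ <;> simp
        · simp [h, h']
        · simp only [h, h', if_false, Option.some.injEq, half.injEq]
          constructor
          · intro h1; cases h1
          · rintro ⟨-, h1, -⟩; exact absurd h1.symm h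
  wt_f i b b' := by
    cases b with
    | zero => simp [particleCrystal_f_zero]
    | half s j l =>
      rw [particleCrystal_f_half]
      split_ifs with h
      · simp
      · intro h1
        rw [← Option.some.inj h1, particleCrystal_wt_half, particleCrystal_wt_half]
        fin_cases i <;> fin_cases j <;> simp_all [simpleRoot]
  pairing_wt i b := by
    cases b with
    | zero =>
      rw [particleCrystal_φ_zero, particleCrystal_ε_zero, particleCrystal_wt_zero]
      simp [pairing]
    | half s j l =>
      rw [particleCrystal_φ_half, particleCrystal_ε_half, particleCrystal_wt_half]
      fin_cases i <;> fin_cases j <;> simp [pairing]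
  ε_f i b b' := by
    cases b with
    | zero => simp [particleCrystal_f_zero]
    | half s j l =>
      rw [particleCrystal_f_half]
      split_ifs with h
      · simp
      · intro h1
        rw [← Option.some.inj h1, particleCrystal_ε_half, particleCrystal_ε_half]
        simp [h]
  φ_f i b b' := by
    cases b with
    | zero => simp [particleCrystal_f_zero]
    | half s j l =>
      rw [particleCrystal_f_half]
      split_ifs with h
      · simp
      · intro h1
        rw [← Option.some.inj h1, particleCrystal_φ_half, particleCrystal_φ_half]
        simp [h]
  e_eq_none i b := by
    cases b with
    | zero => simp [particleCrystal_e_zero, particleCrystal_ε_zero]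
    | half s j l =>
      rw [particleCrystal_e_half, particleCrystal_ε_half]; split_ifs <;> simp
  f_eq_none i b := by
    cases b with
    | zero => simp [particleCrystal_f_zero, particleCrystal_φ_zero]
    | half s j l =>
      rw [particleCrystal_f_half, particleCrystal_φ_half]; split_ifs <;> simp

end

section
/-! ### Exchanging particles of different spin -/

namespace Particle

/-- `true` for a spin-1/2 particle, `false` for a spin-0 particle. -/
def isHalf : Particle → Bool
  | half _ _ _ => true
  | zero _ _ _ => false

/-- The superscript `s`, that is, the change of `a`, as an integer. -/
def sg : Particle → ℤ
  | half s _ _ => s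
  | zero s _ _ => s

/-- The second discrete index, `(-1) ^ j` or `t`. -/
def col : Particle → ℤˣ
  | half _ j _ => (-1) ^ j.val
  | zero _ t _ => t

/-- The lower index `l`. -/
def mode : Particle → ℤ
  | half _ _ l => l
  | zero _ _ l => l

/-- The change of `b`. -/
def db : Particle → ℤ
  | half _ _ _ => 0
  | zero _ t _ => t

/-- Invert the superscript `s` and add `e` to the mode. -/
def flip (e : ℤ) : Particle → Particle
  | half s j l => half (-s) j (l + e)
  | zero s t l => zero (-s) t (l + e)

/-- Add `g` to the mode. -/
def shift (g : ℤ) : Particle → Particle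
  | half s j l => half s j (l + g)
  | zero s t l => zero s t (l + g)

@[simp] theorem isHalf_flip (e : ℤ) (A : Particle) : (A.flip e).isHalf = A.isHalf := by
  cases A <;> rfl
@[simp] theorem sg_flip (e : ℤ) (A : Particle) : (A.flip e).sg = -A.sg := by
  cases A <;> simp [flip, sg]
@[simp] theorem col_flip (e : ℤ) (A : Particle) : (A.flip e).col = A.col := by cases A <;> rfl
@[simp] theorem db_flip (e : ℤ) (A : Particle) : (A.flip e).db = A.db := by cases A <;> rfl
@[simp] theorem mode_flip (e : ℤ) (A : Particle) : (A.flip e).mode = A.mode + e := by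
  cases A <;> rfl
@[simp] theorem isHalf_shift (e : ℤ) (A : Particle) : (A.shift e).isHalf = A.isHalf := by
  cases A <;> rfl
@[simp] theorem sg_shift (e : ℤ) (A : Particle) : (A.shift e).sg = A.sg := by cases A <;> rfl
@[simp] theorem col_shift (e : ℤ) (A : Particle) : (A.shift e).col = A.col := by cases A <;> rfl
@[simp] theorem db_shift (e : ℤ) (A : Particle) : (A.shift e).db = A.db := by cases A <;> rfl
@[simp] theorem mode_shift (e : ℤ) (A : Particle) : (A.shift e).mode = A.mode + e := by
  cases A <;> rfl

theorem flip_flip (e e' : ℤ) (A : Particle) (h : e + e' = 0) : (A.flip e).flip e' = A := by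
  cases A <;> simp [flip, add_assoc, h]

theorem flip_shift (e g : ℤ) (A : Particle) : (A.shift g).flip e = (A.flip e).shift g := by
  cases A <;> simp [flip, shift, add_right_comm]

theorem shift_zero (A : Particle) : A.shift 0 = A := by cases A <;> simp [shift]

theorem sg_eq (A : Particle) : A.sg = 1 ∨ A.sg = -1 := by
  cases A with
  | half s _ _ => rcases Int.units_eq_one_or s with rfl | rfl <;> simp [sg]
  | zero s _ _ => rcases Int.units_eq_one_or s with rfl | rfl <;> simp [sg]

theorem act_eq (A : Particle) (x : ℤ × ℤ) : A.act x = (x.1 + A.sg, x.2 + A.db) := by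
  cases A <;> simp [act, sg, db]

theorem db_eq_zero {A B : Particle} (h : A.isHalf ≠ B.isHalf) : A.db = 0 ∨ B.db = 0 := by
  cases A <;> cases B <;> simp_all [isHalf, db]

theorem neg_one_zpow_eq (l : ℤ) : ((-1 : ℤˣ) ^ l) = if l % 2 = 0 then 1 else -1 := by
  rcases Int.even_or_odd l with h | h
  · rw [h.neg_one_zpow, if_pos (Int.even_iff.1 h)]
  · rw [h.neg_one_zpow, if_neg (by rw [Int.odd_iff.1 h]; decide)]

theorem fin_two_neg_one_pow (j j' : Fin 2) :
    ((-1 : ℤˣ) ^ j.val = (-1) ^ j'.val) ↔ j = j' := by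
  fin_cases j <;> fin_cases j' <;> decide

/-- The condition on the indices, in the same form for both kinds of particles. -/
theorem meaningful_iff (A : Particle) :
    A.Meaningful ↔ (A.col = if (A.mode % 2 = 0 ↔ (A.sg = 1 ↔ A.isHalf = true)) then 1 else -1) := by
  have hj : ∀ j : Fin 2, j = 0 ∨ j = 1 := by decide
  cases A with
  | half s j l =>
    rcases Int.units_eq_one_or s with rfl | rfl <;> rcases hj j with rfl | rfl <;>
      by_cases h : l % 2 = 0 <;>
      simp [Meaningful, col, mode, sg, isHalf, neg_one_zpow_eq, h]
  | zero s t l =>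
    rcases Int.units_eq_one_or s with rfl | rfl <;> rcases Int.units_eq_one_or t with rfl | rfl <;>
      by_cases h : l % 2 = 0 <;>
      simp [Meaningful, col, mode, sg, isHalf, neg_one_zpow_eq, h]

theorem Meaningful.flip {A : Particle} (h : A.Meaningful) {e : ℤ} (he : e % 2 = 1) :
    (A.flip e).Meaningful := by
  rw [meaningful_iff] at h ⊢
  rw [col_flip, h]
  rcases A.sg_eq with hs | hs <;> cases hk : A.isHalf <;> by_cases hm : A.mode % 2 = 0 <;>
    simp [hs, hk, hm] <;> omega

theorem ext_iff' (A B : Particle) :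
    A = B ↔ A.isHalf = B.isHalf ∧ A.sg = B.sg ∧ A.col = B.col ∧ A.mode = B.mode := by
  cases A with
  | half s j l =>
    cases B with
    | half s' j' l' =>
      simp only [half.injEq, isHalf, sg, col, mode, fin_two_neg_one_pow, true_and, Units.val_inj]
    | zero => simp [isHalf]
  | zero s t l =>
    cases B with
    | half => simp [isHalf]
    | zero => simp [isHalf, sg, col, mode, Units.ext_iff]

/-- The sign and the mode of a particle determine its second index. -/
theorem Meaningful.ext {A B : Particle} (hA : A.Meaningful) (hB : B.Meaningful)
    (hk : A.isHalf = B.isHalf) (hs : A.sg = B.sg) (hm : A.mode = B.mode) : A = B := by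
  rw [ext_iff']
  rw [meaningful_iff] at hA hB
  exact ⟨hk, hs, by rw [hA, hB, hs, hm, hk], hm⟩

/-- For particles `A`, `B` of the same spin the relation is `A B = -A' B'`, where `A'` and `B'`
arise from `A` and `B` by adding `g` to the mode of `A` and subtracting it from that of `B`, with `g
= gap A B`. The pair is ordered if `0 < g`. -/
def gap (A B : Particle) : ℤ :=
  (if A.sg = B.sg then 1 else 0) + (if A.col = B.col then 1 else 0) - (A.mode - B.mode)

/-- Positive gaps describe the order that is required of neighbours of the same spin. -/
theorem gap_pos_iff {A B : Particle} (hA : A.Meaningful) (hB : B.Meaningful)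
    (hk : A.isHalf = B.isHalf) :
    0 < gap A B ↔ A.mode < B.mode ∨ (A.mode = B.mode ∧ A.sg = B.sg) := by
  rw [meaningful_iff] at hA hB
  have h1 : (1 : ℤˣ) ≠ -1 := by decide
  have h2 : (-1 : ℤˣ) ≠ 1 := by decide
  have hcol : A.col = B.col ↔ (A.sg = B.sg ↔ (A.mode - B.mode) % 2 = 0) := by
    rw [hA, hB, hk]
    rcases A.sg_eq with hs | hs <;> rcases B.sg_eq with hs' | hs' <;> cases B.isHalf <;>
      by_cases hm : A.mode % 2 = 0 <;> by_cases hm' : B.mode % 2 = 0 <;>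
      simp [hs, hs', hm, hm', h1, h2] <;> omega
  unfold gap
  by_cases hs : A.sg = B.sg <;> by_cases hp : (A.mode - B.mode) % 2 = 0 <;>
    simp only [hs, hp, iff_true, iff_false, not_true, if_true, if_false] at hcol ⊢
  all_goals
    simp only [hcol, if_true, if_false, and_true, and_false, or_false]
    omega

end Particle

/-- The exchange of neighbours `A`, `B` of different spin that act on a domain `(a, b)`, with
`N = m - n`. The relations for a spin-0 particle on the left of a spin-1/2 particle have this form,
and so have, by `xch_xch`, their inverses. -/
def xch (N a : ℤ) (A B : Particle) : Particle × Particle :=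
  if 0 ≤ a + A.sg ∧ a + A.sg ≤ N then (B, A) else (B.flip 1, A.flip (-1))

section xch

variable {N a : ℤ} {A B : Particle}

theorem xch_cases (N a : ℤ) (A B : Particle) :
    ((0 ≤ a + A.sg ∧ a + A.sg ≤ N) ∧ xch N a A B = (B, A)) ∨
    (¬ (0 ≤ a + A.sg ∧ a + A.sg ≤ N) ∧ xch N a A B = (B.flip 1, A.flip (-1))) := by
  unfold xch; split_ifs with h
  · exact Or.inl ⟨h, rfl⟩
  · exact Or.inr ⟨h, rfl⟩

@[simp] theorem isHalf_xch_fst : (xch N a A B).1.isHalf = B.isHalf := by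
  unfold xch; split_ifs <;> simp
@[simp] theorem isHalf_xch_snd : (xch N a A B).2.isHalf = A.isHalf := by
  unfold xch; split_ifs <;> simp
@[simp] theorem db_xch_fst : (xch N a A B).1.db = B.db := by
  unfold xch; split_ifs <;> simp
@[simp] theorem db_xch_snd : (xch N a A B).2.db = A.db := by
  unfold xch; split_ifs <;> simp

theorem sg_xch (h0 : 0 ≤ a) (h1 : a ≤ N) (h2 : 0 ≤ a + B.sg + A.sg) (h3 : a + B.sg + A.sg ≤ N)
    (h4 : 0 ≤ a + B.sg) (h5 : a + B.sg ≤ N) :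
    (xch N a A B).2.sg + (xch N a A B).1.sg = B.sg + A.sg ∧
    0 ≤ a + (xch N a A B).2.sg ∧ a + (xch N a A B).2.sg ≤ N := by
  have := A.sg_eq
  have := B.sg_eq
  rcases xch_cases N a A B with ⟨hc, e⟩ | ⟨hc, e⟩ <;> rw [e] <;> simp only [sg_flip] <;> omega

/-- On admissible products the exchange is an involution. -/
theorem xch_xch (h2 : 0 ≤ a + B.sg + A.sg) (h3 : a + B.sg + A.sg ≤ N)
    (h4 : 0 ≤ a + B.sg) (h5 : a + B.sg ≤ N) :
    xch N a (xch N a A B).1 (xch N a A B).2 = (A, B) := by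
  have := A.sg_eq
  have := B.sg_eq
  rcases xch_cases N a A B with ⟨hc, e⟩ | ⟨hc, e⟩ <;> rw [e] <;> simp only
  -- the exchange is a swap here, and the swap back stays in the range as well
  · rcases xch_cases N a B A with ⟨hc', e'⟩ | ⟨hc', e'⟩ <;> rw [e']
    omega
  -- here `A.sg = -B.sg`, so that the inverted particle leads out of the range again
  · rcases xch_cases N a (B.flip 1) (A.flip (-1)) with ⟨hc', e'⟩ | ⟨hc', e'⟩ <;> rw [e']
    · rw [sg_flip] at hc'; omega
    · rw [flip_flip _ _ _ (by norm_num), flip_flip _ _ _ (by norm_num)]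

/-- The gap between two particles `A`, `A'` of the same spin does not change when they both pass
the particle `B`. -/
theorem gap_xch {A' : Particle} (h0 : 0 ≤ a) (h1 : a ≤ N)
    (h4 : 0 ≤ a + B.sg + A'.sg) (h5 : a + B.sg + A'.sg ≤ N) (h6 : 0 ≤ a + B.sg + A'.sg + A.sg)
    (h7 : a + B.sg + A'.sg + A.sg ≤ N) :
    gap (xch N (a + (xch N a A' B).2.sg) A (xch N a A' B).1).2 (xch N a A' B).2 = gap A A' := by
  have := A.sg_eq
  have := B.sg_eq
  have := A'.sg_eq
  rcases xch_cases N a A' B with ⟨hc, e⟩ | ⟨hc, e⟩ <;> rw [e] <;> simp only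
  · rcases xch_cases N (a + A'.sg) A B with ⟨hc', e'⟩ | ⟨hc', e'⟩ <;> rw [e'] <;>
      simp only [gap, sg_flip, col_flip, mode_flip] <;> split_ifs <;> omega
  · rcases xch_cases N (a + (A'.flip (-1)).sg) A (B.flip 1) with ⟨hc', e'⟩ | ⟨hc', e'⟩ <;> rw [e'] <;>
      simp only [gap, sg_flip, col_flip, mode_flip] at hc' ⊢ <;> split_ifs <;> omega

/-- The gap between two particles `A`, `A'` of the same spin does not change when the particle `B`
passes both of them. -/
theorem gap_xch' {A' : Particle} (h0 : 0 ≤ a) (h1 : a ≤ N) (h6 : 0 ≤ a + A'.sg + A.sg + B.sg)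
    (h7 : a + A'.sg + A.sg + B.sg ≤ N) :
    gap (xch N (a + A'.sg) B A).1 (xch N a (xch N (a + A'.sg) B A).2 A').1 = gap A A' := by
  have := A.sg_eq
  have := B.sg_eq
  have := A'.sg_eq
  rcases xch_cases N (a + A'.sg) B A with ⟨hc, e⟩ | ⟨hc, e⟩ <;> rw [e] <;> simp only
  · rcases xch_cases N a B A' with ⟨hc', e'⟩ | ⟨hc', e'⟩ <;> rw [e'] <;>
      simp only [gap, sg_flip, col_flip, mode_flip] <;> split_ifs <;> omega
  · rcases xch_cases N a (B.flip (-1)) A' with ⟨hc', e'⟩ | ⟨hc', e'⟩ <;> rw [e'] <;>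
      simp only [gap, sg_flip, col_flip, mode_flip] at hc' ⊢ <;> split_ifs <;> omega

/-- Exchanges do not depend on the modes and commute with shifts of them. -/
theorem xch_shift_left (g : ℤ) :
    xch N a (A.shift g) B = ((xch N a A B).1, (xch N a A B).2.shift g) := by
  unfold xch; rw [sg_shift]; split_ifs <;> simp [flip_shift]

theorem xch_shift_right (g : ℤ) :
    xch N a A (B.shift g) = ((xch N a A B).1.shift g, (xch N a A B).2) := by
  unfold xch; split_ifs <;> simp [flip_shift]

end xch

end

section
/-! ### Admissible products -/

variable {m n : ℤ} {x : ℤ × ℤ}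

theorem target_nil (x : ℤ × ℤ) : target x [] = x := rfl

theorem target_cons (x : ℤ × ℤ) (A : Particle) (v : List Particle) :
    target x (A :: v) = ((target x v).1 + A.sg, (target x v).2 + A.db) := act_eq A _

theorem target_append (x : ℤ × ℤ) (u v : List Particle) :
    target x (u ++ v) = target (target x v) u := by
  unfold target; rw [List.foldr_append]

theorem valid_nil : Valid m n (x, []) ↔ InRange m n x := by
  constructor
  · intro h; exact h.inRange [] (List.suffix_refl _)
  · intro h
    refine ⟨by simp, fun v hv => ?_⟩
    rw [List.suffix_nil.1 hv]; exact h

theorem valid_cons {A : Particle} {v : List Particle} :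
    Valid m n (x, A :: v) ↔
      A.Meaningful ∧ InRange m n (target x (A :: v)) ∧ Valid m n (x, v) := by
  constructor
  · intro h
    exact ⟨h.meaningful A (by simp), h.inRange _ (List.suffix_refl _),
      fun B hB => h.meaningful B (List.mem_cons_of_mem _ hB),
      fun w hw => h.inRange w (hw.trans (List.suffix_cons A v))⟩
  · rintro ⟨h1, h2, h3⟩
    refine ⟨fun B hB => ?_, fun w hw => ?_⟩
    · rcases List.mem_cons.1 hB with rfl | hB
      · exact h1
      · exact h3.meaningful B hB
    · rcases List.suffix_cons_iff.1 hw with rfl | hw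
      · exact h2
      · exact h3.inRange w hw

theorem Valid.inRange_target {v : List Particle} (h : Valid m n (x, v)) : InRange m n (target x v) :=
  h.inRange v (List.suffix_refl _)

theorem valid_append {u v : List Particle} :
    Valid m n (x, u ++ v) ↔ Valid m n (x, v) ∧ Valid m n (target x v, u) := by
  induction u with
  | nil =>
    rw [List.nil_append, valid_nil]
    exact ⟨fun h => ⟨h, h.inRange_target⟩, fun h => h.1⟩
  | cons A u ih =>
    rw [List.cons_append, valid_cons, valid_cons, ih, ← List.cons_append, target_append]
    tauto

theorem Valid.pair {A B : Particle} {v : List Particle} (h : Valid m n (x, A :: B :: v)) :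
    A.Meaningful ∧ B.Meaningful ∧ InRange m n (target x v) ∧
    InRange m n ((target x v).1 + B.sg, (target x v).2 + B.db) ∧
    InRange m n ((target x v).1 + B.sg + A.sg, (target x v).2 + B.db + A.db) := by
  obtain ⟨h1, h2, h3⟩ := valid_cons.1 h
  obtain ⟨h4, h5, h6⟩ := valid_cons.1 h3
  rw [target_cons, target_cons] at h2
  rw [target_cons] at h5
  exact ⟨h1, h4, h6.inRange_target, h5, h2⟩

theorem Valid.exchange {A B : Particle} {v : List Particle} (h : Valid m n (x, A :: B :: v))
    (hk : A.isHalf ≠ B.isHalf) :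
    Valid m n (x, (xch (m - n) (target x v).1 A B).1 ::
      (xch (m - n) (target x v).1 A B).2 :: v) ∧
    target x ((xch (m - n) (target x v).1 A B).1 ::
      (xch (m - n) (target x v).1 A B).2 :: v) =
        target x (A :: B :: v) := by
  obtain ⟨hA, hB, ⟨a0, a1, b0, b1⟩, ⟨c0, c1, d0, d1⟩, ⟨e0, e1, f0, f1⟩⟩ := h.pair
  have hv := (valid_cons.1 (valid_cons.1 h).2.2).2.2
  obtain ⟨s1, s2, s3⟩ := sg_xch a0 a1 e0 e1 c0 c1
  have hd := db_eq_zero hk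
  have ht : target x ((xch (m - n) (target x v).1 A B).1 ::
      (xch (m - n) (target x v).1 A B).2 :: v) =
        target x (A :: B :: v) := by
    simp only [target_cons, db_xch_fst, db_xch_snd, Prod.mk.injEq]
    constructor <;> linarith
  refine ⟨valid_cons.2 ⟨?_, ht ▸ h.inRange_target, valid_cons.2 ⟨?_, ?_, hv⟩⟩, ht⟩
  · rcases xch_cases (m - n) (target x v).1 A B with ⟨_, e⟩ | ⟨_, e⟩ <;> rw [e]
    · exact hB
    · exact hB.flip rfl
  · rcases xch_cases (m - n) (target x v).1 A B with ⟨_, e⟩ | ⟨_, e⟩ <;> rw [e]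
    · exact hA
    · exact hA.flip rfl
  · rw [target_cons]
    refine ⟨s2, s3, ?_, ?_⟩ <;> simp only [db_xch_snd] at * <;> rcases hd with hd | hd <;>
      linarith

/-- Two products are related if they arise from each other by successive exchanges of neighbours of
different spin. -/
inductive MEq (m n : ℤ) (x : ℤ × ℤ) : List Particle → List Particle → Prop
  | refl (w : List Particle) : MEq m n x w w
  | step (u : List Particle) (A B : Particle) (v w : List Particle) (hk : A.isHalf ≠ B.isHalf)
      (h : MEq m n x (u ++ (xch (m - n) (target x v).1 A B).1 ::
        (xch (m - n) (target x v).1 A B).2 :: v) w) : MEq m n x (u ++ A :: B :: v) w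

namespace MEq

variable {w w' w'' u v : List Particle}

theorem trans (h : MEq m n x w w') (h' : MEq m n x w' w'') : MEq m n x w w'' := by
  induction h with
  | refl => exact h'
  | step u A B v w hk _ ih => exact .step u A B v _ hk (ih h')

theorem append_left (u : List Particle) (h : MEq m n x w w') : MEq m n x (u ++ w) (u ++ w') := by
  induction h with
  | refl => exact .refl _
  | step u' A B v w hk _ ih =>
    rw [← List.append_assoc] at ih ⊢
    exact .step (u ++ u') A B v _ hk ih

theorem cons (C : Particle) (h : MEq m n x w w') : MEq m n x (C :: w) (C :: w') :=
  h.append_left [C]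

theorem append_right (v : List Particle) (h : MEq m n (target x v) w w') :
    MEq m n x (w ++ v) (w' ++ v) := by
  induction h with
  | refl => exact .refl _
  | step u' A B v' w hk _ ih =>
    rw [List.append_assoc, List.cons_append, List.cons_append] at ih ⊢
    rw [← target_append] at ih
    exact .step u' A B (v' ++ v) _ hk ih

theorem head {A B : Particle} (hk : A.isHalf ≠ B.isHalf) :
    MEq m n x (A :: B :: v) ((xch (m - n) (target x v).1 A B).1 ::
        (xch (m - n) (target x v).1 A B).2 :: v) :=
  .step [] A B v _ hk (.refl _)

theorem valid_step {A B : Particle} (hk : A.isHalf ≠ B.isHalf)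
    (h : Valid m n (x, u ++ A :: B :: v)) :
    Valid m n (x, u ++ (xch (m - n) (target x v).1 A B).1 ::
        (xch (m - n) (target x v).1 A B).2 :: v) ∧
    target x (u ++ (xch (m - n) (target x v).1 A B).1 ::
        (xch (m - n) (target x v).1 A B).2 :: v) =
      target x (u ++ A :: B :: v) := by
  obtain ⟨h1, h2⟩ := valid_append.1 h
  obtain ⟨h3, h4⟩ := h1.exchange hk
  rw [valid_append, target_append, target_append, h4]
  exact ⟨⟨h3, h2⟩, rfl⟩

theorem valid_target (h : MEq m n x w w') (hw : Valid m n (x, w)) :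
    Valid m n (x, w') ∧ target x w' = target x w := by
  induction h with
  | refl => exact ⟨hw, rfl⟩
  | step u A B v w hk _ ih =>
    obtain ⟨h1, h2⟩ := valid_step hk hw
    rw [← h2]; exact ih h1

theorem valid (h : MEq m n x w w') (hw : Valid m n (x, w)) : Valid m n (x, w') :=
  (h.valid_target hw).1

theorem target_eq (h : MEq m n x w w') (hw : Valid m n (x, w)) : target x w' = target x w :=
  (h.valid_target hw).2

theorem symm (h : MEq m n x w w') (hw : Valid m n (x, w)) : MEq m n x w' w := by
  induction h with
  | refl => exact .refl _
  | step u A B v w hk _ ih =>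
    refine (ih (valid_step hk hw).1).trans ?_
    obtain ⟨hA, hB, ⟨a0, a1, b0, b1⟩, ⟨c0, c1, d0, d1⟩, ⟨e0, e1, f0, f1⟩⟩ :=
      (valid_append.1 hw).1.pair
    refine .step _ _ _ _ _ (by simpa using hk.symm) ?_
    rw [xch_xch e0 e1 c0 c1]
    exact .refl _

end MEq

/-! ### Separation of the two kinds of particles -/

/-- Move `A` to the right through a product of particles of the other spin. -/
def push (N : ℤ) (x : ℤ × ℤ) : Particle → List Particle → List Particle × Particle
  | A, [] => ([], A)
  | A, B :: l =>
    ((xch N (target x l).1 A B).1 :: (push N x (xch N (target x l).1 A B).2 l).1,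
      (push N x (xch N (target x l).1 A B).2 l).2)

/-- Move all particles with `isHalf ≠ κ` to the right of those with `isHalf = κ`. -/
def sep (N : ℤ) (x : ℤ × ℤ) (κ : Bool) : List Particle → List Particle × List Particle
  | [] => ([], [])
  | A :: v =>
    if A.isHalf = κ then (A :: (sep N x κ v).1, (sep N x κ v).2)
    else ((push N (target x (sep N x κ v).2) A (sep N x κ v).1).1,
      (push N (target x (sep N x κ v).2) A (sep N x κ v).1).2 :: (sep N x κ v).2)

variable {N : ℤ} {κ : Bool}

theorem sep_cons_of_eq {A : Particle} {v : List Particle} (h : A.isHalf = κ) :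
    sep N x κ (A :: v) = (A :: (sep N x κ v).1, (sep N x κ v).2) := by
  rw [sep, if_pos h]

theorem sep_cons_of_ne {A : Particle} {v : List Particle} (h : A.isHalf ≠ κ) :
    sep N x κ (A :: v) = ((push N (target x (sep N x κ v).2) A (sep N x κ v).1).1,
      (push N (target x (sep N x κ v).2) A (sep N x κ v).1).2 :: (sep N x κ v).2) := by
  rw [sep, if_neg h]

theorem isHalf_push_snd (A : Particle) (l : List Particle) :
    (push N x A l).2.isHalf = A.isHalf := by
  induction l generalizing A with
  | nil => rfl
  | cons B l ih => simp only [push, ih, isHalf_xch_snd]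

theorem isHalf_push_fst (A : Particle) (l : List Particle) (h : ∀ B ∈ l, B.isHalf = κ) :
    ∀ B ∈ (push N x A l).1, B.isHalf = κ := by
  induction l generalizing A with
  | nil => simp [push]
  | cons B l ih =>
    simp only [push, List.mem_cons, forall_eq_or_imp, isHalf_xch_fst] at h ⊢
    exact ⟨h.1, ih _ h.2⟩

theorem isHalf_sep_fst (w : List Particle) : ∀ B ∈ (sep N x κ w).1, B.isHalf = κ := by
  induction w with
  | nil => simp [sep]
  | cons A w ih =>
    by_cases h : A.isHalf = κ
    · rw [sep_cons_of_eq h]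
      simpa [h] using ih
    · rw [sep_cons_of_ne h]
      exact isHalf_push_fst _ _ ih

theorem isHalf_sep_snd (w : List Particle) : ∀ B ∈ (sep N x κ w).2, B.isHalf ≠ κ := by
  induction w with
  | nil => simp [sep]
  | cons A w ih =>
    by_cases h : A.isHalf = κ
    · rw [sep_cons_of_eq h]
      simpa [h] using ih
    · rw [sep_cons_of_ne h]
      intro B hB
      rcases List.mem_cons.1 hB with rfl | hB
      · rwa [isHalf_push_snd]
      · exact ih B hB

theorem meq_push (A : Particle) (l : List Particle) (h : ∀ B ∈ l, B.isHalf ≠ A.isHalf) :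
    MEq m n x (A :: l) ((push (m - n) x A l).1 ++ [(push (m - n) x A l).2]) := by
  induction l generalizing A with
  | nil => exact .refl _
  | cons B l ih =>
    simp only [List.mem_cons, forall_eq_or_imp] at h
    refine (MEq.head h.1.symm).trans ((ih _ ?_).cons _)
    simpa using h.2

theorem meq_sep (w : List Particle) :
    MEq m n x w ((sep (m - n) x κ w).1 ++ (sep (m - n) x κ w).2) := by
  induction w with
  | nil => exact .refl _
  | cons A w ih =>
    by_cases h : A.isHalf = κ
    · rw [sep_cons_of_eq h]
      exact ih.cons A
    · rw [sep_cons_of_ne h]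
      refine (ih.cons A).trans ?_
      rw [← List.cons_append]
      have h1 := MEq.append_right (m := m) (n := n) (x := x) (sep (m - n) x κ w).2
        (meq_push A (sep (m - n) x κ w).1 fun B hB hh =>
          h (hh.symm.trans (isHalf_sep_fst w B hB)))
      rwa [List.append_assoc] at h1

theorem sep_of_eq {as : List Particle} (h : ∀ A ∈ as, A.isHalf = κ) : sep N x κ as = (as, []) := by
  induction as with
  | nil => rfl
  | cons A as ih =>
    simp only [List.mem_cons, forall_eq_or_imp] at h
    rw [sep_cons_of_eq h.1, ih h.2]

theorem sep_of_ne {as : List Particle} (h : ∀ A ∈ as, A.isHalf ≠ κ) : sep N x κ as = ([], as) := by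
  induction as with
  | nil => rfl
  | cons A as ih =>
    simp only [List.mem_cons, forall_eq_or_imp] at h
    rw [sep_cons_of_ne h.1, ih h.2]; rfl

theorem sep_append {as bs : List Particle} (ha : ∀ A ∈ as, A.isHalf = κ)
    (hb : ∀ A ∈ bs, A.isHalf ≠ κ) : sep N x κ (as ++ bs) = (as, bs) := by
  induction as with
  | nil => rw [List.nil_append, sep_of_ne hb]
  | cons A as ih =>
    simp only [List.mem_cons, forall_eq_or_imp] at ha
    rw [List.cons_append, sep_cons_of_eq ha.1, ih ha.2]

theorem target_sep {w : List Particle} (hw : Valid m n (x, w)) :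
    target (target x (sep (m - n) x κ w).2) (sep (m - n) x κ w).1 = target x w := by
  rw [← target_append]; exact (meq_sep w).target_eq hw

theorem sep_congr {v v' : List Particle} (h : sep N x κ v = sep N x κ v') (u : List Particle) :
    sep N x κ (u ++ v) = sep N x κ (u ++ v') := by
  induction u with
  | nil => exact h
  | cons A u ih => rw [List.cons_append, List.cons_append, sep, sep, ih]

/-- Separation is invariant under exchanges. -/
theorem MEq.sep_eq {w w' : List Particle} (h : MEq m n x w w') (hw : Valid m n (x, w)) :
    sep (m - n) x κ w = sep (m - n) x κ w' := by
  induction h with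
  | refl => rfl
  | step u A B v w hk _ ih =>
    rw [← ih (valid_step hk hw).1]
    apply sep_congr
    have hw' := (valid_append.1 hw).1
    obtain ⟨hA, hB, ⟨a0, a1, b0, b1⟩, ⟨c0, c1, d0, d1⟩, ⟨e0, e1, f0, f1⟩⟩ := hw'.pair
    have hv : Valid m n (x, v) := (valid_cons.1 (valid_cons.1 hw').2.2).2.2
    have ht := target_sep (κ := κ) hv
    by_cases hB' : B.isHalf = κ
    · have hA' : A.isHalf ≠ κ := fun h => hk (h.trans hB'.symm)
      rw [sep_cons_of_ne hA', sep_cons_of_eq hB', sep_cons_of_eq (by simpa using hB'),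
        sep_cons_of_ne (by simpa using hA')]
      simp only [push, ht]
    · have hA' : A.isHalf = κ := by
        cases κ <;> cases h1 : A.isHalf <;> cases h2 : B.isHalf <;> simp_all
      rw [sep_cons_of_eq hA', sep_cons_of_ne hB', sep_cons_of_ne (by simpa using hB'),
        sep_cons_of_eq (by simpa using hA')]
      simp only [push, ht, xch_xch e0 e1 c0 c1]

/-- Two products with the same separated form arise from each other by exchanges. -/
theorem MEq.of_sep_eq {w w' : List Particle} (hw' : Valid m n (x, w'))
    (h : sep (m - n) x κ w = sep (m - n) x κ w') : MEq m n x w w' := by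
  refine (meq_sep (κ := κ) w).trans ?_
  rw [h]
  exact (meq_sep w').symm hw'

/-! ### Gaps -/

/-- The gaps between successive particles of a product. -/
def gaps : List Particle → List ℤ
  | A :: B :: l => gap A B :: gaps (B :: l)
  | _ => []

/-- A particle that passes through a group of particles of the other spin preserves their gaps. -/
theorem gaps_push (C : Particle) (l : List Particle) (hv : Valid m n (x, C :: l))
    (h : ∀ B ∈ l, B.isHalf ≠ C.isHalf) : gaps (push (m - n) x C l).1 = gaps l := by
  induction l generalizing C with
  | nil => rfl
  | cons A l ih =>
    have hA : C.isHalf ≠ A.isHalf := (h A (by simp)).symm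
    have hv1 := (hv.exchange hA).1
    have hih := ih _ (valid_cons.1 hv1).2.2 (by
      intro B hB; simpa using h B (List.mem_cons_of_mem _ hB))
    cases l with
    | nil => rfl
    | cons A' l =>
      simp only [push, gaps, target_cons] at hih ⊢
      obtain ⟨-, -, -, ⟨e0, e1, -, -⟩, ⟨f0, f1, -, -⟩⟩ := hv.pair
      obtain ⟨-, -, ⟨a0, a1, -, -⟩, ⟨c0, c1, -, -⟩, -⟩ := (valid_cons.1 hv).2.2.pair
      rw [target_cons] at e0 e1 f0 f1
      rw [hih, gap_xch' a0 a1 f0 f1]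

theorem not_eq_of_ne {A : Particle} (h : A.isHalf ≠ κ) : A.isHalf = !κ := by
  cases κ <;> simpa using h

theorem gaps_sep_append {as bs : List Particle} (hv : Valid m n (x, as ++ bs))
    (ha : ∀ A ∈ as, A.isHalf ≠ κ) (hb : ∀ A ∈ bs, A.isHalf = κ) :
    gaps (sep (m - n) x κ (as ++ bs)).1 = gaps bs := by
  induction as with
  | nil => rw [List.nil_append, sep_of_eq hb]
  | cons A as ih =>
    have hv' := (valid_cons.1 hv).2.2
    simp only [List.mem_cons, forall_eq_or_imp] at ha
    rw [List.cons_append, sep_cons_of_ne ha.1, ← ih hv' ha.2]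
    apply gaps_push
    · have h1 : Valid m n (x, A :: ((sep (m - n) x κ (as ++ bs)).1 ++
          (sep (m - n) x κ (as ++ bs)).2)) := ((meq_sep (as ++ bs)).cons A).valid hv
      rw [← List.cons_append] at h1
      exact (valid_append.1 h1).2
    · intro B hB
      rw [isHalf_sep_fst _ B hB]; exact ha.1.symm

/-- The right side of the separation has the gaps of the left side of the opposite separation. -/
theorem gaps_sep_snd {w : List Particle} (hv : Valid m n (x, w)) :
    gaps (sep (m - n) x κ w).2 = gaps (sep (m - n) x (!κ) w).1 := by
  have h := meq_sep (m := m) (n := n) (x := x) (κ := κ) w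
  rw [h.sep_eq (κ := !κ) hv, gaps_sep_append (h.valid hv)]
  · intro A hA; rw [isHalf_sep_fst w A hA]; simp
  · intro A hA; exact not_eq_of_ne (isHalf_sep_snd w A hA)

/-- Particles of the same spin that are neighbours keep their gap in the separated product. -/
theorem gap_mem_gaps_sep {u v : List Particle} {A B : Particle}
    (hv : Valid m n (x, u ++ A :: B :: v)) (hA : A.isHalf = κ) (hB : B.isHalf = κ) :
    gap A B ∈ gaps (sep (m - n) x κ (u ++ A :: B :: v)).1 := by
  induction u with
  | nil => rw [List.nil_append, sep_cons_of_eq hA, sep_cons_of_eq hB]; simp [gaps]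
  | cons C u ih =>
    have hv' := (valid_cons.1 hv).2.2
    have ih' := ih hv'
    by_cases h : C.isHalf = κ
    · rw [List.cons_append, sep_cons_of_eq h]
      cases hs : (sep (m - n) x κ (u ++ A :: B :: v)).1 with
      | nil => rw [hs] at ih'; simp [gaps] at ih'
      | cons D l =>
        rw [hs] at ih'
        exact List.mem_cons_of_mem _ ih'
    · rw [List.cons_append, sep_cons_of_ne h]
      simp only
      rw [gaps_push]
      · exact ih'
      · have h1 := ((meq_sep (κ := κ) (u ++ A :: B :: v)).cons C).valid hv
        rw [← List.cons_append] at h1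
        exact (valid_append.1 h1).2
      · intro B hB
        rw [isHalf_sep_fst _ B hB]; exact fun h' => h h'.symm

/-- After separation, both groups of particles are ordered. -/
def Good (m n : ℤ) (x : ℤ × ℤ) (w : List Particle) : Prop :=
  ∀ κ : Bool, ∀ g ∈ gaps (sep (m - n) x κ w).1, 0 < g

theorem Good.congr {w w' : List Particle} (h : Good m n x w) (hw : Valid m n (x, w))
    (he : MEq m n x w w') : Good m n x w' := fun κ => by
  rw [← he.sep_eq hw]; exact h κ

theorem good_iff {w : List Particle} (hw : Valid m n (x, w)) (κ : Bool) :
    Good m n x w ↔ (∀ g ∈ gaps (sep (m - n) x κ w).1, 0 < g) ∧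
      (∀ g ∈ gaps (sep (m - n) x κ w).2, 0 < g) := by
  rw [gaps_sep_snd hw]
  constructor
  · intro h; exact ⟨h κ, h !κ⟩
  · rintro ⟨h1, h2⟩ κ'
    by_cases h : κ' = κ
    · rw [h]; exact h1
    · have : κ' = !κ := by cases κ <;> cases κ' <;> simp_all
      rw [this]; exact h2

theorem Good.gap {u v : List Particle} {A B : Particle} (h : Good m n x (u ++ A :: B :: v))
    (hw : Valid m n (x, u ++ A :: B :: v)) (hk : A.isHalf = B.isHalf) : 0 < A.gap B :=
  h _ _ (gap_mem_gaps_sep (κ := B.isHalf) hw hk rfl)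

theorem Good.tail {v : List Particle} {A : Particle} (h : Good m n x (A :: v))
    (hw : Valid m n (x, A :: v)) : Good m n x v := by
  rw [good_iff (valid_cons.1 hw).2.2 A.isHalf]
  rw [good_iff hw A.isHalf, sep_cons_of_eq rfl] at h
  refine ⟨fun g hg => h.1 g ?_, h.2⟩
  cases hs : (sep (m - n) x A.isHalf v).1 with
  | nil => rw [hs] at hg; simp [gaps] at hg
  | cons D l => rw [hs] at hg; exact List.mem_cons_of_mem _ hg

end

section
variable {m n : ℤ} {x : ℤ × ℤ} {N a : ℤ} {κ : Bool}

/-! ### Normal ordering -/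

/-- The mode of a particle in a scale in which the two kinds of particles never tie. -/
def Particle.key (A : Particle) : ℤ := 2 * A.mode + if A.isHalf then 0 else 1

/-- The order condition on neighbours `A`, `B` of different spin that act on a domain `(a, b)`. If
`B` cannot be the second of the two to act unless superscripts are inverted, it is weakened. -/
def Nrm (N a : ℤ) (A B : Particle) : Prop :=
  A.key < B.key + if 0 ≤ a + A.sg ∧ a + A.sg ≤ N then 0 else 2

theorem key_flip (e : ℤ) (A : Particle) : (A.flip e).key = A.key + 2 * e := by
  unfold key; rw [mode_flip, isHalf_flip]; ring

theorem key_mod (A : Particle) : A.key % 2 = if A.isHalf then 0 else 1 := by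
  unfold key; split_ifs <;> omega

theorem key_mod_ne {A B : Particle} (h : A.isHalf ≠ B.isHalf) : A.key % 2 ≠ B.key % 2 := by
  rw [key_mod, key_mod]
  cases hA : A.isHalf <;> cases hB : B.isHalf <;> simp_all

theorem key_ne {A B : Particle} (h : A.isHalf ≠ B.isHalf) : A.key ≠ B.key :=
  fun h' => key_mod_ne h (by rw [h'])

theorem key_sub_of_eq {A B : Particle} (h : A.isHalf = B.isHalf) :
    A.key - B.key = 2 * (A.mode - B.mode) := by
  unfold key; rw [h]; ring

/-- If a pair is ordered, then `A` precedes `B` also after their exchange. -/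
theorem Nrm.lt {A B : Particle} (h : Nrm N a A B) : A.key < (xch N a A B).1.key := by
  unfold Nrm at h
  rcases xch_cases N a A B with ⟨hc, e⟩ | ⟨hc, e⟩ <;> rw [e]
  · rwa [if_pos hc, add_zero] at h
  · rw [if_neg hc] at h
    simp only [key_flip]; omega

/-- Of a pair of particles of different spin and the exchanged pair exactly one is ordered. -/
theorem nrm_xch_iff {A B : Particle} (hk : A.isHalf ≠ B.isHalf)
    (h2 : 0 ≤ a + B.sg + A.sg) (h3 : a + B.sg + A.sg ≤ N) (h4 : 0 ≤ a + B.sg) (h5 : a + B.sg ≤ N) :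
    Nrm N a (xch N a A B).1 (xch N a A B).2 ↔ ¬ Nrm N a A B := by
  have := key_mod_ne hk
  have := A.sg_eq
  have := B.sg_eq
  unfold Nrm
  rcases xch_cases N a A B with ⟨hc, e⟩ | ⟨hc, e⟩ <;> rw [e] <;> simp only [key_flip, sg_flip]
  · rw [if_pos hc, if_pos ⟨h4, h5⟩]; omega
  · have hc' : ¬ (0 ≤ a + -B.sg ∧ a + -B.sg ≤ N) := by omega
    rw [if_neg hc, if_neg hc']; omega

/-- All neighbours of different spin are ordered. -/
def MixedNormal (N : ℤ) (x : ℤ × ℤ) : List Particle → Prop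
  | A :: B :: v => (A.isHalf ≠ B.isHalf → Nrm N (target x v).1 A B) ∧ MixedNormal N x (B :: v)
  | _ => True

theorem MixedNormal.tail {A : Particle} {v : List Particle} (h : MixedNormal N x (A :: v)) :
    MixedNormal N x v := by
  cases v with
  | nil => trivial
  | cons B v => exact h.2

theorem mixedNormal_iff {w : List Particle} :
    MixedNormal N x w ↔ ∀ u v A B, w = u ++ A :: B :: v → A.isHalf ≠ B.isHalf →
      Nrm N (target x v).1 A B := by
  induction w with
  | nil => simp [MixedNormal]
  | cons C w ih =>
    constructor
    · intro h u v A B hw hk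
      cases u with
      | nil =>
        obtain ⟨rfl, rfl⟩ := List.cons.inj hw
        exact h.1 hk
      | cons D u =>
        obtain ⟨rfl, rfl⟩ := List.cons.inj hw
        exact ih.1 h.tail u v A B rfl hk
    · intro h
      have ht : MixedNormal N x w := ih.2 fun u v A B hw hk =>
        h (C :: u) v A B (by rw [hw]; rfl) hk
      cases w with
      | nil => trivial
      | cons D w => exact ⟨h [] w C D rfl, ht⟩

theorem key_le_of_gap_pos {A B : Particle} (hA : A.Meaningful) (hB : B.Meaningful)
    (hk : A.isHalf = B.isHalf) (h : 0 < gap A B) : A.key ≤ B.key := by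
  have := key_sub_of_eq hk
  have := (gap_pos_iff hA hB hk).1 h
  omega

/-- In a product with ordered neighbours, the first particle `A` is also ordered relative to the
first particle `B` of the other spin, once `B` has been moved next to `A`. -/
theorem MixedNormal.nrm_first {A : Particle} {v : List Particle}
    (h : MixedNormal (m - n) x (A :: v)) (hv : Valid m n (x, A :: v))
    (hg : Good m n x v) (hg' : ∀ B w, v = B :: w → A.isHalf = B.isHalf → 0 < gap A B)
    (hA : A.isHalf ≠ κ) {B : Particle} {r : List Particle}
    (hs : (sep (m - n) x κ v).1 = B :: r) :
    Nrm (m - n) (target (target x (sep (m - n) x κ v).2) r).1 A B := by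
  induction v generalizing A B r with
  | nil => simp [sep] at hs
  | cons C v ih =>
    have hv' := (valid_cons.1 hv).2.2
    -- either `C` is itself `B`, or `B` arises from `B'` by passing `C`, and `A.key ≤ C.key < B.key`
    by_cases hC : C.isHalf = κ
    · rw [sep_cons_of_eq hC] at hs ⊢
      obtain ⟨rfl, rfl⟩ := List.cons.inj hs
      simp only
      rw [target_sep (valid_cons.1 hv').2.2]
      exact h.1 fun h' => hA (h'.trans hC)
    · rw [sep_cons_of_ne hC] at hs
      cases hs' : (sep (m - n) x κ v).1 with
      | nil => rw [hs'] at hs; simp [push] at hs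
      | cons B' r' =>
        have hlt := (ih h.2 hv' (hg.tail hv') (fun B w hw hk => by
          subst hw
          exact hg.gap (u := []) hv' hk) hC hs').lt
        rw [hs'] at hs
        simp only [push] at hs
        obtain ⟨rfl, -⟩ := List.cons.inj hs
        have hk : A.isHalf = C.isHalf := by
          rw [not_eq_of_ne hA, not_eq_of_ne hC]
        have := key_le_of_gap_pos hv.pair.1 hv.pair.2.1 hk (hg' C v rfl hk)
        unfold Nrm
        split_ifs <;> omega

/-- Every product can be brought into an order in which all neighbours of different spin are
ordered. A single new particle on the left is moved to the right until it is in order. -/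
theorem exists_mixedNormal_cons (A : Particle) (v : List Particle) (hv : Valid m n (x, A :: v))
    (h : MixedNormal (m - n) x v) :
    ∃ w, MEq m n x (A :: v) w ∧ MixedNormal (m - n) x w ∧
      (w = A :: v ∨ ∃ B u, w = B :: u ∧ B.isHalf ≠ A.isHalf) := by
  induction v generalizing A with
  | nil => exact ⟨_, .refl _, trivial, Or.inl rfl⟩
  | cons B v ih =>
    by_cases hk : A.isHalf = B.isHalf
    · exact ⟨_, .refl _, ⟨fun h' => absurd hk h', h⟩, Or.inl rfl⟩
    by_cases hn : Nrm (m - n) (target x v).1 A B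
    · exact ⟨_, .refl _, ⟨fun _ => hn, h⟩, Or.inl rfl⟩
    obtain ⟨-, -, -, ⟨c0, c1, -, -⟩, ⟨e0, e1, -, -⟩⟩ := hv.pair
    have hx := (hv.exchange hk).1
    obtain ⟨w, hw, hmn, hor⟩ := ih _ (valid_cons.1 hx).2.2 h.tail
    refine ⟨_, (MEq.head hk).trans (hw.cons _), ?_,
      Or.inr ⟨_, w, rfl, by rw [isHalf_xch_fst]; exact fun h => hk h.symm⟩⟩
    -- the exchanged `A` either stays in second place or is preceded by a particle of the spin of
    -- `B`
    rcases hor with rfl | ⟨C, u, rfl, hC⟩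
    · exact ⟨fun _ => (nrm_xch_iff hk e0 e1 c0 c1).2 hn, hmn⟩
    -- the first two particles have the same spin, so there is nothing to check
    · refine ⟨fun h' => ?_, hmn⟩
      simp only [isHalf_xch_fst, isHalf_xch_snd] at h' hC
      cases h1 : A.isHalf <;> cases h2 : B.isHalf <;> cases h3 : C.isHalf <;> simp_all

theorem exists_mixedNormal (w : List Particle) (hv : Valid m n (x, w)) :
    ∃ w', MEq m n x w w' ∧ MixedNormal (m - n) x w' := by
  induction w with
  | nil => exact ⟨[], .refl _, trivial⟩
  | cons A w ih =>
    obtain ⟨w', h1, h2⟩ := ih (valid_cons.1 hv).2.2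
    obtain ⟨w'', h3, h4, -⟩ := exists_mixedNormal_cons A w' ((h1.cons A).valid hv) h2
    exact ⟨w'', (h1.cons A).trans h3, h4⟩

/-- The normal order is unique. -/
theorem mixedNormal_unique (w w' : List Particle) (hv : Valid m n (x, w)) (hg : Good m n x w)
    (h : MixedNormal (m - n) x w) (h' : MixedNormal (m - n) x w') (he : MEq m n x w w') :
    w = w' := by
  induction w generalizing w' with
  | nil =>
    generalize hw : ([] : List Particle) = w at he
    cases he with
    | refl => rfl
    | step u => simp at hw
  | cons A v ih =>
    have hv' := he.valid hv
    cases w' with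
    | nil =>
      have := he.sep_eq (κ := A.isHalf) hv
      rw [sep_cons_of_eq rfl] at this
      simp [sep] at this
    | cons B v' =>
      have hvt := (valid_cons.1 hv).2.2
      have hvt' := (valid_cons.1 hv').2.2
      have hg2 := hg.congr hv he
      by_cases hk : A.isHalf = B.isHalf
      · have hs := he.sep_eq (κ := A.isHalf) hv
        rw [sep_cons_of_eq rfl, sep_cons_of_eq hk.symm] at hs
        obtain ⟨h1, h2⟩ := Prod.mk.inj hs
        obtain ⟨rfl, h3⟩ := List.cons.inj h1
        rw [ih v' hvt (hg.tail hv) h.tail h'.tail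
          (MEq.of_sep_eq (κ := A.isHalf) hvt' (Prod.ext h3 h2))]
      · exfalso
        -- bring the first particle of the spin of `B` next to `A`
        have hs := he.sep_eq (κ := B.isHalf) hv
        rw [sep_cons_of_ne hk, sep_cons_of_eq rfl] at hs
        cases hs' : (sep (m - n) x B.isHalf v).1 with
        | nil => rw [hs'] at hs; simp [push] at hs
        | cons B₁ r =>
          have hB₁ : B₁.isHalf = B.isHalf := isHalf_sep_fst v B₁ (by rw [hs']; simp)
          have hn := h.nrm_first hv (hg.tail hv) (fun C w hw hk => by
            subst hw; exact hg.gap (u := []) hv hk) hk hs'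
          have e1 := (meq_sep (m := m) (n := n) (x := x) (κ := B.isHalf) v).cons A
          rw [hs', List.cons_append] at e1
          have hv1 := e1.valid hv
          have hk1 : A.isHalf ≠ B₁.isHalf := by rwa [hB₁]
          have e2 := e1.trans (MEq.head hk1)
          have hv2 := e2.valid hv
          rw [target_append] at e2 hv2
          have hB : (xch (m - n) (target (target x (sep (m - n) x B.isHalf v).2) r).1 A B₁).1 = B := by
            rw [hs'] at hs
            simp only [push, Prod.mk.injEq, List.cons.injEq] at hs
            exact hs.1.1
          -- the tail of `B :: v'` has the exchanged `A` as its first particle of that spin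
          have e3 := (e2.symm hv).trans he
          have hs3 := e3.sep_eq (κ := B.isHalf) hv2
          rw [hB, sep_cons_of_eq rfl, sep_cons_of_eq rfl] at hs3
          obtain ⟨h3, h4⟩ := Prod.mk.inj hs3
          have hv3 := (valid_cons.1 hv2).2.2
          have e4 := MEq.of_sep_eq hvt' (Prod.ext (List.cons.inj h3).2 h4)
          have hs4 := e4.sep_eq (κ := A.isHalf) hv3
          rw [sep_cons_of_eq isHalf_xch_snd] at hs4
          have hn' := h'.nrm_first hv' (hg2.tail hv') (fun C w hw hk => by
            subst hw; exact hg2.gap (u := []) hv' hk) (Ne.symm hk) (by rw [← hs4])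
          rw [← hs4] at hn'
          simp only at hn'
          rw [target_sep (valid_cons.1 hv3).2.2, target_append] at hn'
          obtain ⟨-, -, -, ⟨c0, c1, -, -⟩, ⟨e0, e1, -, -⟩⟩ := hv1.pair
          rw [target_append] at c0 c1 e0 e1
          -- now both the pair `A`, `B₁` and its exchange are ordered
          have := (nrm_xch_iff hk1 e0 e1 c0 c1).1 (by rw [hB]; exact hn')
          exact this hn

/-! ### Comparison with the definition of normally ordered products -/

theorem boundaryPair_iff {A B : Particle} (h0 : 0 ≤ a) (h1 : a ≤ m - n) (h2 : 0 ≤ a + B.sg)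
    (h3 : a + B.sg ≤ m - n) (h4 : 0 ≤ a + B.sg + A.sg) (h5 : a + B.sg + A.sg ≤ m - n) :
    BoundaryPair m n a A B ↔ A.isHalf ≠ B.isHalf ∧ ¬ (0 ≤ a + A.sg ∧ a + A.sg ≤ m - n) ∧
      A.key = B.key + 1 := by
  cases A with
  | half s j k =>
    cases B with
    | half => simp [BoundaryPair, isHalf]
    | zero s' t l =>
      rcases Int.units_eq_one_or s with rfl | rfl <;> rcases Int.units_eq_one_or s' with rfl | rfl <;>
        simp [BoundaryPair, isHalf, key, mode, sg] at * <;> omega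
  | zero s' t l =>
    cases B with
    | zero => simp [BoundaryPair, isHalf]
    | half s j k =>
      rcases Int.units_eq_one_or s with rfl | rfl <;> rcases Int.units_eq_one_or s' with rfl | rfl <;>
        simp [BoundaryPair, isHalf, key, mode, sg] at * <;> omega

theorem normPair_iff_of_eq {A B : Particle} (hA : A.Meaningful) (hB : B.Meaningful)
    (hk : A.isHalf = B.isHalf) : NormPair m n a A B ↔ 0 < gap A B := by
  have he := ext_iff' A B
  rw [gap_pos_iff hA hB hk]
  have key : A.mode = B.mode ∧ A.sg = B.sg → A = B := fun h => hA.ext hB hk h.2 h.1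
  cases A with
  | half s j k =>
    cases B with
    | half s' j' k' =>
      simp only [NormPair, mode, sg] at *
      constructor
      · rintro (h | ⟨rfl, rfl, rfl⟩)
        · exact Or.inl h
        · exact Or.inr ⟨rfl, rfl⟩
      · rintro (h | h)
        · exact Or.inl h
        · have := key h
          simp only [half.injEq] at this
          exact Or.inr ⟨this.2.2, this.1, this.2.1⟩
    | zero => simp [isHalf] at hk
  | zero s j k =>
    cases B with
    | zero s' j' k' =>
      simp only [NormPair, mode, sg] at *
      constructor
      · rintro (h | ⟨rfl, rfl, rfl⟩)
        · exact Or.inl h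
        · exact Or.inr ⟨rfl, rfl⟩
      · rintro (h | h)
        · exact Or.inl h
        · have := key h
          simp only [zero.injEq] at this
          exact Or.inr ⟨this.2.2, this.1, this.2.1⟩
    | half => simp [isHalf] at hk

theorem normPair_iff_of_ne {A B : Particle} (h0 : 0 ≤ a) (h1 : a ≤ m - n) (h2 : 0 ≤ a + B.sg)
    (h3 : a + B.sg ≤ m - n) (h4 : 0 ≤ a + B.sg + A.sg) (h5 : a + B.sg + A.sg ≤ m - n)
    (hk : A.isHalf ≠ B.isHalf) : NormPair m n a A B ↔ Nrm (m - n) a A B := by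
  have hb := boundaryPair_iff h0 h1 h2 h3 h4 h5
  have : NormPair m n a A B ↔ A.key < B.key ∨ BoundaryPair m n a A B := by
    cases A with
    | half s j k =>
      cases B with
      | half => simp [isHalf] at hk
      | zero s' t l =>
        simp only [NormPair, key, mode, isHalf, if_true, Bool.false_eq_true, if_false]
        refine or_congr_left ?_
        omega
    | zero s' t l =>
      cases B with
      | zero => simp [isHalf] at hk
      | half s j k =>
        simp only [NormPair, key, mode, isHalf, if_true, Bool.false_eq_true, if_false]
        refine or_congr_left ?_
        omega
  have hne := key_ne hk
  rw [this, hb, Nrm]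
  split_ifs with hc
  · simp [hc]
  · simp only [hc, not_false_iff, true_and, hk, ne_eq]
    omega

/-- The conditions in the definition of `normallyOrdered`, for a product that is only a list. -/
def NormalList (m n : ℤ) (x : ℤ × ℤ) (w : List Particle) : Prop :=
  (∀ u v A B, w = u ++ A :: B :: v → NormPair m n (target x v).1 A B) ∧
    ∀ u v A B C, w = u ++ A :: B :: C :: v →
      ¬ (BoundaryPair m n (target x (C :: v)).1 A B ∧ BoundaryPair m n (target x v).1 B C)

theorem NormalList.tail {A : Particle} {v : List Particle} (h : NormalList m n x (A :: v)) :
    NormalList m n x v :=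
  ⟨fun u w B C hv => h.1 (A :: u) w B C (by rw [hv]; rfl),
    fun u w B C D hv => h.2 (A :: u) w B C D (by rw [hv]; rfl)⟩

theorem Valid.normPair_iff {A B : Particle} {v : List Particle} (h : Valid m n (x, A :: B :: v))
    (hk : A.isHalf ≠ B.isHalf) :
    NormPair m n (target x v).1 A B ↔ Nrm (m - n) (target x v).1 A B := by
  obtain ⟨-, -, ⟨a0, a1, -, -⟩, ⟨c0, c1, -, -⟩, ⟨e0, e1, -, -⟩⟩ := h.pair
  exact normPair_iff_of_ne a0 a1 c0 c1 e0 e1 hk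

theorem Valid.boundaryPair_iff {A B : Particle} {v : List Particle}
    (h : Valid m n (x, A :: B :: v)) :
    BoundaryPair m n (target x v).1 A B ↔ A.isHalf ≠ B.isHalf ∧
      ¬ (0 ≤ (target x v).1 + A.sg ∧ (target x v).1 + A.sg ≤ m - n) ∧ A.key = B.key + 1 := by
  obtain ⟨-, -, ⟨a0, a1, -, -⟩, ⟨c0, c1, -, -⟩, ⟨e0, e1, -, -⟩⟩ := h.pair
  exact AltSpin.boundaryPair_iff a0 a1 c0 c1 e0 e1

/-- A product is normally ordered if and only if its neighbours of different spin are ordered and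
both groups of particles are ordered after separation. In the induction a new particle `A` on the
left is compared with the next particle of its spin; if the two could violate the order, then there
is just one particle between them, and it belongs to two boundary pairs. -/
theorem normalList_iff {w : List Particle} (hv : Valid m n (x, w)) :
    NormalList m n x w ↔ MixedNormal (m - n) x w ∧ Good m n x w := by
  constructor
  · intro h
    have hmn : MixedNormal (m - n) x w := by
      rw [mixedNormal_iff]
      rintro u v A B rfl hk
      exact ((valid_append.1 hv).1.normPair_iff hk).1 (h.1 u v A B rfl)
    refine ⟨hmn, ?_⟩
    induction w with
    | nil => intro κ g hg; simp [sep, gaps] at hg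
    | cons A v ih =>
      have hv' := (valid_cons.1 hv).2.2
      have hg := ih hv' h.tail hmn.tail
      have hg' := (good_iff hv' A.isHalf).1 hg
      rw [good_iff hv A.isHalf, sep_cons_of_eq rfl]
      refine ⟨?_, hg'.2⟩
      -- only the gap between `A` and the next particle `D` of its spin in the separated form is new
      suffices hA : ∀ D l, (sep (m - n) x A.isHalf v).1 = D :: l → 0 < gap A D by
        cases hs : (sep (m - n) x A.isHalf v).1 with
        | nil => simp [gaps]
        | cons D l =>
          intro g hmem
          rcases List.mem_cons.1 hmem with rfl | hmem
          · exact hA D l hs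
          · exact hg'.1 g (by rw [hs]; exact hmem)
      intro D l hs
      cases v with
      | nil => simp [sep] at hs
      | cons B v =>
        have hv'' := (valid_cons.1 hv').2.2
        have hpair := h.1 [] v A B rfl
        by_cases hk : B.isHalf = A.isHalf
        · rw [sep_cons_of_eq hk] at hs
          obtain ⟨rfl, -⟩ := List.cons.inj hs
          exact (normPair_iff_of_eq hv.pair.1 hv.pair.2.1 hk.symm).1 hpair
        · rw [sep_cons_of_ne hk] at hs
          cases hs' : (sep (m - n) x A.isHalf v).1 with
          | nil => rw [hs'] at hs; simp [push] at hs
          -- `A₁` becomes `D` when it passes `B`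
          | cons A₁ r =>
            have hA₁ : A₁.isHalf = A.isHalf := isHalf_sep_fst v A₁ (by rw [hs']; simp)
            have hgap : ∀ C u, v = C :: u → B.isHalf = C.isHalf → 0 < gap B C :=
              fun C u hw hk => by subst hw; exact hg.gap (u := []) hv' hk
            have hn2 := hmn.tail.nrm_first hv' (hg.tail hv') hgap hk hs'
            have hn1 := (hv.normPair_iff (Ne.symm hk)).1 hpair
            have ht := target_sep (κ := A.isHalf) hv''
            have e1 := (meq_sep (m := m) (n := n) (x := x) (κ := A.isHalf) v).cons B
            rw [hs', target_cons] at ht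
            rw [hs', List.cons_append] at e1
            have hvB := e1.valid hv'
            have hvx := (hvB.exchange (by rwa [hA₁])).1
            rw [target_append] at hvx
            rw [hs'] at hs
            simp only [push] at hs
            obtain ⟨rfl, -⟩ := List.cons.inj hs
            have hmA := hv.pair.1
            have hkD := isHalf_xch_fst (N := m - n)
              (a := (target (target x (sep (m - n) x A.isHalf v).2) r).1) (A := B) (B := A₁)
            rw [gap_pos_iff hmA (valid_cons.1 hvx).1 (by rw [hkD, hA₁])]
            have hkey := key_sub_of_eq (hA₁.symm.trans hkD.symm : A.isHalf = _)
            obtain ⟨-, -, ⟨a0, a1, -, -⟩, ⟨c0, c1, -, -⟩, ⟨e0, e1, -, -⟩⟩ := hvB.pair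
            obtain ⟨-, -, ⟨a0', a1', -, -⟩, ⟨c0', c1', -, -⟩, ⟨e0', e1', -, -⟩⟩ := hv.pair
            rw [target_append] at a0 a1 c0 c1 e0 e1
            have htv : (target x v).1 =
              (target (target x (sep (m - n) x A.isHalf v).2) r).1 + A₁.sg := by rw [← ht]
            set y := (target (target x (sep (m - n) x A.isHalf v).2) r).1 with hy
            have hsA := A.sg_eq
            have hsB := B.sg_eq
            have hsA₁ := A₁.sg_eq
            unfold Nrm at hn1 hn2
            have hneAB := key_ne (Ne.symm hk)
            rcases xch_cases (m - n) y B A₁ with ⟨hc, e⟩ | ⟨hc, e⟩ <;> rw [e] at hkey ⊢ <;>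
              simp only [key_flip, mode_flip, sg_flip] at hkey ⊢
            · rw [if_pos hc] at hn2
              by_cases hc1 : 0 ≤ (target x v).1 + A.sg ∧ (target x v).1 + A.sg ≤ m - n
              · rw [if_pos hc1] at hn1; omega
              · rw [if_neg hc1] at hn1
                omega
            · rw [if_neg hc] at hn2
              by_cases hc1 : 0 ≤ (target x v).1 + A.sg ∧ (target x v).1 + A.sg ≤ m - n
              · rw [if_pos hc1] at hn1; omega
              · rw [if_neg hc1] at hn1
                -- both exchanges are inverting ones; a violation forces successive keys
                by_contra hcon
                have hk1 : A.key = B.key + 1 ∧ B.key = A₁.key + 1 := by omega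
                cases v with
                | nil => simp [sep] at hs'
                | cons C u =>
                  by_cases hC : C.isHalf = A.isHalf
                  · rw [sep_cons_of_eq hC] at hs' hy
                    obtain ⟨rfl, rfl⟩ := List.cons.inj hs'
                    simp only at hy
                    rw [target_sep (valid_cons.1 hv'').2.2] at hy
                    -- `C = A₁` is the next particle, and `B` belongs to two boundary pairs
                    refine h.2 [] u A B C rfl ⟨?_, ?_⟩
                    · rw [hv.boundaryPair_iff]
                      exact ⟨Ne.symm hk, hc1, hk1.1⟩
                    · rw [hv'.boundaryPair_iff, ← hy]
                      exact ⟨fun h' => hk (h'.trans hC), hc, hk1.2⟩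
                  -- another particle `C` of the spin of `B` follows, and its key leaves no room for
                  -- `A₁`
                  · have hBC : B.isHalf = C.isHalf := by
                      rw [not_eq_of_ne hk, not_eq_of_ne hC]
                    have hgBC := (gap_pos_iff hv'.pair.1 hv'.pair.2.1 hBC).1 (hgap C u rfl hBC)
                    have hkBC := key_sub_of_eq hBC
                    have hsC := C.sg_eq
                    obtain ⟨-, -, ⟨a2, a3, -, -⟩, -, -⟩ := hv'.pair
                    have hg2 := hg.tail hv'
                    rw [target_cons] at htv hc1 a0' a1' c0' c1' e0' e1'
                    rw [sep_cons_of_ne hC] at hs'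
                    cases hs2 : (sep (m - n) x A.isHalf u).1 with
                    | nil => rw [hs2] at hs'; simp [push] at hs'
                    | cons A₂ r₂ =>
                      have hn3 := hmn.tail.tail.nrm_first hv'' (hg2.tail hv'')
                        (fun E w hw hk => by subst hw; exact hg2.gap (u := []) hv'' hk) hC hs2
                      have hlt := hn3.lt
                      rw [hs2] at hs'
                      simp only [push] at hs'
                      rw [(List.cons.inj hs').1] at hlt
                      omega
  · rintro ⟨hmn, hg⟩
    refine ⟨fun u v A B hw => ?_, fun u v A B C hw => ?_⟩
    · subst hw
      have hv' := (valid_append.1 hv).1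
      by_cases hk : A.isHalf = B.isHalf
      · exact (normPair_iff_of_eq hv'.pair.1 hv'.pair.2.1 hk).2 (hg.gap hv hk)
      · exact (hv'.normPair_iff hk).2 (mixedNormal_iff.1 hmn u v A B rfl hk)
    · subst hw
      rintro ⟨h1, h2⟩
      have hv1 := (valid_append.1 hv).1
      have hv2 := (valid_cons.1 hv1).2.2
      obtain ⟨k1, b1, s1⟩ := hv1.boundaryPair_iff.1 h1
      obtain ⟨k2, b2, s2⟩ := hv2.boundaryPair_iff.1 h2
      have he : MEq m n x (u ++ A :: B :: C :: v) _ :=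
        MEq.append_left (u ++ [A]) (MEq.head (v := v) k2) |> fun h => by simpa using h
      have hv3 := he.valid hv
      have hg3 := (hg.congr hv he).gap hv3
      have hkA : A.isHalf = C.isHalf := by
        cases h1 : A.isHalf <;> cases h2 : B.isHalf <;> cases h3 : C.isHalf <;> simp_all
      have hv4 := (valid_append.1 hv3).1
      have hgp := (gap_pos_iff hv4.pair.1 hv4.pair.2.1 (by rw [isHalf_xch_fst, hkA])).1
        (hg3 (by rw [isHalf_xch_fst, hkA]))
      have hkey := key_sub_of_eq hkA
      have hsA := A.sg_eq
      have hsB := B.sg_eq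
      have hsC := C.sg_eq
      obtain ⟨-, -, ⟨a0', a1', -, -⟩, ⟨c0', c1', -, -⟩, ⟨e0', e1', -, -⟩⟩ := hv1.pair
      obtain ⟨-, -, ⟨a2, a3, -, -⟩, ⟨c2, c3, -, -⟩, ⟨e2, e3, -, -⟩⟩ := hv2.pair
      rw [target_cons] at b1 a0' a1' c0' c1' e0' e1'
      -- after the exchange of `B` and `C` the neighbour of `A` has the mode of `A`, but the
      -- opposite superscript
      rcases xch_cases (m - n) (target x v).1 B C with ⟨hc, e⟩ | ⟨hc, e⟩
      · exact b2 hc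
      · rw [e] at hgp
        simp only [mode_flip, sg_flip] at hgp b1 c0' c1' e0' e1' a0' a1'
        omega

end

section
variable {m n : ℤ} {x : ℤ × ℤ} {N a : ℤ} {κ : Bool}

/-! ### Shifting the modes of two neighbours -/

theorem gap_shift_left (g : ℤ) (A B : Particle) : gap (A.shift g) B = gap A B - g := by
  unfold gap; rw [sg_shift, col_shift, mode_shift]; ring

theorem gap_shift_right (g : ℤ) (A B : Particle) : gap A (B.shift g) = gap A B + g := by
  unfold gap; rw [sg_shift, col_shift, mode_shift]; ring

theorem target_shift (g : ℤ) (A : Particle) (v : List Particle) :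
    target x (A.shift g :: v) = target x (A :: v) := by
  rw [target_cons, target_cons, sg_shift, db_shift]

theorem target_shift_pair (g g' : ℤ) (A B : Particle) (u v : List Particle) :
    target x (u ++ A.shift g :: B.shift g' :: v) = target x (u ++ A :: B :: v) := by
  rw [target_append, target_append, target_shift, target_cons, target_shift, ← target_cons]

theorem push_shift (g : ℤ) (A : Particle) (l : List Particle) :
    push N x (A.shift g) l = ((push N x A l).1, (push N x A l).2.shift g) := by
  induction l generalizing A with
  | nil => rfl
  | cons B l ih => simp only [push, xch_shift_left, ih]

/-- A particle that passes through a group of particles of the other spin does not notice shifts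
of the modes in this group, and leaves the gap of two neighbours unchanged. -/
theorem push_shift_pair (C : Particle) (p : List Particle) (A B : Particle) (q : List Particle)
    (hv : Valid m n (x, C :: (p ++ A :: B :: q))) (hk : ∀ D ∈ p ++ A :: B :: q, D.isHalf ≠ C.isHalf) :
    ∃ p' A' B' q' C', gap A' B' = gap A B ∧ ∀ g g',
      push (m - n) x C (p ++ A.shift g :: B.shift g' :: q) =
        (p' ++ A'.shift g :: B'.shift g' :: q', C') := by
  induction p generalizing C with
  | nil =>
    have hA : C.isHalf ≠ A.isHalf := (hk A (by simp)).symm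
    have hv1 : Valid m n (x, C :: A :: B :: q) := hv
    obtain ⟨-, -, -, ⟨e0, e1, -, -⟩, ⟨f0, f1, -, -⟩⟩ := hv1.pair
    obtain ⟨-, -, ⟨a0, a1, -, -⟩, ⟨c0, c1, -, -⟩, -⟩ := (valid_cons.1 hv1).2.2.pair
    rw [target_cons] at e0 e1 f0 f1
    have hg := gap_xch' (B := C) (A := A) (A' := B) a0 a1 f0 f1
    let C₂ := (xch (m - n) (target x q).1 (xch (m - n) ((target x q).1 + B.sg) C A).2 B).2
    refine ⟨[], _, _, (push (m - n) x C₂ q).1, (push (m - n) x C₂ q).2, hg, fun g g' => ?_⟩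
    simp only [List.nil_append, push, xch_shift_right, target_cons, C₂, sg_shift]
  | cons E p ih =>
    have hE : C.isHalf ≠ E.isHalf := (hk E (by simp)).symm
    have hv : Valid m n (x, C :: E :: (p ++ A :: B :: q)) := hv
    have hv1 := (valid_cons.1 (hv.exchange hE).1).2.2
    obtain ⟨p', A', B', q', C', h1, h2⟩ := ih _ hv1 fun D hD => by
      simpa using hk D (List.mem_cons_of_mem _ hD)
    refine ⟨(xch (m - n) (target x (p ++ A :: B :: q)).1 C E).1 :: p', A', B', q', C', h1,
      fun g g' => ?_⟩
    simp only [List.cons_append, push, target_shift_pair]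
    rw [h2]

/-- The gap between two particles does not change when both pass through a group of particles of
the other spin. -/
theorem gap_push_push (A A' : Particle) (l : List Particle) (hv : Valid m n (x, A :: A' :: l))
    (hA : ∀ B ∈ l, B.isHalf ≠ A.isHalf) (hA' : ∀ B ∈ l, B.isHalf ≠ A'.isHalf) :
    gap (push (m - n) (target x [(push (m - n) x A' l).2]) A (push (m - n) x A' l).1).2
      (push (m - n) x A' l).2 = gap A A' := by
  induction l generalizing A A' with
  | nil => rfl
  | cons B l ih =>
    have hk' : A'.isHalf ≠ B.isHalf := (hA' B (by simp)).symm
    have hk : A.isHalf ≠ B.isHalf := (hA B (by simp)).symm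
    have e1 : MEq m n x (A :: A' :: B :: l) _ := (MEq.head hk').cons A
    have hv1 := e1.valid hv
    obtain ⟨hv2, -⟩ := hv1.exchange (by simpa using hk)
    have hv3 := (valid_cons.1 hv2).2.2
    obtain ⟨-, -, -, ⟨e0, e1, -, -⟩, ⟨f0, f1, -, -⟩⟩ := hv.pair
    obtain ⟨-, -, ⟨a0, a1, -, -⟩, ⟨c0, c1, -, -⟩, -⟩ := (valid_cons.1 hv).2.2.pair
    rw [target_cons] at e0 e1 f0 f1
    have ht := (meq_push (m := m) (n := n) (x := x) (xch (m - n) (target x l).1 A' B).2 l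
      fun C hC => by simpa using hA' C (List.mem_cons_of_mem _ hC)).target_eq (valid_cons.1 hv3).2.2
    rw [target_append] at ht
    have ih' := ih _ _ hv3 (fun C hC => by simpa using hA C (List.mem_cons_of_mem _ hC))
      (fun C hC => by simpa using hA' C (List.mem_cons_of_mem _ hC))
    have hg := gap_xch (A := A) (B := B) (A' := A') a0 a1 e0 e1 f0 f1
    simp only [push, ht]
    rw [ih', target_cons]
    exact hg

theorem target_sep_cons {C : Particle} {w : List Particle} (hv : Valid m n (x, C :: w)) :
    Valid m n (target x (sep (m - n) x κ w).2, C :: (sep (m - n) x κ w).1) := by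
  have h1 := ((meq_sep (κ := κ) w).cons C).valid hv
  rw [← List.cons_append] at h1
  exact (valid_append.1 h1).2

/-- Shifting the modes of two neighbours of the same spin has the same effect on the separated
product; here for particles that stand on the left after separation. -/
theorem sep_shift_pair_fst (u v : List Particle) (A B : Particle)
    (hv : Valid m n (x, u ++ A :: B :: v)) (hA : A.isHalf = κ) (hB : B.isHalf = κ) :
    ∃ p A' B' q r, gap A' B' = gap A B ∧ ∀ g g',
      sep (m - n) x κ (u ++ A.shift g :: B.shift g' :: v) =
        (p ++ A'.shift g :: B'.shift g' :: q, r) := by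
  induction u with
  | nil =>
    refine ⟨[], A, B, (sep (m - n) x κ v).1, (sep (m - n) x κ v).2, rfl, fun g g' => ?_⟩
    rw [List.nil_append, sep_cons_of_eq (by simpa using hA), sep_cons_of_eq (by simpa using hB)]
    rfl
  | cons C u ih =>
    obtain ⟨p, A', B', q, r, h1, h2⟩ := ih (valid_cons.1 hv).2.2
    by_cases hC : C.isHalf = κ
    · refine ⟨C :: p, A', B', q, r, h1, fun g g' => ?_⟩
      rw [List.cons_append, sep_cons_of_eq hC, h2]; rfl
    · have h0 := h2 0 0
      simp only [shift_zero] at h0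
      have hv1 := target_sep_cons (κ := κ) (w := u ++ A :: B :: v) hv
      have hk := isHalf_sep_fst (N := m - n) (x := x) (κ := κ) (u ++ A :: B :: v)
      rw [h0] at hv1 hk
      obtain ⟨p', A'', B'', q', C', h3, h4⟩ := push_shift_pair C p A' B' q hv1
        fun D hD => by rw [hk D hD]; exact fun h => hC h.symm
      refine ⟨p', A'', B'', q', C' :: r, h3.trans h1, fun g g' => ?_⟩
      rw [List.cons_append, sep_cons_of_ne hC, h2, h4]

/-- The analogue of `sep_shift_pair_fst` for particles that stand on the right after separation. -/
theorem sep_shift_pair_snd (u v : List Particle) (A B : Particle)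
    (hv : Valid m n (x, u ++ A :: B :: v)) (hA : A.isHalf ≠ κ) (hB : B.isHalf ≠ κ) :
    ∃ p A' B' q r, gap A' B' = gap A B ∧ ∀ g g',
      sep (m - n) x κ (u ++ A.shift g :: B.shift g' :: v) =
        (r, p ++ A'.shift g :: B'.shift g' :: q) := by
  induction u with
  | nil =>
    have e1 := ((meq_sep (m := m) (n := n) (x := x) (κ := κ) v).cons B).cons A
    have hv1 := e1.valid hv
    rw [← List.cons_append, ← List.cons_append, valid_append] at hv1
    have hg := gap_push_push A B _ hv1.2
      (fun D hD => by rw [isHalf_sep_fst _ D hD]; exact fun h => hA h.symm)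
      (fun D hD => by rw [isHalf_sep_fst _ D hD]; exact fun h => hB h.symm)
    refine ⟨[], _, _, (sep (m - n) x κ v).2, (push (m - n) (target (target x (sep (m - n) x κ v).2)
      [(push (m - n) (target x (sep (m - n) x κ v).2) B (sep (m - n) x κ v).1).2]) A
      (push (m - n) (target x (sep (m - n) x κ v).2) B (sep (m - n) x κ v).1).1).1, hg,
      fun g g' => ?_⟩
    rw [List.nil_append, sep_cons_of_ne (by simpa using hA), sep_cons_of_ne (by simpa using hB)]
    simp only [push_shift, target_shift, List.nil_append]
    rfl
  | cons C u ih =>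
    obtain ⟨p, A', B', q, r, h1, h2⟩ := ih (valid_cons.1 hv).2.2
    by_cases hC : C.isHalf = κ
    · refine ⟨p, A', B', q, C :: r, h1, fun g g' => ?_⟩
      rw [List.cons_append, sep_cons_of_eq hC, h2]
    · refine ⟨(push (m - n) (target x (p ++ A' :: B' :: q)) C r).2 :: p, A', B', q,
        (push (m - n) (target x (p ++ A' :: B' :: q)) C r).1, h1, fun g g' => ?_⟩
      rw [List.cons_append, sep_cons_of_ne hC, h2]
      simp only [target_shift_pair, List.cons_append]

/-! ### Coordinates in which the relations become transpositions -/

/-- Coordinates of a product of particles of the same spin; the differences of successive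
coordinates are the gaps. The relation for two neighbours transposes their coordinates. -/
def kcoord : List Particle → List ℤ
  | [] => []
  | [A] => [A.mode]
  | A :: B :: l => ((kcoord (B :: l)).headD 0 - gap A B) :: kcoord (B :: l)

/-- The data of the particles other than their modes. -/
def shape (l : List Particle) : List (Bool × ℤ × ℤˣ) := l.map fun A => (A.isHalf, A.sg, A.col)

theorem length_kcoord (l : List Particle) : (kcoord l).length = l.length := by
  induction l with
  | nil => rfl
  | cons A l ih =>
    cases l with
    | nil => rfl
    | cons B l => simp only [kcoord, List.length_cons] at ih ⊢; rw [ih]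

theorem kcoord_cons_cons (A B : Particle) (l : List Particle) :
    kcoord (A :: B :: l) = ((kcoord (B :: l)).headD 0 - gap A B) :: kcoord (B :: l) := rfl

/-- The relation for two neighbours of the same spin transposes their coordinates. -/
theorem kcoord_swap (p q : List Particle) (A B : Particle) :
    ∃ ks a b t, ks.length = p.length ∧ b = a + gap A B ∧
      kcoord (p ++ A :: B :: q) = ks ++ a :: b :: t ∧
      kcoord (p ++ A.shift (gap A B) :: B.shift (-gap A B) :: q) = ks ++ b :: a :: t := by
  induction p with
  | nil =>
    cases q with
    | nil =>
      refine ⟨[], B.mode - gap A B, B.mode, [], rfl, by ring, rfl, ?_⟩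
      simp only [List.nil_append, kcoord, gap_shift_left, gap_shift_right, mode_shift,
        List.headD_cons, List.cons.injEq, and_true]
      constructor <;> ring
    | cons D q =>
      refine ⟨[], (kcoord (D :: q)).headD 0 - gap B D - gap A B, (kcoord (D :: q)).headD 0 - gap B D,
        kcoord (D :: q), rfl, by ring, rfl, ?_⟩
      simp only [List.nil_append, kcoord, gap_shift_left, gap_shift_right,
        List.headD_cons, List.cons.injEq, and_true]
      constructor <;> ring
  | cons P p ih =>
    obtain ⟨ks, a, b, t, h1, h2, h3, h4⟩ := ih
    cases p with
    | nil =>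
      have : ks = [] := List.length_eq_zero_iff.1 (by simpa using h1)
      subst this
      refine ⟨[a - gap P A], a, b, t, rfl, h2, ?_, ?_⟩
      · simp only [List.nil_append] at h3
        simp only [List.cons_append, List.nil_append]
        rw [kcoord_cons_cons, h3]; rfl
      · simp only [List.nil_append] at h4
        simp only [List.cons_append, List.nil_append]
        rw [kcoord_cons_cons, h4, gap_shift_right, List.headD_cons, h2]
        congr 1; ring
    | cons P' p =>
      cases ks with
      | nil => simp at h1
      | cons k ks =>
        refine ⟨(k - gap P P') :: k :: ks, a, b, t, by simpa using h1, h2, ?_, ?_⟩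
        · simp only [List.cons_append] at h3 ⊢
          rw [kcoord, h3]; rfl
        · simp only [List.cons_append] at h4 ⊢
          rw [kcoord, h4]; rfl

/-- Together with all data other than the modes, the coordinates determine a product. -/
theorem eq_of_kcoord {l l' : List Particle} (hs : shape l = shape l') (hk : kcoord l = kcoord l') :
    l = l' := by
  induction l generalizing l' with
  | nil =>
    cases l' with
    | nil => rfl
    | cons => simp [shape] at hs
  | cons A l ih =>
    cases l' with
    | nil => simp [shape] at hs
    | cons A' l' =>
      simp only [shape, List.map_cons, List.cons.injEq, Prod.mk.injEq] at hs
      obtain ⟨⟨h1, h2, h3⟩, hs⟩ := hs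
      have hlen : l.length = l'.length := by simpa using congrArg List.length hs
      cases l with
      | nil =>
        cases l' with
        | nil =>
          have : A = A' := (ext_iff' A A').2 ⟨h1, h2, h3, by simpa [kcoord] using hk⟩
          rw [this]
        | cons => simp at hlen
      | cons B l =>
        cases l' with
        | nil => simp at hlen
        | cons B' l' =>
          simp only [kcoord, List.cons.injEq] at hk
          have e := ih hs hk.2
          obtain ⟨rfl, rfl⟩ := List.cons.inj e
          have hg := hk.1
          unfold gap at hg
          rw [h2, h3] at hg
          have : A = A' := (ext_iff' A A').2 ⟨h1, h2, h3, by linarith⟩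
          rw [this]

theorem isChain_kcoord_iff (l : List Particle) :
    (kcoord l).IsChain (· < ·) ↔ ∀ g ∈ gaps l, 0 < g := by
  induction l with
  | nil => simp [gaps, kcoord]
  | cons A l ih =>
    cases l with
    | nil => simp [gaps, kcoord]
    | cons B l =>
      have hlen := length_kcoord (B :: l)
      cases hk : kcoord (B :: l) with
      | nil => rw [hk] at hlen; simp at hlen
      | cons k ks =>
        rw [hk] at ih
        rw [kcoord, hk, List.isChain_cons_cons, ih]
        simp [gaps]

/-- The antisymmetric function of `ks` that is dual to `ks₀`. -/
def alt (ks₀ ks : List ℤ) : ℂ :=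
  Matrix.det <| Matrix.of fun i j : Fin ks₀.length =>
    if ks.getD i 0 = ks₀.getD j 0 then (1 : ℂ) else 0

theorem alt_self {ks : List ℤ} (h : ks.IsChain (· < ·)) : alt ks ks = 1 := by
  have hn : ks.Nodup := (List.isChain_iff_pairwise.1 h).imp ne_of_lt
  have : (Matrix.of fun i j : Fin ks.length => if ks.getD i 0 = ks.getD j 0 then (1 : ℂ) else 0) =
      (1 : Matrix (Fin ks.length) (Fin ks.length) ℂ) := by
    ext i j
    rw [Matrix.one_apply, Matrix.of_apply, List.getD_eq_getElem _ _ i.2, List.getD_eq_getElem _ _ j.2]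
    exact if_congr (hn.getElem_inj_iff.trans Fin.ext_iff.symm) rfl rfl
  unfold alt
  rw [this]
  exact Matrix.det_one

/-- Different strictly increasing sequences are orthogonal. -/
theorem alt_eq_zero {ks₀ ks : List ℤ} (h₀ : ks₀.IsChain (· < ·)) (h : ks.IsChain (· < ·))
    (hl : ks.length = ks₀.length) (hne : ks ≠ ks₀) : alt ks₀ ks = 0 := by
  have hp := List.isChain_iff_pairwise.1 h
  have hp₀ := List.isChain_iff_pairwise.1 h₀
  have hn : ks.Nodup := hp.imp ne_of_lt
  -- some entry of `ks` does not occur in `ks₀` and gives a zero row of the determinant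
  have : ∃ k ∈ ks, k ∉ ks₀ := by
    by_contra hc
    push Not at hc
    have hperm : ks.Perm ks₀ := (hn.subperm hc).perm_of_length_le hl.ge
    exact hne (hperm.eq_of_pairwise (fun a b _ _ h h' => absurd h (not_lt.2 h'.le)) hp hp₀)
  obtain ⟨k, hk, hk₀⟩ := this
  obtain ⟨i, hi, rfl⟩ := List.getElem_of_mem hk
  refine Matrix.det_eq_zero_of_row_eq_zero ⟨i, hl ▸ hi⟩ fun j => ?_
  rw [Matrix.of_apply, List.getD_eq_getElem _ _ hi, List.getD_eq_getElem _ _ j.2, if_neg]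
  intro he
  exact hk₀ (he ▸ List.getElem_mem _)

theorem alt_swap (ks₀ ks t : List ℤ) (a b : ℤ) (hl : (ks ++ a :: b :: t).length = ks₀.length) :
    alt ks₀ (ks ++ b :: a :: t) = -alt ks₀ (ks ++ a :: b :: t) := by
  simp only [List.length_append, List.length_cons] at hl
  let i : Fin ks₀.length := ⟨ks.length, by omega⟩
  let j : Fin ks₀.length := ⟨ks.length + 1, by omega⟩
  have hij : i ≠ j := by simp [i, j]
  have h := Matrix.det_permute (Equiv.swap i j) (Matrix.of fun i j : Fin ks₀.length =>
    if (ks ++ a :: b :: t).getD i 0 = ks₀.getD j 0 then (1 : ℂ) else 0)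
  rw [Equiv.Perm.sign_swap hij] at h
  simp only [Units.val_neg, Units.val_one, Int.cast_neg, Int.cast_one, neg_mul, one_mul] at h
  unfold alt
  rw [← h]
  congr 1
  ext r c
  simp only [Matrix.submatrix_apply, Matrix.of_apply, id]
  have : (ks ++ b :: a :: t).getD r 0 = (ks ++ a :: b :: t).getD (Equiv.swap i j r) 0 := by
    by_cases hr : r = i
    · subst hr
      rw [Equiv.swap_apply_left]
      simp [i, j, List.getD_eq_getElem?_getD]
    · by_cases hr' : r = j
      · subst hr'
        rw [Equiv.swap_apply_right]
        simp [i, j, List.getD_eq_getElem?_getD]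
      · rw [Equiv.swap_apply_of_ne_of_ne hr hr']
        have h1 : r.val ≠ ks.length := fun h => hr (Fin.ext h)
        have h2 : r.val ≠ ks.length + 1 := fun h => hr' (Fin.ext h)
        rcases lt_or_gt_of_ne h1 with h | h
        · simp [List.getD_eq_getElem?_getD, List.getElem?_append_left h]
        · obtain ⟨d, hd⟩ : ∃ d, r.val = ks.length + (d + 2) := ⟨r.val - ks.length - 2, by omega⟩
          rw [List.getD_eq_getElem?_getD, List.getD_eq_getElem?_getD, hd,
            List.getElem?_append_right (by omega), List.getElem?_append_right (by omega),
            Nat.add_sub_cancel_left]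
          rfl
  rw [this]

end

section
variable {m n : ℤ} {x : ℤ × ℤ} {N a : ℤ} {κ : Bool}

/-! ### The commutation relations in terms of gaps and exchanges -/

theorem gap_even {A B : Particle} (hA : A.Meaningful) (hB : B.Meaningful)
    (hk : A.isHalf = B.isHalf) : gap A B % 2 = 0 := by
  rw [meaningful_iff] at hA hB
  have h1 := A.sg_eq
  have h2 := B.sg_eq
  unfold gap
  rw [hA, hB, hk]
  cases B.isHalf <;> rcases h1 with h1 | h1 <;> rcases h2 with h2 | h2 <;> rw [h1, h2] <;>
    rcases Int.emod_two_eq A.mode with h3 | h3 <;> rcases Int.emod_two_eq B.mode with h4 | h4 <;>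
    simp [h3, h4] <;> omega

theorem Particle.Meaningful.shift {A : Particle} (h : A.Meaningful) {g : ℤ} (hg : g % 2 = 0) :
    (A.shift g).Meaningful := by
  rw [meaningful_iff] at h ⊢
  rw [col_shift, sg_shift, mode_shift, isHalf_shift, h]
  have : (A.mode + g) % 2 = A.mode % 2 := by omega
  rw [this]

theorem valid_shift_pair {A B : Particle} {u v : List Particle}
    (hv : Valid m n (x, u ++ A :: B :: v)) (hk : A.isHalf = B.isHalf) :
    Valid m n (x, u ++ A.shift (gap A B) :: B.shift (-gap A B) :: v) := by
  rw [valid_append] at hv ⊢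
  obtain ⟨h1, h2⟩ := hv
  obtain ⟨hA, hr, h3⟩ := valid_cons.1 h1
  obtain ⟨hB, hr', h4⟩ := valid_cons.1 h3
  have he := gap_even hA hB hk
  have ht : target x (A.shift (gap A B) :: B.shift (-gap A B) :: v) = target x (A :: B :: v) :=
    target_shift_pair _ _ A B [] v
  refine ⟨valid_cons.2 ⟨hA.shift he, by rwa [ht],
    valid_cons.2 ⟨hB.shift (by omega), by rwa [target_shift], h4⟩⟩, by rwa [ht]⟩

theorem Exchange.of_eq {A B C D : Particle} {c : ℤ} (h : Exchange m n a A B c C D)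
    (hk : A.isHalf = B.isHalf) :
    c = -1 ∧ C = A.shift (gap A B) ∧ D = B.shift (-gap A B) := by
  cases h <;> simp only [isHalf, reduceCtorEq] at hk
  case half_half s s' j j' k l ν hν =>
    subst hν
    have h1 : ((s : ℤ) = s') ↔ s = s' := Units.val_inj
    refine ⟨rfl, ?_, ?_⟩ <;>
      simp only [Particle.shift, gap, sg, col, mode, fin_two_neg_one_pow, h1, half.injEq,
        true_and] <;> split_ifs <;> ring
  case zero_zero s s' t t' k l ν hν =>
    subst hν
    have h1 : ((s : ℤ) = s') ↔ s = s' := Units.val_inj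
    refine ⟨rfl, ?_, ?_⟩ <;>
      simp only [Particle.shift, gap, sg, col, mode, h1, zero.injEq, true_and] <;>
      by_cases e1 : s = s' <;> by_cases e2 : t = t' <;> simp only [e1, e2, if_true, if_false] <;> ring

theorem exchange_of_eq {A B : Particle} (hk : A.isHalf = B.isHalf) :
    Exchange m n a A B (-1) (A.shift (gap A B)) (B.shift (-gap A B)) := by
  cases A with
  | half s j k =>
    cases B with
    | half s' j' l =>
      have h := Exchange.half_half (m := m) (n := n) (a := a) s s' j j' k l _ rfl
      obtain ⟨-, h1, h2⟩ := h.of_eq rfl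
      rwa [h1, h2] at h
    | zero => simp [isHalf] at hk
  | zero s t k =>
    cases B with
    | half => simp [isHalf] at hk
    | zero s' t' l =>
      have h := Exchange.zero_zero (m := m) (n := n) (a := a) s s' t t' k l _ rfl
      obtain ⟨-, h1, h2⟩ := h.of_eq rfl
      rwa [h1, h2] at h

theorem Exchange.of_ne {A B C D : Particle} {c : ℤ} (h : Exchange m n a A B c C D)
    (hk : A.isHalf ≠ B.isHalf) (h0 : 0 ≤ a) (h1 : a ≤ m - n) (h2 : 0 ≤ a + B.sg)
    (h3 : a + B.sg ≤ m - n) :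
    A.isHalf = false ∧ B.isHalf = true ∧ c = 1 ∧ xch (m - n) a A B = (C, D) := by
  cases h <;> simp only [isHalf, ne_eq, not_true_eq_false] at hk <;>
    refine ⟨rfl, rfl, rfl, ?_⟩ <;> simp only [sg, Units.val_one, Units.val_neg] at h2 h3 <;>
    rcases xch_cases (m - n) a _ _ with ⟨hc, he⟩ | ⟨hc, he⟩ <;> rw [he] <;>
    simp only [sg, Units.val_one, Units.val_neg] at hc <;> (try (exfalso; omega)) <;> rfl

theorem exchange_of_ne {A B : Particle} (hA : A.isHalf = false) (hB : B.isHalf = true)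
    (h2 : 0 ≤ a + B.sg) (h3 : a + B.sg ≤ m - n) (h0 : 0 ≤ a) (h1 : a ≤ m - n) :
    Exchange m n a A B 1 (xch (m - n) a A B).1 (xch (m - n) a A B).2 := by
  suffices ∃ c C D, Exchange m n a A B c C D by
    obtain ⟨c, C, D, h⟩ := this
    obtain ⟨-, -, hc, he⟩ := h.of_ne (by simp [hA, hB]) h0 h1 h2 h3
    rw [he]
    rwa [hc] at h
  cases A with
  | half => simp [isHalf] at hA
  | zero s t k =>
    cases B with
    | zero => simp [isHalf] at hB
    | half s' j l =>
      by_cases hs : s = s'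
      · subst hs
        exact ⟨_, _, _, .same s t j k l⟩
      · rcases Int.units_eq_one_or s with rfl | rfl <;>
          rcases Int.units_eq_one_or s' with rfl | rfl
        · exact absurd rfl hs
        · by_cases ha : a = m - n
          · exact ⟨_, _, _, .plus_minus_boundary t j k l ha⟩
          · exact ⟨_, _, _, .plus_minus t j k l ha⟩
        · by_cases ha : a = 0
          · exact ⟨_, _, _, .minus_plus_boundary t j k l ha⟩
          · exact ⟨_, _, _, .minus_plus t j k l ha⟩
        · exact absurd rfl hs

/-! ### Classes of products modulo the relations -/

open Classical in
/-- The class of a product in `𝒜/ℛ`, zero for a product that is not allowed. -/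
def vecS (m n : ℤ) (z : State) : (Mono m n →₀ ℂ) ⧸ relations m n :=
  if h : Valid m n z then vec (m := m) (n := n) ⟨z, h⟩ else 0

theorem vecS_of_valid {z : State} (h : Valid m n z) : vecS m n z = vec ⟨z, h⟩ := dif_pos h

theorem vec_eq_vecS (z : Mono m n) : vec z = vecS m n z.1 := (vecS_of_valid z.2).symm

theorem vecS_exchange {A B C D : Particle} {c : ℤ} {u v : List Particle}
    (h : Exchange m n (target x v).1 A B c C D) (hv : Valid m n (x, u ++ A :: B :: v))
    (hv' : Valid m n (x, u ++ C :: D :: v)) :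
    vecS m n (x, u ++ A :: B :: v) = (c : ℂ) • vecS m n (x, u ++ C :: D :: v) := by
  rw [vecS_of_valid hv, vecS_of_valid hv', vec, vec, ← map_smul, ← sub_eq_zero, ← map_sub]
  rw [Submodule.mkQ_apply, Submodule.Quotient.mk_eq_zero]
  refine Submodule.subset_span ⟨⟨_, hv⟩, ⟨_, hv'⟩, x, u, v, A, B, C, D, c, rfl, rfl, h, ?_⟩
  simp

theorem vecS_shift_pair {A B : Particle} {u v : List Particle}
    (hv : Valid m n (x, u ++ A :: B :: v)) (hk : A.isHalf = B.isHalf) :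
    vecS m n (x, u ++ A :: B :: v) =
      -vecS m n (x, u ++ A.shift (gap A B) :: B.shift (-gap A B) :: v) := by
  rw [vecS_exchange (exchange_of_eq hk) hv (valid_shift_pair hv hk)]
  simp

theorem MEq.vecS_eq {w w' : List Particle} (h : MEq m n x w w') (hw : Valid m n (x, w)) :
    vecS m n (x, w) = vecS m n (x, w') := by
  induction h with
  | refl => rfl
  | step u A B v w hk h ih =>
    obtain ⟨hv, -⟩ := MEq.valid_step hk hw
    rw [← ih hv]
    obtain ⟨-, -, ⟨a0, a1, -, -⟩, ⟨b0, b1, -, -⟩, ⟨c0, c1, -, -⟩⟩ := (valid_append.1 hw).1.pair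
    cases hA : A.isHalf with
    | false =>
      have hB : B.isHalf = true := by simpa [hA] using hk
      rw [vecS_exchange (exchange_of_ne hA hB b0 b1 a0 a1) hw hv]
      simp
    | true =>
      have hB : B.isHalf = false := by simpa [hA] using hk
      obtain ⟨-, s0, s1⟩ := sg_xch (A := A) a0 a1 c0 c1 b0 b1
      have hx := exchange_of_ne (m := m) (n := n) (a := (target x v).1)
        (A := (xch (m - n) (target x v).1 A B).1) (B := (xch (m - n) (target x v).1 A B).2)
        (by simpa using hB) (by simpa using hA) s0 s1 a0 a1
      rw [xch_xch c0 c1 b0 b1] at hx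
      rw [vecS_exchange hx hv hw]
      simp

/-! ### Linear independence of the separately ordered products -/

theorem shape_shift_pair (p q : List Particle) (A B : Particle) (g g' : ℤ) :
    shape (p ++ A.shift g :: B.shift g' :: q) = shape (p ++ A :: B :: q) := by
  simp [shape]

theorem length_shape (l : List Particle) : (shape l).length = l.length := List.length_map ..

theorem alt_kcoord_swap {l₀ p q : List Particle} {A B : Particle}
    (h : shape (p ++ A :: B :: q) = shape l₀) :
    alt (kcoord l₀) (kcoord (p ++ A.shift (gap A B) :: B.shift (-gap A B) :: q)) =
      -alt (kcoord l₀) (kcoord (p ++ A :: B :: q)) := by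
  obtain ⟨ks, a, b, t, -, -, h3, h4⟩ := kcoord_swap p q A B
  have hl : (ks ++ a :: b :: t).length = (kcoord l₀).length := by
    rw [← h3, length_kcoord, length_kcoord, ← length_shape, h, length_shape]
  rw [h3, h4, alt_swap _ _ _ _ _ hl]

open Classical in
/-- The functional dual to a separately ordered product `(x₀, hs ++ zs)`: bring the particles of a
product into separate order and take the antisymmetric functions of the coordinates of both
groups. -/
def coef (N : ℤ) (x₀ : ℤ × ℤ) (hs zs : List Particle) (z : State) : ℂ :=
  if z.1 = x₀ ∧ shape (sep N z.1 true z.2).1 = shape hs ∧ shape (sep N z.1 true z.2).2 = shape zs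
  then alt (kcoord hs) (kcoord (sep N z.1 true z.2).1) *
    alt (kcoord zs) (kcoord (sep N z.1 true z.2).2)
  else 0

/-- The functional respects the relations: between particles of the same spin the determinant
changes its sign, and between particles of different spin the separated form does not change. -/
theorem coef_exchange {A B C D : Particle} {c : ℤ} {u v : List Particle} {x₀ : ℤ × ℤ}
    {hs zs : List Particle} (h : Exchange m n (target x v).1 A B c C D)
    (hv : Valid m n (x, u ++ A :: B :: v)) :
    coef (m - n) x₀ hs zs (x, u ++ A :: B :: v) =
      c * coef (m - n) x₀ hs zs (x, u ++ C :: D :: v) := by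
  by_cases hk : A.isHalf = B.isHalf
  · obtain ⟨rfl, rfl, rfl⟩ := h.of_eq hk
    by_cases hA : A.isHalf = true
    · obtain ⟨p, A', B', q, r, h1, h2⟩ := sep_shift_pair_fst u v A B hv hA (hk ▸ hA)
      have h0 := h2 0 0
      simp only [shift_zero] at h0
      unfold coef
      simp only [h0, h2, shape_shift_pair]
      split_ifs with hc
      · rw [← h1, alt_kcoord_swap hc.2.1]; simp
      · simp
    · obtain ⟨p, A', B', q, r, h1, h2⟩ := sep_shift_pair_snd u v A B hv hA (hk ▸ hA)
      have h0 := h2 0 0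
      simp only [shift_zero] at h0
      unfold coef
      simp only [h0, h2, shape_shift_pair]
      split_ifs with hc
      · rw [← h1, alt_kcoord_swap hc.2.2]; simp
      · simp
  · obtain ⟨-, -, ⟨a0, a1, -, -⟩, ⟨b0, b1, -, -⟩, -⟩ := (valid_append.1 hv).1.pair
    obtain ⟨-, -, rfl, he⟩ := h.of_ne hk a0 a1 b0 b1
    have hm : MEq m n x (u ++ A :: B :: v) (u ++ C :: D :: v) := by
      have := (MEq.head (m := m) (n := n) (x := x) (v := v) hk).append_left u
      rwa [he] at this
    have hs := hm.sep_eq (κ := true) hv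
    unfold coef
    simp only [hs]
    simp

/-- `coef` as a linear functional on `𝒜/ℛ`. -/
def coefDual (m n : ℤ) (x₀ : ℤ × ℤ) (hs zs : List Particle) :
    Module.Dual ℂ ((Mono m n →₀ ℂ) ⧸ relations m n) :=
  (relations m n).liftQ
    (Finsupp.linearCombination ℂ fun z : Mono m n => coef (m - n) x₀ hs zs z.1) <| by
    rw [relations, Submodule.span_le]
    rintro _ ⟨⟨_, hy⟩, ⟨_, hz⟩, x, u, v, A, B, C, D, c, rfl, rfl, he, rfl⟩
    simp only [SetLike.mem_coe, LinearMap.mem_ker, map_sub, Finsupp.linearCombination_single,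
      smul_eq_mul]
    rw [coef_exchange he hy, one_mul, sub_self]

theorem coefDual_vec (x₀ : ℤ × ℤ) (hs zs : List Particle) (z : Mono m n) :
    coefDual m n x₀ hs zs (vec z) = coef (m - n) x₀ hs zs z.1 := by
  unfold coefDual vec
  rw [Submodule.mkQ_apply, Submodule.liftQ_apply, Finsupp.linearCombination_single, one_smul]

theorem sepPair_iff_gap {A B : Particle} (hA : A.Meaningful) (hB : B.Meaningful)
    (hk : A.isHalf = B.isHalf) : SepPair A B ↔ 0 < gap A B := by
  rw [← normPair_iff_of_eq (m := 0) (n := 0) (a := 0) hA hB hk]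
  cases A <;> cases B <;> simp [isHalf] at hk <;> rfl

theorem isChain_sepPair_of_eq {l : List Particle} (hm : ∀ A ∈ l, A.Meaningful)
    (hk : ∀ A ∈ l, A.isHalf = κ) : l.IsChain SepPair ↔ ∀ g ∈ gaps l, 0 < g := by
  induction l with
  | nil => simp [gaps]
  | cons A l ih =>
    cases l with
    | nil => simp [gaps]
    | cons B l =>
      have h := ih (fun C hC => hm C (by simp [hC])) (fun C hC => hk C (by simp [hC]))
      rw [List.isChain_cons_cons, h, sepPair_iff_gap (hm A (by simp)) (hm B (by simp))
        ((hk A (by simp)).trans (hk B (by simp)).symm)]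
      simp [gaps]

theorem isChain_sepPair_iff {w : List Particle} (hm : ∀ A ∈ w, A.Meaningful) :
    w.IsChain SepPair ↔ ∃ hs zs, w = hs ++ zs ∧ (∀ A ∈ hs, A.isHalf = true) ∧
      (∀ A ∈ zs, A.isHalf ≠ true) ∧ (∀ g ∈ gaps hs, 0 < g) ∧ ∀ g ∈ gaps zs, 0 < g := by
  constructor
  · intro h
    have : ∃ hs zs, w = hs ++ zs ∧ (∀ A ∈ hs, A.isHalf = true) ∧ ∀ A ∈ zs, A.isHalf ≠ true := by
      clear hm
      induction w with
      | nil => exact ⟨[], [], rfl, by simp, by simp⟩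
      | cons A w ih =>
        obtain ⟨hs, zs, rfl, h1, h2⟩ := ih h.tail
        cases A with
        | half s j l => exact ⟨half s j l :: hs, zs, rfl, by simpa [isHalf] using h1, h2⟩
        | zero s t l =>
          cases hs with
          | nil => exact ⟨[], zero s t l :: zs, rfl, by simp, by simpa [isHalf] using h2⟩
          | cons B hs =>
            have h3 := h1 B (by simp)
            rw [List.cons_append, List.isChain_cons_cons] at h
            cases B with
            | half => exact h.1.elim
            | zero => simp [isHalf] at h3
    obtain ⟨hs, zs, rfl, h1, h2⟩ := this
    rw [List.isChain_append] at h
    refine ⟨hs, zs, rfl, h1, h2, ?_, ?_⟩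
    · exact (isChain_sepPair_of_eq (fun A hA => hm A (by simp [hA])) h1).1 h.1
    · exact (isChain_sepPair_of_eq (κ := false) (fun A hA => hm A (by simp [hA]))
        fun A hA => by simpa using h2 A hA).1 h.2.1
  · rintro ⟨hs, zs, rfl, h1, h2, h3, h4⟩
    rw [List.isChain_append]
    refine ⟨?_, ?_, fun A hA B hB => ?_⟩
    · exact (isChain_sepPair_of_eq (fun A hA => hm A (by simp [hA])) h1).2 h3
    · exact (isChain_sepPair_of_eq (κ := false) (fun A hA => hm A (by simp [hA]))
        fun A hA => by simpa using h2 A hA).2 h4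
    · have e1 := h1 A (List.mem_of_mem_getLast? hA)
      have e2 := h2 B (List.mem_of_mem_head? hB)
      cases A with
      | zero => simp [isHalf] at e1
      | half =>
        cases B with
        | half => simp [isHalf] at e2
        | zero => trivial

/-- Separately ordered products are the products that equal their separated form and have only
positive gaps. -/
theorem mem_separatelyOrdered_iff (z : Mono m n) :
    z ∈ separatelyOrdered m n ↔
      z.1.2 = (sep (m - n) z.1.1 true z.1.2).1 ++ (sep (m - n) z.1.1 true z.1.2).2 ∧
      Good m n z.1.1 z.1.2 := by
  obtain ⟨⟨x, w⟩, hv⟩ := z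
  have hv : Valid m n (x, w) := hv
  change w.IsChain SepPair ↔ w = (sep (m - n) x true w).1 ++ (sep (m - n) x true w).2 ∧
    Good m n x w
  rw [isChain_sepPair_iff hv.meaningful, good_iff hv true]
  constructor
  · rintro ⟨hs, zs, rfl, h1, h2, h3, h4⟩
    rw [sep_append h1 h2]
    exact ⟨rfl, h3, h4⟩
  · rintro ⟨h1, h2, h3⟩
    exact ⟨_, _, h1, isHalf_sep_fst w, isHalf_sep_snd w, h2, h3⟩

/-- The functionals `coefDual` form a system dual to the separately ordered products. -/
theorem linearIndependent_separatelyOrdered (m n : ℤ) :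
    LinearIndependent ℂ (fun z : separatelyOrdered m n => vec z.1) := by
  refine LinearIndependent.of_pairwise_dual_eq_zero_one _ (fun z : separatelyOrdered m n =>
    coefDual m n z.1.1.1 (sep (m - n) z.1.1.1 true z.1.1.2).1
      (sep (m - n) z.1.1.1 true z.1.1.2).2) ?_ ?_
  · intro z y hne
    simp only [coefDual_vec]
    unfold coef
    split_ifs with hc
    swap
    · rfl
    obtain ⟨hx, h1, h2⟩ := hc
    obtain ⟨hz, gz⟩ := (mem_separatelyOrdered_iff z.1).1 z.2
    obtain ⟨hy, gy⟩ := (mem_separatelyOrdered_iff y.1).1 y.2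
    obtain ⟨gz1, gz2⟩ := (good_iff z.1.2 true).1 gz
    obtain ⟨gy1, gy2⟩ := (good_iff y.1.2 true).1 gy
    by_cases e1 : kcoord (sep (m - n) y.1.1.1 true y.1.1.2).1 =
        kcoord (sep (m - n) z.1.1.1 true z.1.1.2).1
    · by_cases e2 : kcoord (sep (m - n) y.1.1.1 true y.1.1.2).2 =
          kcoord (sep (m - n) z.1.1.1 true z.1.1.2).2
      · refine absurd (Subtype.ext (Subtype.ext (Prod.ext hx.symm ?_))) hne
        rw [hz, hy, eq_of_kcoord h1 e1, eq_of_kcoord h2 e2]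
      · rw [alt_eq_zero ((isChain_kcoord_iff _).2 gz2) ((isChain_kcoord_iff _).2 gy2) _ e2,
          mul_zero]
        rw [length_kcoord, length_kcoord, ← length_shape, h2, length_shape]
    · rw [alt_eq_zero ((isChain_kcoord_iff _).2 gz1) ((isChain_kcoord_iff _).2 gy1) _ e1, zero_mul]
      rw [length_kcoord, length_kcoord, ← length_shape, h1, length_shape]
  · intro z
    obtain ⟨hz, gz⟩ := (mem_separatelyOrdered_iff z.1).1 z.2
    obtain ⟨gz1, gz2⟩ := (good_iff z.1.2 true).1 gz
    simp only [coefDual_vec]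
    rw [coef, if_pos ⟨rfl, rfl, rfl⟩, alt_self ((isChain_kcoord_iff _).2 gz1),
      alt_self ((isChain_kcoord_iff _).2 gz2), mul_one]

/-! ### The separately ordered products span -/

/-- The number of inversions. -/
def inversions : List ℤ → ℕ
  | [] => 0
  | a :: l => l.countP (· < a) + inversions l

/-- Sorting two neighbours lowers the number of inversions. -/
theorem inversions_swap_lt (ks t : List ℤ) {a b : ℤ} (h : b < a) :
    inversions (ks ++ b :: a :: t) < inversions (ks ++ a :: b :: t) := by
  induction ks with
  | nil =>
    have h1 : ¬ a < b := by omega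
    simp only [List.nil_append, inversions, List.countP_cons, decide_eq_true_eq, h, h1, if_true,
      if_false]
    omega
  | cons k ks ih =>
    simp only [List.cons_append, inversions]
    have : (ks ++ b :: a :: t).countP (· < k) = (ks ++ a :: b :: t).countP (· < k) :=
      ((List.Perm.swap a b t).append_left ks).countP_eq _
    omega

theorem exists_of_mem_gaps {l : List Particle} {g : ℤ} (h : g ∈ gaps l) :
    ∃ p A B q, l = p ++ A :: B :: q ∧ g = gap A B := by
  induction l with
  | nil => simp [gaps] at h
  | cons A l ih =>
    cases l with
    | nil => simp [gaps] at h
    | cons B l =>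
      simp only [gaps, List.mem_cons] at h
      rcases h with rfl | h
      · exact ⟨[], A, B, l, rfl, rfl⟩
      · obtain ⟨p, C, D, q, h1, h2⟩ := ih h
        exact ⟨A :: p, C, D, q, by rw [h1]; rfl, h2⟩

/-- A group of neighbouring particles of the same spin can be sorted modulo the relations. -/
theorem vecS_mem_of_sorted (W : Submodule ℂ ((Mono m n →₀ ℂ) ⧸ relations m n))
    (u l v : List Particle) (hk : ∀ A ∈ l, A.isHalf = κ) (hv : Valid m n (x, u ++ (l ++ v)))
    (hW : ∀ l', (∀ A ∈ l', A.isHalf = κ) → Valid m n (x, u ++ (l' ++ v)) →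
      (∀ g ∈ gaps l', 0 < g) → vecS m n (x, u ++ (l' ++ v)) ∈ W) :
    vecS m n (x, u ++ (l ++ v)) ∈ W := by
  induction hi : inversions (kcoord l) using Nat.strong_induction_on generalizing l with
  | _ i ih =>
    by_cases hg : ∀ g ∈ gaps l, 0 < g
    · exact hW l hk hv hg
    push Not at hg
    obtain ⟨_, hmem, hle⟩ := hg
    obtain ⟨p, A, B, q, rfl, rfl⟩ := exists_of_mem_gaps hmem
    have hAB : A.isHalf = B.isHalf := (hk A (by simp)).trans (hk B (by simp)).symm
    have e : ∀ A B : Particle, u ++ (p ++ A :: B :: q ++ v) = (u ++ p) ++ A :: B :: (q ++ v) := by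
      simp
    rw [e] at hv ⊢
    have hs := vecS_shift_pair hv hAB
    have hv' := valid_shift_pair hv hAB
    -- a negative gap is an inversion, which the relation removes; if the gap is zero, then the
    -- relation says that the product is its own negative
    rcases hle.lt_or_eq with hlt | h0
    · rw [hs]
      refine W.neg_mem ?_
      rw [← e] at hv' ⊢
      obtain ⟨ks, a, b, t, -, h2, h3, h4⟩ := kcoord_swap p q A B
      refine ih _ ?_ _ ?_ hv' rfl
      · rw [← hi, h3, h4]
        exact inversions_swap_lt _ _ (by omega)
      · intro C hC
        simp only [List.mem_append, List.mem_cons] at hC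
        rcases hC with hC | rfl | rfl | hC
        · exact hk C (by simp [hC])
        · simpa using hk A (by simp)
        · simpa using hk B (by simp)
        · exact hk C (by simp [hC])
    · rw [h0] at hs
      simp only [neg_zero, shift_zero] at hs
      have : vecS m n (x, u ++ p ++ A :: B :: (q ++ v)) = 0 := by
        rw [eq_neg_iff_add_eq_zero, ← two_smul ℂ] at hs
        exact (smul_eq_zero.1 hs).resolve_left two_ne_zero
      rw [this]
      exact W.zero_mem

theorem span_separatelyOrdered (m n : ℤ) :
    Submodule.span ℂ (Set.range fun z : separatelyOrdered m n => vec z.1) = ⊤ := by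
  have h1 : ∀ z : Mono m n,
      vec z ∈ Submodule.span ℂ (Set.range fun z : separatelyOrdered m n => vec z.1) := by
    rintro ⟨⟨x, w⟩, hv⟩
    have hv : Valid m n (x, w) := hv
    rw [vec_eq_vecS]
    change vecS m n (x, w) ∈ _
    rw [(meq_sep (κ := true) w).vecS_eq hv]
    have hv' := (meq_sep (κ := true) w).valid hv
    refine vecS_mem_of_sorted (κ := true) _ [] _ _ (isHalf_sep_fst w) hv' fun hs k1 v1 g1 => ?_
    simp only [List.nil_append] at v1 ⊢
    have := vecS_mem_of_sorted (κ := false) (x := x)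
      (Submodule.span ℂ (Set.range fun z : separatelyOrdered m n => vec z.1)) hs
      (sep (m - n) x true w).2 [] (fun A hA => by simpa using isHalf_sep_snd w A hA)
    simp only [List.append_nil] at this
    refine this v1 fun zs k2 v2 g2 => ?_
    rw [vecS_of_valid v2]
    refine Submodule.subset_span ⟨⟨⟨(x, hs ++ zs), v2⟩, ?_⟩, rfl⟩
    exact (isChain_sepPair_iff v2.meaningful).2 ⟨hs, zs, rfl, k1, by simpa using k2, g1, g2⟩
  rw [eq_top_iff]
  rintro y -
  obtain ⟨w, rfl⟩ := (relations m n).mkQ_surjective y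
  induction w using Finsupp.induction_linear with
  | zero => rw [map_zero]; exact Submodule.zero_mem _
  | add f g hf hg => rw [map_add]; exact Submodule.add_mem _ hf hg
  | single z c =>
    have : Finsupp.single z c = c • Finsupp.single z (1 : ℂ) := by simp
    rw [this, map_smul]
    exact Submodule.smul_mem _ _ (h1 z)

end

section
variable {m n : ℤ} {x : ℤ × ℤ} {N a : ℤ} {κ : Bool} {i : Fin 2}

/-! ### Crystal operators on products of particles -/

theorem f_eq_some {A A' : Particle} (h : particleCrystal.f i A = some A') :
    ∃ s j l, A = half s j l ∧ j ≠ i ∧ A' = half s i (l - 1) := by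
  cases A with
  | zero s t l => rw [particleCrystal_f_zero] at h; simp at h
  | half s j l =>
    rw [particleCrystal_f_half] at h
    split_ifs at h with hj
    exact ⟨s, j, l, rfl, hj, (Option.some.inj h).symm⟩

theorem e_eq_some {A A' : Particle} (h : particleCrystal.e i A = some A') :
    ∃ s l, A = half s i l ∧ A' = half s (i + 1) (l + 1) := by
  cases A with
  | zero s t l => rw [particleCrystal_e_zero] at h; simp at h
  | half s j l =>
    rw [particleCrystal_e_half] at h
    split_ifs at h with hj
    subst hj
    exact ⟨s, l, rfl, (Option.some.inj h).symm⟩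

theorem neg_one_pow_add_one (i : Fin 2) : (-1 : ℤˣ) ^ (i + 1).val = -(-1) ^ i.val := by
  fin_cases i <;> rfl

theorem meaningful_f {A A' : Particle} (h : particleCrystal.f i A = some A') (hA : A.Meaningful) :
    A'.Meaningful := by
  obtain ⟨s, j, l, rfl, hj, rfl⟩ := f_eq_some h
  rw [fin_two_eq_add_one hj] at hA
  simp only [Meaningful, neg_one_pow_add_one] at hA ⊢
  rw [zpow_sub_one, ← hA]
  simp

theorem meaningful_e {A A' : Particle} (h : particleCrystal.e i A = some A') (hA : A.Meaningful) :
    A'.Meaningful := by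
  obtain ⟨s, l, rfl, rfl⟩ := e_eq_some h
  simp only [Meaningful, neg_one_pow_add_one] at hA ⊢
  rw [zpow_add_one, ← hA]
  simp

theorem valid_replace {A A' : Particle} {u v : List Particle} (h : Valid m n (x, u ++ A :: v))
    (hm : A'.Meaningful) (hs : A'.sg = A.sg) (hd : A'.db = A.db) :
    Valid m n (x, u ++ A' :: v) := by
  rw [valid_append] at h ⊢
  have ht : target x (A' :: v) = target x (A :: v) := by rw [target_cons, target_cons, hs, hd]
  obtain ⟨-, hr, hv⟩ := valid_cons.1 h.1
  rw [ht]
  exact ⟨valid_cons.2 ⟨hm, by rwa [ht], hv⟩, h.2⟩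

/-- The particle on which `f_i` acts has no particle with `φ_i ≠ 0` directly on its left. -/
theorem exists_of_listF {w w' : List Particle} (h : particleCrystal.listF i w = some w') :
    ∃ u A A' v, w = u ++ A :: v ∧ w' = u ++ A' :: v ∧ particleCrystal.f i A = some A' ∧
      (particleCrystal.sig i v).1 < particleCrystal.φ i A ∧
      ∀ B ∈ u.getLast?, particleCrystal.φ i B = 0 := by
  induction w generalizing w' with
  | nil => simp [CrystalData.listF] at h
  | cons b l ih =>
    rw [CrystalData.listF] at h
    split_ifs at h with hc
    · obtain ⟨b', hb, rfl⟩ := Option.map_eq_some_iff.1 h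
      exact ⟨[], b, b', l, rfl, rfl, hb, hc, by simp⟩
    · obtain ⟨l', hl, rfl⟩ := Option.map_eq_some_iff.1 h
      obtain ⟨u, A, A', v, rfl, rfl, h1, h2, h3⟩ := ih hl
      refine ⟨b :: u, A, A', v, rfl, rfl, h1, h2, fun B hB => ?_⟩
      cases u with
      | nil =>
        obtain rfl : b = B := by simpa using hB
        obtain ⟨s, j, l, rfl, hj, rfl⟩ := f_eq_some h1
        rw [List.nil_append, CrystalData.sig_cons] at hc
        simp only [cancel, particleCrystal_ε_half, particleCrystal_φ_half, if_neg hj] at hc h2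
        omega
      | cons c u => exact h3 B (by simpa [List.getLast?_cons_cons] using hB)

/-- The particle on which `e_i` acts has no particle with `ε_i ≠ 0` directly on its right. -/
theorem exists_of_listE {w w' : List Particle} (h : particleCrystal.listE i w = some w') :
    ∃ u A A' v, w = u ++ A :: v ∧ w' = u ++ A' :: v ∧ particleCrystal.e i A = some A' ∧
      ∀ B ∈ v.head?, particleCrystal.ε i B = 0 := by
  induction w generalizing w' with
  | nil => simp [CrystalData.listE] at h
  | cons b l ih =>
    rw [CrystalData.listE] at h
    split_ifs at h with hc
    · obtain ⟨b', hb, rfl⟩ := Option.map_eq_some_iff.1 h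
      refine ⟨[], b, b', l, rfl, rfl, hb, fun B hB => ?_⟩
      obtain ⟨s, k, rfl, rfl⟩ := e_eq_some hb
      rw [particleCrystal_φ_half, if_pos rfl] at hc
      cases l with
      | nil => simp at hB
      | cons c l =>
        obtain rfl : c = B := by simpa using hB
        rw [CrystalData.sig_cons] at hc
        simp only [cancel] at hc
        omega
    · obtain ⟨l', hl, rfl⟩ := Option.map_eq_some_iff.1 h
      obtain ⟨u, A, A', v, rfl, rfl, h1, h2⟩ := ih hl
      exact ⟨b :: u, A, A', v, rfl, rfl, h1, h2⟩

theorem valid_listF {w w' : List Particle} (h : particleCrystal.listF i w = some w')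
    (hv : Valid m n (x, w)) : Valid m n (x, w') := by
  obtain ⟨u, A, A', v, rfl, rfl, h1, -⟩ := exists_of_listF h
  have hm := meaningful_f h1 (hv.meaningful A (by simp))
  obtain ⟨s, j, l, rfl, hj, rfl⟩ := f_eq_some h1
  exact valid_replace hv hm rfl rfl

theorem valid_listE {w w' : List Particle} (h : particleCrystal.listE i w = some w')
    (hv : Valid m n (x, w)) : Valid m n (x, w') := by
  obtain ⟨u, A, A', v, rfl, rfl, h1, -⟩ := exists_of_listE h
  have hm := meaningful_e h1 (hv.meaningful A (by simp))
  obtain ⟨s, l, rfl, rfl⟩ := e_eq_some h1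
  exact valid_replace hv hm rfl rfl

theorem isChain_sepPair_replace {A A' : Particle} {u v : List Particle}
    (h : (u ++ A :: v).IsChain SepPair) (hl : ∀ B ∈ u.getLast?, SepPair B A → SepPair B A')
    (hr : ∀ B ∈ v.head?, SepPair A B → SepPair A' B) : (u ++ A' :: v).IsChain SepPair := by
  rw [List.isChain_append, List.isChain_cons] at h ⊢
  obtain ⟨h1, ⟨h2, h3⟩, h4⟩ := h
  refine ⟨h1, ⟨fun B hB => hr B hB (h2 B hB), h3⟩, fun B hB C hC => ?_⟩
  obtain rfl : A' = C := by simpa using hC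
  exact hl B hB (h4 B hB A (by simp))

/-- `f_i` preserves separate order: the left neighbour of the particle on which it acts has the
index `i` if it has spin 1/2, so that the gap between them does not change, and the gap between the
particle and its right neighbour does not decrease. -/
theorem isChain_listF {w w' : List Particle} (h : particleCrystal.listF i w = some w')
    (hm : ∀ A ∈ w, A.Meaningful) (hc : w.IsChain SepPair) : w'.IsChain SepPair := by
  obtain ⟨u, A, A', v, rfl, rfl, h1, -, h2⟩ := exists_of_listF h
  have hA := hm A (by simp)
  have hA' := meaningful_f h1 hA
  obtain ⟨s, j, l, rfl, hj, rfl⟩ := f_eq_some h1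
  refine isChain_sepPair_replace hc (fun B hB hp => ?_) fun B hB hp => ?_
  · have hB' := hm B (by simp [List.mem_of_mem_getLast? hB])
    have h3 := h2 B hB
    cases B with
    | zero => exact hp.elim
    | half s' j' l' =>
      rw [particleCrystal_φ_half] at h3
      obtain rfl : j' = i := by by_contra hne; simp [hne] at h3
      rw [sepPair_iff_gap hB' hA rfl] at hp
      rw [sepPair_iff_gap hB' hA' rfl]
      simp only [gap, sg, col, mode, fin_two_neg_one_pow, if_neg hj.symm, if_true] at hp ⊢
      split_ifs at hp ⊢ <;> omega
  · have hB' := hm B (by simp [List.mem_of_mem_head? hB])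
    cases B with
    | zero => trivial
    | half s' j' l' =>
      rw [sepPair_iff_gap hA hB' rfl] at hp
      rw [sepPair_iff_gap hA' hB' rfl]
      simp only [gap, sg, col, mode, fin_two_neg_one_pow] at hp ⊢
      split_ifs at hp ⊢ <;> omega

theorem isChain_listE {w w' : List Particle} (h : particleCrystal.listE i w = some w')
    (hm : ∀ A ∈ w, A.Meaningful) (hc : w.IsChain SepPair) : w'.IsChain SepPair := by
  obtain ⟨u, A, A', v, rfl, rfl, h1, h2⟩ := exists_of_listE h
  have hA := hm A (by simp)
  have hA' := meaningful_e h1 hA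
  obtain ⟨s, l, rfl, rfl⟩ := e_eq_some h1
  refine isChain_sepPair_replace hc (fun B hB hp => ?_) fun B hB hp => ?_
  · have hB' := hm B (by simp [List.mem_of_mem_getLast? hB])
    cases B with
    | zero => exact hp.elim
    | half s' j' l' =>
      rw [sepPair_iff_gap hB' hA rfl] at hp
      rw [sepPair_iff_gap hB' hA' rfl]
      simp only [gap, sg, col, mode, fin_two_neg_one_pow] at hp ⊢
      split_ifs at hp ⊢ <;> omega
  · have hB' := hm B (by simp [List.mem_of_mem_head? hB])
    have h3 := h2 B hB
    cases B with
    | zero => trivial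
    | half s' j' l' =>
      rw [particleCrystal_ε_half] at h3
      obtain rfl : j' = i + 1 := fin_two_eq_add_one fun h => by simp [h] at h3
      rw [sepPair_iff_gap hA hB' rfl] at hp
      rw [sepPair_iff_gap hA' hB' rfl]
      simp only [gap, sg, col, mode, fin_two_neg_one_pow, if_neg (fin_two_add_one_ne i).symm,
        if_true] at hp ⊢
      split_ifs at hp ⊢ <;> omega

/-! ### The crystals of products and of separately ordered products -/

theorem stateCrystal_f_eq_some {z z' : State} :
    stateCrystal.f i z = some z' ↔ z'.1 = z.1 ∧ particleCrystal.listF i z.2 = some z'.2 := by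
  obtain ⟨x, w⟩ := z
  obtain ⟨x', w'⟩ := z'
  change (particleCrystal.listF i w).map _ = _ ↔ _
  simp only [Option.map_eq_some_iff, Prod.mk.injEq]
  constructor
  · rintro ⟨l, h, rfl, rfl⟩; exact ⟨rfl, h⟩
  · rintro ⟨rfl, h⟩; exact ⟨_, h, rfl, rfl⟩

theorem stateCrystal_e_eq_some {z z' : State} :
    stateCrystal.e i z = some z' ↔ z'.1 = z.1 ∧ particleCrystal.listE i z.2 = some z'.2 := by
  obtain ⟨x, w⟩ := z
  obtain ⟨x', w'⟩ := z'
  change (particleCrystal.listE i w).map _ = _ ↔ _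
  simp only [Option.map_eq_some_iff, Prod.mk.injEq]
  constructor
  · rintro ⟨l, h, rfl, rfl⟩; exact ⟨rfl, h⟩
  · rintro ⟨rfl, h⟩; exact ⟨_, h, rfl, rfl⟩

theorem stateCrystal_isCrystal : stateCrystal.IsCrystal := by
  have hC := particleCrystal_isCrystal.tensorPowers
  refine ⟨fun i b b' => ?_, fun i b b' h => ?_, fun i b => hC.pairing_wt i b.2, fun i b b' h => ?_,
    fun i b b' h => ?_, fun i b => ?_, fun i b => ?_⟩
  · rw [stateCrystal_e_eq_some, stateCrystal_f_eq_some, eq_comm]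
    exact and_congr_right fun _ => hC.e_iff_f i b.2 b'.2
  · exact hC.wt_f i b.2 b'.2 (stateCrystal_f_eq_some.1 h).2
  · exact hC.ε_f i b.2 b'.2 (stateCrystal_f_eq_some.1 h).2
  · exact hC.φ_f i b.2 b'.2 (stateCrystal_f_eq_some.1 h).2
  · exact Option.map_eq_none_iff.trans (hC.e_eq_none i b.2)
  · exact Option.map_eq_none_iff.trans (hC.f_eq_none i b.2)

theorem stable_valid (m n : ℤ) : stateCrystal.Stable {z | Valid m n z} := by
  rintro i ⟨x, w⟩ hv ⟨x', w'⟩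
  rw [stateCrystal_f_eq_some, stateCrystal_e_eq_some]
  constructor
  · rintro ⟨rfl, h⟩; exact valid_listE h hv
  · rintro ⟨rfl, h⟩; exact valid_listF h hv

theorem monoCrystal_isCrystal (m n : ℤ) : (monoCrystal m n).IsCrystal :=
  stateCrystal_isCrystal.restrict (stable_valid m n)

theorem monoCrystal_f_eq_some {z z' : Mono m n} :
    (monoCrystal m n).f i z = some z' ↔
      z'.1.1 = z.1.1 ∧ particleCrystal.listF i z.1.2 = some z'.1.2 :=
  CrystalData.restrict_f_eq_some.trans stateCrystal_f_eq_some

theorem monoCrystal_e_eq_some {z z' : Mono m n} :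
    (monoCrystal m n).e i z = some z' ↔
      z'.1.1 = z.1.1 ∧ particleCrystal.listE i z.1.2 = some z'.1.2 :=
  CrystalData.restrict_e_eq_some.trans stateCrystal_e_eq_some

theorem stable_separatelyOrdered (m n : ℤ) :
    (monoCrystal m n).Stable (separatelyOrdered m n) := by
  intro i z hz z'
  rw [monoCrystal_f_eq_some, monoCrystal_e_eq_some]
  exact ⟨fun h => isChain_listE h.2 z.2.meaningful hz, fun h => isChain_listF h.2 z.2.meaningful hz⟩

theorem sepCrystal_isCrystal (m n : ℤ) : (sepCrystal m n).IsCrystal :=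
  (monoCrystal_isCrystal m n).restrict (stable_separatelyOrdered m n)

/-! ### Separation commutes with the crystal operators -/

theorem sig_xch (N a : ℤ) {A B : Particle} (hk : A.isHalf ≠ B.isHalf) :
    particleCrystal.sig i [(xch N a A B).1, (xch N a A B).2] = particleCrystal.sig i [A, B] := by
  cases A <;> cases B <;> simp only [isHalf, ne_eq, not_true_eq_false] at hk <;>
    rcases xch_cases N a _ _ with ⟨-, he⟩ | ⟨-, he⟩ <;> rw [he] <;>
    simp only [Particle.flip, CrystalData.sig_cons, CrystalData.sig_nil, cancel_zero_left,
      particleCrystal_ε_half, particleCrystal_φ_half, particleCrystal_ε_zero,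
      particleCrystal_φ_zero, cancel_zero_right]

/-- Exchanges commute with `f_i`, since `f_i` acts on the same spin-1/2 particle before and after.
-/
theorem listF_xch (N a : ℤ) {A B : Particle} (hk : A.isHalf ≠ B.isHalf) {w : List Particle}
    (h : particleCrystal.listF i [A, B] = some w) :
    ∃ A' B', w = [A', B'] ∧ A'.isHalf = A.isHalf ∧ B'.isHalf = B.isHalf ∧
      particleCrystal.listF i [(xch N a A B).1, (xch N a A B).2] =
        some [(xch N a A' B').1, (xch N a A' B').2] := by
  simp only [CrystalData.listF, CrystalData.sig_nil] at h ⊢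
  cases A with
  | half s j l =>
    cases B with
    | half => simp [isHalf] at hk
    | zero s' t l' =>
      simp only [CrystalData.sig_cons, CrystalData.sig_nil, cancel_zero_right,
        particleCrystal_φ_half, particleCrystal_ε_zero, particleCrystal_φ_zero,
        particleCrystal_f_half, particleCrystal_f_zero] at h
      by_cases hj : j = i
      · simp [hj] at h
      · simp [hj] at h
        subst h
        refine ⟨_, _, rfl, rfl, rfl, ?_⟩
        by_cases hc : 0 ≤ a + (s : ℤ) ∧ a + (s : ℤ) ≤ N
        · have e1 : xch N a (half s j l) (zero s' t l') = (zero s' t l', half s j l) := if_pos hc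
          have e2 : xch N a (half s i (l - 1)) (zero s' t l') = (zero s' t l', half s i (l - 1)) := if_pos hc
          rw [e1, e2]
          simp [CrystalData.sig_cons, CrystalData.sig_nil, cancel_zero_right,
            particleCrystal_φ_half, particleCrystal_ε_half, particleCrystal_φ_zero,
            particleCrystal_f_half, hj]
        · have e1 : xch N a (half s j l) (zero s' t l') = ((zero s' t l').flip 1, (half s j l).flip (-1)) :=
            if_neg hc
          have e2 : xch N a (half s i (l - 1)) (zero s' t l') =
            ((zero s' t l').flip 1, (half s i (l - 1)).flip (-1)) := if_neg hc
          rw [e1, e2]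
          simp [Particle.flip, CrystalData.sig_cons, CrystalData.sig_nil, cancel_zero_right,
            particleCrystal_φ_half, particleCrystal_ε_half, particleCrystal_φ_zero,
            particleCrystal_f_half, hj]
          ring
  | zero s' t l' =>
    cases B with
    | zero => simp [isHalf] at hk
    | half s j l =>
      simp only [CrystalData.sig_cons, CrystalData.sig_nil, cancel_zero_right,
        particleCrystal_φ_half, particleCrystal_ε_half, particleCrystal_φ_zero,
        particleCrystal_f_half, particleCrystal_f_zero] at h
      by_cases hj : j = i
      · simp [hj] at h
      · simp [hj] at h
        subst h
        refine ⟨_, _, rfl, rfl, rfl, ?_⟩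
        by_cases hc : 0 ≤ a + (s' : ℤ) ∧ a + (s' : ℤ) ≤ N
        · have e1 : xch N a (zero s' t l') (half s j l) = (half s j l, zero s' t l') := if_pos hc
          have e2 : xch N a (zero s' t l') (half s i (l - 1)) = (half s i (l - 1), zero s' t l') := if_pos hc
          rw [e1, e2]
          simp [CrystalData.sig_cons, CrystalData.sig_nil, cancel_zero_right,
            particleCrystal_φ_half, particleCrystal_ε_zero, particleCrystal_φ_zero,
            particleCrystal_f_half, hj]
        · have e1 : xch N a (zero s' t l') (half s j l) = ((half s j l).flip 1, (zero s' t l').flip (-1)) :=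
            if_neg hc
          have e2 : xch N a (zero s' t l') (half s i (l - 1)) =
            ((half s i (l - 1)).flip 1, (zero s' t l').flip (-1)) := if_neg hc
          rw [e1, e2]
          simp [Particle.flip, CrystalData.sig_cons, CrystalData.sig_nil, cancel_zero_right,
            particleCrystal_φ_half, particleCrystal_ε_zero, particleCrystal_φ_zero,
            particleCrystal_f_half, hj]

theorem MEq.sig_eq {w w' : List Particle} (h : MEq m n x w w') :
    particleCrystal.sig i w' = particleCrystal.sig i w := by
  induction h with
  | refl => rfl
  | step u A B v w hk h ih =>
    have e : ∀ C D : Particle, u ++ C :: D :: v = u ++ ([C, D] ++ v) := fun C D => rfl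
    rw [ih, e, e, CrystalData.sig_append, CrystalData.sig_append, CrystalData.sig_append,
      CrystalData.sig_append, sig_xch _ _ hk]

theorem MEq.sum_wt_eq {w w' : List Particle} (h : MEq m n x w w') :
    (w'.map particleCrystal.wt).sum = (w.map particleCrystal.wt).sum := by
  induction h with
  | refl => rfl
  | step u A B v w hk h ih =>
    rw [ih]
    simp only [List.map_append, List.map_cons, List.sum_append, List.sum_cons]
    congr 1
    rw [← add_assoc, ← add_assoc]
    congr 1
    cases A <;> cases B <;> simp only [isHalf, ne_eq, not_true_eq_false] at hk <;>
      rcases xch_cases (m - n) (target x v).1 _ _ with ⟨-, he⟩ | ⟨-, he⟩ <;> rw [he] <;>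
      simp only [Particle.flip, particleCrystal_wt_half, particleCrystal_wt_zero, Prod.mk_add_mk,
        Prod.mk.injEq] <;> refine ⟨?_, ?_, ?_⟩ <;> ring

/-- Products that arise from each other by exchanges still do so after the action of `f_i`. -/
theorem MEq.listF {w w' : List Particle} (h : MEq m n x w w') {w₁ : List Particle}
    (hf : particleCrystal.listF i w = some w₁) (hv : Valid m n (x, w)) :
    ∃ w₁', particleCrystal.listF i w' = some w₁' ∧ MEq m n x w₁ w₁' := by
  induction h generalizing w₁ with
  | refl => exact ⟨w₁, hf, .refl _⟩
  | step u A B v w hk h ih =>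
    suffices ∃ w₂, particleCrystal.listF i (u ++ (xch (m - n) (target x v).1 A B).1 ::
        (xch (m - n) (target x v).1 A B).2 :: v) = some w₂ ∧ MEq m n x w₁ w₂ by
      obtain ⟨w₂, h1, h2⟩ := this
      obtain ⟨w₃, h3, h4⟩ := ih h1 (MEq.valid_step hk hv).1
      exact ⟨w₃, h3, h2.trans h4⟩
    have e : ∀ C D : Particle, u ++ C :: D :: v = u ++ ([C, D] ++ v) := fun C D => rfl
    rw [e, CrystalData.listF_append, CrystalData.listF_append, CrystalData.sig_append] at hf
    rw [e, CrystalData.listF_append, CrystalData.listF_append, CrystalData.sig_append,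
      sig_xch _ _ hk]
    -- `f_i` acts on `u`, on the exchanged pair, or on `v`
    split_ifs at hf ⊢ with h1 h2
    · obtain ⟨u', hu, rfl⟩ := Option.map_eq_some_iff.1 hf
      rw [hu]
      exact ⟨_, rfl, .step u' A B v _ hk (.refl _)⟩
    · obtain ⟨p, hp, rfl⟩ := Option.map_eq_some_iff.1 hf
      obtain ⟨q, hq, rfl⟩ := Option.map_eq_some_iff.1 hp
      obtain ⟨A', B', rfl, hA, hB, h3⟩ := listF_xch (m - n) (target x v).1 hk hq
      rw [h3]
      exact ⟨_, rfl, .step u A' B' v _ (by rwa [hA, hB]) (.refl _)⟩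
    · obtain ⟨p, hp, rfl⟩ := Option.map_eq_some_iff.1 hf
      obtain ⟨v', hv', rfl⟩ := Option.map_eq_some_iff.1 hp
      have ht : target x v' = target x v := by
        obtain ⟨v1, A, A', v2, rfl, rfl, h3, -⟩ := exists_of_listF hv'
        obtain ⟨s, j, l, rfl, -, rfl⟩ := f_eq_some h3
        rw [target_append, target_append, target_cons, target_cons]
        rfl
      rw [hv']
      refine ⟨_, rfl, ?_⟩
      have := MEq.step (m := m) (n := n) (x := x) u A B v' _ hk (.refl _)
      rwa [ht] at this

/-- The separately ordered form of a product, without the sign. -/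
def sepMono (z : Mono m n) : Mono m n :=
  ⟨(z.1.1, (sep (m - n) z.1.1 true z.1.2).1 ++ (sep (m - n) z.1.1 true z.1.2).2),
    (meq_sep z.1.2).valid z.2⟩

theorem meq_sepMono (z : Mono m n) : MEq m n z.1.1 z.1.2 (sepMono z).1.2 := meq_sep z.1.2

theorem sepMono_eq_iff {z z' : Mono m n} :
    sepMono z = sepMono z' ↔ z.1.1 = z'.1.1 ∧ MEq m n z.1.1 z.1.2 z'.1.2 := by
  obtain ⟨⟨x, w⟩, hv⟩ := z
  obtain ⟨⟨x', w'⟩, hv'⟩ := z'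
  have hv : Valid m n (x, w) := hv
  constructor
  · intro h
    obtain rfl : x = x' := congrArg (fun z : Mono m n => z.1.1) h
    have h2 : (sepMono ⟨(x, w), hv⟩).1.2 = (sepMono ⟨(x, w'), hv'⟩).1.2 := by rw [h]
    have h1 := meq_sepMono ⟨(x, w), hv⟩
    rw [h2] at h1
    exact ⟨rfl, h1.trans ((meq_sepMono ⟨(x, w'), hv'⟩).symm hv')⟩
  · rintro ⟨h, h'⟩
    obtain rfl : x = x' := h
    have h' : MEq m n x w w' := h'
    simp only [sepMono, h'.sep_eq (κ := true) hv]

theorem vec_sepMono (z : Mono m n) : vec (sepMono z) = vec z := by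
  rw [vec_eq_vecS, vec_eq_vecS]
  exact ((meq_sepMono z).vecS_eq z.2).symm

theorem sepMono_of_mem {z : Mono m n} (hz : z ∈ separatelyOrdered m n) : sepMono z = z :=
  Subtype.ext (Prod.ext rfl ((mem_separatelyOrdered_iff z).1 hz).1.symm)

theorem sepMono_mem_iff (z : Mono m n) :
    sepMono z ∈ separatelyOrdered m n ↔ Good m n z.1.1 z.1.2 := by
  rw [mem_separatelyOrdered_iff]
  have h : sepMono (sepMono z) = sepMono z := by
    symm
    exact sepMono_eq_iff.2 ⟨rfl, meq_sepMono z⟩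
  have hm := meq_sepMono z
  exact ⟨fun hg => hg.2.congr (sepMono z).2 (hm.symm z.2), fun hg =>
    ⟨(congrArg (fun z : Mono m n => z.1.2) h).symm, hg.congr z.2 hm⟩⟩

theorem monoCrystal_ε_sepMono (z : Mono m n) :
    (monoCrystal m n).ε i (sepMono z) = (monoCrystal m n).ε i z :=
  congrArg Prod.fst (meq_sepMono z).sig_eq

theorem monoCrystal_φ_sepMono (z : Mono m n) :
    (monoCrystal m n).φ i (sepMono z) = (monoCrystal m n).φ i z :=
  congrArg Prod.snd (meq_sepMono z).sig_eq

theorem monoCrystal_wt_sepMono (z : Mono m n) :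
    (monoCrystal m n).wt (sepMono z) = (monoCrystal m n).wt z :=
  (meq_sepMono z).sum_wt_eq

theorem f_sepMono {z z' : Mono m n} (h : (monoCrystal m n).f i z = some z') :
    (monoCrystal m n).f i (sepMono z) = some (sepMono z') := by
  rw [monoCrystal_f_eq_some] at h ⊢
  refine ⟨h.1, ?_⟩
  obtain ⟨w, h1, h2⟩ := (meq_sepMono z).listF h.2 z.2
  have hw : Valid m n (z.1.1, w) := valid_listF h1 (sepMono z).2
  have hz' : Valid m n (z.1.1, z'.1.2) := h.1 ▸ z'.2
  -- `w` is obtained from the separated word `sepMono z`, so that it is separated itself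
  have h3 : (⟨(z.1.1, w), hw⟩ : Mono m n).1.2 = (sepMono z').1.2 := by
    have e : sepMono z' = sepMono (⟨(z.1.1, w), hw⟩ : Mono m n) :=
      sepMono_eq_iff.2 ⟨h.1, by rw [h.1]; exact h2⟩
    rw [e]
    obtain ⟨u, A, A', v, e1, e2, h4, -⟩ := exists_of_listF h1
    change w = (sep (m - n) z.1.1 true w).1 ++ (sep (m - n) z.1.1 true w).2
    have k1 := isHalf_sep_fst (N := m - n) (x := z.1.1) (κ := true) z.1.2
    have k2 := isHalf_sep_snd (N := m - n) (x := z.1.1) (κ := true) z.1.2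
    change (sep (m - n) z.1.1 true z.1.2).1 ++ (sep (m - n) z.1.1 true z.1.2).2 = u ++ A :: v at e1
    obtain ⟨s, j, l, rfl, -, rfl⟩ := f_eq_some h4
    rcases List.append_eq_append_iff.1 e1 with ⟨r, e3, e4⟩ | ⟨r, e3, e4⟩
    · exact absurd rfl (k2 (half s j l) (by rw [e4]; simp))
    · cases r with
      | nil => exact absurd rfl (k2 (half s j l) (by rw [← List.nil_append (sep _ _ _ _).2, ← e4]; simp))
      | cons C r =>
        rw [List.cons_append, List.cons.injEq] at e4
        obtain ⟨rfl, rfl⟩ := e4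
        have : u ++ half s i (l - 1) :: (r ++ (sep (m - n) z.1.1 true z.1.2).2) =
          (u ++ half s i (l - 1) :: r) ++ (sep (m - n) z.1.1 true z.1.2).2 := by simp
        rw [e2, this, sep_append _ k2]
        intro B hB
        simp only [List.mem_append, List.mem_cons] at hB
        rcases hB with hB | rfl | hB
        · exact k1 B (by rw [e3]; simp [hB])
        · rfl
        · exact k1 B (by rw [e3]; simp [hB])
  rw [h1]
  exact congrArg some h3

theorem e_sepMono {z z' : Mono m n} (h : (monoCrystal m n).e i z = some z') :
    (monoCrystal m n).e i (sepMono z) = some (sepMono z') := by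
  have hC := monoCrystal_isCrystal m n
  exact (hC.e_iff_f i _ _).2 (f_sepMono ((hC.e_iff_f i _ _).1 h))

/-! ### Normally ordered products -/

theorem mem_normallyOrdered_iff (z : Mono m n) :
    z ∈ normallyOrdered m n ↔ MixedNormal (m - n) z.1.1 z.1.2 ∧ Good m n z.1.1 z.1.2 :=
  normalList_iff z.2

/-- The separation of normally ordered products is a bijection onto the separately ordered
products. -/
def normEquivSep (m n : ℤ) : normallyOrdered m n ≃ separatelyOrdered m n :=
  Equiv.ofBijective
    (fun y => ⟨sepMono y.1, (sepMono_mem_iff _).2 ((mem_normallyOrdered_iff _).1 y.2).2⟩) <| by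
    constructor
    · intro y y' h
      have h' := congrArg Subtype.val h
      obtain ⟨h1, h2⟩ := sepMono_eq_iff.1 h'
      obtain ⟨⟨⟨x, w⟩, hv⟩, hy⟩ := y
      obtain ⟨⟨⟨x', w'⟩, hv'⟩, hy'⟩ := y'
      obtain rfl : x = x' := h1
      obtain ⟨p, g⟩ := (mem_normallyOrdered_iff _).1 hy
      obtain ⟨p', -⟩ := (mem_normallyOrdered_iff _).1 hy'
      obtain rfl : w = w' := mixedNormal_unique w w' hv g p p' h2
      rfl
    · intro z
      obtain ⟨w, h1, h2⟩ := exists_mixedNormal z.1.1.2 z.1.2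
      have hv := h1.valid z.1.2
      have hg := ((mem_separatelyOrdered_iff _).1 z.2).2.congr z.1.2 h1
      refine ⟨⟨⟨(z.1.1.1, w), hv⟩, (mem_normallyOrdered_iff _).2 ⟨h2, hg⟩⟩, Subtype.ext ?_⟩
      have : sepMono (⟨(z.1.1.1, w), hv⟩ : Mono m n) = sepMono z.1 := by
        symm
        exact sepMono_eq_iff.2 ⟨rfl, h1⟩
      exact this.trans (sepMono_of_mem z.2)

theorem vec_normEquivSep (y : normallyOrdered m n) : vec (normEquivSep m n y).1 = vec y.1 :=
  vec_sepMono y.1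

theorem linearIndependent_normallyOrdered (m n : ℤ) :
    LinearIndependent ℂ (fun z : normallyOrdered m n => vec z.1) := by
  have h := (linearIndependent_separatelyOrdered m n).comp _ (normEquivSep m n).injective
  convert h using 2 with y
  exact (vec_normEquivSep y).symm

theorem span_normallyOrdered (m n : ℤ) :
    Submodule.span ℂ (Set.range fun z : normallyOrdered m n => vec z.1) = ⊤ := by
  have h : (fun z : normallyOrdered m n => vec z.1) =
      (fun z : separatelyOrdered m n => vec z.1) ∘ normEquivSep m n :=
    funext fun y => (vec_normEquivSep y).symm
  rw [h, (normEquivSep m n).surjective.range_comp, span_separatelyOrdered]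

theorem SameUpToSign.eq {y y' : normallyOrdered m n} (h : SameUpToSign y.1 y'.1) : y = y' := by
  classical
  have hi := linearIndependent_normallyOrdered m n
  by_contra hne
  rcases h with h | h
  · exact hne (hi.injective h)
  · have := linearIndependent_iff'.1 hi {y, y'} (fun _ => 1)
      (by rw [Finset.sum_pair hne]; simp [h]) y (by simp)
    exact one_ne_zero this

theorem normalOrder_eq {z : Mono m n} {y : normallyOrdered m n}
    (h : sepMono z = (normEquivSep m n y).1) : normalOrder z = some y := by
  have hv : vec z = vec y.1 := by rw [← vec_sepMono, h, vec_normEquivSep]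
  have he : ∃ y : normallyOrdered m n, SameUpToSign z y.1 := ⟨y, Or.inl hv⟩
  rw [normalOrder, dif_pos he]
  have hs := he.choose_spec
  refine congrArg some (SameUpToSign.eq ?_).symm
  unfold SameUpToSign at hs ⊢
  rwa [← hv]

theorem normEquivSep_isIso (m n : ℤ) :
    (normCrystal m n).IsIso (sepCrystal m n) (normEquivSep m n) where
  wt y := monoCrystal_wt_sepMono y.1
  ε i y := monoCrystal_ε_sepMono y.1
  φ i y := monoCrystal_φ_sepMono y.1
  e i y := by
    have hs := stable_separatelyOrdered m n
    have hC := monoCrystal_isCrystal m n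
    cases h : (monoCrystal m n).e i y.1 with
    | none =>
      have h1 : (sepCrystal m n).e i (normEquivSep m n y) = none := by
        rw [(sepCrystal_isCrystal m n).e_eq_none]
        exact (monoCrystal_ε_sepMono y.1).trans ((hC.e_eq_none i _).1 h)
      have h2 : (normCrystal m n).e i y = none := by
        change ((monoCrystal m n).e i y.1).bind normalOrder = none
        rw [h]; rfl
      rw [h1, h2]; rfl
    | some z =>
      have h3 := e_sepMono h
      have hz : sepMono z ∈ separatelyOrdered m n := (hs i _ (normEquivSep m n y).2 _).1 h3
      have h1 : (sepCrystal m n).e i (normEquivSep m n y) = some ⟨sepMono z, hz⟩ :=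
        CrystalData.restrict_e_eq_some.2 h3
      have h2 : (normCrystal m n).e i y = some ((normEquivSep m n).symm ⟨sepMono z, hz⟩) := by
        change ((monoCrystal m n).e i y.1).bind normalOrder = _
        rw [h]
        exact normalOrder_eq (by rw [Equiv.apply_symm_apply])
      rw [h1, h2, Option.map_some, Equiv.apply_symm_apply]
  f i y := by
    have hs := stable_separatelyOrdered m n
    have hC := monoCrystal_isCrystal m n
    cases h : (monoCrystal m n).f i y.1 with
    | none =>
      have h1 : (sepCrystal m n).f i (normEquivSep m n y) = none := by
        rw [(sepCrystal_isCrystal m n).f_eq_none]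
        exact (monoCrystal_φ_sepMono y.1).trans ((hC.f_eq_none i _).1 h)
      have h2 : (normCrystal m n).f i y = none := by
        change ((monoCrystal m n).f i y.1).bind normalOrder = none
        rw [h]; rfl
      rw [h1, h2]; rfl
    | some z =>
      have h3 := f_sepMono h
      have hz : sepMono z ∈ separatelyOrdered m n := (hs i _ (normEquivSep m n y).2 _).2 h3
      have h1 : (sepCrystal m n).f i (normEquivSep m n y) = some ⟨sepMono z, hz⟩ :=
        CrystalData.restrict_f_eq_some.2 h3
      have h2 : (normCrystal m n).f i y = some ((normEquivSep m n).symm ⟨sepMono z, hz⟩) := by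
        change ((monoCrystal m n).f i y.1).bind normalOrder = _
        rw [h]
        exact normalOrder_eq (by rw [Equiv.apply_symm_apply])
      rw [h1, h2, Option.map_some, Equiv.apply_symm_apply]

theorem normCrystal_isCrystal (m n : ℤ) : (normCrystal m n).IsCrystal :=
  (normEquivSep_isIso m n).isCrystal (sepCrystal_isCrystal m n)

end

section
variable {m n : ℤ} {x : ℤ × ℤ} {i : Fin 2}

/-! ### Paths and sequences of domains -/

theorem ground_domainAt {p : ℤ → ℤ} (k : ℤ) : ground m n k (domainAt m n p k) = p k := by
  unfold ground domainAt domainPair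
  by_cases h : k % 2 = 1
  · rw [if_pos h, if_pos h]
    split_ifs <;> simp only <;> omega
  · rw [if_neg h, if_neg h]
    have e : k - 1 + 1 = k := by omega
    split_ifs <;> simp only <;> omega

/-- The conditions on walls at odd positions are just what is needed to recover both domains from
the two values of the path. -/
theorem domainAt_ground_seq {d : ℤ → ℤ × ℤ} (hd : IsDomainSeq m n d) (k : ℤ) :
    domainAt m n (fun k => ground m n k (d k)) k = d k := by
  have key : ∀ k, k % 2 = 1 → domainPair m n k (ground m n (k + 1) (d (k + 1)))
      (ground m n k (d k)) = (d (k + 1), d k) := by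
    intro k hk
    rcases hy : d (k + 1) with ⟨y1, y2⟩
    rcases hx : d k with ⟨x1, x2⟩
    have h1 := hd.inRange (k + 1)
    have h2 := hd.inRange k
    have h3 : (y1, y2) = (x1, x2) ∨ WallAllowed m n k (y1, y2) (x1, x2) := by
      by_cases h : d (k + 1) = d k
      · left; rw [← hy, ← hx, h]
      · right; rw [← hy, ← hx]; exact hd.allowed k h
    rw [hy] at h1
    rw [hx] at h2
    simp only [InRange, WallAllowed, Prod.mk.injEq] at h1 h2 h3
    unfold ground domainPair
    have e1 : ¬ (k + 1) % 2 = 1 := by omega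
    simp only [hk, e1, if_true, if_false]
    by_cases h4 : k % 4 = 1
    · have e2 : ¬ (k + 1) % 4 = 0 := by omega
      simp only [h4, e2, if_true, if_false]
      split_ifs <;> simp only [Prod.mk.injEq] <;> omega
    · have e2 : (k + 1) % 4 = 0 := by omega
      simp only [h4, e2, if_true, if_false]
      split_ifs <;> simp only [Prod.mk.injEq] <;> omega
  unfold domainAt
  by_cases h : k % 2 = 1
  · rw [if_pos h, key k h]
  · have := key (k - 1) (by omega)
    rw [sub_add_cancel] at this
    rw [if_neg h, this]

/-- `M₁` and `M₂` are inverse bijections. -/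
def pathEquivDomains (h : 0 < n ∧ n < m) : SpinPath m n ≃ DomainSeq m n where
  toFun := toDomains h
  invFun := toPath
  left_inv _ := Subtype.ext (funext fun k => ground_domainAt k)
  right_inv d := Subtype.ext (funext fun k => domainAt_ground_seq d.2 k)

/-! ### Surviving letters of a path -/

/-- The number of `1`s of the word of a ground state at `k`. -/
def groundOnes (m n : ℤ) (i : Fin 2) (k : ℤ) (x : ℤ × ℤ) : ℤ :=
  if i = 1 then ground m n k x else cap m n k - ground m n k x

/-- The number of `0`s that a ground state has to the left of the position `k`. -/
def groundZeros (m n : ℤ) (i : Fin 2) (k : ℤ) (x : ℤ × ℤ) : ℤ :=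
  if k % 2 = 0 then groundOnes m n i k x else m - groundOnes m n i (k + 1) x

theorem letters_of_ground {p : ℤ → ℤ} {k : ℤ} (h : p k = ground m n k x) :
    letters m n p i k =
      ((groundOnes m n i k x).toNat, (cap m n k - groundOnes m n i k x).toNat) := by
  unfold letters groundOnes
  rw [h]
  split_ifs
  · rfl
  · rw [sub_sub_cancel]

theorem groundOnes_bounds (hx : InRange m n x) (k : ℤ) :
    0 ≤ groundOnes m n i k x ∧ groundOnes m n i k x ≤ cap m n k := by
  unfold InRange at hx
  unfold groundOnes ground cap
  split_ifs <;> omega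

/-- A ground state satisfies the recursion for surviving `0`s, and its `1`s are cancelled
completely by `0`s on their left. -/
theorem groundZeros_step (hx : InRange m n x) (k : ℤ) :
    0 ≤ groundZeros m n i k x ∧ groundOnes m n i (k + 1) x ≤ groundZeros m n i (k + 1) x ∧
    groundZeros m n i k x = cap m n (k + 1) - groundOnes m n i (k + 1) x +
      (groundZeros m n i (k + 1) x - groundOnes m n i (k + 1) x) := by
  unfold InRange at hx
  unfold groundZeros groundOnes ground cap
  rcases (by omega : k % 4 = 0 ∨ k % 4 = 1 ∨ k % 4 = 2 ∨ k % 4 = 3) with h | h | h | h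
  · have h0 : (k) % 2 = 0 := by omega
    have h1 : (k + 1) % 2 = 1 := by omega
    have h2 : (k + 1) % 4 = 1 := by omega
    have h3 : (k + 1 + 1) % 2 = 0 := by omega
    have h4 : (k + 1 + 1) % 4 = 2 := by omega
    by_cases hi : i = 1 <;>
      simp only [hi, h, h0, h1, h2, h3, h4, if_true, if_false, one_ne_zero, zero_ne_one,
        OfNat.ofNat_ne_zero] <;> simp <;> omega
  · have h0 : (k) % 2 = 1 := by omega
    have h1 : (k + 1) % 2 = 0 := by omega
    have h2 : (k + 1) % 4 = 2 := by omega
    have h3 : (k + 1 + 1) % 2 = 1 := by omega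
    have h4 : (k + 1 + 1) % 4 = 3 := by omega
    by_cases hi : i = 1 <;>
      simp only [hi, h, h0, h1, h2, h3, h4, if_true, if_false, one_ne_zero, zero_ne_one,
        OfNat.ofNat_ne_zero] <;> simp <;> omega
  · have h0 : (k) % 2 = 0 := by omega
    have h1 : (k + 1) % 2 = 1 := by omega
    have h2 : (k + 1) % 4 = 3 := by omega
    have h3 : (k + 1 + 1) % 2 = 0 := by omega
    have h4 : (k + 1 + 1) % 4 = 0 := by omega
    by_cases hi : i = 1 <;>
      simp only [hi, h, h0, h1, h2, h3, h4, if_true, if_false, one_ne_zero, zero_ne_one,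
        OfNat.ofNat_ne_zero] <;> simp <;> omega
  · have h0 : (k) % 2 = 1 := by omega
    have h1 : (k + 1) % 2 = 0 := by omega
    have h2 : (k + 1) % 4 = 0 := by omega
    have h3 : (k + 1 + 1) % 2 = 1 := by omega
    have h4 : (k + 1 + 1) % 4 = 1 := by omega
    by_cases hi : i = 1 <;>
      simp only [hi, h, h0, h1, h2, h3, h4, if_true, if_false, one_ne_zero, zero_ne_one,
        OfNat.ofNat_ne_zero] <;> simp <;> omega

/-- The number of `0`s that survive in `p(k+r) ⋯ p(k+1)`. -/
def leftSeq (m n : ℤ) (p : ℤ → ℤ) (i : Fin 2) (k : ℤ) (r : ℕ) : ℕ :=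
  (reduce (((List.range r).reverse).map fun t : ℕ => letters m n p i (k + 1 + (t : ℤ)))).2

/-- The number of `1`s that survive in `p(k-1) ⋯ p(k-r)`. -/
def rightSeq (m n : ℤ) (p : ℤ → ℤ) (i : Fin 2) (k : ℤ) (r : ℕ) : ℕ :=
  (reduce ((List.range r).map fun t : ℕ => letters m n p i (k - 1 - (t : ℤ)))).1

theorem zerosLeft_eq (p : ℤ → ℤ) (k : ℤ) :
    zerosLeft m n p i k = ⨆ r, leftSeq m n p i k r := by
  unfold zerosLeft leftSeq
  congr 1
  funext r
  simp only [List.pure_def, List.bind_eq_flatMap, ← List.map_eq_flatMap, List.map_map,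
    Function.comp_def]

theorem onesRight_eq (p : ℤ → ℤ) (k : ℤ) :
    onesRight m n p i k = ⨆ r, rightSeq m n p i k r := by
  unfold onesRight rightSeq
  congr 1
  funext r
  simp only [List.pure_def, List.bind_eq_flatMap, ← List.map_eq_flatMap, List.map_map,
    Function.comp_def]

theorem leftSeq_succ (p : ℤ → ℤ) (k : ℤ) (r : ℕ) :
    leftSeq m n p i k (r + 1) = (letters m n p i (k + 1)).2 +
      (leftSeq m n p i (k + 1) r - (letters m n p i (k + 1)).1) := by
  unfold leftSeq
  rw [List.range_succ_eq_map, List.reverse_cons, List.map_append, reduce_append]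
  simp only [List.map_cons, List.map_nil, reduce_cons, reduce_nil, cancel_zero_right,
    Nat.cast_zero, add_zero, ← List.map_reverse, List.map_map]
  have : (fun t : ℕ => letters m n p i (k + 1 + t)) ∘ Nat.succ =
      fun t : ℕ => letters m n p i (k + 1 + 1 + t) := by
    funext t
    simp only [Function.comp]
    congr 1
    push_cast
    ring
  rw [this]
  rfl

theorem rightSeq_succ (p : ℤ → ℤ) (k : ℤ) (r : ℕ) :
    rightSeq m n p i k (r + 1) = (letters m n p i (k - 1)).1 +
      (rightSeq m n p i (k - 1) r - (letters m n p i (k - 1)).2) := by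
  unfold rightSeq
  rw [List.range_succ_eq_map]
  simp only [List.map_cons, reduce_cons, Nat.cast_zero, sub_zero, List.map_map]
  have : (fun t : ℕ => letters m n p i (k - 1 - t)) ∘ Nat.succ =
      fun t : ℕ => letters m n p i (k - 1 - 1 - t) := by
    funext t
    simp only [Function.comp]
    congr 1
    push_cast
    ring
  rw [this]
  rfl

theorem isGreatest_step {s s' : ℕ → ℕ} {a b M : ℕ} (h0 : s' 0 = 0)
    (hs : ∀ r, s' (r + 1) = a + (s r - b)) (h : IsGreatest (Set.range s) M) :
    IsGreatest (Set.range s') (a + (M - b)) := by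
  obtain ⟨⟨r, hr⟩, hM⟩ := h
  refine ⟨⟨r + 1, by rw [hs, hr]⟩, ?_⟩
  rintro _ ⟨t, rfl⟩
  cases t with
  | zero => rw [h0]; exact Nat.zero_le _
  | succ t =>
    have : s t ≤ M := hM ⟨t, rfl⟩
    rw [hs]; omega

theorem zerosLeft_eq_of_isGreatest {p : ℤ → ℤ} {k : ℤ} {M : ℕ}
    (h : IsGreatest (Set.range (leftSeq m n p i k)) M) : zerosLeft m n p i k = M :=
  (zerosLeft_eq p k).trans h.csSup_eq

theorem onesRight_eq_of_isGreatest {p : ℤ → ℤ} {k : ℤ} {M : ℕ}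
    (h : IsGreatest (Set.range (rightSeq m n p i k)) M) : onesRight m n p i k = M :=
  (onesRight_eq p k).trans h.csSup_eq

/-- The supremum is attained after one or two steps. -/
theorem isGreatest_leftSeq_ground {p : ℤ → ℤ} (hx : InRange m n x) {K : ℤ}
    (hp : ∀ k, K < k → p k = ground m n k x) {k : ℤ} (hk : K ≤ k) :
    IsGreatest (Set.range (leftSeq m n p i k)) (groundZeros m n i k x).toNat := by
  constructor
  · have h1 := leftSeq_succ (m := m) (n := n) (i := i) p k 0
    have h2 := leftSeq_succ (m := m) (n := n) (i := i) p k 1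
    have h3 := leftSeq_succ (m := m) (n := n) (i := i) p (k + 1) 0
    have h4 : leftSeq m n p i (k + 1) 0 = 0 := rfl
    have h5 : leftSeq m n p i (k + 1 + 1) 0 = 0 := rfl
    rw [letters_of_ground (hp _ (by omega))] at h1 h2 h3
    have b1 := groundOnes_bounds (i := i) hx (k + 1)
    have b2 := groundOnes_bounds (i := i) hx (k + 1 + 1)
    have b3 := groundZeros_step (i := i) hx k
    simp only [h4, h5, zero_add] at h1 h2 h3
    by_cases he : k % 2 = 0
    · refine ⟨2, ?_⟩
      have g : groundZeros m n i (k + 1) x = m - groundOnes m n i (k + 1 + 1) x := by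
        rw [groundZeros, if_neg (by omega)]
      have c : cap m n (k + 1 + 1) = m := if_neg (by omega)
      rw [c] at h3
      rw [h2, h3]
      omega
    · refine ⟨1, ?_⟩
      have g : groundZeros m n i k x = m - groundOnes m n i (k + 1) x := by
        rw [groundZeros, if_neg he]
      have c : cap m n (k + 1) = m := if_neg (by omega)
      rw [c] at h1
      rw [h1]
      omega
  · rintro _ ⟨r, rfl⟩
    induction r generalizing k with
    | zero => exact Nat.zero_le _
    | succ r ih =>
      have h1 := ih (k := k + 1) (by omega)
      have b1 := groundOnes_bounds (i := i) hx (k + 1)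
      have b3 := groundZeros_step (i := i) hx k
      rw [leftSeq_succ, letters_of_ground (hp _ (by omega))]
      simp only
      omega

/-- The number of `1`s that a ground state has to the right of the position `k`. -/
def groundOnesRight (m n : ℤ) (i : Fin 2) (k : ℤ) (x : ℤ × ℤ) : ℤ :=
  if k % 2 = 0 then m - groundOnes m n i k x else groundOnes m n i (k - 1) x

theorem groundOnesRight_step (hx : InRange m n x) (k : ℤ) :
    0 ≤ groundOnesRight m n i k x ∧
    cap m n k - groundOnes m n i k x ≤ groundOnesRight m n i k x ∧
    groundOnesRight m n i (k + 1) x = groundOnes m n i k x +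
      (groundOnesRight m n i k x - (cap m n k - groundOnes m n i k x)) := by
  unfold InRange at hx
  unfold groundOnesRight groundOnes ground cap
  rcases (by omega : k % 4 = 0 ∨ k % 4 = 1 ∨ k % 4 = 2 ∨ k % 4 = 3) with h | h | h | h
  · have h0 : (k) % 2 = 0 := by omega
    have h1 : (k + 1) % 2 = 1 := by omega
    have h2 : (k + 1) % 4 = 1 := by omega
    have h3 : (k - 1) % 2 = 1 := by omega
    have h4 : (k - 1) % 4 = 3 := by omega
    rw [add_sub_cancel_right]
    by_cases hi : i = 1 <;>
      simp only [hi, h, h0, h1, h2, h3, h4, if_true, if_false, one_ne_zero, zero_ne_one,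
        OfNat.ofNat_ne_zero] <;> simp <;> omega
  · have h0 : (k) % 2 = 1 := by omega
    have h1 : (k + 1) % 2 = 0 := by omega
    have h2 : (k + 1) % 4 = 2 := by omega
    have h3 : (k - 1) % 2 = 0 := by omega
    have h4 : (k - 1) % 4 = 0 := by omega
    rw [add_sub_cancel_right]
    by_cases hi : i = 1 <;>
      simp only [hi, h, h0, h1, h2, h3, h4, if_true, if_false, one_ne_zero, zero_ne_one,
        OfNat.ofNat_ne_zero] <;> simp <;> omega
  · have h0 : (k) % 2 = 0 := by omega
    have h1 : (k + 1) % 2 = 1 := by omega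
    have h2 : (k + 1) % 4 = 3 := by omega
    have h3 : (k - 1) % 2 = 1 := by omega
    have h4 : (k - 1) % 4 = 1 := by omega
    rw [add_sub_cancel_right]
    by_cases hi : i = 1 <;>
      simp only [hi, h, h0, h1, h2, h3, h4, if_true, if_false, one_ne_zero, zero_ne_one,
        OfNat.ofNat_ne_zero] <;> simp <;> omega
  · have h0 : (k) % 2 = 1 := by omega
    have h1 : (k + 1) % 2 = 0 := by omega
    have h2 : (k + 1) % 4 = 0 := by omega
    have h3 : (k - 1) % 2 = 0 := by omega
    have h4 : (k - 1) % 4 = 2 := by omega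
    rw [add_sub_cancel_right]
    by_cases hi : i = 1 <;>
      simp only [hi, h, h0, h1, h2, h3, h4, if_true, if_false, one_ne_zero, zero_ne_one,
        OfNat.ofNat_ne_zero] <;> simp <;> omega

theorem isGreatest_rightSeq_ground {p : ℤ → ℤ} (hx : InRange m n x) {K : ℤ}
    (hp : ∀ k, k < K → p k = ground m n k x) {k : ℤ} (hk : k ≤ K) :
    IsGreatest (Set.range (rightSeq m n p i k)) (groundOnesRight m n i k x).toNat := by
  constructor
  · have h1 := rightSeq_succ (m := m) (n := n) (i := i) p k 0
    have h2 := rightSeq_succ (m := m) (n := n) (i := i) p k 1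
    have h3 := rightSeq_succ (m := m) (n := n) (i := i) p (k - 1) 0
    have h4 : rightSeq m n p i (k - 1) 0 = 0 := rfl
    have h5 : rightSeq m n p i (k - 1 - 1) 0 = 0 := rfl
    rw [letters_of_ground (hp _ (by omega))] at h1 h2 h3
    have b1 := groundOnes_bounds (i := i) hx (k - 1)
    have b2 := groundOnes_bounds (i := i) hx (k - 1 - 1)
    have b3 := groundOnesRight_step (i := i) hx (k - 1)
    rw [sub_add_cancel] at b3
    simp only [h4, h5, zero_add] at h1 h2 h3
    by_cases he : k % 2 = 0
    · refine ⟨2, ?_⟩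
      have g : groundOnesRight m n i (k - 1) x = groundOnes m n i (k - 1 - 1) x := by
        rw [groundOnesRight, if_neg (by omega)]
      rw [h2, h3]
      omega
    · refine ⟨1, ?_⟩
      have g : groundOnesRight m n i k x = groundOnes m n i (k - 1) x := by
        rw [groundOnesRight, if_neg he]
      rw [h1]
      omega
  · rintro _ ⟨r, rfl⟩
    induction r generalizing k with
    | zero => exact Nat.zero_le _
    | succ r ih =>
      have h1 := ih (k := k - 1) (by omega)
      have b1 := groundOnes_bounds (i := i) hx (k - 1)
      have b3 := groundOnesRight_step (i := i) hx (k - 1)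
      rw [sub_add_cancel] at b3
      rw [rightSeq_succ, letters_of_ground (hp _ (by omega))]
      simp only
      omega

theorem zerosLeft_ground {p : ℤ → ℤ} (hx : InRange m n x) {K : ℤ}
    (hp : ∀ k, K < k → p k = ground m n k x) {k : ℤ} (hk : K ≤ k) :
    zerosLeft m n p i k = (groundZeros m n i k x).toNat :=
  zerosLeft_eq_of_isGreatest (isGreatest_leftSeq_ground hx hp hk)

theorem onesRight_ground {p : ℤ → ℤ} (hx : InRange m n x) {K : ℤ}
    (hp : ∀ k, k < K → p k = ground m n k x) {k : ℤ} (hk : k ≤ K) :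
    onesRight m n p i k = (groundOnesRight m n i k x).toNat :=
  onesRight_eq_of_isGreatest (isGreatest_rightSeq_ground hx hp hk)

section path

variable {p : ℤ → ℤ} (hp : IsPath m n p)
include hp

theorem IsPath.exists_left : ∃ x, InRange m n x ∧ ∃ K, ∀ k, K < k → p k = ground m n k x := by
  obtain ⟨x, hx, h⟩ := hp.left
  obtain ⟨K, hK⟩ := eventually_atTop.1 h
  exact ⟨x, hx, K, fun k hk => hK k hk.le⟩

theorem IsPath.exists_right : ∃ x, InRange m n x ∧ ∃ K, ∀ k, k < K → p k = ground m n k x := by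
  obtain ⟨x, hx, h⟩ := hp.right
  obtain ⟨K, hK⟩ := eventually_atBot.1 h
  exact ⟨x, hx, K, fun k hk => hK k hk.le⟩

theorem IsPath.exists_isGreatest_left (k : ℤ) :
    ∃ M, IsGreatest (Set.range (leftSeq m n p i k)) M := by
  obtain ⟨x, hx, K, hK⟩ := hp.exists_left
  rcases le_total K k with h | h
  · exact ⟨_, isGreatest_leftSeq_ground hx hK h⟩
  · induction k, h using Int.leInductionDown with
    | base => exact ⟨_, isGreatest_leftSeq_ground hx hK le_rfl⟩
    | pred k h ih =>
      obtain ⟨M, hM⟩ := ih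
      have hs := leftSeq_succ (m := m) (n := n) (i := i) p (k - 1)
      rw [sub_add_cancel] at hs
      exact ⟨_, isGreatest_step rfl hs hM⟩

theorem IsPath.exists_isGreatest_right (k : ℤ) :
    ∃ M, IsGreatest (Set.range (rightSeq m n p i k)) M := by
  obtain ⟨x, hx, K, hK⟩ := hp.exists_right
  rcases le_total k K with h | h
  · exact ⟨_, isGreatest_rightSeq_ground hx hK h⟩
  · induction k, h using Int.leInduction with
    | base => exact ⟨_, isGreatest_rightSeq_ground hx hK le_rfl⟩
    | succ k h ih =>
      obtain ⟨M, hM⟩ := ih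
      have hs := rightSeq_succ (m := m) (n := n) (i := i) p (k + 1)
      rw [add_sub_cancel_right] at hs
      exact ⟨_, isGreatest_step rfl hs hM⟩

theorem IsPath.zerosLeft_step (k : ℤ) :
    zerosLeft m n p i k = (letters m n p i (k + 1)).2 +
      (zerosLeft m n p i (k + 1) - (letters m n p i (k + 1)).1) := by
  obtain ⟨M, hM⟩ := hp.exists_isGreatest_left (i := i) (k + 1)
  have h1 : zerosLeft m n p i (k + 1) = M := zerosLeft_eq_of_isGreatest hM
  rw [h1]
  exact zerosLeft_eq_of_isGreatest (isGreatest_step (s' := leftSeq m n p i k) rfl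
    (fun r => leftSeq_succ p k r) hM)

theorem IsPath.onesRight_step (k : ℤ) :
    onesRight m n p i (k + 1) = (letters m n p i k).1 +
      (onesRight m n p i k - (letters m n p i k).2) := by
  obtain ⟨M, hM⟩ := hp.exists_isGreatest_right (i := i) k
  have h1 : onesRight m n p i k = M := onesRight_eq_of_isGreatest hM
  rw [h1]
  refine onesRight_eq_of_isGreatest (isGreatest_step (s' := rightSeq m n p i (k + 1)) rfl
    (fun r => ?_) hM)
  rw [rightSeq_succ, add_sub_cancel_right]

/-- Far on the left all `0`s are cancelled. -/
theorem IsPath.exists_zerosLeft_le :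
    ∃ K, ∀ k, K ≤ k → zerosLeft m n p i k ≤ onesRight m n p i (k + 1) := by
  obtain ⟨x, hx, K, hK⟩ := hp.exists_left
  have h0 : ∃ K', K ≤ K' ∧ zerosLeft m n p i K' ≤ onesRight m n p i (K' + 1) := by
    obtain ⟨k, hk, he⟩ : ∃ k, K < k ∧ k % 2 = 0 := by
      rcases Int.emod_two_eq K with h | h
      · exact ⟨K + 2, by omega, by omega⟩
      · exact ⟨K + 1, by omega, by omega⟩
    refine ⟨k, hk.le, ?_⟩
    rw [zerosLeft_ground hx hK hk.le, hp.onesRight_step, letters_of_ground (hK k hk),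
      groundZeros, if_pos he]
    exact Nat.le_add_right _ _
  obtain ⟨K', -, h1⟩ := h0
  refine ⟨K', fun k hk => ?_⟩
  induction k, hk using Int.leInduction with
  | base => exact h1
  | succ k hk ih =>
    have h2 := hp.zerosLeft_step (i := i) k
    have h3 := hp.onesRight_step (i := i) (k + 1)
    omega

/-- Far on the right all `1`s are cancelled. -/
theorem IsPath.exists_onesRight_le :
    ∃ K, ∀ k, k ≤ K → onesRight m n p i (k + 1) ≤ zerosLeft m n p i k := by
  obtain ⟨x, hx, K, hK⟩ := hp.exists_right
  have h0 : ∃ K', onesRight m n p i (K' + 1) ≤ zerosLeft m n p i K' := by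
    obtain ⟨k, hk, he⟩ : ∃ k, k < K ∧ k % 2 = 0 := by
      rcases Int.emod_two_eq K with h | h
      · exact ⟨K - 2, by omega, by omega⟩
      · exact ⟨K - 1, by omega, by omega⟩
    refine ⟨k - 1, ?_⟩
    have c : cap m n k = m := if_neg (by omega)
    rw [hp.zerosLeft_step, sub_add_cancel, onesRight_ground hx hK hk.le,
      letters_of_ground (hK k hk), groundOnesRight, if_pos he, c]
    exact Nat.le_add_right _ _
  obtain ⟨K', h1⟩ := h0
  refine ⟨K', fun k hk => ?_⟩
  induction k, hk using Int.leInductionDown with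
  | base => exact h1
  | pred k hk ih =>
    have h2 := hp.zerosLeft_step (i := i) (k - 1)
    have h3 := hp.onesRight_step (i := i) k
    rw [sub_add_cancel] at h2 ⊢
    omega

/-- The operator `f_i` acts at `q` if and only if a `0` of `q` survives the `1`s on its right, and
no `0` from the left of `q` survives the `1`s of `q`. -/
theorem IsPath.isGreatest_iff (q : ℤ) :
    IsGreatest {k | 0 < freeZeros m n p i k} q ↔
      onesRight m n p i q < (letters m n p i q).2 ∧
      zerosLeft m n p i q ≤ (letters m n p i q).1 := by
  have hz := hp.zerosLeft_step (i := i)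
  have ho := hp.onesRight_step (i := i)
  have hq := ho q
  constructor
  · rintro ⟨h1, h2⟩
    have h1 : 0 < (letters m n p i q).2 - onesRight m n p i q := h1
    have h3 : ∀ k, q < k → (letters m n p i k).2 ≤ onesRight m n p i k := fun k hk => by
      by_contra hc
      have : k ≤ q := h2 (show 0 < (letters m n p i k).2 - onesRight m n p i k by omega)
      omega
    obtain ⟨K, hK⟩ := hp.exists_zerosLeft_le (i := i)
    -- no `0` survives far on the left, and this propagates to the right as far as `q`
    have h4 : zerosLeft m n p i q ≤ onesRight m n p i (q + 1) := by
      have : ∀ k, k ≤ max K q → q ≤ k → zerosLeft m n p i k ≤ onesRight m n p i (k + 1) := by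
        intro k hk
        induction k, hk using Int.leInductionDown with
        | base => exact fun _ => hK _ (le_max_left _ _)
        | pred k hk ih =>
          intro hk'
          have h5 := ih (by omega)
          have h6 := h3 k (by omega)
          have h7 := hz (k - 1)
          have h8 := ho k
          rw [sub_add_cancel] at h7 ⊢
          omega
      exact this q (le_max_right _ _) le_rfl
    omega
  · rintro ⟨h1, h2⟩
    refine ⟨show 0 < (letters m n p i q).2 - onesRight m n p i q by omega, fun k hk => ?_⟩
    have hk : 0 < (letters m n p i k).2 - onesRight m n p i k := hk
    by_contra hc
    have : ∀ k, q ≤ k → zerosLeft m n p i k ≤ onesRight m n p i (k + 1) := by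
      intro k hk
      induction k, hk using Int.leInduction with
      | base => omega
      | succ k hk ih =>
        have h7 := hz k
        have h8 := ho (k + 1)
        omega
    have h5 := this (k - 1) (by omega)
    have h7 := hz (k - 1)
    rw [sub_add_cancel] at h5 h7
    omega

/-- The operator `e_i` acts at `q` if and only if a `1` of `q` survives the `0`s on its left, and no
`1` from the right of `q` survives the `0`s of `q`. -/
theorem IsPath.isLeast_iff (q : ℤ) :
    IsLeast {k | 0 < freeOnes m n p i k} q ↔
      zerosLeft m n p i q < (letters m n p i q).1 ∧
      onesRight m n p i q ≤ (letters m n p i q).2 := by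
  have hz := hp.zerosLeft_step (i := i)
  have ho := hp.onesRight_step (i := i)
  have hq := hz (q - 1)
  rw [sub_add_cancel] at hq
  constructor
  · rintro ⟨h1, h2⟩
    have h1 : 0 < (letters m n p i q).1 - zerosLeft m n p i q := h1
    have h3 : ∀ k, k < q → (letters m n p i k).1 ≤ zerosLeft m n p i k := fun k hk => by
      by_contra hc
      have : q ≤ k := h2 (show 0 < (letters m n p i k).1 - zerosLeft m n p i k by omega)
      omega
    obtain ⟨K, hK⟩ := hp.exists_onesRight_le (i := i)
    -- no `1` survives far on the right, and this propagates to the left as far as `q`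
    have h4 : onesRight m n p i q ≤ zerosLeft m n p i (q - 1) := by
      have : ∀ k, min K (q - 1) ≤ k → k ≤ q - 1 →
          onesRight m n p i (k + 1) ≤ zerosLeft m n p i k := by
        intro k hk
        induction k, hk using Int.leInduction with
        | base => exact fun _ => hK _ (min_le_left _ _)
        | succ k hk ih =>
          intro hk'
          have h5 := ih (by omega)
          have h6 := h3 (k + 1) (by omega)
          have h7 := hz k
          have h8 := ho (k + 1)
          omega
      have := this (q - 1) (min_le_right _ _) le_rfl
      rwa [sub_add_cancel] at this
    omega
  · rintro ⟨h1, h2⟩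
    refine ⟨show 0 < (letters m n p i q).1 - zerosLeft m n p i q by omega, fun k hk => ?_⟩
    have hk : 0 < (letters m n p i k).1 - zerosLeft m n p i k := hk
    by_contra hc
    have : ∀ k, k ≤ q - 1 → onesRight m n p i (k + 1) ≤ zerosLeft m n p i k := by
      intro k hk
      induction k, hk using Int.leInductionDown with
      | base => rw [sub_add_cancel]; omega
      | pred k hk ih =>
        have h7 := hz (k - 1)
        have h8 := ho k
        rw [sub_add_cancel] at h7 ⊢
        omega
    have h5 := this k (by omega)
    have h8 := ho k
    omega

/-- The surviving `0`s at `k` in telescoping form. The subtractions are truncated: they express the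
cancellation of the `0`s on the left of a position against the `1`s on its right. -/
theorem IsPath.freeZeros_eq (k : ℤ) : freeZeros m n p i k =
    (zerosLeft m n p i (k - 1) - onesRight m n p i k) -
      (zerosLeft m n p i k - onesRight m n p i (k + 1)) := by
  have h7 := hp.zerosLeft_step (i := i) (k - 1)
  have h8 := hp.onesRight_step (i := i) k
  rw [sub_add_cancel] at h7
  unfold freeZeros
  omega

theorem IsPath.freeOnes_eq (k : ℤ) : freeOnes m n p i k =
    (onesRight m n p i (k + 1) - zerosLeft m n p i k) -
      (onesRight m n p i k - zerosLeft m n p i (k - 1)) := by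
  have h7 := hp.zerosLeft_step (i := i) (k - 1)
  have h8 := hp.onesRight_step (i := i) k
  rw [sub_add_cancel] at h7
  unfold freeOnes
  omega

end path

theorem sum_Ioc_telescope (T F : ℤ → ℕ) {J K : ℤ} (h : J ≤ K)
    (hT : ∀ k, T k + F k = T (k - 1)) :
    T K + ∑ k ∈ Finset.Ioc J K, F k = T J := by
  induction K, h using Int.leInduction with
  | base => simp
  | succ K h ih =>
    have : Finset.Ioc J (K + 1) = insert (K + 1) (Finset.Ioc J K) := by
      ext k; simp only [Finset.mem_Ioc, Finset.mem_insert]; omega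
    rw [this, Finset.sum_insert (by simp), ← ih, ← add_assoc, hT (K + 1), add_sub_cancel_right]

theorem exists_sum_freeZeros (p : SpinPath m n) {J : ℤ} (hx : InRange m n x)
    (hJ : ∀ k, k < J → p.1 k = ground m n k x) :
    ∃ K, (∀ k, freeZeros m n p.1 i k ≠ 0 → k ∈ Finset.Ioc (J - 1) K) ∧
      ∑ k ∈ Finset.Ioc (J - 1) K, freeZeros m n p.1 i k =
        zerosLeft m n p.1 i (J - 1) - onesRight m n p.1 i J := by
  obtain ⟨K, hK⟩ := p.2.exists_zerosLeft_le (i := i)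
  refine ⟨max K (J - 1), fun k hk => ?_, ?_⟩
  · rw [Finset.mem_Ioc]
    constructor
    · by_contra hc
      apply hk
      have b := groundOnesRight_step (i := i) hx k
      rw [freeZeros, onesRight_ground hx hJ (by omega), letters_of_ground (hJ k (by omega))]
      simp only
      omega
    · by_contra hc
      apply hk
      rw [p.2.freeZeros_eq]
      have := hK (k - 1) (by omega)
      rw [sub_add_cancel] at this
      omega
  · have h := sum_Ioc_telescope (fun k => zerosLeft m n p.1 i k - onesRight m n p.1 i (k + 1))
      (freeZeros m n p.1 i) (le_max_right K (J - 1)) fun k => by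
        have h7 := p.2.zerosLeft_step (i := i) (k - 1)
        have h8 := p.2.onesRight_step (i := i) k
        rw [sub_add_cancel] at h7 ⊢
        unfold freeZeros
        omega
    have h' := hK _ (le_max_left K (J - 1))
    rw [sub_add_cancel] at h
    omega

theorem pathφ_eq (p : SpinPath m n) {J : ℤ} (hx : InRange m n x)
    (hJ : ∀ k, k < J → p.1 k = ground m n k x) :
    pathφ m n i p = zerosLeft m n p.1 i (J - 1) - onesRight m n p.1 i J := by
  obtain ⟨K, h1, h2⟩ := exists_sum_freeZeros (i := i) p hx hJ
  rw [← h2]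
  exact finsum_eq_sum_of_support_subset _ fun k hk => Finset.mem_coe.2 (h1 k hk)

theorem pathε_eq (p : SpinPath m n) {K : ℤ} (hx : InRange m n x)
    (hK : ∀ k, K < k → p.1 k = ground m n k x) :
    pathε m n i p = onesRight m n p.1 i (K + 1) - zerosLeft m n p.1 i K := by
  obtain ⟨J, hJ⟩ := p.2.exists_onesRight_le (i := i)
  have h0 : ∀ k, freeOnes m n p.1 i k ≠ 0 → k ∈ Finset.Ioc (min J K) K := fun k hk => by
    rw [Finset.mem_Ioc]
    constructor
    · by_contra hc
      apply hk
      rw [p.2.freeOnes_eq]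
      have := hJ k (by omega)
      omega
    · by_contra hc
      apply hk
      have b := groundZeros_step (i := i) hx (k - 1)
      rw [sub_add_cancel] at b
      rw [freeOnes, zerosLeft_ground hx hK (by omega), letters_of_ground (hK k (by omega))]
      simp only
      omega
  rw [pathε, finsum_eq_sum_of_support_subset _ fun k hk => Finset.mem_coe.2 (h0 k hk)]
  have hT : ∀ K', min J K ≤ K' → (onesRight m n p.1 i (min J K + 1) -
      zerosLeft m n p.1 i (min J K)) + ∑ k ∈ Finset.Ioc (min J K) K', freeOnes m n p.1 i k =
        onesRight m n p.1 i (K' + 1) - zerosLeft m n p.1 i K' := by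
    intro K' h
    induction K', h using Int.leInduction with
    | base => simp
    | succ K' h ih =>
      have e : Finset.Ioc (min J K) (K' + 1) = insert (K' + 1) (Finset.Ioc (min J K) K') := by
        ext k; simp only [Finset.mem_Ioc, Finset.mem_insert]; omega
      have h7 := p.2.zerosLeft_step (i := i) K'
      have h8 := p.2.onesRight_step (i := i) (K' + 1)
      rw [e, Finset.sum_insert (by simp), add_left_comm, ih, freeOnes]
      omega
  have h1 := hT K (min_le_right _ _)
  have h2 := hJ (min J K) (min_le_left _ _)
  omega

theorem letters_update_of_ne (p : ℤ → ℤ) (v : ℤ) {k q : ℤ} (h : k ≠ q) :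
    letters m n (Function.update p q v) i k = letters m n p i k := by
  unfold letters
  rw [Function.update_of_ne h]

theorem letters_update_add {p : ℤ → ℤ} (hp : IsPath m n p) {q : ℤ}
    (h : 0 < (letters m n p i q).2) :
    letters m n (Function.update p q (p q + change i)) i q =
      ((letters m n p i q).1 + 1, (letters m n p i q).2 - 1) := by
  have hb := hp.bounds q
  unfold letters at h ⊢
  unfold change
  rw [Function.update_self]
  split_ifs at h ⊢ <;> simp only [Prod.mk.injEq] at h ⊢ <;> omega

theorem letters_update_sub {p : ℤ → ℤ} (hp : IsPath m n p) {q : ℤ}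
    (h : 0 < (letters m n p i q).1) :
    letters m n (Function.update p q (p q - change i)) i q =
      ((letters m n p i q).1 - 1, (letters m n p i q).2 + 1) := by
  have hb := hp.bounds q
  unfold letters at h ⊢
  unfold change
  rw [Function.update_self]
  split_ifs at h ⊢ <;> simp only [Prod.mk.injEq] at h ⊢ <;> omega

theorem zerosLeft_update (p : ℤ → ℤ) (q v : ℤ) :
    zerosLeft m n (Function.update p q v) i q = zerosLeft m n p i q := by
  rw [zerosLeft_eq, zerosLeft_eq]
  congr 1
  funext r
  unfold leftSeq
  congr 3
  funext t
  exact letters_update_of_ne p v (by omega)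

theorem onesRight_update (p : ℤ → ℤ) (q v : ℤ) :
    onesRight m n (Function.update p q v) i q = onesRight m n p i q := by
  rw [onesRight_eq, onesRight_eq]
  congr 1
  funext r
  unfold rightSeq
  congr 3
  funext t
  exact letters_update_of_ne p v (by omega)

theorem pathF_eq_some {p p' : SpinPath m n} :
    pathF m n i p = some p' ↔ ∃ q, onesRight m n p.1 i q < (letters m n p.1 i q).2 ∧
      zerosLeft m n p.1 i q ≤ (letters m n p.1 i q).1 ∧
      p'.1 = Function.update p.1 q (p.1 q + change i) := by
  unfold pathF
  split_ifs with h
  · have hs := h.choose_spec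
    rw [Option.some_inj]
    constructor
    · rintro rfl
      have h2 := (p.2.isGreatest_iff _).1 hs
      exact ⟨_, h2.1, h2.2, rfl⟩
    · rintro ⟨q, h1, h2, h3⟩
      have : h.choose = q := hs.unique ((p.2.isGreatest_iff q).2 ⟨h1, h2⟩)
      exact Subtype.ext (by rw [h3, ← this])
  · refine iff_of_false (by simp) ?_
    rintro ⟨q, h1, h2, -⟩
    exact h ⟨q, (p.2.isGreatest_iff q).2 ⟨h1, h2⟩⟩

theorem pathE_eq_some {p p' : SpinPath m n} :
    pathE m n i p = some p' ↔ ∃ q, zerosLeft m n p.1 i q < (letters m n p.1 i q).1 ∧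
      onesRight m n p.1 i q ≤ (letters m n p.1 i q).2 ∧
      p'.1 = Function.update p.1 q (p.1 q - change i) := by
  unfold pathE
  split_ifs with h
  · have hs := h.choose_spec
    rw [Option.some_inj]
    constructor
    · rintro rfl
      have h2 := (p.2.isLeast_iff _).1 hs
      exact ⟨_, h2.1, h2.2, rfl⟩
    · rintro ⟨q, h1, h2, h3⟩
      have : h.choose = q := hs.unique ((p.2.isLeast_iff q).2 ⟨h1, h2⟩)
      exact Subtype.ext (by rw [h3, ← this])
  · refine iff_of_false (by simp) ?_
    rintro ⟨q, h1, h2, -⟩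
    exact h ⟨q, (p.2.isLeast_iff q).2 ⟨h1, h2⟩⟩

/-- The two operators are inverse to each other, since the conditions for `f_i` at `q` before the
change of a letter at `q` are the conditions for `e_i` at `q` after it. -/
theorem pathE_iff_pathF (p p' : SpinPath m n) :
    pathE m n i p = some p' ↔ pathF m n i p' = some p := by
  rw [pathE_eq_some, pathF_eq_some]
  constructor
  · rintro ⟨q, h1, h2, h3⟩
    refine ⟨q, ?_, ?_, ?_⟩
    · rw [h3, onesRight_update, letters_update_sub p.2 (by omega)]
      simp only
      omega
    · rw [h3, zerosLeft_update, letters_update_sub p.2 (by omega)]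
      simp only
      omega
    · simp [h3]
  · rintro ⟨q, h1, h2, h3⟩
    refine ⟨q, ?_, ?_, ?_⟩
    · rw [h3, zerosLeft_update, letters_update_add p'.2 (by omega)]
      simp only
      omega
    · rw [h3, onesRight_update, letters_update_add p'.2 (by omega)]
      simp only
      omega
    · simp [h3]

end

section
variable {m n : ℤ} {x : ℤ × ℤ} {i : Fin 2} {s s' : ℤˣ} {l : ℤ} {d : ℕ}

/-! ### The words of walls at even positions -/

/-- The spin-1/2 particle with the superscript `s` and the mode `l`; its index `j` is determined. -/
def Hp (s : ℤˣ) (l : ℤ) : Particle := half s (if s = 1 ↔ l % 2 = 0 then 0 else 1) l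

/-- The spin-0 particle with the first superscript `s` and the mode `l`; the second superscript is
determined. -/
def Zp (s : ℤˣ) (l : ℤ) : Particle := zero s (if l % 2 = 0 then -s else s) l

theorem isHalf_Hp : (Hp s l).isHalf = true := rfl
theorem isHalf_Zp : (Zp s l).isHalf = false := rfl
theorem sg_Hp : (Hp s l).sg = s := rfl
theorem sg_Zp : (Zp s l).sg = s := rfl
theorem mode_Hp : (Hp s l).mode = l := rfl
theorem mode_Zp : (Zp s l).mode = l := rfl
theorem db_Hp : (Hp s l).db = 0 := rfl

theorem db_Zp : (Zp s l).db = if l % 2 = 0 then -(s : ℤ) else s := by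
  unfold Zp db
  split_ifs <;> simp

theorem meaningful_Hp (s : ℤˣ) (l : ℤ) : (Hp s l).Meaningful := by
  rw [Hp, Meaningful, neg_one_zpow_eq]
  rcases Int.units_eq_one_or s with rfl | rfl <;> by_cases h : l % 2 = 0 <;> simp [h]

theorem meaningful_Zp (s : ℤˣ) (l : ℤ) : (Zp s l).Meaningful := by
  rw [Zp, Meaningful, neg_one_zpow_eq]
  rcases Int.units_eq_one_or s with rfl | rfl <;> by_cases h : l % 2 = 0 <;> simp [h]

theorem Particle.Meaningful.eq_Hp {A : Particle} (h : A.Meaningful) (hA : A.isHalf = true) :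
    ∃ s, A = Hp s A.mode := by
  cases A with
  | zero => simp [isHalf] at hA
  | half s j l => exact ⟨s, h.ext (meaningful_Hp s l) rfl rfl rfl⟩

theorem Particle.Meaningful.eq_Zp {A : Particle} (h : A.Meaningful) (hA : A.isHalf = false) :
    ∃ s, A = Zp s A.mode := by
  cases A with
  | half => simp [isHalf] at hA
  | zero s t l => exact ⟨s, h.ext (meaningful_Zp s l) rfl rfl rfl⟩

/-- The word of `α` spin-1/2 particles with superscript `s` and `β` spin-0 particles with
superscript `s'`, all of the mode `l`, that act on a domain at the distance `d` from the boundary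
that lies in the direction `-s`. -/
def evenWord (s s' : ℤˣ) (l : ℤ) (d α β : ℕ) : List Particle :=
  if s' = -s ∧ d < β then
    List.replicate (α - (β - d)) (Hp s l) ++
      (List.replicate (β - d) [Zp s' l, Hp s l]).flatten ++ List.replicate d (Zp s' l)
  else List.replicate α (Hp s l) ++ List.replicate β (Zp s' l)

theorem units_ne_neg (s : ℤˣ) : s ≠ -s := by
  rcases Int.units_eq_one_or s with rfl | rfl <;> decide

theorem evenWord_zero_zero : evenWord s s' l d 0 0 = [] := by
  rw [evenWord, if_neg (by simp)]; rfl

theorem evenWord_of_eq {α β : ℕ} (h : s' = s ∨ β ≤ d) :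
    evenWord s s' l d α β = List.replicate α (Hp s l) ++ List.replicate β (Zp s' l) := by
  rw [evenWord, if_neg]
  rintro ⟨h1, h2⟩
  rcases h with h | h
  · exact units_ne_neg s (h.symm.trans h1)
  · omega

theorem evenWord_of_lt {α β : ℕ} (h : s' = -s) (h' : d < β) :
    evenWord s s' l d α β = List.replicate (α - (β - d)) (Hp s l) ++
      (List.replicate (β - d) [Zp s' l, Hp s l]).flatten ++ List.replicate d (Zp s' l) :=
  if_pos ⟨h, h'⟩

theorem eq_or_eq_neg (s s' : ℤˣ) : s' = s ∨ s' = -s := by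
  rcases Int.units_eq_one_or s with rfl | rfl <;> rcases Int.units_eq_one_or s' with rfl | rfl <;>
    simp

theorem evenWord_cons_zero {β : ℕ} (h : s' = s ∨ β + 1 ≤ d) :
    evenWord s s' l d 0 (β + 1) = Zp s' l :: evenWord s s' l d 0 β := by
  rw [evenWord_of_eq h, evenWord_of_eq (h.imp_right (by omega))]
  simp [List.replicate_succ]

theorem evenWord_cons_half {α β : ℕ} (h : s' = s ∨ β ≤ d + α) :
    evenWord s s' l d (α + 1) β = Hp s l :: evenWord s s' l d α β := by
  by_cases h1 : s' = s ∨ β ≤ d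
  · rw [evenWord_of_eq h1, evenWord_of_eq h1, List.replicate_succ, List.cons_append]
  · push Not at h1
    have h2 := (eq_or_eq_neg s s').resolve_left h1.1
    have h3 := h.resolve_left h1.1
    have e : α + 1 - (β - d) = (α - (β - d)) + 1 := by omega
    rw [evenWord_of_lt h2 h1.2, evenWord_of_lt h2 h1.2, e, List.replicate_succ]
    rfl

theorem evenWord_cons_pair {α β : ℕ} (hs : s' = -s) (h : d + α = β) :
    evenWord s s' l d (α + 1) (β + 1) = Zp s' l :: Hp s l :: evenWord s s' l d α β := by
  rw [evenWord_of_lt hs (by omega)]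
  have e1 : α + 1 - (β + 1 - d) = 0 := by omega
  have e2 : β + 1 - d = α + 1 := by omega
  rw [e1, e2, List.replicate_succ]
  by_cases h1 : β ≤ d
  · obtain rfl : α = 0 := by omega
    rw [evenWord_of_eq (Or.inr h1)]
    obtain rfl : β = d := by omega
    simp
  · rw [evenWord_of_lt hs (by omega)]
    have e3 : α - (β - d) = 0 := by omega
    have e4 : β - d = α := by omega
    rw [e3, e4]
    rfl

/-- Induction on the words of walls at even positions, from right to left. -/
theorem evenWord_induction {P : ℕ → ℕ → List Particle → Prop} (s s' : ℤˣ) (l : ℤ) (d : ℕ)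
    (h0 : P 0 0 [])
    (hz : ∀ β, s' = s ∨ β + 1 ≤ d → P 0 β (evenWord s s' l d 0 β) →
      P 0 (β + 1) (Zp s' l :: evenWord s s' l d 0 β))
    (hh : ∀ α β, s' = s ∨ β ≤ d + α → P α β (evenWord s s' l d α β) →
      P (α + 1) β (Hp s l :: evenWord s s' l d α β))
    (hzh : ∀ α β, s' = -s → d + α = β → P α β (evenWord s s' l d α β) →
      P (α + 1) (β + 1) (Zp s' l :: Hp s l :: evenWord s s' l d α β)) (α β : ℕ)
    (h : s' = s ∨ β ≤ d + α) : P α β (evenWord s s' l d α β) := by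
  induction α generalizing β with
  | zero =>
    induction β with
    | zero => rw [evenWord_zero_zero]; exact h0
    | succ β ih =>
      have h : s' = s ∨ β + 1 ≤ d := h
      rw [evenWord_cons_zero h]
      exact hz β h (ih (h.imp_right (by omega)))
  | succ α ih =>
    by_cases h1 : s' = s ∨ β ≤ d + α
    · rw [evenWord_cons_half h1]
      exact hh α β h1 (ih β h1)
    · push Not at h1
      have h2 := h.resolve_left h1.1
      obtain ⟨β, rfl⟩ : ∃ b, β = b + 1 := ⟨β - 1, by omega⟩
      have hs := (eq_or_eq_neg s s').resolve_left h1.1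
      rw [evenWord_cons_pair hs (by omega)]
      exact hzh α β hs (by omega) (ih β (Or.inr (by omega)))

theorem target_evenWord (α β : ℕ) (h : s' = s ∨ β ≤ d + α) :
    target x (evenWord s s' l d α β) =
      (x.1 + s * α + s' * β, x.2 + β * (Zp s' l).db) := by
  refine evenWord_induction (P := fun α β w => target x w =
    (x.1 + s * α + s' * β, x.2 + β * (Zp s' l).db)) s s' l d ?_ ?_ ?_ ?_ α β h
  · simp [target_nil]
  · intro β _ ih
    rw [target_cons, ih, sg_Zp, Prod.mk.injEq]
    push_cast
    constructor <;> ring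
  · intro α β _ ih
    rw [target_cons, ih, sg_Hp, db_Hp, Prod.mk.injEq]
    push_cast
    constructor <;> ring
  · intro α β _ _ ih
    rw [target_cons, target_cons, ih, sg_Hp, db_Hp, sg_Zp, Prod.mk.injEq]
    push_cast
    constructor <;> ring

theorem particleCrystal_ε_Zp : particleCrystal.ε i (Zp s l) = 0 := particleCrystal_ε_zero i _ _ _
theorem particleCrystal_φ_Zp : particleCrystal.φ i (Zp s l) = 0 := particleCrystal_φ_zero i _ _ _

theorem sig_evenWord (α β : ℕ) (h : s' = s ∨ β ≤ d + α) :
    particleCrystal.sig i (evenWord s s' l d α β) =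
      (α * particleCrystal.ε i (Hp s l), α * particleCrystal.φ i (Hp s l)) := by
  have hH : particleCrystal.ε i (Hp s l) = 0 ∨ particleCrystal.φ i (Hp s l) = 0 := by
    rw [Hp, particleCrystal_ε_half, particleCrystal_φ_half]
    split_ifs <;> simp
  refine evenWord_induction (P := fun α β w => particleCrystal.sig i w =
    (α * particleCrystal.ε i (Hp s l), α * particleCrystal.φ i (Hp s l))) s s' l d ?_ ?_ ?_ ?_ α β h
  · simp [CrystalData.sig_nil]
  · intro β _ ih
    rw [CrystalData.sig_cons, ih, particleCrystal_ε_Zp, particleCrystal_φ_Zp, cancel_zero_left]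
  · intro α β _ ih
    rw [CrystalData.sig_cons, ih]
    rcases hH with h | h <;> rw [h] <;> simp [cancel] <;> ring
  · intro α β _ _ ih
    rw [CrystalData.sig_cons, particleCrystal_ε_Zp, particleCrystal_φ_Zp, cancel_zero_left,
      CrystalData.sig_cons, ih]
    rcases hH with h | h <;> rw [h] <;> simp [cancel] <;> ring

/-! ### Appending particles to the words -/

/-- The distance of `a` from the boundary of `[0, N]` in the direction `-s`. -/
def dist (N : ℤ) (s : ℤˣ) (a : ℤ) : ℤ := if s = 1 then a else N - a

theorem target_replicate (A : Particle) (r : ℕ) :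
    target x (List.replicate r A) = (x.1 + r * A.sg, x.2 + r * A.db) := by
  induction r with
  | zero => simp [target_nil]
  | succ r ih =>
    rw [List.replicate_succ, target_cons, ih, Prod.mk.injEq]
    push_cast
    constructor <;> ring

/-- A spin-1/2 particle passes spin-0 particles without a change as long as these do not leave the
range by themselves. -/
theorem meq_replicate_zero_half {r : ℕ} (h0 : 0 ≤ x.1) (h1 : x.1 ≤ m - n)
    (h2 : 0 ≤ x.1 + r * s') (h3 : x.1 + r * s' ≤ m - n) :
    MEq m n x (List.replicate r (Zp s' l) ++ [Hp s l])
      (Hp s l :: List.replicate r (Zp s' l)) := by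
  induction r with
  | zero => exact .refl _
  | succ r ih =>
    push_cast at h2 h3
    have hs := Int.units_eq_one_or s'
    have h4 : 0 ≤ x.1 + r * s' ∧ x.1 + r * s' ≤ m - n := by
      rcases hs with rfl | rfl <;> simp only [Units.val_neg, Units.val_one] at h2 h3 ⊢ <;> omega
    rw [List.replicate_succ, List.cons_append]
    refine ((ih h4.1 h4.2).cons _).trans ?_
    have h5 := MEq.head (m := m) (n := n) (x := x) (v := List.replicate r (Zp s' l))
      (A := Zp s' l) (B := Hp s l) (by simp [isHalf_Hp, isHalf_Zp])
    rw [target_replicate] at h5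
    rcases xch_cases (m - n) (x.1 + r * (Zp s' l).sg) (Zp s' l) (Hp s l) with ⟨-, he⟩ | ⟨hc, -⟩
    · rwa [he] at h5
    · exfalso
      rw [sg_Zp] at hc
      apply hc
      constructor <;> linarith

theorem flatten_replicate_succ' {γ : Type} (L : List γ) (c : ℕ) :
    (List.replicate (c + 1) L).flatten = (List.replicate c L).flatten ++ L := by
  rw [List.replicate_succ', List.flatten_append]; simp

/-- A spin-1/2 particle on the right of the word of a wall is absorbed by exchanges: it passes the
spin-0 particles next to it, and where the boundary is now reached earlier, it forms one more
boundary pair. -/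
theorem meq_evenWord_snoc_half {α β : ℕ} (h0 : 0 ≤ x.1) (h1 : x.1 ≤ m - n)
    (hd : (d : ℤ) = dist (m - n) s x.1) (h : s' = s ∨ β ≤ d + 1 + α)
    (hs : s' = s → 0 ≤ x.1 + β * s ∧ x.1 + β * s ≤ m - n) :
    MEq m n x (evenWord s s' l (d + 1) α β ++ [Hp s l]) (evenWord s s' l d (α + 1) β) := by
  by_cases hb : s' = s ∨ β ≤ d
  · rw [evenWord_of_eq (hb.imp_right (by omega)), evenWord_of_eq hb, List.replicate_succ',
      List.append_assoc, List.append_assoc]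
    refine MEq.append_left _ ?_
    have h2 : 0 ≤ x.1 + β * s' ∧ x.1 + β * s' ≤ m - n := by
      rcases eq_or_eq_neg s s' with rfl | rfl
      · exact hs rfl
      · have hb := hb.resolve_left (units_ne_neg s).symm
        unfold dist at hd
        rcases Int.units_eq_one_or s with rfl | rfl <;> simp at hd ⊢ <;> omega
    exact meq_replicate_zero_half h0 h1 h2.1 h2.2
  · push Not at hb
    have h2 := (eq_or_eq_neg s s').resolve_left hb.1
    have h3 : 0 ≤ x.1 + d * s' ∧ x.1 + d * s' ≤ m - n := by
      subst h2
      unfold dist at hd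
      rcases Int.units_eq_one_or s with rfl | rfl <;> simp at hd ⊢ <;> omega
    have hm := meq_replicate_zero_half (m := m) (n := n) (x := x) (s := s) (s' := s') (l := l)
      (r := d) h0 h1 h3.1 h3.2
    rw [evenWord_of_lt h2 hb.2]
    by_cases hb' : β = d + 1
    · subst hb'
      rw [evenWord_of_eq (Or.inr le_rfl)]
      have e1 : α + 1 - (d + 1 - d) = α := by omega
      have e2 : d + 1 - d = 1 := by omega
      rw [e1, e2, List.append_assoc, List.append_assoc, List.replicate_succ (n := d)]
      exact (hm.cons _).append_left _
    · rw [evenWord_of_lt h2 (by omega)]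
      have h4 := h.resolve_left hb.1
      obtain ⟨c, hc⟩ : ∃ c, β - d = c + 1 := ⟨β - d - 1, by omega⟩
      have e1 : α + 1 - (β - d) = α - (β - (d + 1)) := by omega
      have e2 : β - (d + 1) = c := by omega
      rw [e1, hc, e2, flatten_replicate_succ', List.replicate_succ (n := d)]
      simp only [List.append_assoc]
      exact ((hm.cons _).append_left _).append_left _

theorem evenWord_snoc_zero {d' α β : ℕ} (h : s' = s ∨ d' = d + 1) :
    evenWord s s' l d α β ++ [Zp s' l] = evenWord s s' l d' α (β + 1) := by
  by_cases hb : s' = s ∨ β ≤ d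
  · rw [evenWord_of_eq hb, evenWord_of_eq, List.replicate_succ', List.append_assoc]
    rcases hb with hb | hb
    · exact Or.inl hb
    · exact h.imp_right (by omega)
  · push Not at hb
    have h2 := (eq_or_eq_neg s s').resolve_left hb.1
    obtain rfl := h.resolve_left hb.1
    rw [evenWord_of_lt h2 hb.2, evenWord_of_lt h2 (by omega), List.replicate_succ' (n := d)]
    have e : β + 1 - (d + 1) = β - d := by omega
    rw [e]
    simp only [List.append_assoc]

/-! ### The particles of a wall -/

/-- The particles of the wall at `k` with the domain `y` on its left and `x` on its right. -/
def block (m n k : ℤ) (y x : ℤ × ℤ) : List Particle :=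
  (wallWord m n k y x).flatMap (Elem.particles k)

theorem flatMap_copies {k c : ℤ} {w : Elem} {L : List Particle} (h : w.particles k = L) :
    (copies c w).flatMap (Elem.particles k) = (List.replicate c.toNat L).flatten := by
  rw [copies, List.flatMap_replicate, h]

theorem flatMap_copies_single {k c : ℤ} {w : Elem} {A : Particle} (h : w.particles k = [A]) :
    (copies c w).flatMap (Elem.particles k) = List.replicate c.toNat A := by
  rw [flatMap_copies h, List.flatten_replicate_singleton]

/-- The word of a wall at an even position in terms of the differences of the domains. -/
def evenBlock (N l ay ax B : ℤ) : List Particle :=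
  if ax < B then
    List.replicate ay.toNat (Hp 1 l) ++ (List.replicate (B - ax).toNat [Zp (-1) l, Hp 1 l]).flatten ++
      List.replicate ax.toNat (Zp (-1) l)
  else if N - ax < -B then
    List.replicate (N - ay).toNat (Hp (-1) l) ++
      (List.replicate (-B - (N - ax)).toNat [Zp 1 l, Hp (-1) l]).flatten ++
      List.replicate (N - ax).toNat (Zp 1 l)
  else List.replicate (ay - ax + B).toNat (Hp 1 l) ++ List.replicate (-(ay - ax + B)).toNat (Hp (-1) l) ++
    List.replicate B.toNat (Zp (-1) l) ++ List.replicate (-B).toNat (Zp 1 l)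

/-- The sign with which the difference of the second components enters at the position `-2l`. -/
def sgn (l : ℤ) : ℤ := if l % 2 = 0 then 1 else -1

theorem neg_two_mul_ediv (l : ℤ) : -(-(2 * l) / 2) = l := by omega

theorem block_eq_evenBlock (l : ℤ) (y x : ℤ × ℤ) :
    block m n (-2 * l) y x = evenBlock (m - n) l y.1 x.1 (sgn l * (y.2 - x.2)) := by
  unfold block wallWord evenBlock sgn
  rcases Int.emod_two_eq l with hl | hl
  · have h0 : -2 * l % 4 = 0 := by omega
    have p1 : (Elem.line 1 0).particles (-2 * l) = [Hp 1 l] := by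
      simp [Elem.particles, Hp, hl, neg_two_mul_ediv]
    have p2 : (Elem.line (-1) 1).particles (-2 * l) = [Hp (-1) l] := by
      simp [Elem.particles, Hp, hl, neg_two_mul_ediv]
    have p3 : (Elem.bullet (-1) 1).particles (-2 * l) = [Zp (-1) l] := by
      simp [Elem.particles, Zp, hl, neg_two_mul_ediv]
    have p4 : (Elem.bullet 1 (-1)).particles (-2 * l) = [Zp 1 l] := by
      simp [Elem.particles, Zp, hl, neg_two_mul_ediv]
    have p5 : (Elem.bottom 1 0).particles (-2 * l) = [Zp (-1) l, Hp 1 l] := by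
      simp [Elem.particles, Zp, Hp, hl, neg_two_mul_ediv]
    have p6 : (Elem.top (-1) 1).particles (-2 * l) = [Zp 1 l, Hp (-1) l] := by
      simp [Elem.particles, Zp, Hp, hl, neg_two_mul_ediv]
    have e1 : y.1 + y.2 - x.1 - x.2 = y.1 - x.1 + (y.2 - x.2) := by ring
    have e2 : x.1 + x.2 - y.1 - y.2 = -(y.1 - x.1 + (y.2 - x.2)) := by ring
    have e3 : x.1 + x.2 - y.2 - m + n = -(y.2 - x.2) - (m - n - x.1) := by ring
    have e4 : x.2 - y.2 = -(y.2 - x.2) := by ring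
    simp only [h0, hl, if_true, one_mul, e1, e2, e3, e4]
    split_ifs <;> simp only [List.flatMap_append, flatMap_copies_single p1,
      flatMap_copies_single p2, flatMap_copies_single p3, flatMap_copies_single p4,
      flatMap_copies p5, flatMap_copies p6]
  · have h0 : -2 * l % 4 = 2 := by omega
    have p1 : (Elem.line 1 1).particles (-2 * l) = [Hp 1 l] := by
      simp [Elem.particles, Hp, hl, neg_two_mul_ediv]
    have p2 : (Elem.line (-1) 0).particles (-2 * l) = [Hp (-1) l] := by
      simp [Elem.particles, Hp, hl, neg_two_mul_ediv]
    have p3 : (Elem.bullet (-1) (-1)).particles (-2 * l) = [Zp (-1) l] := by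
      simp [Elem.particles, Zp, hl, neg_two_mul_ediv]
    have p4 : (Elem.bullet 1 1).particles (-2 * l) = [Zp 1 l] := by
      simp [Elem.particles, Zp, hl, neg_two_mul_ediv]
    have p5 : (Elem.bottom (-1) 1).particles (-2 * l) = [Zp (-1) l, Hp 1 l] := by
      simp [Elem.particles, Zp, Hp, hl, neg_two_mul_ediv]
    have p6 : (Elem.top 1 0).particles (-2 * l) = [Zp 1 l, Hp (-1) l] := by
      simp [Elem.particles, Zp, Hp, hl, neg_two_mul_ediv]
    have e1 : x.2 - x.1 - y.2 + y.1 = y.1 - x.1 + -1 * (y.2 - x.2) := by ring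
    have e2 : y.2 - y.1 - x.2 + x.1 = -(y.1 - x.1 + -1 * (y.2 - x.2)) := by ring
    have e3 : y.2 - x.2 + x.1 - m + n = -(-1 * (y.2 - x.2)) - (m - n - x.1) := by ring
    have e4 : x.2 - y.2 = -1 * (y.2 - x.2) := by ring
    have e5 : y.2 - x.2 = - (-1 * (y.2 - x.2)) := by ring
    have h1 : ¬ (1 : ℤ) = 0 := by omega
    have h2 : ¬ (2 : ℤ) = 0 := by omega
    have h3 : ¬ (2 : ℤ) = 1 := by omega
    simp only [h0, hl, h1, h2, h3, if_true, if_false, e1, e2, e3, e4]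
    generalize hB : -1 * (y.2 - x.2) = B
    have e5 : y.2 - x.2 = -B := by omega
    simp only [e5]
    split_ifs <;> simp only [List.flatMap_append, flatMap_copies_single p1,
      flatMap_copies_single p2, flatMap_copies_single p3, flatMap_copies_single p4,
      flatMap_copies p5, flatMap_copies p6]

theorem evenBlock_eq {N ay ax B : ℤ} (s s' : ℤˣ) (α β : ℕ) (h0 : 0 ≤ ax) (h1 : ax ≤ N)
    (h2 : 0 ≤ ay) (h3 : ay ≤ N) (hA : ay - ax + B = s * α) (hB : B = -(s' * β)) :
    evenBlock N l ay ax B = evenWord s s' l (dist N s ax).toNat α β := by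
  unfold evenBlock
  rcases Int.units_eq_one_or s with rfl | rfl <;> rcases Int.units_eq_one_or s' with rfl | rfl <;>
    simp only [Units.val_one, Units.val_neg, one_mul, neg_mul, neg_neg] at hA hB
  · rw [evenWord_of_eq (Or.inl rfl), if_neg (by omega), if_neg (by omega)]
    have e1 : (ay - ax + B).toNat = α := by omega
    have e2 : (-(ay - ax + B)).toNat = 0 := by omega
    have e3 : B.toNat = 0 := by omega
    have e4 : (-B).toNat = β := by omega
    rw [e1, e2, e3, e4]
    simp
  -- here `s' = -s`, and the three cases of `evenBlock` distinguish whether the boundary is reached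
  · have hd : dist N 1 ax = ax := if_pos rfl
    rw [hd]
    split_ifs with c1 c2
    · rw [evenWord_of_lt rfl (by omega)]
      have e1 : α - (β - ax.toNat) = ay.toNat := by omega
      have e2 : β - ax.toNat = (B - ax).toNat := by omega
      rw [e1, e2]
    · omega
    · rw [evenWord_of_eq (Or.inr (by omega))]
      have e1 : (ay - ax + B).toNat = α := by omega
      have e2 : (-(ay - ax + B)).toNat = 0 := by omega
      have e3 : B.toNat = β := by omega
      have e4 : (-B).toNat = 0 := by omega
      rw [e1, e2, e3, e4]
      simp
  · have hd : dist N (-1) ax = N - ax := if_neg (by decide)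
    rw [hd]
    split_ifs with c1 c2
    · omega
    · rw [evenWord_of_lt (by decide) (by omega)]
      have e1 : α - (β - (N - ax).toNat) = (N - ay).toNat := by omega
      have e2 : β - (N - ax).toNat = (-B - (N - ax)).toNat := by omega
      rw [e1, e2]
    · rw [evenWord_of_eq (Or.inr (by omega))]
      have e1 : (ay - ax + B).toNat = 0 := by omega
      have e2 : (-(ay - ax + B)).toNat = α := by omega
      have e3 : B.toNat = 0 := by omega
      have e4 : (-B).toNat = β := by omega
      rw [e1, e2, e3, e4]
      simp
  · rw [evenWord_of_eq (Or.inl rfl), if_neg (by omega), if_neg (by omega)]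
    have e1 : (ay - ax + B).toNat = 0 := by omega
    have e2 : (-(ay - ax + B)).toNat = α := by omega
    have e3 : B.toNat = β := by omega
    have e4 : (-B).toNat = 0 := by omega
    rw [e1, e2, e3, e4]
    simp

theorem exists_sign_mul (a : ℤ) : ∃ (s : ℤˣ) (α : ℕ), a = s * α := by
  rcases le_total 0 a with h | h
  · exact ⟨1, a.toNat, by simp [h]⟩
  · exact ⟨-1, (-a).toNat, by simp [h]⟩

/-- The boundary value `0` or `N` of the first coordinate that lies in the direction `-s`. -/
def bdry (N : ℤ) (s : ℤˣ) : ℤ := if s = 1 then 0 else N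

/-- The word of a wall at an odd position. -/
theorem block_odd (hN : 0 < m - n) (l : ℤ) {y x : ℤ × ℤ} (s : ℤˣ) (D : ℕ)
    (hx : x.1 = bdry (m - n) s) (hy : y.2 - x.2 = D * (Zp s (l - 1)).db) :
    block m n (-2 * l + 1) y x = (List.replicate D [Hp (-s) l, Zp s (l - 1)]).flatten := by
  have q1 : -(-(2 * l) / 2) = l := by omega
  have q2 : -((-(2 * l) + 1 + 1) / 2) = l - 1 := by omega
  have q3 : ¬ (-(2 * l) + 1) % 2 = 0 := by omega
  rw [db_Zp] at hy
  unfold block wallWord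
  unfold bdry at hx
  rcases Int.emod_two_eq l with hl | hl
  · have h0 : (-2 * l + 1) % 4 = 1 := by omega
    have h1 : ¬ (l - 1) % 2 = 0 := by omega
    rw [if_neg (by omega), if_pos h0]
    rcases Int.units_eq_one_or s with rfl | rfl
    · rw [if_pos rfl] at hx
      have p : (Elem.bottom 1 1).particles (-2 * l + 1) = [Hp (-1) l, Zp 1 (l - 1)] := by
        simp [Elem.particles, Zp, Hp, hl, h1, q1, q2, q3]
      rw [if_pos hx, flatMap_copies p]
      congr 2
      rw [if_neg h1] at hy
      simp at hy
      omega
    · rw [if_neg (by decide)] at hx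
      have p : (Elem.top (-1) 0).particles (-2 * l + 1) = [Hp 1 l, Zp (-1) (l - 1)] := by
        simp [Elem.particles, Zp, Hp, hl, h1, q1, q2, q3]
      rw [if_neg (by omega), flatMap_copies p]
      congr 2
      rw [if_neg h1] at hy
      simp at hy
      omega
  · have h0 : (-2 * l + 1) % 4 = 3 := by omega
    have h1 : (l - 1) % 2 = 0 := by omega
    rw [if_neg (by omega), if_neg (by omega), if_neg (by omega)]
    rcases Int.units_eq_one_or s with rfl | rfl
    · rw [if_pos rfl] at hx
      have p : (Elem.bottom (-1) 0).particles (-2 * l + 1) = [Hp (-1) l, Zp 1 (l - 1)] := by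
        simp [Elem.particles, Zp, Hp, hl, h1, q1, q2, q3]
      rw [if_pos hx, flatMap_copies p]
      congr 2
      rw [if_pos h1] at hy
      simp at hy
      omega
    · rw [if_neg (by decide)] at hx
      have p : (Elem.top 1 1).particles (-2 * l + 1) = [Hp 1 l, Zp (-1) (l - 1)] := by
        simp [Elem.particles, Zp, Hp, hl, h1, q1, q2, q3]
      rw [if_neg (by omega), flatMap_copies p]
      congr 2
      rw [if_pos h1] at hy
      simp at hy
      omega

end

section
variable {m n : ℤ} {x : ℤ × ℤ} {i : Fin 2} {s s' : ℤˣ} {l : ℤ} {d : ℕ}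

/-! ### Normal order of the words of domain walls -/

theorem NormalList.nil : NormalList m n x [] :=
  ⟨by simp, by simp⟩

theorem normalList_cons {A : Particle} {v : List Particle} (h : NormalList m n x v)
    (h1 : ∀ B u, v = B :: u → NormPair m n (target x u).1 A B)
    (h2 : ∀ B C u, v = B :: C :: u →
      ¬ (BoundaryPair m n (target x (C :: u)).1 A B ∧ BoundaryPair m n (target x u).1 B C)) :
    NormalList m n x (A :: v) := by
  constructor
  · rintro u w B C hw
    rcases u with _ | ⟨D, u⟩
    · obtain ⟨rfl, rfl⟩ := List.cons.inj hw
      exact h1 _ _ rfl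
    · obtain ⟨rfl, rfl⟩ := List.cons.inj hw
      exact h.1 _ _ _ _ rfl
  · rintro u w B C E hw
    rcases u with _ | ⟨D, u⟩
    · obtain ⟨rfl, rfl⟩ := List.cons.inj hw
      exact h2 _ _ _ rfl
    · obtain ⟨rfl, rfl⟩ := List.cons.inj hw
      exact h.2 _ _ _ _ _ rfl

theorem BoundaryPair.key_eq {a : ℤ} {A B : Particle} (h : BoundaryPair m n a A B) :
    A.key = B.key + 1 := by
  cases A <;> cases B <;> simp [BoundaryPair, key, mode, isHalf] at h ⊢ <;> omega

theorem BoundaryPair.isHalf_ne {a : ℤ} {A B : Particle} (h : BoundaryPair m n a A B) :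
    A.isHalf ≠ B.isHalf := by
  cases A <;> cases B <;> simp [BoundaryPair, isHalf] at h ⊢

theorem normPair_of_key {a : ℤ} {A B : Particle} (h : A.key < B.key ∨ A = B) :
    NormPair m n a A B := by
  rcases h with h | rfl
  · cases A <;> cases B <;> simp [NormPair, key, mode, isHalf] at h ⊢ <;> left <;> omega
  · cases A <;> simp [NormPair]

theorem normalList_cons_of_key {A : Particle} {v : List Particle} (h : NormalList m n x v)
    (hA : ∀ B ∈ v.head?, A.key < B.key ∨ A = B) : NormalList m n x (A :: v) := by
  refine normalList_cons h (fun B u hv => ?_) (fun B C u hv hb => ?_)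
  · exact normPair_of_key (hA B (by simp [hv]))
  · rcases hA B (by simp [hv]) with h1 | h1
    · have := hb.1.key_eq
      omega
    · exact hb.1.isHalf_ne (by rw [h1])

theorem normalList_cons_of_boundaryPair {A B : Particle} {v : List Particle}
    (h : NormalList m n x (B :: v)) (hb : BoundaryPair m n (target x v).1 A B)
    (hB : ∀ C ∈ v.head?, B.key ≤ C.key) : NormalList m n x (A :: B :: v) := by
  refine normalList_cons h (fun C u hv => ?_) (fun C D u hv hc => ?_)
  · obtain ⟨rfl, rfl⟩ := List.cons.inj hv
    cases A <;> cases B <;> first | exact Or.inr hb | exact hb.elim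
  · obtain ⟨rfl, rfl⟩ := List.cons.inj hv
    have := hc.2.key_eq
    have := hB D (by simp)
    omega

theorem key_Hp : (Hp s l).key = 2 * l := by simp [Hp, key, isHalf, mode]
theorem key_Zp : (Zp s l).key = 2 * l + 1 := by simp [Zp, key, isHalf, mode]

theorem boundaryPair_Zp_Hp {a : ℤ} (h : a = bdry (m - n) s) :
    BoundaryPair m n a (Zp (-s) l) (Hp s l) := by
  unfold bdry at h
  refine ⟨rfl, rfl, ?_⟩
  rcases Int.units_eq_one_or s with rfl | rfl <;> simpa using h

theorem boundaryPair_Hp_Zp {a : ℤ} (h : a = bdry (m - n) s) :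
    BoundaryPair m n a (Hp (-s) l) (Zp s (l - 1)) := by
  unfold bdry at h
  refine ⟨rfl, rfl, ?_⟩
  rcases Int.units_eq_one_or s with rfl | rfl <;> simpa using h

theorem dist_add (N : ℤ) (s : ℤˣ) (a t : ℤ) : dist N s (a + s * t) = dist N s a + t := by
  unfold dist
  rcases Int.units_eq_one_or s with rfl | rfl <;> simp <;> ring

theorem dist_nonneg {N : ℤ} {a : ℤ} (h0 : 0 ≤ a) (h1 : a ≤ N) : 0 ≤ dist N s a := by
  unfold dist; split_ifs <;> omega

theorem dist_eq_zero_iff {N a : ℤ} : dist N s a = 0 ↔ a = bdry N s := by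
  unfold dist bdry; split_ifs <;> omega

theorem inRange_iff_dist {y : ℤ × ℤ} (s : ℤˣ) : InRange m n y ↔
    0 ≤ dist (m - n) s y.1 ∧ dist (m - n) s y.1 ≤ m - n ∧ 0 ≤ y.2 ∧ y.2 ≤ n := by
  unfold InRange dist
  split_ifs <;> constructor <;> rintro ⟨h1, h2, h3, h4⟩ <;> refine ⟨?_, ?_, h3, h4⟩ <;> omega

theorem db_Zp_eq (s : ℤˣ) (l : ℤ) : (Zp s l).db = 1 ∨ (Zp s l).db = -1 := by
  rw [db_Zp]
  rcases Int.units_eq_one_or s with rfl | rfl <;> split_ifs <;> simp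

/-- Smaller words of the same kind lead to domains in the range. -/
theorem inRange_of_le {α β α' β' : ℕ} (hx : InRange m n x)
    (h : InRange m n (x.1 + s * α + s' * β, x.2 + β * (Zp s' l).db)) (h1 : α' ≤ α) (h2 : β' ≤ β)
    (hd : (d : ℤ) = dist (m - n) s x.1)
    (hc : s' = s ∨ β' ≤ d + α' ∧ (α' + β ≤ α + β' ∨ α' ≤ β')) :
    InRange m n (x.1 + s * α' + s' * β', x.2 + β' * (Zp s' l).db) := by
  have hb : ∀ p q : ℤ, x.1 + s * p + s' * q = x.1 + s * (p + (s * s' : ℤˣ) * q) := by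
    intro p q
    rcases Int.units_eq_one_or s with rfl | rfl <;> simp <;> ring
  rw [inRange_iff_dist s] at h hx ⊢
  simp only [hb, dist_add] at h ⊢
  rcases eq_or_eq_neg s s' with rfl | rfl
  · have : ((s' * s' : ℤˣ) : ℤ) = 1 := by simp
    rw [this] at h ⊢
    rcases db_Zp_eq s' l with h3 | h3 <;> rw [h3] at h ⊢ <;> omega
  · have : ((s * -s : ℤˣ) : ℤ) = -1 := by simp
    rw [this] at h ⊢
    have hc := hc.resolve_left (units_ne_neg s).symm
    rcases db_Zp_eq (-s) l with h3 | h3 <;> rw [h3] at h ⊢ <;> omega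

/-- Prepending the word of a wall at an even position. -/
theorem normalList_evenWord {v : List Particle} {α β : ℕ} {y : ℤ × ℤ} (hN : 0 < m - n)
    (hd : (d : ℤ) = dist (m - n) s x.1) (hy : target y v = x)
    (hv : Valid m n (y, v)) (hn : NormalList m n y v) (hl : ∀ C ∈ v.head?, 2 * l + 1 < C.key)
    (h : s' = s ∨ β ≤ d + α)
    (hr : InRange m n (x.1 + s * α + s' * β, x.2 + β * (Zp s' l).db)) :
    Valid m n (y, evenWord s s' l d α β ++ v) ∧
    NormalList m n y (evenWord s s' l d α β ++ v) ∧
    (∀ C ∈ (evenWord s s' l d α β ++ v).head?,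
      2 * l + 1 < C.key ∨ C = Zp s' l ∨ (0 < α ∧ C = Hp s l)) := by
  have hx : InRange m n x := hy ▸ hv.inRange_target
  -- besides normal order, the induction keeps track of the first particle
  refine evenWord_induction (P := fun α β w =>
    InRange m n (x.1 + s * α + s' * β, x.2 + β * (Zp s' l).db) →
    Valid m n (y, w ++ v) ∧ NormalList m n y (w ++ v) ∧
    (∀ C ∈ (w ++ v).head?, 2 * l + 1 < C.key ∨ C = Zp s' l ∨ (0 < α ∧ C = Hp s l)))
    s s' l d ?_ ?_ ?_ ?_ α β h hr
  · exact fun _ => ⟨hv, hn, fun C hC => Or.inl (hl C hC)⟩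
  · intro β hc ih hr
    obtain ⟨h1, h2, h3⟩ := ih (inRange_of_le hx hr le_rfl (by omega) hd
      (hc.imp_right fun _ => by omega))
    refine ⟨valid_cons.2 ⟨meaningful_Zp _ _, ?_, h1⟩, normalList_cons_of_key h2 ?_, by simp⟩
    · have := target_evenWord (x := x) (l := l) (d := d) 0 (β + 1) hc
      rw [← this, evenWord_cons_zero hc, ← hy, ← target_append] at hr
      exact hr
    · intro C hC
      rcases h3 C hC with h4 | rfl | h4
      · exact Or.inl (by rw [key_Zp]; exact h4)
      · exact Or.inr rfl
      · omega
  · intro α β hc ih hr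
    obtain ⟨h1, h2, h3⟩ := ih (inRange_of_le hx hr (by omega) le_rfl hd
      (hc.imp_right fun _ => by omega))
    refine ⟨valid_cons.2 ⟨meaningful_Hp _ _, ?_, h1⟩, normalList_cons_of_key h2 ?_, by simp⟩
    · have := target_evenWord (x := x) (l := l) (d := d) (α + 1) β (hc.imp_right (by omega))
      rw [← this, evenWord_cons_half hc, ← hy, ← target_append] at hr
      exact hr
    · intro C hC
      rcases h3 C hC with h4 | rfl | ⟨-, rfl⟩
      · exact Or.inl (by rw [key_Hp]; omega)
      · exact Or.inl (by rw [key_Hp, key_Zp]; omega)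
      · exact Or.inr rfl
  · intro α β hs hc ih hr
    obtain ⟨h1, h2, h3⟩ := ih (inRange_of_le hx hr (by omega) (by omega) hd
      (Or.inr (by omega)))
    subst hs
    have ht := target_evenWord (x := x) (l := l) (d := d) α β (s := s) (s' := -s)
      (Or.inr (by omega))
    have hd0 := dist_nonneg (s := s) hx.1 hx.2.1
    -- the word without the leftmost pair leads exactly to the boundary
    have htd : dist (m - n) s (target x (evenWord s (-s) l d α β)).1 = 0 := by
      rw [ht]
      have : x.1 + s * α + ((-s : ℤˣ) : ℤ) * β = x.1 + s * ((α : ℤ) - β) := by push_cast; ring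
      rw [this, dist_add]
      omega
    have hr' := h1.inRange_target
    rw [target_append, hy] at hr'
    have h4 : Valid m n (y, Hp s l ::
        (evenWord s (-s) l d α β ++ v)) := by
      refine valid_cons.2 ⟨meaningful_Hp _ _, ?_, h1⟩
      rw [target_cons, target_append, hy]
      rw [inRange_iff_dist s] at hr' ⊢
      have e : ∀ a, dist (m - n) s (a + s) = dist (m - n) s a + 1 := fun a => by
        have := dist_add (m - n) s a 1
        rwa [mul_one] at this
      rw [sg_Hp, db_Hp, add_zero]
      simp only [e, htd] at hr' ⊢
      omega
    refine ⟨valid_cons.2 ⟨meaningful_Zp _ _, ?_, h4⟩, normalList_cons_of_boundaryPair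
      (normalList_cons_of_key h2 ?_) ?_ ?_, by simp⟩
    · have := target_evenWord (x := x) (l := l) (d := d) (α + 1) (β + 1) (s := s) (s' := -s) (Or.inr (by omega))
      rw [← this, evenWord_cons_pair rfl hc, ← hy, ← target_append] at hr
      exact hr
    · intro C hC
      rcases h3 C hC with h4 | rfl | ⟨-, rfl⟩
      · exact Or.inl (by rw [key_Hp]; omega)
      · exact Or.inl (by rw [key_Hp, key_Zp]; omega)
      · exact Or.inr rfl
    · refine boundaryPair_Zp_Hp ?_
      rw [← dist_eq_zero_iff, ← htd, ← hy, ← target_append]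
      rfl
    · intro C hC
      rcases h3 C hC with h4 | rfl | ⟨-, rfl⟩
      · rw [key_Hp]; omega
      · rw [key_Hp, key_Zp]; omega
      · rfl

/-- Prepending the word of a wall at an odd position. -/
theorem normalList_oddWord {v : List Particle} {D : ℕ} {y : ℤ × ℤ} (hN : 0 < m - n)
    (hx : x.1 = bdry (m - n) s) (hy : target y v = x) (hv : Valid m n (y, v))
    (hn : NormalList m n y v) (hl : ∀ C ∈ v.head?, 2 * l ≤ C.key)
    (hr : InRange m n (x.1, x.2 + D * (Zp s (l - 1)).db)) :
    target y ((List.replicate D [Hp (-s) l, Zp s (l - 1)]).flatten ++ v) =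
      (x.1, x.2 + D * (Zp s (l - 1)).db) ∧
    Valid m n (y, (List.replicate D [Hp (-s) l, Zp s (l - 1)]).flatten ++ v) ∧
    NormalList m n y ((List.replicate D [Hp (-s) l, Zp s (l - 1)]).flatten ++ v) ∧
    (∀ C ∈ ((List.replicate D [Hp (-s) l, Zp s (l - 1)]).flatten ++ v).head?, 2 * l ≤ C.key) := by
  have hx' : InRange m n x := hy ▸ hv.inRange_target
  induction D with
  | zero => exact ⟨by simp [hy], hv, hn, hl⟩
  | succ D ih =>
    have hr1 : InRange m n (x.1, x.2 + D * (Zp s (l - 1)).db) := by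
      unfold InRange at *
      rcases db_Zp_eq s (l - 1) with h3 | h3 <;> rw [h3] at hr ⊢ <;> push_cast at hr <;>
        simp only at * <;> omega
    obtain ⟨h0, h1, h2, h3⟩ := ih hr1
    have e : (List.replicate (D + 1) [Hp (-s) l, Zp s (l - 1)]).flatten ++ v =
        Hp (-s) l :: Zp s (l - 1) ::
          ((List.replicate D [Hp (-s) l, Zp s (l - 1)]).flatten ++ v) := by
      simp [List.replicate_succ]
    have ht : target y (Hp (-s) l :: Zp s (l - 1) ::
        ((List.replicate D [Hp (-s) l, Zp s (l - 1)]).flatten ++ v)) =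
        (x.1, x.2 + (D + 1 : ℕ) * (Zp s (l - 1)).db) := by
      rw [target_cons, target_cons, h0, sg_Hp, sg_Zp, db_Hp, Prod.mk.injEq]
      push_cast
      constructor <;> ring
    rw [e]
    refine ⟨ht, valid_cons.2 ⟨meaningful_Hp _ _, by rwa [ht], valid_cons.2
      ⟨meaningful_Zp _ _, ?_, h1⟩⟩, normalList_cons_of_boundaryPair
      (normalList_cons_of_key h2 fun C hC => ?_) ?_ fun C hC => ?_, by simp [key_Hp]⟩
    · have e2 : x.2 + D * (Zp s (l - 1)).db + (Zp s (l - 1)).db =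
          x.2 + (D + 1 : ℕ) * (Zp s (l - 1)).db := by push_cast; ring
      rw [target_cons, h0, sg_Zp, e2, hx]
      have hr' := hr.2.2
      unfold InRange bdry
      rcases Int.units_eq_one_or s with rfl | rfl
      · exact ⟨by simp, by simp; omega, hr'⟩
      · exact ⟨by simp; omega, by simp, hr'⟩
    · have := h3 C hC
      rw [key_Zp]
      omega
    · rw [h0]
      exact boundaryPair_Hp_Zp hx
    · have := h3 C hC
      rw [key_Zp]
      omega

/-! ### The words of sequences of domains -/

/-- The parameters of the word of a wall at an even position; the superscript of an empty group of
spin-1/2 particles may be prescribed. -/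
theorem exists_evenWord_of_sign (hx : InRange m n x) {y : ℤ × ℤ} (hy : InRange m n y) (l : ℤ)
    (t : ℤˣ) : ∃ (s s' : ℤˣ) (d α β : ℕ), (d : ℤ) = dist (m - n) s x.1 ∧ (s' = s ∨ β ≤ d + α) ∧
      y = (x.1 + s * α + s' * β, x.2 + β * (Zp s' l).db) ∧
      block m n (-2 * l) y x = evenWord s s' l d α β ∧ (α = 0 → s = t) := by
  obtain ⟨s, α, hα, ht⟩ : ∃ (s : ℤˣ) (α : ℕ),
      y.1 - x.1 + sgn l * (y.2 - x.2) = s * α ∧ (α = 0 → s = t) := by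
    obtain ⟨s, α, hα⟩ := exists_sign_mul (y.1 - x.1 + sgn l * (y.2 - x.2))
    rcases Nat.eq_zero_or_pos α with rfl | h
    · exact ⟨t, 0, by simpa using hα, fun _ => rfl⟩
    · exact ⟨s, α, hα, fun h' => by omega⟩
  obtain ⟨s', β, hβ⟩ := exists_sign_mul (-(sgn l * (y.2 - x.2)))
  have hd := dist_nonneg (s := s) hx.1 hx.2.1
  have e1 : y.1 = x.1 + s * α + s' * β := by linarith
  have e2 : y.2 = x.2 + β * (Zp s' l).db := by
    rw [db_Zp]
    unfold sgn at hβ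
    split_ifs at hβ ⊢ <;> linarith
  refine ⟨s, s', (dist (m - n) s x.1).toNat, α, β, by omega, ?_, Prod.ext e1 e2, ?_, ht⟩
  · refine (eq_or_eq_neg s s').imp_right fun h => ?_
    have h1 := dist_nonneg (s := s) hy.1 hy.2.1
    have h2 : y.1 = x.1 + s * ((α : ℤ) - β) := by
      rw [e1, h]; push_cast; ring
    rw [h2, dist_add] at h1
    omega
  · rw [block_eq_evenBlock, evenBlock_eq s s' α β hx.1 hx.2.1 hy.1 hy.2.1 hα (by linarith)]

theorem exists_evenWord (hx : InRange m n x) {y : ℤ × ℤ} (hy : InRange m n y) (l : ℤ) :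
    ∃ (s s' : ℤˣ) (d α β : ℕ), (d : ℤ) = dist (m - n) s x.1 ∧ (s' = s ∨ β ≤ d + α) ∧
      y = (x.1 + s * α + s' * β, x.2 + β * (Zp s' l).db) ∧
      block m n (-2 * l) y x = evenWord s s' l d α β := by
  obtain ⟨s, s', d, α, β, h1, h2, h3, h4, -⟩ := exists_evenWord_of_sign hx hy l 1
  exact ⟨s, s', d, α, β, h1, h2, h3, h4⟩

theorem exists_oddWord (h : 0 < m - n) {y : ℤ × ℤ} (l : ℤ)
    (hw : WallAllowed m n (-2 * l + 1) y x) :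
    ∃ (s : ℤˣ) (D : ℕ), x.1 = bdry (m - n) s ∧ y = (x.1, x.2 + D * (Zp s (l - 1)).db) ∧
      block m n (-2 * l + 1) y x = (List.replicate D [Hp (-s) l, Zp s (l - 1)]).flatten := by
  have key : ∃ (s : ℤˣ) (D : ℕ), x.1 = bdry (m - n) s ∧
      y = (x.1, x.2 + D * (Zp s (l - 1)).db) := by
    unfold WallAllowed at hw
    rcases hw with h1 | ⟨h1, ⟨h2, h3, h4⟩ | ⟨h2, h3, h4⟩⟩ | ⟨h1, ⟨h2, h3, h4⟩ | ⟨h2, h3, h4⟩⟩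
    · omega
    · refine ⟨1, (y.2 - x.2).toNat, by simp [bdry, h3], Prod.ext (by simp [h2, h3]) ?_⟩
      rw [db_Zp, if_neg (by omega)]
      simp
      omega
    · refine ⟨-1, (x.2 - y.2).toNat, by simp [bdry, h3], Prod.ext (by simp [h2, h3]) ?_⟩
      rw [db_Zp, if_neg (by omega)]
      simp
      omega
    · refine ⟨1, (x.2 - y.2).toNat, by simp [bdry, h3], Prod.ext (by simp [h2, h3]) ?_⟩
      rw [db_Zp, if_pos (by omega)]
      simp
      omega
    · refine ⟨-1, (y.2 - x.2).toNat, by simp [bdry, h3], Prod.ext (by simp [h2, h3]) ?_⟩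
      rw [db_Zp, if_pos (by omega)]
      simp
      omega
  obtain ⟨s, D, h1, h2⟩ := key
  exact ⟨s, D, h1, h2, block_odd h l s D h1 (by rw [h2]; ring)⟩

theorem block_self (hx : InRange m n x) (k : ℤ) : block m n k x x = [] := by
  obtain ⟨h1, h2, -, -⟩ := hx
  unfold block wallWord
  split_ifs <;> first | omega | simp [copies]

/-- The particles of the walls at `J`, …, `J + r - 1`. -/
def blocks (m n : ℤ) (d : ℤ → ℤ × ℤ) (J : ℤ) : ℕ → List Particle
  | 0 => []
  | r + 1 => block m n (J + r) (d (J + r + 1)) (d (J + r)) ++ blocks m n d J r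

/-- The words of successive walls act as they should, and they form a normally ordered product. -/
theorem blocks_spec (hN : 0 < m - n) {d : ℤ → ℤ × ℤ} (hd : IsDomainSeq m n d) (J : ℤ) (r : ℕ) :
    target (d J) (blocks m n d J r) = d (J + r) ∧ Valid m n (d J, blocks m n d J r) ∧
    NormalList m n (d J) (blocks m n d J r) ∧
    ∀ C ∈ (blocks m n d J r).head?, -2 * ((J + r - 1) / 2) ≤ C.key := by
  induction r with
  | zero => exact ⟨by simp [blocks, target_nil], valid_nil.2 (hd.inRange J), .nil, by simp [blocks]⟩
  | succ r ih =>
    obtain ⟨h0, h1, h2, h3⟩ := ih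
    rw [blocks]
    have e : J + (r + 1 : ℕ) = J + r + 1 := by push_cast; ring
    rw [e]
    generalize hv : blocks m n d J r = v at *
    generalize J + (r : ℤ) = K at *
    have e2 : K + 1 - 1 = K := by ring
    rw [e2]
    rcases Int.emod_two_eq K with hK | hK
    · obtain ⟨l, rfl⟩ : ∃ l, K = -2 * l := ⟨-K / 2, by omega⟩
      obtain ⟨s, s', e, α, β, g1, g2, g3, g4⟩ := exists_evenWord (hd.inRange (-2 * l))
        (hd.inRange (-2 * l + 1)) l
      have hr := hd.inRange (-2 * l + 1)
      rw [g3] at hr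
      obtain ⟨k1, k2, k3⟩ := normalList_evenWord hN g1 h0 h1 h2
        (fun C hC => by have := h3 C hC; omega) g2 hr
      rw [g4]
      refine ⟨?_, k1, k2, fun C hC => ?_⟩
      · rw [target_append, h0, target_evenWord _ _ g2, g3]
      · rcases k3 C hC with h | rfl | ⟨-, rfl⟩
        · omega
        · rw [key_Zp]; omega
        · rw [key_Hp]; omega
    · by_cases hw : d (K + 1) = d K
      · rw [hw, block_self (hd.inRange K), List.nil_append]
        exact ⟨h0, h1, h2, fun C hC => by have := h3 C hC; omega⟩
      · have hw' := hd.allowed K hw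
        obtain ⟨l, rfl⟩ : ∃ l, K = -2 * l + 1 := ⟨-(K / 2), by omega⟩
        obtain ⟨s, D, g1, g2, g3⟩ := exists_oddWord hN l hw'
        have hr := hd.inRange (-2 * l + 1 + 1)
        rw [g2] at hr
        obtain ⟨k0, k1, k2, k3⟩ := normalList_oddWord hN g1 h0 h1 h2
          (fun C hC => by have := h3 C hC; omega) hr
        rw [g3]
        exact ⟨by rw [k0, g2], k1, k2, fun C hC => by have := k3 C hC; omega⟩

theorem eq_of_no_walls {d : ℤ → ℤ × ℤ} {J K : ℤ} (h : J ≤ K)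
    (hd : ∀ k, J ≤ k → k < K → d (k + 1) = d k) : d K = d J := by
  induction K, h using Int.leInduction with
  | base => rfl
  | succ K h ih => rw [hd K h (by omega), ih fun k h1 h2 => hd k h1 (by omega)]

/-- Positions without a wall have the empty word, so the walls may be replaced by an interval of
positions that contains them. -/
theorem toState_eq_blocks (d : DomainSeq m n) {J : ℤ} {r : ℕ} (hJ : J ≤ 0)
    (h : ∀ k ∈ walls d.1, J ≤ k ∧ k < J + r) : toState d = (d.1 J, blocks m n d.1 J r) := by
  -- the statement for any set `F` of positions that contains the walls, by induction on the
  -- interval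
  have key : ∀ (r : ℕ) (F : Finset ℤ), (∀ k ∈ F, J ≤ k ∧ k < J + r) →
      (∀ k, J ≤ k → k < J + r → k ∉ F → d.1 (k + 1) = d.1 k) →
      ((F.sort (· ≥ ·)).flatMap fun k => block m n k (d.1 (k + 1)) (d.1 k)) =
        blocks m n d.1 J r := by
    intro r
    induction r with
    | zero =>
      intro F h1 _
      have : F = ∅ := Finset.eq_empty_of_forall_notMem fun k hk => by
        have := h1 k hk
        push_cast at this
        omega
      rw [this, Finset.sort_empty]
      rfl
    | succ r ih =>
      intro F h1 h2
      rw [blocks]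
      by_cases hF : J + r ∈ F
      · have e := Finset.sort_insert (r := (· ≥ ·)) (a := J + r) (s := F.erase (J + r))
          (fun b hb => by
            have := h1 b (Finset.mem_of_mem_erase hb)
            push_cast at this
            show b ≤ J + r
            omega) (Finset.notMem_erase _ _)
        rw [Finset.insert_erase hF] at e
        rw [e, List.flatMap_cons, ih]
        · intro k hk
          have g1 := h1 k (Finset.mem_of_mem_erase hk)
          have g2 := Finset.ne_of_mem_erase hk
          push_cast at g1
          omega
        · intro k g1 g2 g3
          refine h2 k g1 (by push_cast; omega) fun g4 => g3 (Finset.mem_erase.2 ⟨by omega, g4⟩)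
      · rw [h2 _ (by omega) (by push_cast; omega) hF, block_self (d.2.inRange _), List.nil_append]
        refine ih F (fun k hk => ?_) fun k g1 g2 g3 => h2 k g1 (by push_cast; omega) g3
        have g1 := h1 k hk
        have g2 : k ≠ J + r := fun h => hF (h ▸ hk)
        push_cast at g1
        omega
  unfold toState
  congr 1
  · unfold rightDomain
    refine eq_of_no_walls (Finset.le_min' _ _ _ fun k hk => ?_) fun k h1 h2 => ?_
    · rcases Finset.mem_insert.1 hk with rfl | hk
      · exact hJ
      · exact (h k (d.2.finite.mem_toFinset.1 hk)).1
    · by_contra hc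
      have := Finset.min'_le (insert 0 d.2.finite.toFinset) k
        (Finset.mem_insert_of_mem (d.2.finite.mem_toFinset.2 (show k ∈ walls d.1 from hc)))
      omega
  · refine key r _ (fun k hk => h k (d.2.finite.mem_toFinset.1 hk)) fun k _ _ h3 => ?_
    by_contra hc
    exact h3 (d.2.finite.mem_toFinset.2 hc)

theorem exists_bounds (d : DomainSeq m n) :
    ∃ (J : ℤ) (r : ℕ), J ≤ 0 ∧ ∀ k ∈ walls d.1, J ≤ k ∧ k < J + r := by
  obtain ⟨A, hA⟩ := d.2.finite.bddBelow
  obtain ⟨B, hB⟩ := d.2.finite.bddAbove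
  refine ⟨min A 0, (B + 1 - min A 0).toNat, min_le_right _ _, fun k hk => ?_⟩
  have h1 := hA hk
  have h2 := hB hk
  omega

theorem toState_spec (hN : 0 < m - n) (d : DomainSeq m n) :
    Valid m n (toState d) ∧ NormalList m n (toState d).1 (toState d).2 := by
  obtain ⟨J, r, hJ, h⟩ := exists_bounds d
  rw [toState_eq_blocks d hJ h]
  obtain ⟨-, h1, h2, -⟩ := blocks_spec hN d.2 J r
  exact ⟨h1, h2⟩

end

section
variable {m n : ℤ} {x : ℤ × ℤ} {i : Fin 2} {s s' : ℤˣ} {l : ℤ} {d : ℕ}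

/-! ### Recovering a path from its particles -/

/-- The linear part of the ground state path as a function of the domain. -/
def lin (q : ℤ) (v : ℤ × ℤ) : ℤ := if q % 2 = 1 then -v.2 else if q % 4 = 0 then v.1 + v.2 else
  v.2 - v.1

theorem ground_sub (q : ℤ) (y : ℤ × ℤ) :
    ground m n q y - ground m n q x = lin q y - lin q x := by
  unfold ground lin
  split_ifs <;> ring

/-- The contribution of a particle to the value of the path at `q`. -/
def contrib (q : ℤ) (A : Particle) : ℤ := if -2 * A.mode < q then lin q (A.sg, A.db) else 0

theorem sum_contrib_evenWord (q : ℤ) {α β : ℕ} (h : s' = s ∨ β ≤ d + α) :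
    ((evenWord s s' l d α β).map (contrib q)).sum =
      α * contrib q (Hp s l) + β * contrib q (Zp s' l) := by
  refine evenWord_induction (P := fun α β w => (w.map (contrib q)).sum =
    α * contrib q (Hp s l) + β * contrib q (Zp s' l)) s s' l d ?_ ?_ ?_ ?_ α β h
  · simp
  · intro β _ ih
    rw [List.map_cons, List.sum_cons, ih]; push_cast; ring
  · intro α β _ ih
    rw [List.map_cons, List.sum_cons, ih]; push_cast; ring
  · intro α β _ _ ih
    rw [List.map_cons, List.sum_cons, List.map_cons, List.sum_cons, ih]; push_cast; ring

theorem sum_contrib_block (hN : 0 < m - n) (hx : InRange m n x) {y : ℤ × ℤ} (hy : InRange m n y)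
    (k : ℤ) (hw : y ≠ x → WallAllowed m n k y x) (q : ℤ) :
    ((block m n k y x).map (contrib q)).sum = if k < q then lin q y - lin q x else 0 := by
  rcases Int.emod_two_eq k with hk | hk
  · obtain ⟨l, rfl⟩ : ∃ l, k = -2 * l := ⟨-k / 2, by omega⟩
    obtain ⟨s, s', d, α, β, -, h2, h3, h4⟩ := exists_evenWord hx hy l
    rw [h4, sum_contrib_evenWord q h2, contrib, contrib, mode_Hp, mode_Zp]
    split_ifs
    · rw [h3, sg_Hp, db_Hp, sg_Zp]
      unfold lin
      split_ifs <;> simp only <;> ring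
    · ring
  · by_cases hyx : y = x
    · rw [hyx, block_self hx]
      simp
    · obtain ⟨l, rfl⟩ : ∃ l, k = -2 * l + 1 := ⟨-(k / 2), by omega⟩
      obtain ⟨s, D, h1, h2, h3⟩ := exists_oddWord hN l (hw hyx)
      rw [h3]
      have e : ((List.replicate D [Hp (-s) l, Zp s (l - 1)]).flatten.map (contrib q)).sum =
          D * (contrib q (Hp (-s) l) + contrib q (Zp s (l - 1))) := by
        rw [List.map_flatten, List.sum_flatten]
        simp
      rw [e, contrib, contrib, mode_Hp, mode_Zp, h2, sg_Hp, db_Hp, sg_Zp, db_Zp]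
      unfold lin
      rcases Int.units_eq_one_or s with rfl | rfl <;> split_ifs <;> first | omega | (simp; try ring)

theorem sum_contrib_blocks (hN : 0 < m - n) {d : ℤ → ℤ × ℤ} (hd : IsDomainSeq m n d) {J q : ℤ}
    (hq : J ≤ q) (r : ℕ) : ((blocks m n d J r).map (contrib q)).sum =
      lin q (d (min q (J + r))) - lin q (d J) := by
  induction r with
  | zero => simp [blocks, hq]
  | succ r ih =>
    rw [blocks, List.map_append, List.sum_append, ih, sum_contrib_block hN (hd.inRange _)
      (hd.inRange _) _ (hd.allowed _)]
    split_ifs with h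
    · have e1 : min q (J + r) = J + r := by omega
      have e2 : min q (J + (r + 1 : ℕ)) = J + r + 1 := by push_cast; omega
      rw [e1, e2]
      ring
    · have e1 : min q (J + r) = q := by omega
      have e2 : min q (J + (r + 1 : ℕ)) = q := by push_cast; omega
      rw [e1, e2]
      ring

/-- The value of the path at `q` is that of the initial ground state, changed by the contributions
of the particles with a position on the right of `q`. The two particles of a boundary pair count at
the even positions next to it, which gives the same sums. -/
theorem ground_eq_toState (hN : 0 < m - n) (d : DomainSeq m n) (q : ℤ) :
    ground m n q (d.1 q) =
      ground m n q (toState d).1 + ((toState d).2.map (contrib q)).sum := by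
  obtain ⟨J, r, hJ, h⟩ := exists_bounds d
  have h' : ∀ k ∈ walls d.1, min J q ≤ k ∧ k < min J q + ((max (J + r) q - min J q).toNat : ℤ) :=
    fun k hk => by
      have := h k hk
      omega
  rw [toState_eq_blocks d (by omega) h', sum_contrib_blocks hN d.2 (min_le_right _ _)]
  have e : min q (min J q + ((max (J + r) q - min J q).toNat : ℤ)) = q := by omega
  rw [e, ← ground_sub (m := m) (n := n)]
  ring

/-- By `ground_eq_toState` the particles determine the path, and hence the domains. -/
theorem toState_injective (h : 0 < n ∧ n < m) : Function.Injective (toState (m := m) (n := n)) := by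
  intro d d' hd
  apply (pathEquivDomains h).symm.injective
  refine Subtype.ext (funext fun q => ?_)
  show ground m n q (d.1 q) = ground m n q (d'.1 q)
  rw [ground_eq_toState (by omega), ground_eq_toState (by omega), hd]

/-! ### Every normally ordered product comes from a sequence of domains -/

theorem mode_evenWord {α β : ℕ} {A : Particle} (hA : A ∈ evenWord s s' l d α β) : A.mode = l := by
  unfold evenWord at hA
  split_ifs at hA <;>
    simp only [List.mem_append, List.mem_replicate, List.mem_flatten] at hA
  · rcases hA with (⟨-, rfl⟩ | ⟨L, ⟨-, rfl⟩, hA⟩) | ⟨-, rfl⟩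
    · rfl
    · simp only [List.mem_cons, List.not_mem_nil, or_false] at hA
      rcases hA with rfl | rfl <;> rfl
    · rfl
  · rcases hA with ⟨-, rfl⟩ | ⟨-, rfl⟩ <;> rfl

/-- The position of a wall is bounded by the mode of the first particle. -/
theorem top_blocks (hN : 0 < m - n) {d : ℤ → ℤ × ℤ} (hd : IsDomainSeq m n d) (J : ℤ) (r : ℕ)
    {k : ℤ} (hJ : J ≤ k) (hr : k < J + r) (hk : k ∈ walls d) :
    ∃ C w, blocks m n d J r = C :: w ∧ k ≤ -2 * C.mode + 1 ∧
      (k = -2 * C.mode + 1 → C.isHalf = true ∧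
        ∃ B u, w = B :: u ∧ BoundaryPair m n (target (d J) u).1 C B) := by
  induction r with
  | zero => push_cast at hr; omega
  | succ r ih =>
    rw [blocks]
    push_cast at hr
    obtain ⟨h0, -⟩ := blocks_spec hN hd J r
    by_cases hw : d (J + r + 1) = d (J + r)
    · rw [hw, block_self (hd.inRange _), List.nil_append]
      refine ih ?_
      by_contra hc
      have : k = J + r := by omega
      subst this
      exact hk hw
    · have hw' := hd.allowed _ hw
      have hr : k ≤ J + r := by omega
      clear ih
      generalize blocks m n d J r = v at *
      generalize J + (r : ℤ) = K at *
      rcases Int.emod_two_eq K with hK | hK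
      · obtain ⟨l, rfl⟩ : ∃ l, K = -2 * l := ⟨-K / 2, by omega⟩
        obtain ⟨s, s', e, α, β, g1, g2, g3, g4⟩ := exists_evenWord (hd.inRange (-2 * l))
          (hd.inRange (-2 * l + 1)) l
        rw [g4]
        have hm := fun A => mode_evenWord (s := s) (s' := s') (l := l) (d := e) (α := α) (β := β)
          (A := A)
        have ht := target_evenWord (x := d (-2 * l)) (l := l) _ _ g2
        rcases hE : evenWord s s' l e α β with _ | ⟨A, E⟩
        · rw [hE, target_nil, ← g3] at ht
          exact absurd ht.symm hw
        · have := hm A (by rw [hE]; simp)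
          exact ⟨A, E ++ v, rfl, by omega, fun h => by omega⟩
      · obtain ⟨l, rfl⟩ : ∃ l, K = -2 * l + 1 := ⟨-(K / 2), by omega⟩
        obtain ⟨s, D, g1, g2, g3⟩ := exists_oddWord hN l hw'
        rw [g3]
        rcases D with _ | D
        · rw [Nat.cast_zero, zero_mul, add_zero] at g2
          exact absurd g2 hw
        · rw [List.replicate_succ, List.flatten_cons]
          refine ⟨_, _, rfl, by rw [mode_Hp]; omega, fun _ => ⟨rfl, _, _, rfl, ?_⟩⟩
          apply boundaryPair_Hp_Zp
          show (target (d J) ((List.replicate D [Hp (-s) l, Zp s (l - 1)]).flatten ++ v)).1 = _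
          rw [target_append, h0, ← g1]
          clear g3 g2
          induction D with
          | zero => rfl
          | succ D ih =>
            rw [List.replicate_succ, List.flatten_cons, target_append, target_cons, target_cons,
              target_nil, ih, sg_Hp, sg_Zp]
            push_cast
            ring

theorem top_toState (hN : 0 < m - n) (d : DomainSeq m n) {w : List Particle}
    (hd : toState d = (x, w)) {k : ℤ} (hk : k ∈ walls d.1) :
    ∃ C u, w = C :: u ∧ k ≤ -2 * C.mode + 1 ∧ (k = -2 * C.mode + 1 → C.isHalf = true ∧
      ∃ B v, u = B :: v ∧ BoundaryPair m n (target x v).1 C B) := by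
  obtain ⟨J, r, hJ, h⟩ := exists_bounds d
  rw [toState_eq_blocks d hJ h] at hd
  obtain ⟨rfl, rfl⟩ := Prod.mk.inj hd
  exact top_blocks hN d.2 J r (h k hk).1 (h k hk).2 hk

/-- Changing the domain on the left of the last possible wall. -/
theorem exists_extension (hN : 0 < m - n) (d : DomainSeq m n) {K : ℤ}
    (hK : ∀ k ∈ walls d.1, k ≤ K) {y : ℤ × ℤ} (hy : InRange m n y)
    (hw : y ≠ d.1 K → WallAllowed m n K y (d.1 K)) :
    ∃ (d' : DomainSeq m n) (x : ℤ × ℤ) (v : List Particle), Valid m n (x, v) ∧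
      target x v = d.1 K ∧
      target x (block m n K (d.1 (K + 1)) (d.1 K) ++ v) = d.1 (K + 1) ∧
      toState d = (x, block m n K (d.1 (K + 1)) (d.1 K) ++ v) ∧
      toState d' = (x, block m n K y (d.1 K) ++ v) := by
  obtain ⟨J₀, r₀, hJ₀, h₀⟩ := exists_bounds d
  obtain ⟨J, r, hJ, rfl, h⟩ : ∃ (J : ℤ) (r : ℕ), J ≤ 0 ∧ K = J + r ∧
      ∀ k ∈ walls d.1, J ≤ k :=
    ⟨min J₀ K, (K - min J₀ K).toNat, by omega, by omega, fun k hk => by have := h₀ k hk; omega⟩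
  have hd' : IsDomainSeq m n fun q => if q ≤ J + r then d.1 q else y := by
    have hwalls : walls (fun q => if q ≤ J + r then d.1 q else y) ⊆ insert (J + (r : ℤ)) (walls d.1) := by
      intro k hk
      unfold walls at hk
      simp only [Set.mem_ofPred_eq] at hk
      rcases eq_or_ne k (J + r) with h1 | h1
      · exact Or.inl h1
      · right
        split_ifs at hk with h2 h3
        · exact hk
        · omega
        · omega
        · exact absurd rfl hk
    refine ⟨fun k => ?_, (d.2.finite.insert _).subset hwalls, fun k hk => ?_⟩
    · show InRange m n (if k ≤ J + r then d.1 k else y)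
      split_ifs
      exacts [d.2.inRange k, hy]
    · have hk' := hk
      unfold walls at hk
      simp only [Set.mem_ofPred_eq] at hk
      rcases hwalls hk' with rfl | h1
      · simp only [le_refl, if_true, if_neg (show ¬ J + (r : ℤ) + 1 ≤ J + r by omega)] at hk ⊢
        exact hw hk
      · have h2 := hK k h1
        rcases h2.eq_or_lt with rfl | h2
        · simp only [le_refl, if_true, if_neg (show ¬ J + (r : ℤ) + 1 ≤ J + r by omega)] at hk ⊢
          exact hw hk
        · simp only [if_pos h2.le, if_pos (show k + 1 ≤ J + r by omega)]
          exact d.2.allowed k h1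
  obtain ⟨h1, h2, -, -⟩ := blocks_spec hN d.2 J r
  obtain ⟨h3, -⟩ := blocks_spec hN d.2 J (r + 1)
  rw [blocks, Nat.cast_add, Nat.cast_one, ← add_assoc] at h3
  have hb : ∀ t : ℕ, t ≤ r → blocks m n (fun q => if q ≤ J + r then d.1 q else y) J t =
      blocks m n d.1 J t := by
    intro t ht
    induction t with
    | zero => rfl
    | succ t ih =>
      rw [blocks, blocks, ih (by omega)]
      simp only [if_pos (show J + (t : ℤ) ≤ J + r by omega),
        if_pos (show J + (t : ℤ) + 1 ≤ J + r by omega)]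
  refine ⟨⟨_, hd'⟩, d.1 J, blocks m n d.1 J r, h2, h1, h3, ?_, ?_⟩
  · rw [toState_eq_blocks d hJ (r := r + 1)
      fun k hk => ⟨h k hk, by have := hK k hk; push_cast; omega⟩]
    rfl
  · rw [toState_eq_blocks ⟨_, hd'⟩ hJ (r := r + 1) fun k hk => ?_, blocks, hb r le_rfl]
    · simp only [le_refl, if_true, if_neg (show ¬ J + (r : ℤ) + 1 ≤ J + r by omega)]
      rw [if_pos (by omega)]
    · have hk' : (if k + 1 ≤ J + r then d.1 (k + 1) else y) ≠
        (if k ≤ J + r then d.1 k else y) := hk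
      push_cast
      by_cases h3 : k + 1 ≤ J + r
      · rw [if_pos h3, if_pos (by omega)] at hk'
        have := h k hk'
        omega
      · rw [if_neg h3] at hk'
        by_cases h4 : k ≤ J + r
        · omega
        · rw [if_neg h4] at hk'
          exact absurd rfl hk'

theorem target_toState (hN : 0 < m - n) (d : DomainSeq m n) {K : ℤ}
    (hK : ∀ k ∈ walls d.1, k ≤ K) : target (toState d).1 (toState d).2 = d.1 (K + 1) := by
  obtain ⟨-, x, v, -, -, h3, h4, -⟩ :=
    exists_extension hN d hK (d.2.inRange (K + 1)) (d.2.allowed K)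
  rw [h4, h3]

theorem block_target_evenWord {α β : ℕ} (hd : (d : ℤ) = dist (m - n) s x.1)
    (h : s' = s ∨ β ≤ d + α) (hx : InRange m n x)
    (hy : InRange m n (target x (evenWord s s' l d α β))) :
    block m n (-2 * l) (target x (evenWord s s' l d α β)) x = evenWord s s' l d α β := by
  obtain rfl : d = (dist (m - n) s x.1).toNat := by omega
  rw [target_evenWord _ _ h] at hy ⊢
  have e : sgn l * (x.2 + β * (Zp s' l).db - x.2) = -(s' * β) := by
    rw [db_Zp]; unfold sgn; split_ifs <;> ring
  rw [block_eq_evenBlock]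
  exact evenBlock_eq s s' α β hx.1 hx.2.1 hy.1 hy.2.1 (by rw [e]; ring) e

/-- Prepending a particle of the same mode to the word of a wall at an even position. -/
theorem cons_evenWord {α β : ℕ} {A : Particle} (hd : (d : ℤ) = dist (m - n) s x.1)
    (h : s' = s ∨ β ≤ d + α) (hx : InRange m n x) (hA : A.Meaningful) (hl : A.mode = l)
    (hr : InRange m n (target x (evenWord s s' l d α β)))
    (hr' : InRange m n (target x (A :: evenWord s s' l d α β)))
    (hp : ∀ B u, evenWord s s' l d α β = B :: u → NormPair m n (target x u).1 A B)
    (hb : ∀ B u, evenWord s s' l d α β = B :: u → A.isHalf = true →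
      ¬ BoundaryPair m n (target x u).1 A B) :
    ∃ (t t' : ℤˣ) (d' α' β' : ℕ), (d' : ℤ) = dist (m - n) t x.1 ∧ (t' = t ∨ β' ≤ d' + α') ∧
      A :: evenWord s s' l d α β = evenWord t t' l d' α' β' := by
  obtain ⟨hx0, hx1, -, -⟩ := hx
  rw [target_cons] at hr'
  have ht := target_evenWord (x := x) (l := l) α β h
  -- the position relative to the boundary in the direction `-t`
  have hdist : ∀ t : ℤˣ, dist (m - n) t (target x (evenWord s s' l d α β)).1 =
      dist (m - n) t x.1 + t * (s * α + s' * β) := fun t => by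
    rw [ht]
    have : x.1 + s * α + s' * β = x.1 + t * (t * (s * α + s' * β)) := by
      rcases Int.units_eq_one_or t with rfl | rfl <;> simp <;> ring
    rw [this, dist_add]
  have h0 : ∀ t, 0 ≤ dist (m - n) t (target x (evenWord s s' l d α β)).1 := fun t =>
    dist_nonneg hr.1 hr.2.1
  have h1 : ∀ t, 0 ≤ dist (m - n) t ((target x (evenWord s s' l d α β)).1 + A.sg) := fun t =>
    dist_nonneg hr'.1 hr'.2.1
  have hneg : ∀ (t : ℤˣ) (a : ℤ), dist (m - n) t (a + ((-t : ℤˣ) : ℤ)) = dist (m - n) t a - 1 := by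
    intro t a
    have := dist_add (m - n) t a (-1)
    rw [← sub_eq_add_neg] at this
    rw [← this]
    push_cast
    ring_nf
  have hd0 : ∀ t, 0 ≤ dist (m - n) t x.1 := fun t => dist_nonneg hx0 hx1
  -- first for a word that consists of spin-0 particles only
  rcases Nat.eq_zero_or_pos α with rfl | hα
  · have hw : evenWord s s' l d 0 β = List.replicate β (Zp s' l) := by
      rw [evenWord_of_eq (h.imp_right (by omega))]; simp
    cases hk : A.isHalf with
    | true =>
      obtain ⟨t, hA'⟩ := hA.eq_Hp hk
      rw [hl] at hA'
      subst hA'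
      have hc : s' = t ∨ β ≤ (dist (m - n) t x.1).toNat := by
        refine (eq_or_eq_neg t s').imp_right fun h2 => ?_
        have h3 := hdist t
        have h4 := h0 t
        have h5 := hd0 t
        rw [h3, h2] at h4
        have : (t : ℤ) * (s * (0 : ℕ) + ((-t : ℤˣ) : ℤ) * β) = -β := by
          rcases Int.units_eq_one_or t with rfl | rfl <;> simp
        rw [this] at h4
        omega
      have h5 := hd0 t
      refine ⟨t, s', (dist (m - n) t x.1).toNat, 1, β, by omega, hc.imp_right (by omega), ?_⟩
      rw [hw, evenWord_of_eq hc]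
      rfl
    | false =>
      obtain ⟨t, hA'⟩ := hA.eq_Zp hk
      rw [hl] at hA'
      subst hA'
      have h5 := hd0 t
      refine ⟨t, t, (dist (m - n) t x.1).toNat, 0, β + 1, by omega, Or.inl rfl, ?_⟩
      rw [evenWord_of_eq (Or.inl rfl), hw]
      rcases β with _ | β
      · rfl
      · have h6 := hp (Zp s' l) (List.replicate β (Zp s' l)) (by rw [hw]; rfl)
        simp only [NormPair, Zp, lt_irrefl, false_or] at h6
        obtain rfl := h6.2.1
        rfl
  · obtain ⟨a, rfl⟩ : ∃ a, α = a + 1 := ⟨α - 1, by omega⟩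
    -- the word begins with a spin-1/2 particle, or with a boundary pair at the boundary
    by_cases hc : s' = s ∨ β ≤ d + a
    · have hw := evenWord_cons_half (l := l) hc
      have h6 := hp _ _ hw
      have h7 := hb _ _ hw
      cases hk : A.isHalf with
      | true =>
        obtain ⟨t, hA'⟩ := hA.eq_Hp hk
        rw [hl] at hA'
        subst hA'
        simp only [NormPair, Hp, lt_irrefl, false_or] at h6
        obtain rfl := h6.2.1
        exact ⟨t, s', d, a + 1 + 1, β, hd, hc.imp_right (by omega),
          (evenWord_cons_half (hc.imp_right (by omega))).symm⟩
      | false =>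
        obtain ⟨t, hA'⟩ := hA.eq_Zp hk
        rw [hl] at hA'
        subst hA'
        simp only [NormPair, Zp, Hp, lt_irrefl, false_or, BoundaryPair] at h6
        obtain ⟨rfl, -, h6⟩ := h6
        have h8 : dist (m - n) s (target x (evenWord s s' l d a β)).1 = 0 := by
          rw [dist_eq_zero_iff]
          unfold bdry
          rcases h6 with ⟨rfl, h6⟩ | ⟨rfl, h6⟩ <;> simpa using h6
        rw [target_evenWord _ _ hc] at h8
        have h9 : x.1 + s * a + s' * β = x.1 + s * (a + (s * s' : ℤˣ) * β) := by
          rcases Int.units_eq_one_or s with rfl | rfl <;> simp <;> ring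
        rw [h9, dist_add, ← hd] at h8
        rcases eq_or_eq_neg s s' with rfl | rfl
        · -- then there are no spin-0 particles, and the other superscript may be chosen
          have : ((s' * s' : ℤˣ) : ℤ) = 1 := by simp
          rw [this] at h8
          obtain rfl : β = 0 := by omega
          refine ⟨s', -s', d, a + 1, 1, hd, Or.inr (by omega), ?_⟩
          rw [evenWord_cons_pair rfl (by omega), evenWord_cons_half (Or.inl rfl),
            evenWord_of_eq (Or.inl rfl), evenWord_of_eq (Or.inr (by omega))]
          rfl
        · have : ((s * -s : ℤˣ) : ℤ) = -1 := by simp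
          rw [this] at h8
          refine ⟨s, -s, d, a + 1, β + 1, hd, Or.inr (by omega), ?_⟩
          rw [evenWord_cons_pair rfl (by omega), hw]
    · push Not at hc
      obtain rfl := (eq_or_eq_neg s s').resolve_left hc.1
      have h2 := h.resolve_left hc.1
      obtain ⟨b, rfl⟩ : ∃ b, β = b + 1 := ⟨β - 1, by omega⟩
      have h3 : dist (m - n) s (target x (evenWord s (-s) l d (a + 1) (b + 1))).1 = 0 := by
        rw [hdist, ← hd]
        rcases Int.units_eq_one_or s with rfl | rfl <;> simp <;> omega
      have h4 : ¬ A.sg = ((-s : ℤˣ) : ℤ) := fun h4 => by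
        have := h1 s
        rw [h4, hneg, h3] at this
        omega
      cases hk : A.isHalf with
      | true =>
        obtain ⟨t, hA'⟩ := hA.eq_Hp hk
        rw [hl] at hA'
        subst hA'
        have h5 : t = s := (eq_or_eq_neg s t).resolve_right fun h5 => h4 (by rw [h5, sg_Hp])
        subst h5
        exact ⟨t, -t, d, a + 1 + 1, b + 1, hd, Or.inr (by omega),
          (evenWord_cons_half (Or.inr (by omega))).symm⟩
      | false =>
        obtain ⟨t, hA'⟩ := hA.eq_Zp hk
        rw [hl] at hA'
        subst hA'
        have h6 := hp _ _ (evenWord_cons_pair (l := l) rfl (by omega))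
        simp only [NormPair, Zp, lt_irrefl, false_or] at h6
        exact absurd (by rw [h6.2.1, sg_Zp]) h4

theorem wallAllowed_odd {y : ℤ × ℤ} {D : ℕ} (hx : x.1 = bdry (m - n) s)
    (hy : y = (x.1, x.2 + (D + 1 : ℕ) * (Zp s (l - 1)).db)) :
    WallAllowed m n (-2 * l + 1) y x := by
  rw [hy, db_Zp, WallAllowed]
  unfold bdry at hx
  right
  rcases Int.units_eq_one_or s with rfl | rfl <;> split_ifs at * <;> simp at * <;> omega

theorem bdry_injective {N : ℤ} (hN : 0 < N) (h : bdry N s = bdry N s') : s = s' := by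
  unfold bdry at h
  rcases Int.units_eq_one_or s with rfl | rfl <;> rcases Int.units_eq_one_or s' with rfl | rfl <;>
    simp at h ⊢ <;> omega

theorem NormPair.cases {a : ℤ} {A B : Particle} (h : NormPair m n a A B) :
    A.key < B.key ∨ A = B ∨ BoundaryPair m n a A B := by
  cases A <;> cases B <;> simp only [NormPair, key, mode, isHalf] at h ⊢
  · rcases h with h | ⟨rfl, rfl, rfl⟩
    · left; omega
    · simp
  · rcases h with h | h
    · left; simp; omega
    · exact Or.inr (Or.inr h)
  · rcases h with h | h
    · left; simp; omega
    · exact Or.inr (Or.inr h)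
  · rcases h with h | ⟨rfl, rfl, rfl⟩
    · left; omega
    · simp

theorem key_eq_of_isHalf {A : Particle} (h : A.isHalf = true) : A.key = 2 * A.mode := by
  simp [key, h]

theorem key_eq_of_not_isHalf {A : Particle} (h : A.isHalf = false) : A.key = 2 * A.mode + 1 := by
  simp [key, h]

/-- Prepending a boundary pair with the spin-1/2 particle on the left: it adds to the wall at the
odd position that the modes of the pair prescribe. -/
theorem exists_toState_pair (hN : 0 < m - n) {A B : Particle} {u : List Particle}
    (hv : Valid m n (x, A :: B :: u)) (hn : NormalList m n x (A :: B :: u))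
    (hA : A.isHalf = true) (hb : BoundaryPair m n (target x u).1 A B)
    (ih : ∃ d : DomainSeq m n, toState d = (x, u)) :
    ∃ d : DomainSeq m n, toState d = (x, A :: B :: u) := by
  obtain ⟨d, hd⟩ := ih
  obtain ⟨hmA, hrA, hvB⟩ := valid_cons.1 hv
  obtain ⟨hmB, -, hvu⟩ := valid_cons.1 hvB
  have hB : B.isHalf = false := by
    have := hb.isHalf_ne
    rw [hA] at this
    simpa using this.symm
  obtain ⟨t, hA'⟩ := hmA.eq_Hp hA
  obtain ⟨s, hB'⟩ := hmB.eq_Zp hB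
  generalize A.mode = l at hA'
  generalize B.mode = l' at hB'
  subst hA' hB'
  obtain ⟨rfl, rfl, hbd⟩ := hb
  have hbd' : (target x u).1 = bdry (m - n) s := by
    unfold bdry
    rcases hbd with ⟨rfl, h⟩ | ⟨rfl, h⟩ <;> simpa using h
  -- all walls of the remaining product lie at or on the right of the position of the pair
  have hK : ∀ k ∈ walls d.1, k ≤ -2 * l + 1 := by
    intro k hk
    obtain ⟨C, v, rfl, h1, h2⟩ := top_toState hN d hd hk
    have h4 := hn.2 [] v _ _ C rfl
    rcases (hn.tail.1 [] v _ C rfl).cases with h3 | rfl | h3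
    · rw [key_Zp] at h3
      cases hC : C.isHalf with
      | true => rw [key_eq_of_isHalf hC] at h3; omega
      | false => rw [key_eq_of_not_isHalf hC] at h3; omega
    · -- two spin-0 particles with superscript `s` cannot act before the boundary is reached
      exfalso
      rw [target_cons, ← dist_eq_zero_iff, sg_Zp] at hbd'
      have h5 := (valid_cons.1 hvu).2.2.inRange_target
      have h6 := dist_nonneg (s := s) h5.1 h5.2.1
      have h7 := dist_add (m - n) s (target x v).1 1
      rw [mul_one] at h7
      simp only at hbd'
      omega
    · exact absurd ⟨boundaryPair_Hp_Zp hbd', h3⟩ h4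
  have ht := target_toState hN d hK
  rw [hd] at ht
  simp only at ht
  -- at this position there is a wall at the same boundary, or none at all (`D = 0`)
  have hodd : (d.1 (-2 * l + 1)).1 = bdry (m - n) s ∧ ∃ D : ℕ, d.1 (-2 * l + 1 + 1) =
      ((d.1 (-2 * l + 1)).1, (d.1 (-2 * l + 1)).2 + D * (Zp s (l - 1)).db) := by
    rw [ht] at hbd'
    by_cases hy : d.1 (-2 * l + 1 + 1) = d.1 (-2 * l + 1)
    · exact ⟨by rw [← hy, hbd'], 0, by rw [hy]; simp⟩
    · obtain ⟨s₀, D, h1, h2, -⟩ := exists_oddWord hN l (d.2.allowed _ hy)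
      obtain rfl : s₀ = s := bdry_injective hN (by rw [← h1, ← hbd', h2])
      exact ⟨h1, D, h2⟩
  obtain ⟨hodd, D, hD⟩ := hodd
  have hy : target x (Hp (-s) l :: Zp s (l - 1) :: u) = ((d.1 (-2 * l + 1)).1,
      (d.1 (-2 * l + 1)).2 + (D + 1 : ℕ) * (Zp s (l - 1)).db) := by
    rw [target_cons, target_cons, ht, hD, sg_Hp, sg_Zp, db_Hp, Prod.mk.injEq]
    push_cast
    constructor <;> ring
  have hr := hv.inRange_target
  obtain ⟨d', x', v', h1, h2, h3, h4, h5⟩ := exists_extension hN d hK hr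
    (fun _ => wallAllowed_odd hodd hy)
  obtain ⟨rfl, rfl⟩ := Prod.mk.inj (hd.symm.trans h4)
  refine ⟨d', h5.trans ?_⟩
  rw [block_odd hN l s (D + 1) hodd (by rw [hy]; ring), block_odd hN l s D hodd (by rw [hD]; ring)]
  rfl

/-- Every normally ordered product comes from a sequence of domains. A new leftmost particle either
forms a boundary pair at an odd position together with the next particle, or it extends a wall at
an even position, possibly an empty one. -/
theorem exists_toState (hN : 0 < m - n) (N : ℕ) (w : List Particle) (hw : w.length ≤ N)
    (hv : Valid m n (x, w)) (hn : NormalList m n x w) :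
    ∃ d : DomainSeq m n, toState d = (x, w) := by
  induction N generalizing w with
  | zero =>
    obtain rfl : w = [] := List.length_eq_zero_iff.1 (by omega)
    have hwall : walls (fun _ : ℤ => x) = ∅ := by ext; simp [walls]
    let d : DomainSeq m n := ⟨fun _ => x, fun _ => hv.inRange_target,
      by rw [hwall]; exact Set.finite_empty, fun k hk => absurd rfl hk⟩
    refine ⟨d, ?_⟩
    rw [toState_eq_blocks d le_rfl (r := 0) fun k hk => absurd rfl hk]
    rfl
  | succ N ih =>
    rcases w with _ | ⟨A, v⟩
    · exact ih [] (by simp) hv hn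
    have hv' := (valid_cons.1 hv).2.2
    rw [List.length_cons] at hw
    by_cases hb : ∃ B u, v = B :: u ∧ A.isHalf = true ∧ BoundaryPair m n (target x u).1 A B
    · obtain ⟨B, u, rfl, hA, hb⟩ := hb
      rw [List.length_cons] at hw
      exact exists_toState_pair hN hv hn hA hb
        (ih u (by omega) (valid_cons.1 hv').2.2 hn.tail.tail)
    · obtain ⟨d, hd⟩ := ih v (by omega) hv' hn.tail
      have hmA := (valid_cons.1 hv).1
      -- all walls of the remaining product lie at or on the right of the position of `A`
      have hK : ∀ k ∈ walls d.1, k ≤ -2 * A.mode := by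
        intro k hk
        obtain ⟨C, u, rfl, h1, h2⟩ := top_toState hN d hd hk
        rcases (hn.1 [] u A C rfl).cases with h3 | rfl | h3
        · cases hA : A.isHalf <;> cases hC : C.isHalf <;>
            simp only [key, hA, hC, Bool.false_eq_true, if_true, if_false] at h3
          · omega
          · omega
          · by_contra hc
            have := (h2 (by omega)).1
            rw [hC] at this
            exact absurd this (by decide)
          · omega
        · -- two equal particles at the boundary
          by_contra hc
          obtain ⟨hA, B, w, rfl, h4⟩ := h2 (by omega)
          rw [hv'.boundaryPair_iff] at h4
          have h5 := hv.inRange_target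
          obtain ⟨-, -, h6, h9, h10⟩ := hv'.pair
          simp only [target_cons, InRange] at h5 h6 h9 h10
          rcases A.sg_eq with h7 | h7 <;> rcases B.sg_eq with h8 | h8 <;> omega
        · have hA : A.isHalf = false := by
            by_contra hA
            exact hb ⟨C, u, rfl, by simpa using hA, h3⟩
          have hC : C.isHalf = true := by
            have := h3.isHalf_ne
            rw [hA] at this
            simpa using this.symm
          have h5 := h3.key_eq
          rw [key_eq_of_isHalf hC, key_eq_of_not_isHalf hA] at h5
          by_contra hc
          obtain ⟨-, B, w, rfl, h4⟩ := h2 (by omega)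
          exact hn.2 [] w A C B rfl ⟨h3, h4⟩
      generalize hl : A.mode = l at hK
      obtain ⟨d', x', v', h1, h2, h3, h4, h5⟩ := exists_extension hN d hK hv.inRange_target
        (fun _ => Or.inl (by omega))
      obtain ⟨rfl, rfl⟩ := Prod.mk.inj (hd.symm.trans h4)
      obtain ⟨s, s', e, α, β, g1, g2, g3, g4⟩ := exists_evenWord (d.2.inRange (-2 * l))
        (d.2.inRange (-2 * l + 1)) l
      rw [g4] at hv hn hv' hb h5 ⊢
      have htA : ∀ u, target x (u ++ v') = target (d.1 (-2 * l)) u := fun u => by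
        rw [target_append, h2]
      obtain ⟨t, t', e', α', β', k1, k2, k3⟩ := cons_evenWord (A := A) g1 g2 (d.2.inRange _) hmA hl
        (by rw [← htA]; exact hv'.inRange_target)
        (by rw [← htA]; exact hv.inRange_target)
        (fun B u h => by
          rw [← htA]
          exact hn.1 [] _ A B (by rw [h]; rfl))
        (fun B u h hA hB => hb ⟨B, u ++ v', by rw [h]; rfl, hA, by rwa [htA]⟩)
      refine ⟨d', h5.trans ?_⟩
      have h6 : target x (A :: (evenWord s s' l e α β ++ v')) =
          target (d.1 (-2 * l)) (evenWord t t' l e' α' β') := by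
        rw [← k3, ← htA]; rfl
      have h7 := hv.inRange_target
      rw [h6] at h7 ⊢
      rw [block_target_evenWord k1 k2 (d.2.inRange _) h7, ← k3]
      rfl

/-- The bijection between sequences of domains and normally ordered products. -/
def domainsEquivNorm (h : 0 < n ∧ n < m) : DomainSeq m n ≃ normallyOrdered m n :=
  Equiv.ofBijective (fun d => ⟨⟨toState d, (toState_spec (by omega) d).1⟩,
    (toState_spec (by omega) d).2⟩) <| by
  constructor
  · intro d d' hd
    exact toState_injective h (congrArg (fun y => y.1.1) hd)
  · rintro ⟨⟨⟨x, w⟩, hv⟩, hn⟩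
    obtain ⟨d, hd⟩ := exists_toState (by omega) _ w le_rfl hv hn
    exact ⟨d, Subtype.ext (Subtype.ext hd)⟩

end

section
variable {m n : ℤ} {x : ℤ × ℤ} {i : Fin 2} {s s' : ℤˣ} {l : ℤ} {d : ℕ}

/-! ### The signatures of the words of domain walls -/

/-- `f_i` does not vanish on the spin-1/2 particle with superscript `s` and mode `l`; otherwise
`e_i` does not vanish on it. -/
def active (i : Fin 2) (s : ℤˣ) (l : ℤ) : Prop := i = 1 ↔ (s = 1 ↔ l % 2 = 0)

theorem particleCrystal_Hp (i : Fin 2) (s : ℤˣ) (l : ℤ) :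
    (active i s l ∧ particleCrystal.ε i (Hp s l) = 0 ∧ particleCrystal.φ i (Hp s l) = 1 ∧
      particleCrystal.f i (Hp s l) = some (Hp s (l - 1))) ∨
    (¬ active i s l ∧ particleCrystal.ε i (Hp s l) = 1 ∧ particleCrystal.φ i (Hp s l) = 0) := by
  have hi : i = 0 ∨ i = 1 := by fin_cases i <;> simp
  unfold active Hp
  rw [particleCrystal_ε_half, particleCrystal_φ_half, particleCrystal_f_half]
  have hl : ¬ (l - 1) % 2 = 0 ↔ l % 2 = 0 := by omega
  rcases hi with rfl | rfl <;> by_cases h : s = 1 <;> by_cases h' : l % 2 = 0 <;>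
    simp [h, h'] <;> omega

theorem active_neg : active i (-s) l ↔ ¬ active i s l := by
  unfold active
  rcases Int.units_eq_one_or s with rfl | rfl <;> by_cases hl : l % 2 = 0 <;> simp [hl]

theorem active_sub_one : active i s (l - 1) ↔ ¬ active i s l := by
  have hl : (l - 1) % 2 = 0 ↔ ¬ l % 2 = 0 := by omega
  unfold active
  rw [hl]
  tauto

theorem eq_of_not_active (h : ¬ active i s l) (h' : ¬ active i s' l) : s' = s := by
  rcases eq_or_eq_neg s s' with rfl | rfl
  · rfl
  · exact absurd (active_neg.2 h) h'

theorem groundOnes_sub (i : Fin 2) (k : ℤ) (y : ℤ × ℤ) :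
    groundOnes m n i k y - groundOnes m n i k x = change i * (lin k y - lin k x) := by
  rw [← ground_sub (m := m) (n := n)]
  unfold groundOnes change
  split_ifs <;> ring

/-- The excess of the `1`s of a ground state at the positions `k - 1` and `k` over `n`. -/
def excess (m n : ℤ) (i : Fin 2) (k : ℤ) (x : ℤ × ℤ) : ℤ :=
  groundOnes m n i (k - 1) x + groundOnes m n i k x - n

theorem excess_eq (i : Fin 2) {k : ℤ} (hk : k % 2 = 1) (x : ℤ × ℤ) :
    excess m n i k x = m - groundOnes m n i (k + 1) x - groundOnes m n i k x := by
  unfold excess groundOnes ground cap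
  split_ifs <;> omega

/-- The excess measures the distance from one of the two boundaries. -/
theorem excess_eq_dist (h : active i s l) (x : ℤ × ℤ) :
    excess m n i (-2 * l + 1) x = dist (m - n) s x.1 := by
  have h1 : (-2 * l + 1) % 2 = 1 := by omega
  have h2 : ¬ (-2 * l + 1 - 1) % 2 = 1 := by omega
  have h3 : (-2 * l + 1 - 1) % 4 = 0 ↔ l % 2 = 0 := by omega
  unfold excess groundOnes ground cap dist
  unfold active at h
  simp only [h1, h2, h3, if_true, if_false]
  split_ifs <;> first | omega | (exfalso; tauto)

/-- All letters of a wall at an even position are equal, and their number is, up to sign, the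
change of the path at this position. -/
theorem sig_block_even {y : ℤ × ℤ} (hx : InRange m n x) (hy : InRange m n y) {k : ℤ}
    (hk : k % 2 = 0) :
    ((particleCrystal.sig i (block m n k y x)).1 = 0 ∨
      (particleCrystal.sig i (block m n k y x)).2 = 0) ∧
    ((particleCrystal.sig i (block m n k y x)).2 : ℤ) -
      (particleCrystal.sig i (block m n k y x)).1 =
        groundOnes m n i k y - groundOnes m n i k x := by
  obtain ⟨l, rfl⟩ : ∃ l, k = -2 * l := ⟨-k / 2, by omega⟩
  obtain ⟨s, s', e, α, β, -, h2, h3, h4⟩ := exists_evenWord hx hy l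
  have hlin : lin (-2 * l) y - lin (-2 * l) x = (if l % 2 = 0 then 1 else -1) * (s * α) := by
    have h1 : ¬ (-2 * l) % 2 = 1 := by omega
    have h5 : (-2 * l) % 4 = 0 ↔ l % 2 = 0 := by omega
    rw [h3, db_Zp]
    unfold lin
    simp only [h1, h5, if_false]
    split_ifs <;> ring
  rw [h4, sig_evenWord _ _ h2, groundOnes_sub, hlin]
  have hi : i = 0 ∨ i = 1 := by fin_cases i <;> simp
  rcases particleCrystal_Hp i s l with ⟨h5, h6, h7, -⟩ | ⟨h5, h6, h7⟩ <;> rw [h6, h7] <;>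
    refine ⟨by simp, ?_⟩ <;> unfold active at h5 <;> unfold change <;>
    rcases Int.units_eq_one_or s with rfl | rfl <;> rcases hi with rfl | rfl <;>
    split_ifs <;> simp_all

theorem sig_oddWord (s : ℤˣ) (l : ℤ) (D : ℕ) :
    particleCrystal.sig i (List.replicate D [Hp (-s) l, Zp s (l - 1)]).flatten =
      (D * particleCrystal.ε i (Hp (-s) l), D * particleCrystal.φ i (Hp (-s) l)) := by
  induction D with
  | zero => simp [CrystalData.sig_nil]
  | succ D ih =>
    rw [List.replicate_succ, List.flatten_cons, CrystalData.sig_append, ih, CrystalData.sig_cons,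
      CrystalData.sig_cons, CrystalData.sig_nil, particleCrystal_ε_Zp, particleCrystal_φ_Zp,
      cancel_zero_left, cancel_zero_right]
    rcases particleCrystal_Hp i (-s) l with ⟨-, h6, h7, -⟩ | ⟨-, h6, h7⟩ <;> rw [h6, h7] <;>
      simp [cancel] <;> ring

/-- The change of `b` by a spin-0 particle, compared with the change of the path under `f_i`. -/
theorem change_mul_db (i : Fin 2) (s : ℤˣ) (l : ℤ) :
    (active i s l → change i * (Zp s (l - 1)).db = 1) ∧
      (¬ active i s l → change i * (Zp s (l - 1)).db = -1) := by
  have h4 : (l - 1) % 2 = 0 ↔ ¬ l % 2 = 0 := by omega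
  have hi : i = 0 ∨ i = 1 := by fin_cases i <;> simp
  rw [db_Zp]
  unfold active change
  rcases Int.units_eq_one_or s with rfl | rfl <;> rcases hi with rfl | rfl <;>
    by_cases h5 : l % 2 = 0 <;> simp [h4, h5]

/-- All letters of a wall at an odd position are equal, and their number is, up to sign, the
change of the path at the next position. The letter decides at which boundary the wall is. -/
theorem sig_block_odd (hN : 0 < m - n) {y : ℤ × ℤ} {k : ℤ} (hk : k % 2 = 1)
    (hw : WallAllowed m n k y x) :
    (excess m n i k x = 0 ∧ (particleCrystal.sig i (block m n k y x)).2 = 0 ∧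
      groundOnes m n i (k + 1) y - groundOnes m n i (k + 1) x =
        (particleCrystal.sig i (block m n k y x)).1) ∨
    (excess m n i k x = m - n ∧ (particleCrystal.sig i (block m n k y x)).1 = 0 ∧
      groundOnes m n i (k + 1) y - groundOnes m n i (k + 1) x =
        -((particleCrystal.sig i (block m n k y x)).2 : ℤ)) := by
  obtain ⟨l, rfl⟩ : ∃ l, k = -2 * l + 1 := ⟨-(k / 2), by omega⟩
  obtain ⟨s, D, h1, h2, h3⟩ := exists_oddWord hN l hw
  have h0 : dist (m - n) s x.1 = 0 := dist_eq_zero_iff.2 h1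
  have h0' : dist (m - n) (-s) x.1 = m - n := by
    unfold dist at h0 ⊢
    rcases Int.units_eq_one_or s with rfl | rfl <;> simp at h0 ⊢ <;> omega
  have hlin : lin (-2 * l + 1 + 1) y - lin (-2 * l + 1 + 1) x = D * (Zp s (l - 1)).db := by
    have h4 : ¬ (-2 * l + 1 + 1) % 2 = 1 := by omega
    rw [h2]
    unfold lin
    rw [if_neg h4]
    split_ifs <;> ring
  have hdb := change_mul_db i s l
  rw [h3, sig_oddWord, groundOnes_sub, hlin]
  have e : change i * (D * (Zp s (l - 1)).db) = D * (change i * (Zp s (l - 1)).db) := by ring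
  rw [e]
  rcases particleCrystal_Hp i (-s) l with ⟨h5, h6, h7, -⟩ | ⟨h5, h6, h7⟩ <;> rw [h6, h7]
  · right
    rw [excess_eq_dist h5, hdb.2 (active_neg.1 h5)]
    exact ⟨h0', by simp, by simp⟩
  · left
    rw [active_neg, not_not] at h5
    rw [excess_eq_dist h5, hdb.1 h5]
    exact ⟨h0, by simp, by simp⟩

theorem excess_nonneg {k : ℤ} (hx : InRange m n x) (hk : k % 2 = 1) : 0 ≤ excess m n i k x := by
  obtain ⟨l, rfl⟩ : ∃ l, k = -2 * l + 1 := ⟨-(k / 2), by omega⟩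
  by_cases h : active i 1 l
  · rw [excess_eq_dist h]; exact dist_nonneg hx.1 hx.2.1
  · rw [excess_eq_dist (active_neg.2 h)]; exact dist_nonneg hx.1 hx.2.1

/-- The particles of the walls between `J` and `q`, the position `q` excluded. -/
def lowerWord (m n : ℤ) (d : ℤ → ℤ × ℤ) (J q : ℤ) : List Particle := blocks m n d J (q - J).toNat

/-- The particles of the walls between `q` and `T`, the position `T` excluded. -/
def upperWord (m n : ℤ) (d : ℤ → ℤ × ℤ) (T q : ℤ) : List Particle := blocks m n d q (T - q).toNat

theorem lowerWord_succ {d : ℤ → ℤ × ℤ} (hd : IsDomainSeq m n d) {J : ℤ}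
    (hJ : ∀ k ∈ walls d, J ≤ k) (q : ℤ) :
    lowerWord m n d J (q + 1) = block m n q (d (q + 1)) (d q) ++ lowerWord m n d J q := by
  unfold lowerWord
  rcases lt_or_ge q J with h | h
  · have : d (q + 1) = d q := by
      by_contra hc
      have := hJ q hc
      omega
    have e1 : (q + 1 - J).toNat = 0 := by omega
    have e2 : (q - J).toNat = 0 := by omega
    rw [this, block_self (hd.inRange q), e1, e2, List.nil_append]
  · obtain ⟨r, rfl⟩ : ∃ r : ℕ, q = J + r := ⟨(q - J).toNat, by omega⟩
    have e1 : (J + r + 1 - J).toNat = r + 1 := by omega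
    have e2 : (J + r - J).toNat = r := by omega
    rw [e1, e2, blocks]

theorem blocks_succ' (d : ℤ → ℤ × ℤ) (J : ℤ) (r : ℕ) : blocks m n d J (r + 1) =
    blocks m n d (J + 1) r ++ block m n J (d (J + 1)) (d J) := by
  induction r with
  | zero => simp [blocks]
  | succ r ih =>
    rw [blocks, ih, blocks]
    have e : J + (r + 1 : ℕ) = J + 1 + r := by push_cast; ring
    rw [e, List.append_assoc]

theorem upperWord_eq {d : ℤ → ℤ × ℤ} (hd : IsDomainSeq m n d) {T : ℤ}
    (hT : ∀ k ∈ walls d, k < T) (q : ℤ) :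
    upperWord m n d T q = upperWord m n d T (q + 1) ++ block m n q (d (q + 1)) (d q) := by
  unfold upperWord
  rcases le_or_gt T q with h | h
  · have : d (q + 1) = d q := by
      by_contra hc
      have := hT q hc
      omega
    have e1 : (T - (q + 1)).toNat = 0 := by omega
    have e2 : (T - q).toNat = 0 := by omega
    rw [this, block_self (hd.inRange q), e1, e2]
    rfl
  · obtain ⟨r, rfl⟩ : ∃ r : ℕ, T = q + r + 1 := ⟨(T - q - 1).toNat, by omega⟩
    have e1 : (q + r + 1 - q).toNat = r + 1 := by omega
    have e2 : (q + r + 1 - (q + 1)).toNat = r := by omega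
    rw [e1, e2, blocks_succ']

theorem toState_eq_append (d : DomainSeq m n) {J T : ℤ} (hJ0 : J ≤ 0) (hJT : J ≤ T)
    (hJ : ∀ k ∈ walls d.1, J ≤ k) (hT : ∀ k ∈ walls d.1, k < T) (q : ℤ) :
    toState d = (d.1 J, upperWord m n d.1 T q ++ lowerWord m n d.1 J q) := by
  have h1 : ∀ q, upperWord m n d.1 T (q + 1) ++ lowerWord m n d.1 J (q + 1) =
      upperWord m n d.1 T q ++ lowerWord m n d.1 J q := fun q => by
    rw [upperWord_eq d.2 hT q, lowerWord_succ d.2 hJ q, List.append_assoc]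
  have h2 : ∀ q, upperWord m n d.1 T q ++ lowerWord m n d.1 J q =
      upperWord m n d.1 T J ++ lowerWord m n d.1 J J := fun q => by
    rcases le_total J q with h | h
    · induction q, h using Int.leInduction with
      | base => rfl
      | succ k _ ih => rw [h1, ih]
    · induction q, h using Int.leInductionDown with
      | base => rfl
      | pred k _ ih => rw [← ih, ← h1 (k - 1), sub_add_cancel]
  rw [h2, toState_eq_blocks d hJ0 (r := (T - J).toNat)
    fun k hk => ⟨hJ k hk, by have := hT k hk; omega⟩]
  have e : (J - J).toNat = 0 := by omega
  unfold upperWord lowerWord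
  rw [e, blocks, List.append_nil]

theorem target_lowerWord (hN : 0 < m - n) {d : ℤ → ℤ × ℤ} (hd : IsDomainSeq m n d) {J q : ℤ}
    (hq : J ≤ q) : target (d J) (lowerWord m n d J q) = d q := by
  have e : J + ((q - J).toNat : ℤ) = q := by omega
  have := (blocks_spec hN hd J (q - J).toNat).1
  rwa [e] at this

end

section
variable {m n : ℤ} {x : ℤ × ℤ} {i : Fin 2} {s s' : ℤˣ} {l : ℤ} {d : ℕ}

/-! ### Surviving letters in terms of particles -/

/-- The cases of `sig_block_odd`, including the absence of a wall. -/
theorem sig_block_odd_cases (hN : 0 < m - n) {y : ℤ × ℤ} {k : ℤ} (hx : InRange m n x)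
    (hk : k % 2 = 1) (hw : y ≠ x → WallAllowed m n k y x) :
    (y = x ∧ particleCrystal.sig i (block m n k y x) = (0, 0)) ∨
    (excess m n i k x = 0 ∧ (particleCrystal.sig i (block m n k y x)).2 = 0 ∧
      groundOnes m n i (k + 1) y - groundOnes m n i (k + 1) x =
        (particleCrystal.sig i (block m n k y x)).1) ∨
    (excess m n i k x = m - n ∧ (particleCrystal.sig i (block m n k y x)).1 = 0 ∧
      groundOnes m n i (k + 1) y - groundOnes m n i (k + 1) x =
        -((particleCrystal.sig i (block m n k y x)).2 : ℤ)) := by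
  by_cases h : y = x
  · left
    rw [h, block_self hx]
    exact ⟨rfl, rfl⟩
  · exact Or.inr (sig_block_odd hN hk (hw h))

theorem letters_toPath (d : DomainSeq m n) (k : ℤ) : letters m n (toPath d).1 i k =
    ((groundOnes m n i k (d.1 k)).toNat, (cap m n k - groundOnes m n i k (d.1 k)).toNat) :=
  letters_of_ground rfl

theorem lowerWord_of_le {d : ℤ → ℤ × ℤ} {J q : ℤ} (h : q ≤ J) : lowerWord m n d J q = [] := by
  have e : (q - J).toNat = 0 := by omega
  rw [lowerWord, e, blocks]

theorem upperWord_of_le {d : ℤ → ℤ × ℤ} {T q : ℤ} (h : T ≤ q) : upperWord m n d T q = [] := by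
  have e : (T - q).toNat = 0 := by omega
  rw [upperWord, e, blocks]

theorem eq_of_le_walls {d : ℤ → ℤ × ℤ} {J k : ℤ} (hJ : ∀ k ∈ walls d, J ≤ k) (h : k ≤ J) :
    d k = d J :=
  (eq_of_no_walls h fun q _ h2 => by
    by_contra hc
    have := hJ q hc
    omega).symm

theorem eq_of_walls_lt {d : ℤ → ℤ × ℤ} {T k : ℤ} (hT : ∀ k ∈ walls d, k < T) (h : T ≤ k) :
    d k = d T :=
  eq_of_no_walls h fun q h1 _ => by
    by_contra hc
    have := hT q hc
    omega

/-- The `1`s that survive to the right of an even position, in terms of particles. -/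
theorem onesRight_toPath (hN : 0 < m - n) (d : DomainSeq m n) {J q : ℤ}
    (hJ : ∀ k ∈ walls d.1, J ≤ k) (hJ2 : J % 2 = 0) (hq : q % 2 = 0) (hJq : J ≤ q) :
    (onesRight m n (toPath d).1 i (q + 1) : ℤ) = groundOnes m n i q (d.1 q) +
      (particleCrystal.sig i (lowerWord m n d.1 J q)).1 := by
  obtain ⟨r, rfl⟩ : ∃ r : ℕ, q = J + 2 * r := ⟨((q - J) / 2).toNat, by omega⟩
  clear hJq
  induction r with
  | zero =>
    simp only [Nat.cast_zero, mul_zero, add_zero] at hq ⊢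
    have hr := d.2.inRange J
    have hb := groundOnes_bounds (i := i) hr J
    -- there are no particles on the right of `J`, and the path is a ground state there
    have h1 : onesRight m n (toPath d).1 i (J + 1) = (groundOnesRight m n i (J + 1) (d.1 J)).toNat :=
      onesRight_ground hr (K := J + 1) (fun k hk => by
        show ground m n k (d.1 k) = _
        rw [eq_of_le_walls hJ (by omega)]) le_rfl
    rw [h1, groundOnesRight, if_neg (by omega), add_sub_cancel_right, lowerWord_of_le le_rfl,
      CrystalData.sig_nil]
    push_cast
    omega
  | succ r ih =>
    have ih := ih (by omega)
    have e : J + 2 * ((r + 1 : ℕ) : ℤ) = J + 2 * r + 1 + 1 := by push_cast; ring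
    rw [e] at hq ⊢
    generalize J + 2 * (r : ℤ) = q at *
    have hp := (toPath d).2
    -- one step from `q` to `q + 2`: the letters of the path at `q + 1` and `q + 2` against the
    -- walls at `q` and `q + 1`
    have s1 := hp.onesRight_step (i := i) (q + 1)
    have s2 := hp.onesRight_step (i := i) (q + 1 + 1)
    rw [letters_toPath] at s1 s2
    have b1 := groundOnes_bounds (i := i) (d.2.inRange (q + 1)) (q + 1)
    have b2 := groundOnes_bounds (i := i) (d.2.inRange (q + 1 + 1)) (q + 1 + 1)
    have c1 : cap m n (q + 1) = n := if_pos (by omega)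
    have c2 : cap m n (q + 1 + 1) = m := if_neg (by omega)
    obtain ⟨g1, g2⟩ := sig_block_even (i := i) (d.2.inRange q) (d.2.inRange (q + 1)) (k := q)
      (by omega)
    have g3 := sig_block_odd_cases (i := i) hN (d.2.inRange (q + 1)) (by omega)
      (d.2.allowed (q + 1))
    have g4 := excess_nonneg (i := i) (k := q + 1) (d.2.inRange (q + 1)) (by omega)
    have g5 := excess_eq (m := m) (n := n) i (k := q + 1) (by omega) (d.1 (q + 1))
    have g6 : excess m n i (q + 1) (d.1 (q + 1)) = groundOnes m n i q (d.1 (q + 1)) +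
        groundOnes m n i (q + 1) (d.1 (q + 1)) - n := by rw [excess, add_sub_cancel_right]
    rw [lowerWord_succ d.2 hJ, lowerWord_succ d.2 hJ, CrystalData.sig_append,
      CrystalData.sig_append]
    simp only [cancel, c1, c2] at *
    rcases g3 with ⟨g3, g7⟩ | g3 | g3
    · rw [g7]
      rw [g3] at s2 b2 ⊢
      simp only
      omega
    · omega
    · omega

/-- The `0`s that survive to the left of an even position, in terms of particles. -/
theorem zerosLeft_toPath (hN : 0 < m - n) (d : DomainSeq m n) {T q : ℤ}
    (hT : ∀ k ∈ walls d.1, k < T) (hT2 : T % 2 = 1) (hq : q % 2 = 0) (hqT : q < T) :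
    (zerosLeft m n (toPath d).1 i q : ℤ) = groundOnes m n i q (d.1 (q + 1)) +
      (particleCrystal.sig i (upperWord m n d.1 T (q + 1))).2 := by
  obtain ⟨r, rfl⟩ : ∃ r : ℕ, q = T - 1 - 2 * r := ⟨((T - 1 - q) / 2).toNat, by omega⟩
  clear hqT
  induction r with
  | zero =>
    simp only [Nat.cast_zero, mul_zero, sub_zero, sub_add_cancel] at hq ⊢
    have hr := d.2.inRange T
    have hb := groundOnes_bounds (i := i) hr (T - 1)
    have h1 : zerosLeft m n (toPath d).1 i (T - 1) = (groundZeros m n i (T - 1) (d.1 T)).toNat :=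
      zerosLeft_ground hr (K := T - 1) (fun k hk => by
        show ground m n k (d.1 k) = _
        rw [eq_of_walls_lt hT (by omega)]) le_rfl
    rw [h1, groundZeros, if_pos hq, upperWord_of_le le_rfl, CrystalData.sig_nil]
    push_cast
    omega
  | succ r ih =>
    have ih := ih (by omega)
    have e : T - 1 - 2 * (r : ℤ) = T - 1 - 2 * ((r + 1 : ℕ) : ℤ) + 1 + 1 := by push_cast; ring
    rw [e] at ih
    generalize T - 1 - 2 * ((r + 1 : ℕ) : ℤ) = q at *
    have hp := (toPath d).2
    have s1 := hp.zerosLeft_step (i := i) q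
    have s2 := hp.zerosLeft_step (i := i) (q + 1)
    rw [letters_toPath] at s1 s2
    have b1 := groundOnes_bounds (i := i) (d.2.inRange (q + 1)) (q + 1)
    have b2 := groundOnes_bounds (i := i) (d.2.inRange (q + 1 + 1)) (q + 1 + 1)
    have c1 : cap m n (q + 1) = n := if_pos (by omega)
    have c2 : cap m n (q + 1 + 1) = m := if_neg (by omega)
    obtain ⟨g1, g2⟩ := sig_block_even (i := i) (d.2.inRange (q + 1 + 1))
      (d.2.inRange (q + 1 + 1 + 1)) (k := q + 1 + 1) (by omega)
    have g3 := sig_block_odd_cases (i := i) hN (d.2.inRange (q + 1)) (by omega)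
      (d.2.allowed (q + 1))
    have g4 := excess_nonneg (i := i) (k := q + 1) (d.2.inRange (q + 1)) (by omega)
    have g5 := excess_eq (m := m) (n := n) i (k := q + 1) (by omega) (d.1 (q + 1))
    have g6 : excess m n i (q + 1) (d.1 (q + 1)) = groundOnes m n i q (d.1 (q + 1)) +
        groundOnes m n i (q + 1) (d.1 (q + 1)) - n := by rw [excess, add_sub_cancel_right]
    rw [upperWord_eq d.2 hT (q + 1), upperWord_eq d.2 hT (q + 1 + 1), CrystalData.sig_append,
      CrystalData.sig_append]
    simp only [cancel, c1, c2] at *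
    rcases g3 with ⟨g3, g7⟩ | g3 | g3
    · have g8 : groundOnes m n i (q + 1 + 1) (d.1 (q + 1 + 1)) =
          groundOnes m n i (q + 1 + 1) (d.1 (q + 1)) := by rw [g3]
      rw [g7]
      simp only
      omega
    · omega
    · omega

/-- Bounds for the positions of the walls that also enclose the position `q`. -/
theorem exists_bounds_around (d : DomainSeq m n) (q : ℤ) : ∃ J T : ℤ, J ≤ 0 ∧ J % 2 = 0 ∧
    T % 2 = 1 ∧ J < q - 4 ∧ q < T ∧ (∀ k ∈ walls d.1, J ≤ k) ∧ ∀ k ∈ walls d.1, k < T := by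
  obtain ⟨J, r, hJ, h⟩ := exists_bounds d
  refine ⟨2 * (min J (q - 5) / 2), 2 * (max (J + r) (q + 1) / 2) + 1, by omega, by omega, by omega,
    by omega, by omega, fun k hk => ?_, fun k hk => ?_⟩ <;> have := h k hk <;> omega

theorem pathφ_toPath (hN : 0 < m - n) (d : DomainSeq m n) :
    pathφ m n i (toPath d) = (particleCrystal.sig i (toState d).2).2 := by
  obtain ⟨J, T, hJ0, hJ2, hT2, h1, h2, hJ, hT⟩ := exists_bounds_around d 0
  rw [pathφ_eq (toPath d) (d.2.inRange J) (J := J + 1) (fun k hk => by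
    show ground m n k (d.1 k) = _
    rw [eq_of_le_walls hJ (by omega)]), add_sub_cancel_right]
  have h3 := onesRight_toPath (i := i) hN d hJ hJ2 hJ2 le_rfl
  have h4 := zerosLeft_toPath (i := i) hN d hT hT2 hJ2 (by omega)
  rw [lowerWord_of_le le_rfl, CrystalData.sig_nil] at h3
  rw [toState_eq_append d hJ0 (by omega) hJ hT J, lowerWord_of_le le_rfl, List.append_nil,
    upperWord_eq d.2 hT, CrystalData.sig_append]
  obtain ⟨g1, g2⟩ := sig_block_even (i := i) (d.2.inRange J) (d.2.inRange (J + 1)) (k := J) hJ2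
  simp only [cancel] at *
  omega

theorem pathε_toPath (hN : 0 < m - n) (d : DomainSeq m n) :
    pathε m n i (toPath d) = (particleCrystal.sig i (toState d).2).1 := by
  obtain ⟨J, T, hJ0, hJ2, hT2, h1, h2, hJ, hT⟩ := exists_bounds_around d 0
  rw [pathε_eq (toPath d) (d.2.inRange T) (K := T - 1) (fun k hk => by
    show ground m n k (d.1 k) = _
    rw [eq_of_walls_lt hT (by omega)])]
  have h3 := onesRight_toPath (i := i) hN d hJ hJ2 (q := T - 1) (by omega) (by omega)
  have h4 := zerosLeft_toPath (i := i) hN d hT hT2 (q := T - 1) (by omega) (by omega)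
  have h5 := lowerWord_succ d.2 hJ (T - 1)
  obtain ⟨g1, g2⟩ := sig_block_even (i := i) (d.2.inRange (T - 1)) (d.2.inRange (T - 1 + 1))
    (k := T - 1) (by omega)
  rw [sub_add_cancel] at h4 h5 g1 g2
  rw [upperWord_of_le le_rfl, CrystalData.sig_nil] at h4
  rw [toState_eq_append d hJ0 (by omega) hJ hT T, upperWord_of_le le_rfl, List.nil_append, h5,
    CrystalData.sig_append]
  simp only [cancel] at *
  omega

/-! ### Degrees -/

theorem sum_mode_particles (k : ℤ) (w : Elem) :
    ((w.particles k).map mode).sum = w.degree k := by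
  cases w <;> simp only [Elem.particles, Elem.degree] <;> (try split_ifs) <;> simp [mode] <;> omega

theorem sum_mode_block (k : ℤ) (y x : ℤ × ℤ) : ((block m n k y x).map mode).sum =
    ((wallWord m n k y x).map (Elem.degree k)).sum := by
  unfold block
  induction wallWord m n k y x with
  | nil => rfl
  | cons w v ih =>
    rw [List.flatMap_cons, List.map_append, List.sum_append, ih, List.map_cons, List.sum_cons,
      sum_mode_particles]

theorem sum_mode_blocks (d : ℤ → ℤ × ℤ) (J : ℤ) (r : ℕ) : ((blocks m n d J r).map mode).sum =
    ∑ k ∈ Finset.Ico J (J + r), ((wallWord m n k (d (k + 1)) (d k)).map (Elem.degree k)).sum := by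
  induction r with
  | zero => simp [blocks]
  | succ r ih =>
    have e : Finset.Ico J (J + (r + 1 : ℕ)) = insert (J + (r : ℤ)) (Finset.Ico J (J + r)) := by
      ext k
      simp only [Finset.mem_Ico, Finset.mem_insert]
      push_cast
      omega
    rw [blocks, List.map_append, List.sum_append, ih, sum_mode_block, e,
      Finset.sum_insert (by simp)]

theorem domainDegree_eq (d : DomainSeq m n) :
    domainDegree m n d.1 = ((toState d).2.map mode).sum := by
  obtain ⟨J, r, hJ, h⟩ := exists_bounds d
  rw [toState_eq_blocks d hJ h, sum_mode_blocks]
  refine finsum_eq_sum_of_support_subset _ fun k hk => ?_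
  rw [Function.mem_support, ← sum_mode_block] at hk
  rw [Finset.coe_Ico]
  refine h k fun hc => hk ?_
  rw [hc, block_self (d.2.inRange k)]
  rfl

theorem wt_degree (w : List Particle) :
    (particleCrystal.tensorPowers.wt w).2.2 = (w.map mode).sum := by
  show (w.map particleCrystal.wt).sum.2.2 = _
  induction w with
  | nil => rfl
  | cons A v ih =>
    rw [List.map_cons, List.sum_cons, List.map_cons, List.sum_cons, ← ih]
    cases A with
    | half s j l => rw [particleCrystal_wt_half]; rfl
    | zero s t l => rw [particleCrystal_wt_zero]; rfl

end

section
variable {m n : ℤ} {x : ℤ × ℤ} {i : Fin 2} {s s' : ℤˣ} {l : ℤ} {d : ℕ}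

/-! ### The Kashiwara operators on domain walls -/

theorem blocks_congr {d d' : ℤ → ℤ × ℤ} {J : ℤ} {r : ℕ}
    (h : ∀ k, J ≤ k → k ≤ J + r → d' k = d k) : blocks m n d' J r = blocks m n d J r := by
  induction r with
  | zero => rfl
  | succ r ih =>
    push_cast at h
    rw [blocks, blocks, ih fun k h1 h2 => h k h1 (by omega), h _ (by omega) (by omega),
      h _ (by omega) (by omega)]

/-- Replacing the domains at two successive positions. -/
theorem exists_replacement (d : DomainSeq m n) {q J T : ℤ} (hJ0 : J ≤ 0)
    (hJ : ∀ k ∈ walls d.1, J ≤ k) (hT : ∀ k ∈ walls d.1, k < T) (hJq : J < q - 2) (hqT : q < T)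
    {y z : ℤ × ℤ} (hy : InRange m n y) (hz : InRange m n z)
    (h1 : d.1 (q + 1) ≠ y → WallAllowed m n q (d.1 (q + 1)) y)
    (h2 : y ≠ z → WallAllowed m n (q - 1) y z)
    (h3 : z ≠ d.1 (q - 2) → WallAllowed m n (q - 2) z (d.1 (q - 2))) :
    ∃ d' : DomainSeq m n, (∀ k, d'.1 k = if k = q then y else if k = q - 1 then z else d.1 k) ∧
      toState d = (d.1 J, upperWord m n d.1 T (q + 1) ++ (block m n q (d.1 (q + 1)) (d.1 q) ++
        (block m n (q - 1) (d.1 q) (d.1 (q - 1)) ++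
          (block m n (q - 2) (d.1 (q - 1)) (d.1 (q - 2)) ++ lowerWord m n d.1 J (q - 2))))) ∧
      toState d' = (d.1 J, upperWord m n d.1 T (q + 1) ++ (block m n q (d.1 (q + 1)) y ++
        (block m n (q - 1) y z ++
          (block m n (q - 2) z (d.1 (q - 2)) ++ lowerWord m n d.1 J (q - 2))))) := by
  -- the words of a sequence of domains at `q`, `q - 1` and `q - 2` are split off
  have split : ∀ d : DomainSeq m n, (∀ k ∈ walls d.1, J ≤ k) → (∀ k ∈ walls d.1, k < T) →
      toState d = (d.1 J, upperWord m n d.1 T (q + 1) ++ (block m n q (d.1 (q + 1)) (d.1 q) ++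
        (block m n (q - 1) (d.1 q) (d.1 (q - 1)) ++
          (block m n (q - 2) (d.1 (q - 1)) (d.1 (q - 2)) ++ lowerWord m n d.1 J (q - 2))))) := by
    intro d hJ hT
    have e1 := lowerWord_succ d.2 hJ (q - 1)
    have e2 := lowerWord_succ d.2 hJ (q - 2)
    rw [sub_add_cancel] at e1
    rw [show q - 2 + 1 = q - 1 by ring] at e2
    rw [toState_eq_append d hJ0 (by omega) hJ hT (q + 1), lowerWord_succ d.2 hJ q, e1, e2]
  let d' : ℤ → ℤ × ℤ := fun k => if k = q then y else if k = q - 1 then z else d.1 k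
  have e0 : d' q = y := if_pos rfl
  have e1 : d' (q - 1) = z := (if_neg (by omega)).trans (if_pos rfl)
  have e2 : ∀ k, k ≠ q → k ≠ q - 1 → d' k = d.1 k := fun k h h' =>
    (if_neg h).trans (if_neg h')
  have hw : ∀ k ∈ walls d', k ∈ ({q, q - 1, q - 2} : Set ℤ) ∨ k ∈ walls d.1 := by
    intro k hk
    by_contra hc
    push Not at hc
    simp only [Set.mem_insert_iff, Set.mem_singleton_iff, not_or] at hc
    apply hc.2
    have hk' : d' (k + 1) ≠ d' k := hk
    rwa [e2 _ (by omega) (by omega), e2 _ (by omega) (by omega)] at hk'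
  have hd' : IsDomainSeq m n d' := by
    refine ⟨fun k => ?_, ((Set.toFinite ({q, q - 1, q - 2} : Set ℤ)).union d.2.finite).subset hw,
      fun k hk => ?_⟩
    · simp only [d']
      split_ifs
      exacts [hy, hz, d.2.inRange k]
    · have hk' : d' (k + 1) ≠ d' k := hk
      by_cases hq : k = q ∨ k = q - 1 ∨ k = q - 2
      · rcases hq with rfl | rfl | rfl
        · rw [e0, e2 _ (by omega) (by omega)] at hk' ⊢
          exact h1 hk'
        · rw [sub_add_cancel, e0, e1] at hk' ⊢
          exact h2 hk'
        · rw [show q - 2 + 1 = q - 1 by ring, e1, e2 (q - 2) (by omega) (by omega)] at hk' ⊢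
          exact h3 hk'
      · rw [e2 (k + 1) (by omega) (by omega), e2 k (by omega) (by omega)] at hk' ⊢
        exact d.2.allowed k hk'
  refine ⟨⟨d', hd'⟩, fun k => rfl, split d hJ hT, ?_⟩
  have hJ' : ∀ k ∈ walls d', J ≤ k := fun k hk => by
    rcases hw k hk with h | h
    · simp only [Set.mem_insert_iff, Set.mem_singleton_iff] at h; omega
    · exact hJ k h
  have hT' : ∀ k ∈ walls d', k < T := fun k hk => by
    rcases hw k hk with h | h
    · simp only [Set.mem_insert_iff, Set.mem_singleton_iff] at h; omega
    · exact hT k h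
  have hU : upperWord m n d' T (q + 1) = upperWord m n d.1 T (q + 1) :=
    blocks_congr fun k h1 _ => e2 k (by omega) (by omega)
  have hV : lowerWord m n d' J (q - 2) = lowerWord m n d.1 J (q - 2) :=
    blocks_congr fun k _ h2 => e2 k (by omega) (by omega)
  have := split ⟨d', hd'⟩ hJ' hT'
  simp only [e0, e1, e2 J (by omega) (by omega), e2 (q + 1) (by omega) (by omega),
    e2 (q - 2) (by omega) (by omega), hU, hV] at this
  exact this

/-- A spin-1/2 particle that merges with the word of a wall at an even position to its left. The
hypotheses on `i` say that both carry the same letter, so that their superscripts agree. -/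
theorem meq_block_snoc_half {Y : ℤ × ℤ} (hx : InRange m n x) (hy : InRange m n (x.1 + s, x.2))
    (hY : InRange m n Y) (hs : ¬ active i s l)
    (hφ : (particleCrystal.sig i (block m n (-2 * l) Y (x.1 + s, x.2))).2 = 0) :
    ∃ (s' : ℤˣ) (d α β : ℕ), (d : ℤ) = dist (m - n) s x.1 ∧ (s' = s ∨ β ≤ d + (α + 1)) ∧
      Y = target x (evenWord s s' l d (α + 1) β) ∧
      MEq m n x (block m n (-2 * l) Y (x.1 + s, x.2) ++ [Hp s l])
        (evenWord s s' l d (α + 1) β) := by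
  obtain ⟨t, s', e, α, β, h1, h2, h3, h4, h5⟩ := exists_evenWord_of_sign hy hY l s
  obtain rfl : t = s := by
    -- an empty group of spin-1/2 particles may be given the superscript `s`
    rcases Nat.eq_zero_or_pos α with h | h
    · exact h5 h
    · rw [h4, sig_evenWord _ _ h2] at hφ
      rcases particleCrystal_Hp i t l with ⟨-, -, h6, -⟩ | ⟨h6, -⟩
      · rw [h6] at hφ
        simp only at hφ
        omega
      · exact eq_of_not_active hs h6
  have hd := dist_add (m - n) t x.1 1
  have hd0 := dist_nonneg (s := t) hx.1 hx.2.1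
  rw [mul_one] at hd
  simp only at h1 h3
  obtain ⟨d, rfl⟩ : ∃ d, e = d + 1 := ⟨e - 1, by omega⟩
  have h2' : s' = t ∨ β ≤ d + (α + 1) := h2.imp_right (by omega)
  refine ⟨s', d, α, β, by push_cast at h1; omega, h2', ?_, ?_⟩
  · rw [target_evenWord _ _ h2', h3, Prod.mk.injEq]
    push_cast
    constructor <;> ring
  · rw [h4]
    refine meq_evenWord_snoc_half hx.1 hx.2.1 (by push_cast at h1; omega)
      (h2.imp_right (by omega)) fun h6 => ?_
    subst h6
    have g1 := hx.1
    have g2 := hx.2.1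
    have g3 := hY.1
    have g4 := hY.2.1
    rw [h3] at g3 g4
    simp only at g3 g4
    rcases Int.units_eq_one_or s' with rfl | rfl <;>
      simp only [Units.val_neg, Units.val_one] at g3 g4 ⊢ <;> omega

theorem meq_block_snoc_half' {Y : ℤ × ℤ} (hx : InRange m n x) (hy : InRange m n (x.1 + s, x.2))
    (hY : InRange m n Y) (hs : ¬ active i s l)
    (hφ : (particleCrystal.sig i (block m n (-2 * l) Y (x.1 + s, x.2))).2 = 0) :
    MEq m n x (block m n (-2 * l) Y (x.1 + s, x.2) ++ [Hp s l]) (block m n (-2 * l) Y x) := by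
  obtain ⟨s', d, α, β, h1, h2, rfl, h4⟩ := meq_block_snoc_half hx hy hY hs hφ
  rwa [block_target_evenWord h1 h2 hx hY]

/-- A pair of particles at the boundary that merges with the word of a wall at an even position. -/
theorem meq_block_snoc_pair {Y : ℤ × ℤ} (hN : 0 < m - n) (hx : InRange m n x)
    (hb : x.1 = bdry (m - n) s) (hy : InRange m n (x.1, x.2 + (Zp s l).db))
    (hY : InRange m n Y) (hs : ¬ active i (-s) l)
    (hφ : (particleCrystal.sig i (block m n (-2 * l) Y (x.1, x.2 + (Zp s l).db))).2 = 0) :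
    MEq m n x (block m n (-2 * l) Y (x.1, x.2 + (Zp s l).db) ++ [Hp (-s) l, Zp s l])
      (block m n (-2 * l) Y x) := by
  have e : (x.1, x.2 + (Zp s l).db) =
      ((x.1 + s, x.2 + (Zp s l).db).1 + ((-s : ℤˣ) : ℤ), (x.1 + s, x.2 + (Zp s l).db).2) := by
    simp
  have hx1 : InRange m n (x.1 + s, x.2 + (Zp s l).db) := by
    obtain ⟨h1, h2, h3, h4⟩ := hy
    unfold bdry at hb
    refine ⟨?_, ?_, h3, h4⟩ <;>
      rcases Int.units_eq_one_or s with rfl | rfl <;> simp at hb h1 h2 ⊢ <;> omega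
  have hyy := hy
  rw [e] at hφ hy
  obtain ⟨s', d, α, β, h1, h2, h3, h4⟩ := meq_block_snoc_half hx1 hy hY hs hφ
  rw [← e] at h4
  simp only at h1
  have h5 : ∀ v, target x (v ++ [Zp s l]) = target (x.1 + s, x.2 + (Zp s l).db) v := fun v => by
    rw [target_append, target_cons, target_nil, sg_Zp]
  have hx0 : dist (m - n) (-s) x.1 = m - n ∧
      dist (m - n) (-s) (x.1 + s) = m - n - 1 := by
    unfold bdry at hb
    unfold dist
    rcases Int.units_eq_one_or s with rfl | rfl <;> simp at hb ⊢ <;> omega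
  rw [hx0.2] at h1
  -- after a first spin-1/2 particle with the superscript `-s` the boundary is reached, and there is
  -- no room for spin-0 particles with the same superscript
  obtain ⟨β, hβ, h6⟩ : ∃ β', evenWord (-s) s' l d (α + 1) β = evenWord (-s) s l d (α + 1) β' ∧
      β' ≤ d + (α + 1) := by
    rcases eq_or_eq_neg (-s) s' with rfl | rfl
    · have h7 := hY.1
      have h8 := hY.2.1
      rw [h3, target_evenWord _ _ h2] at h7 h8
      obtain rfl : β = 0 := by
        unfold bdry at hb
        rcases Int.units_eq_one_or s with rfl | rfl <;> simp at hb h7 h8 ⊢ <;> omega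
      refine ⟨0, ?_, by omega⟩
      rw [evenWord_of_eq (Or.inl rfl), evenWord_of_eq (Or.inr (by omega))]
      rfl
    · rw [neg_neg] at h2 ⊢
      exact ⟨β, rfl, h2.resolve_left (units_ne_neg s)⟩
  rw [hβ] at h3 h4
  have h7 := evenWord_snoc_zero (s := -s) (s' := s) (l := l) (d := d) (d' := d + 1) (α := α + 1)
    (β := β) (Or.inr rfl)
  have h8 : Y = target x (evenWord (-s) s l (d + 1) (α + 1) (β + 1)) := by
    rw [← h7, h5, h3]
  have h9 := block_target_evenWord (m := m) (n := n) (x := x) (s := -s) (s' := s) (l := l)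
    (d := d + 1) (α := α + 1) (β := β + 1) (by rw [hx0.1]; push_cast; omega) (Or.inr (by omega)) hx
    (by rw [← h8]; exact hY)
  rw [← h8] at h9
  rw [h9, ← h7]
  have e1 : block m n (-2 * l) Y (x.1, x.2 + (Zp s l).db) ++ [Hp (-s) l, Zp s l] =
      (block m n (-2 * l) Y (x.1, x.2 + (Zp s l).db) ++ [Hp (-s) l]) ++ [Zp s l] := by simp
  rw [e1]
  exact h4.append_right [Zp s l]

end

section
variable {m n : ℤ} {x : ℤ × ℤ} {i : Fin 2} {s s' : ℤˣ} {l : ℤ}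

/-- Factors on the left without surviving `0`s are not affected by `f_i`. -/
theorem listF_append_of_φ_eq_zero {U W : List Particle} (h : (particleCrystal.sig i U).2 = 0) :
    particleCrystal.listF i (U ++ W) = (particleCrystal.listF i W).map (U ++ ·) := by
  rw [CrystalData.listF_append, h, if_neg (by omega)]

theorem listF_Zp_cons (w : List Particle) : particleCrystal.listF i (Zp s l :: w) =
    (particleCrystal.listF i w).map (Zp s l :: ·) := by
  rw [CrystalData.listF, particleCrystal_φ_Zp, if_neg (by omega)]

theorem listF_Hp_cons {w : List Particle} (h : active i s l)
    (hw : (particleCrystal.sig i w).1 = 0) :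
    particleCrystal.listF i (Hp s l :: w) = some (Hp s (l - 1) :: w) := by
  rcases particleCrystal_Hp i s l with ⟨-, -, h1, h2⟩ | ⟨h1, -⟩
  · rw [CrystalData.listF, hw, h1, h2]
    rfl
  · exact absurd h h1

/-- The action of `f_i` on a sequence of domains changes the path at `q` and agrees with the action
on the particles up to exchanges of particles of different spin. -/
def ActsAt (i : Fin 2) (d : DomainSeq m n) (q : ℤ) : Prop :=
  ∃ (d' : DomainSeq m n) (w : List Particle),
    (toPath d').1 = Function.update (toPath d).1 q ((toPath d).1 q + change i) ∧
    (toState d').1 = (toState d).1 ∧ particleCrystal.listF i (toState d).2 = some w ∧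
    MEq m n (toState d).1 w (toState d').2

/-- If the domains change only at `q` and `q - 1`, it suffices to compare these two values of the
path. -/
theorem toPath_eq_update {d d' : DomainSeq m n} {q : ℤ} {y z : ℤ × ℤ}
    (h : ∀ k, d'.1 k = if k = q then y else if k = q - 1 then z else d.1 k)
    (h1 : ground m n q y = ground m n q (d.1 q) + change i)
    (h2 : ground m n (q - 1) z = ground m n (q - 1) (d.1 (q - 1))) :
    (toPath d').1 = Function.update (toPath d).1 q ((toPath d).1 q + change i) := by
  funext k
  show ground m n k (d'.1 k) = _
  rw [h]
  split_ifs with h3 h4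
  · subst h3
    rw [Function.update_self]
    exact h1
  · subst h4
    rw [Function.update_of_ne h3]
    exact h2
  · rw [Function.update_of_ne h3]
    rfl

/-- Moving by `-s` in the first coordinate changes the path at an even position. -/
theorem ground_sub_half (hs : active i s l) (z : ℤ × ℤ) :
    ground m n (-2 * (l - 1)) z =
      ground m n (-2 * (l - 1)) (z.1 + s, z.2) + change i := by
  have h1 : ¬ (-2 * (l - 1)) % 2 = 1 := by omega
  have h2 : (-2 * (l - 1)) % 4 = 0 ↔ ¬ l % 2 = 0 := by omega
  have hi : i = 0 ∨ i = 1 := by fin_cases i <;> simp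
  unfold active at hs
  unfold ground change
  simp only [h1, h2, if_false]
  rcases Int.units_eq_one_or s with rfl | rfl <;> rcases hi with rfl | rfl <;>
    by_cases hl : l % 2 = 0 <;> simp [hl] at hs ⊢ <;> omega

/-- At an odd position, the path depends only on the second coordinate of the domain. -/
theorem ground_odd {q : ℤ} (hq : q % 2 = 1) (z : ℤ × ℤ) : ground m n q z = n - z.2 := if_pos hq

variable {d : DomainSeq m n} {J T : ℤ}

/-- A spin-1/2 particle away from the boundary moves to the next even position. -/
theorem actsAt_of_half (hN : 0 < m - n) (hJ0 : J ≤ 0) (hJ : ∀ k ∈ walls d.1, J ≤ k)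
    (hT : ∀ k ∈ walls d.1, k < T) {q : ℤ} (hq : q % 2 = 0) (hJq : J < q - 2) (hqT : q < T)
    (hyz : d.1 q = d.1 (q - 1))
    (hU : (particleCrystal.sig i (upperWord m n d.1 T (q + 1) ++
      block m n q (d.1 (q + 1)) (d.1 q))).2 = 0)
    (hB : (particleCrystal.sig i (block m n q (d.1 (q + 1)) (d.1 q))).2 = 0)
    (hV : (particleCrystal.sig i (lowerWord m n d.1 J (q - 2))).1 <
      (particleCrystal.sig i (block m n (q - 2) (d.1 (q - 1)) (d.1 (q - 2)))).2)
    (hX : 0 < excess m n i (q - 1) (d.1 (q - 1))) : ActsAt i d q := by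
  obtain ⟨l, rfl⟩ : ∃ l, q = -2 * (l - 1) := ⟨1 - q / 2, by omega⟩
  have e1 : -2 * (l - 1) - 1 = -2 * l + 1 := by ring
  have e2 : -2 * (l - 1) - 2 = -2 * l := by ring
  have hV0 := target_lowerWord hN d.2 (J := J) (q := -2 * l) (by omega)
  rw [e1, e2] at hV
  rw [e1] at hyz hX
  obtain ⟨s, s', e, α, β, g1, g2, g3, g4⟩ := exists_evenWord (d.2.inRange (-2 * l))
    (d.2.inRange (-2 * l + 1)) l
  rw [g4, sig_evenWord _ _ g2] at hV
  obtain ⟨hs, hα⟩ : active i s l ∧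
      (particleCrystal.sig i (lowerWord m n d.1 J (-2 * l))).1 < α := by
    rcases particleCrystal_Hp i s l with ⟨h1, -, h2, -⟩ | ⟨-, -, h2⟩ <;> rw [h2] at hV
    · exact ⟨h1, by omega⟩
    · simp at hV
  obtain ⟨α, rfl⟩ : ∃ a, α = a + 1 := ⟨α - 1, by omega⟩
  rw [excess_eq_dist hs] at hX
  have hd := dist_add (m - n) s (d.1 (-2 * l + 1)).1 (-1)
  have hr := d.2.inRange (-2 * l + 1)
  -- the particle may be removed from the wall, since the distance from the boundary is positive
  have g2' : s' = s ∨ β ≤ e + α := by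
    refine (eq_or_eq_neg s s').imp_right fun h => ?_
    have h1 : (d.1 (-2 * l + 1)).1 = (d.1 (-2 * l)).1 + s * (((α + 1 : ℕ) : ℤ) - β) := by
      rw [g3, h]; push_cast; ring
    rw [h1, dist_add] at hX
    omega
  have hz : InRange m n ((d.1 (-2 * l + 1)).1 + s * (-1), (d.1 (-2 * l + 1)).2) := by
    rw [inRange_iff_dist s] at hr ⊢
    simp only [hd]
    omega
  have ht : target (d.1 (-2 * l)) (evenWord s s' l e α β) =
      ((d.1 (-2 * l + 1)).1 + s * (-1), (d.1 (-2 * l + 1)).2) := by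
    rw [target_evenWord _ _ g2', g3, Prod.mk.injEq]
    push_cast
    exact ⟨by ring, rfl⟩
  have hb := block_target_evenWord g1 g2' (d.2.inRange _) (l := l) (ht ▸ hz)
  rw [ht] at hb
  -- `z` is the domain at `q` and `q - 1` after the removal of the particle
  have hback : ∃ z : ℤ × ℤ, z = ((d.1 (-2 * l + 1)).1 + (s : ℤ) * (-1), (d.1 (-2 * l + 1)).2) ∧
      (z.1 + (s : ℤ), z.2) = d.1 (-2 * (l - 1)) :=
    ⟨_, rfl, by rw [hyz]; exact Prod.ext (by simp) rfl⟩
  obtain ⟨z, hz', hback⟩ := hback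
  rw [← hz'] at ht hb hz
  -- the new walls: one particle less at `q - 2`, and one more at `q`
  obtain ⟨d', hd', h1, h2⟩ := exists_replacement d (q := -2 * (l - 1)) hJ0 hJ hT hJq hqT hz hz
    (fun _ => Or.inl hq) (fun h => absurd rfl h) (fun _ => Or.inl (by omega))
  rw [e1, e2, block_self hz, hb, List.nil_append] at h2
  rw [e1, e2, hyz, block_self (d.2.inRange _), g4, evenWord_cons_half g2', ← hyz,
    List.nil_append, ← List.append_assoc] at h1
  -- `f_i` acts on the first particle of the wall at `q - 2`
  have hw := listF_append_of_φ_eq_zero (W := Hp s l :: evenWord s s' l e α β ++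
    lowerWord m n d.1 J (-2 * l)) hU
  rw [List.cons_append, listF_Hp_cons hs (by
    rw [CrystalData.sig_append, sig_evenWord _ _ g2']
    rcases particleCrystal_Hp i s l with ⟨-, h3, h4, -⟩ | ⟨h3, -⟩
    · rw [h3, h4]
      simp only [cancel, mul_one, mul_zero]
      omega
    · exact absurd hs h3), Option.map_some] at hw
  refine ⟨d', _, toPath_eq_update hd' ?_ ?_, by rw [h1, h2], (congrArg _ (by rw [h1]; rfl)).trans hw, ?_⟩
  · rw [ground_sub_half hs, hback]
  · rw [ground_odd (by omega), ground_odd (by omega), e1, hz']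
  · rw [h1, h2]
    simp only
    have h3 := meq_block_snoc_half' (x := z) (s := s) (l := l - 1) (i := i)
      (Y := d.1 (-2 * (l - 1) + 1)) hz (by rw [hback]; exact d.2.inRange _)
      (d.2.inRange (-2 * (l - 1) + 1)) (by rw [active_sub_one, not_not]; exact hs)
      (by rw [hback]; exact hB)
    rw [hback] at h3
    have h4 : target (d.1 J) (evenWord s s' l e α β ++ lowerWord m n d.1 J (-2 * l)) = z := by
      rw [target_append, hV0, ht]
    rw [← h4] at h3
    have h5 := h3.append_right.append_left (upperWord m n d.1 T (-2 * (l - 1) + 1))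
    rw [h4] at h5
    simpa only [List.append_assoc, List.cons_append, List.nil_append] using h5

theorem target_oddWord (l' : ℤ) (D : ℕ) : target x
    (List.replicate D [Hp (-s) l, Zp s l']).flatten = (x.1, x.2 + D * (Zp s l').db) := by
  induction D with
  | zero => simp [target_nil]
  | succ D ih =>
    rw [List.replicate_succ, List.flatten_cons, target_append, ih]
    simp only [target_cons, target_nil, sg_Hp, db_Hp, sg_Zp, Prod.mk.injEq]
    push_cast
    constructor <;> ring

/-- The spin-1/2 particle of a boundary pair at an odd position moves to the even position on the
left. -/
theorem actsAt_of_pair (hN : 0 < m - n) (hJ0 : J ≤ 0) (hJ : ∀ k ∈ walls d.1, J ≤ k)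
    (hT : ∀ k ∈ walls d.1, k < T) {q : ℤ} (hq : q % 2 = 0) (hJq : J < q - 2) (hqT : q < T)
    (hyz : d.1 q ≠ d.1 (q - 1))
    (hU : (particleCrystal.sig i (upperWord m n d.1 T (q + 1) ++
      block m n q (d.1 (q + 1)) (d.1 q))).2 = 0)
    (hB : (particleCrystal.sig i (block m n q (d.1 (q + 1)) (d.1 q))).2 = 0)
    (hV : (particleCrystal.sig i (lowerWord m n d.1 J (q - 1))).1 <
      (particleCrystal.sig i (block m n (q - 1) (d.1 q) (d.1 (q - 1)))).2) : ActsAt i d q := by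
  obtain ⟨l, rfl⟩ : ∃ l, q = -2 * (l - 1) := ⟨1 - q / 2, by omega⟩
  have e1 : -2 * (l - 1) - 1 = -2 * l + 1 := by ring
  have e3 : -2 * l + 1 + 1 = -2 * (l - 1) := by ring
  have hV0 := target_lowerWord hN d.2 (J := J) (q := -2 * (l - 1) - 1) (by omega)
  have hV1 := lowerWord_succ d.2 hJ (-2 * (l - 1) - 2)
  rw [show -2 * (l - 1) - 2 + 1 = -2 * (l - 1) - 1 by ring] at hV1
  have hw := d.2.allowed (-2 * l + 1)
    (by show d.1 (-2 * l + 1 + 1) ≠ d.1 (-2 * l + 1); rwa [e3, ← e1])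
  rw [e3] at hw
  obtain ⟨s, D, g1, g2, g3⟩ := exists_oddWord hN l hw
  rw [e1] at hV hV0 hV1 hyz
  rw [g3, sig_oddWord] at hV
  obtain ⟨hs, hD⟩ : active i (-s) l ∧
      (particleCrystal.sig i (lowerWord m n d.1 J (-2 * l + 1))).1 < D := by
    rcases particleCrystal_Hp i (-s) l with ⟨h1, -, h2, -⟩ | ⟨-, -, h2⟩ <;> rw [h2] at hV
    · exact ⟨h1, by omega⟩
    · simp at hV
  obtain ⟨D, rfl⟩ : ∃ a, D = a + 1 := ⟨D - 1, by omega⟩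
  have hr := d.2.inRange (-2 * l + 1)
  have hr' := d.2.inRange (-2 * (l - 1))
  obtain ⟨y, hy⟩ : ∃ y : ℤ × ℤ, y = ((d.1 (-2 * l + 1)).1,
    (d.1 (-2 * l + 1)).2 + D * (Zp s (l - 1)).db) := ⟨_, rfl⟩
  have hback : (y.1, y.2 + (Zp s (l - 1)).db) = d.1 (-2 * (l - 1)) := by
    rw [g2, hy, Prod.mk.injEq]
    push_cast
    exact ⟨rfl, by ring⟩
  have hyr : InRange m n y := by
    rw [g2] at hr'
    rw [hy]
    obtain ⟨h1, h2, h3, h4⟩ := hr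
    obtain ⟨-, -, h5, h6⟩ := hr'
    refine ⟨h1, h2, ?_, ?_⟩ <;> rcases db_Zp_eq s (l - 1) with h | h <;>
      simp only [h] at h5 h6 ⊢ <;> push_cast at h5 h6 <;> omega
  -- the new walls: one boundary pair less at `q - 1`, and its particles are merged into the wall at
  -- `q`
  obtain ⟨d', hd', h1, h2⟩ := exists_replacement d (q := -2 * (l - 1)) hJ0 hJ hT hJq hqT hyr
    (z := d.1 (-2 * (l - 1) - 1)) (d.2.inRange _) (fun _ => Or.inl hq) (fun h => by
      rw [e1] at h ⊢
      obtain ⟨D, rfl⟩ | rfl : (∃ a, D = a + 1) ∨ D = 0 := by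
        rcases D with - | D
        exacts [Or.inr rfl, Or.inl ⟨D, rfl⟩]
      · exact wallAllowed_odd g1 hy
      · exact absurd (by rw [hy]; simp) h) (fun _ => Or.inl (by omega))
  rw [e1] at h1 h2
  rw [block_odd hN l s D g1 (by rw [hy]; ring), ← hV1] at h2
  rw [g3, List.replicate_succ, List.flatten_cons, ← List.append_assoc, ← hV1] at h1
  -- `f_i` acts on the first boundary pair of the wall at `q - 1`
  have hw := listF_append_of_φ_eq_zero (W := Hp (-s) l :: Zp s (l - 1) ::
    (List.replicate D [Hp (-s) l, Zp s (l - 1)]).flatten ++ lowerWord m n d.1 J (-2 * l + 1)) hU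
  rw [List.cons_append, List.cons_append, listF_Hp_cons hs (by
    rw [CrystalData.sig_cons, particleCrystal_ε_Zp, particleCrystal_φ_Zp, cancel_zero_left,
      CrystalData.sig_append, sig_oddWord]
    rcases particleCrystal_Hp i (-s) l with ⟨-, h3, h4, -⟩ | ⟨h3, -⟩
    · rw [h3, h4]
      simp only [cancel, mul_one, mul_zero]
      omega
    · exact absurd hs h3), Option.map_some] at hw
  refine ⟨d', _, toPath_eq_update hd' ?_ rfl, by rw [h1, h2],
    (congrArg _ (by rw [h1]; simp)).trans hw, ?_⟩
  · have h3 := (change_mul_db i s l).2 (active_neg.1 hs)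
    have h4 := ground_sub (m := m) (n := n) (x := y) (-2 * (l - 1))
      (d.1 (-2 * (l - 1)))
    have h5 : lin (-2 * (l - 1)) (d.1 (-2 * (l - 1))) - lin (-2 * (l - 1)) y =
        (Zp s (l - 1)).db := by
      rw [← hback]
      have h6 : ¬ (-2 * (l - 1)) % 2 = 1 := by omega
      unfold lin
      rw [if_neg h6, if_neg h6]
      split_ifs <;> ring
    rcases db_Zp_eq s (l - 1) with h | h <;> rw [h] at h3 h5 <;> omega
  · rw [h1, h2]
    simp only
    have h3 := meq_block_snoc_pair (x := y) (s := s) (l := l - 1) (i := i)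
      (Y := d.1 (-2 * (l - 1) + 1)) hN hyr (by rw [hy]; exact g1) (by rw [hback]; exact hr')
      (d.2.inRange (-2 * (l - 1) + 1)) (by rw [active_sub_one, not_not]; exact hs)
      (by rw [hback]; exact hB)
    rw [hback] at h3
    have h4 : target (d.1 J) ((List.replicate D [Hp (-s) l, Zp s (l - 1)]).flatten ++
        lowerWord m n d.1 J (-2 * l + 1)) = y := by
      rw [target_append, hV0, target_oddWord, hy]
    rw [← h4] at h3
    have h5 := h3.append_right.append_left (upperWord m n d.1 T (-2 * (l - 1) + 1))
    rw [h4] at h5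
    simpa only [List.append_assoc, List.cons_append, List.nil_append] using h5

/-- If the mode of the spin-1/2 particle of a boundary pair at an even position is lowered by `1`,
then the exchange gives a boundary pair at an odd position. -/
theorem xch_boundary {N a : ℤ} (h : a = bdry N s) (l : ℤ) :
    xch N a (Zp (-s) l) (Hp s (l - 1)) = (Hp (-s) l, Zp s (l - 1)) := by
  rcases xch_cases N a (Zp (-s) l) (Hp s (l - 1)) with ⟨h1, -⟩ | ⟨-, h1⟩
  · rw [sg_Zp, h] at h1
    unfold bdry at h1
    rcases Int.units_eq_one_or s with rfl | rfl <;> simp at h1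
  · rw [h1, Prod.mk.injEq]
    have e1 : l % 2 = 0 ↔ ¬ (l - 1) % 2 = 0 := by omega
    constructor
    · simp only [Hp, Particle.flip, e1]
      rcases Int.units_eq_one_or s with rfl | rfl <;> by_cases h2 : (l - 1) % 2 = 0 <;> simp [h2]
    · simp only [Zp, Particle.flip, e1]
      rcases Int.units_eq_one_or s with rfl | rfl <;> by_cases h2 : (l - 1) % 2 = 0 <;> simp [h2] <;>
        ring

/-- A spin-1/2 particle at an even position next to the boundary forms a boundary pair at the odd
position on the left. -/
theorem actsAt_of_boundary (hN : 0 < m - n) (hJ0 : J ≤ 0) (hJ : ∀ k ∈ walls d.1, J ≤ k)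
    (hT : ∀ k ∈ walls d.1, k < T) {q : ℤ} (hq : q % 2 = 1) (hJq : J < q - 2) (hqT : q < T)
    (hU : (particleCrystal.sig i (upperWord m n d.1 T (q + 1) ++
      block m n q (d.1 (q + 1)) (d.1 q))).2 = 0)
    (hV : (particleCrystal.sig i (lowerWord m n d.1 J (q - 1))).1 <
      (particleCrystal.sig i (block m n (q - 1) (d.1 q) (d.1 (q - 1)))).2)
    (hX : excess m n i q (d.1 q) = 0) : ActsAt i d q := by
  obtain ⟨l, rfl⟩ : ∃ l, q = -2 * l + 1 := ⟨-(q / 2), by omega⟩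
  have e1 : -2 * l + 1 - 1 = -2 * l := by ring
  have hV0 := target_lowerWord hN d.2 (J := J) (q := -2 * l) (by omega)
  have hV1 := lowerWord_succ d.2 hJ (-2 * l + 1 - 2)
  rw [show -2 * l + 1 - 2 + 1 = -2 * l by ring] at hV1
  rw [e1] at hV
  obtain ⟨s, s', e, α, β, g1, g2, g3, g4⟩ := exists_evenWord (d.2.inRange (-2 * l))
    (d.2.inRange (-2 * l + 1)) l
  rw [g4, sig_evenWord _ _ g2] at hV
  obtain ⟨hs, hα⟩ : active i s l ∧
      (particleCrystal.sig i (lowerWord m n d.1 J (-2 * l))).1 < α := by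
    rcases particleCrystal_Hp i s l with ⟨h1, -, h2, -⟩ | ⟨-, -, h2⟩ <;> rw [h2] at hV
    · exact ⟨h1, by omega⟩
    · simp at hV
  rw [excess_eq_dist hs] at hX
  have hb := dist_eq_zero_iff.1 hX
  -- the wall at `q - 1` leads to the boundary, so its word begins with a boundary pair
  obtain ⟨rfl, hβ⟩ : s' = -s ∧ e + α = β := by
    have h0 := dist_nonneg (s := s) (d.2.inRange (-2 * l)).1 (d.2.inRange (-2 * l)).2.1
    rcases eq_or_eq_neg s s' with rfl | rfl
    · have h1 : (d.1 (-2 * l + 1)).1 = (d.1 (-2 * l)).1 + s' * ((α : ℤ) + β) := by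
        rw [g3]; ring
      rw [h1, dist_add] at hX
      omega
    · refine ⟨rfl, ?_⟩
      have h1 : (d.1 (-2 * l + 1)).1 = (d.1 (-2 * l)).1 + s * ((α : ℤ) - β) := by
        rw [g3]; push_cast; ring
      rw [h1, dist_add] at hX
      omega
  obtain ⟨α, rfl⟩ : ∃ a, α = a + 1 := ⟨α - 1, by omega⟩
  obtain ⟨β, rfl⟩ : ∃ b, β = b + 1 := ⟨β - 1, by omega⟩
  have hdb : (Zp (-s) l).db = (Zp s (l - 1)).db := by
    have h1 : l % 2 = 0 ↔ ¬ (l - 1) % 2 = 0 := by omega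
    rw [db_Zp, db_Zp]
    by_cases h2 : (l - 1) % 2 = 0 <;> simp [h1, h2]
  rw [hdb] at g3
  have hr := d.2.inRange (-2 * l + 1)
  have hr' := d.2.inRange (-2 * l)
  have g2' : -s = s ∨ β ≤ e + α := Or.inr (by omega)
  -- `z` is the domain at `q` after the removal of this pair
  obtain ⟨z, hz⟩ : ∃ z : ℤ × ℤ, z = ((d.1 (-2 * l + 1)).1,
    (d.1 (-2 * l + 1)).2 - (Zp s (l - 1)).db) := ⟨_, rfl⟩
  have ht : target (d.1 (-2 * l)) (evenWord s (-s) l e α β) = z := by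
    rw [target_evenWord _ _ g2', hz, g3, hdb, Prod.mk.injEq]
    push_cast
    constructor <;> ring
  have hzr : InRange m n z := by
    rw [← ht, target_evenWord _ _ g2', hdb]
    rw [g3] at hr
    obtain ⟨h1, h2, h3, h4⟩ := hr
    obtain ⟨-, -, h5, h6⟩ := hr'
    refine ⟨?_, ?_, ?_, ?_⟩
    · push_cast at h1 ⊢; linarith
    · push_cast at h2 ⊢; linarith
    all_goals
      rcases db_Zp_eq s (l - 1) with h | h <;>
        simp only [h] at h3 h4 ⊢ <;> push_cast at h3 h4 <;> omega
  -- the wall at `q` consists of `D` boundary pairs of the same kind, where `D = 0` is possible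
  obtain ⟨D, hD⟩ : ∃ D : ℕ, d.1 (-2 * l + 1 + 1) = ((d.1 (-2 * l + 1)).1,
      (d.1 (-2 * l + 1)).2 + D * (Zp s (l - 1)).db) := by
    by_cases h : d.1 (-2 * l + 1 + 1) = d.1 (-2 * l + 1)
    · exact ⟨0, by rw [h]; simp⟩
    · obtain ⟨t, D, h1, h2, -⟩ := exists_oddWord hN l (d.2.allowed _ h)
      obtain rfl := bdry_injective hN (hb.symm.trans h1)
      exact ⟨D, h2⟩
  have hD' : d.1 (-2 * l + 1 + 1) = (z.1, z.2 + (D + 1 : ℕ) * (Zp s (l - 1)).db) := by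
    rw [hD, hz, Prod.mk.injEq]
    push_cast
    exact ⟨rfl, by ring⟩
  have hz1 : z.1 = bdry (m - n) s := by rw [hz]; exact hb
  have hbl := block_target_evenWord g1 g2' hr' (l := l) (ht ▸ hzr)
  rw [ht] at hbl
  -- the new walls: one pair less at `q - 1`, and one boundary pair more at `q`
  obtain ⟨d', hd', h1, h2⟩ := exists_replacement d (q := -2 * l + 1) hJ0 hJ hT hJq hqT hzr
    (z := d.1 (-2 * l + 1 - 1)) (d.2.inRange _) (fun _ => wallAllowed_odd hz1 hD')
    (fun _ => Or.inl (by omega)) (fun h => by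
      have := d.2.allowed (-2 * l + 1 - 2)
      have e : -2 * l + 1 - 2 + 1 = -2 * l + 1 - 1 := by ring
      rw [walls, Set.mem_ofPred_eq, e] at this
      exact this h)
  rw [e1, ← hV1] at h1 h2
  rw [hbl, block_odd hN l (y := d.1 (-2 * l + 1 + 1)) s (D + 1) hz1 (by rw [hD']; ring),
    flatten_replicate_succ'] at h2
  rw [block_odd hN l (y := d.1 (-2 * l + 1 + 1)) s D hb (by rw [hD]; ring)] at h1 hU
  rw [g4, evenWord_cons_pair rfl (by omega), ← List.append_assoc] at h1
  have hw := listF_append_of_φ_eq_zero (W := Zp (-s) l :: Hp s l :: evenWord s (-s) l e α β ++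
    lowerWord m n d.1 J (-2 * l)) hU
  rw [List.cons_append, List.cons_append, listF_Zp_cons, listF_Hp_cons hs (by
    rw [CrystalData.sig_append, sig_evenWord _ _ g2']
    rcases particleCrystal_Hp i s l with ⟨-, h3, h4, -⟩ | ⟨h3, -⟩
    · rw [h3, h4]
      simp only [cancel, mul_one, mul_zero]
      omega
    · exact absurd hs h3), Option.map_some, Option.map_some] at hw
  refine ⟨d', _, toPath_eq_update hd' ?_ rfl, by rw [h1, h2],
    (congrArg _ (by rw [h1]; rfl)).trans hw, ?_⟩
  · rw [ground_odd hq, ground_odd hq, hz]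
    have h3 := (change_mul_db i s l).1 hs
    rcases db_Zp_eq s (l - 1) with h | h <;> rw [h] at h3 ⊢ <;> simp only <;> omega
  · rw [h1, h2]
    simp only
    have h4 : target (d.1 J) (evenWord s (-s) l e α β ++ lowerWord m n d.1 J (-2 * l)) = z := by
      rw [target_append, hV0, ht]
    -- a single exchange brings the shifted particle into normal order
    have h3 := MEq.head (m := m) (n := n) (x := d.1 J) (A := Zp (-s) l) (B := Hp s (l - 1))
      (v := evenWord s (-s) l e α β ++ lowerWord m n d.1 J (-2 * l)) (by simp [isHalf_Zp, isHalf_Hp])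
    rw [h4, xch_boundary hz1] at h3
    have h5 := h3.append_left (upperWord m n d.1 T (-2 * l + 1 + 1) ++
      (List.replicate D [Hp (-s) l, Zp s (l - 1)]).flatten)
    simpa only [List.append_assoc, List.cons_append, List.nil_append] using h5

end

section
variable {m n : ℤ} {x : ℤ × ℤ} {i : Fin 2}

/-- A wall at an odd position changes the path at the next position. -/
theorem groundOnes_ne {y : ℤ × ℤ} {k : ℤ} (hk : k % 2 = 1) (hw : WallAllowed m n k y x) :
    groundOnes m n i (k + 1) y ≠ groundOnes m n i (k + 1) x := by
  have h1 : ¬ (k + 1) % 2 = 1 := by omega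
  unfold WallAllowed at hw
  unfold groundOnes ground
  simp only [h1, if_false]
  split_ifs <;> omega

/-- The path changes at an even position: the particle comes from the wall at `q - 2` if there is no
wall at `q - 1`, and otherwise from the wall at `q - 1`. -/
theorem actsAt_even (hN : 0 < m - n) (d : DomainSeq m n) {q : ℤ} (hq : q % 2 = 0)
    (h1 : onesRight m n (toPath d).1 i q < (letters m n (toPath d).1 i q).2)
    (h2 : zerosLeft m n (toPath d).1 i q ≤ (letters m n (toPath d).1 i q).1) : ActsAt i d q := by
  obtain ⟨J, T, hJ0, hJ2, hT2, hJq, hqT, hJ, hT⟩ := exists_bounds_around d (q + 2)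
  rw [letters_toPath] at h1 h2
  have hp := (toPath d).2
  have b1 := groundOnes_bounds (i := i) (d.2.inRange q) q
  have h3 := zerosLeft_toPath (i := i) hN d hT hT2 hq (by omega)
  have h4 := onesRight_toPath (i := i) hN d hJ hJ2 (q := q - 2) (by omega) (by omega)
  have h5 := hp.onesRight_step (i := i) (q - 1)
  rw [letters_toPath] at h5
  have e : q - 2 + 1 = q - 1 := by ring
  rw [e] at h4
  rw [sub_add_cancel] at h5
  have b2 := groundOnes_bounds (i := i) (d.2.inRange (q - 1)) (q - 1)
  have c1 : cap m n (q - 1) = n := if_pos (by omega)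
  have c2 : cap m n q = m := if_neg (by omega)
  obtain ⟨g1, g2⟩ := sig_block_even (i := i) (d.2.inRange q) (d.2.inRange (q + 1)) hq
  obtain ⟨g3, g4⟩ := sig_block_even (i := i) (d.2.inRange (q - 2)) (d.2.inRange (q - 1))
    (k := q - 2) (by omega)
  have hw := d.2.allowed (q - 1)
  rw [walls, Set.mem_ofPred_eq, sub_add_cancel] at hw
  have g5 := sig_block_odd_cases (i := i) hN (d.2.inRange (q - 1)) (by omega) hw
  have g6 := excess_eq (m := m) (n := n) i (k := q - 1) (by omega) (d.1 (q - 1))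
  have g7 : excess m n i (q - 1) (d.1 (q - 1)) = groundOnes m n i (q - 2) (d.1 (q - 1)) +
      groundOnes m n i (q - 1) (d.1 (q - 1)) - n := by
    rw [excess, show q - 1 - 1 = q - 2 by ring]
  rw [sub_add_cancel] at g5 g6
  -- no `0` survives in the wall at `q`, and none in it together with the walls on its left
  have hB : (particleCrystal.sig i (block m n q (d.1 (q + 1)) (d.1 q))).2 = 0 := by omega
  have hU : (particleCrystal.sig i (upperWord m n d.1 T (q + 1) ++
      block m n q (d.1 (q + 1)) (d.1 q))).2 = 0 := by
    rw [CrystalData.sig_append]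
    simp only [cancel]
    omega
  by_cases hyz : d.1 q = d.1 (q - 1)
  · have e1 : groundOnes m n i q (d.1 q) = groundOnes m n i q (d.1 (q - 1)) := by rw [hyz]
    exact actsAt_of_half hN hJ0 hJ hT hq (by omega) (by omega) hyz hU hB (by omega) (by omega)
  · refine actsAt_of_pair hN hJ0 hJ hT hq (by omega) (by omega) hyz hU hB ?_
    have g8 := groundOnes_ne (i := i) (by omega) (hw hyz)
    have h6 := lowerWord_succ d.2 hJ (q - 2)
    rw [e] at h6
    rw [sub_add_cancel] at g8
    rw [h6, CrystalData.sig_append]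
    rcases g5 with ⟨g5, -⟩ | g5 | g5
    · exact absurd g5 hyz
    · omega
    · simp only [cancel]
      omega

/-- The path changes at an odd position: the domain at `q` is at the boundary, and the particle
comes from the wall at `q - 1`. -/
theorem actsAt_odd (hN : 0 < m - n) (d : DomainSeq m n) {q : ℤ} (hq : q % 2 = 1)
    (h1 : onesRight m n (toPath d).1 i q < (letters m n (toPath d).1 i q).2)
    (h2 : zerosLeft m n (toPath d).1 i q ≤ (letters m n (toPath d).1 i q).1) : ActsAt i d q := by
  obtain ⟨J, T, hJ0, hJ2, hT2, hJq, hqT, hJ, hT⟩ := exists_bounds_around d (q + 2)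
  rw [letters_toPath] at h1 h2
  have hp := (toPath d).2
  have b1 := groundOnes_bounds (i := i) (d.2.inRange q) q
  have h3 := onesRight_toPath (i := i) hN d hJ hJ2 (q := q - 1) (by omega) (by omega)
  have h4 := zerosLeft_toPath (i := i) hN d hT hT2 (q := q + 1) (by omega) (by omega)
  have h5 := hp.zerosLeft_step (i := i) q
  rw [letters_toPath] at h5
  rw [sub_add_cancel] at h3
  have b2 := groundOnes_bounds (i := i) (d.2.inRange (q + 1)) (q + 1)
  have c1 : cap m n q = n := if_pos hq
  have c2 : cap m n (q + 1) = m := if_neg (by omega)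
  obtain ⟨g1, g2⟩ := sig_block_even (i := i) (d.2.inRange (q + 1)) (d.2.inRange (q + 1 + 1))
    (k := q + 1) (by omega)
  obtain ⟨g3, g4⟩ := sig_block_even (i := i) (d.2.inRange (q - 1)) (d.2.inRange q)
    (k := q - 1) (by omega)
  have g5 := sig_block_odd_cases (i := i) hN (d.2.inRange q) hq (d.2.allowed q)
  have g6 := excess_eq (m := m) (n := n) i hq (d.1 q)
  have g7 : excess m n i q (d.1 q) = groundOnes m n i (q - 1) (d.1 q) +
      groundOnes m n i q (d.1 q) - n := rfl
  have g8 := excess_nonneg (i := i) (d.2.inRange q) hq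
  have h6 : (particleCrystal.sig i (upperWord m n d.1 T (q + 1) ++
      block m n q (d.1 (q + 1)) (d.1 q))).2 = 0 ∧ excess m n i q (d.1 q) = 0 := by
    rw [upperWord_eq d.2 hT (q + 1), CrystalData.sig_append, CrystalData.sig_append]
    simp only [cancel]
    rcases g5 with ⟨g5, g9⟩ | g5 | g5
    · have e1 : groundOnes m n i (q + 1) (d.1 (q + 1)) = groundOnes m n i (q + 1) (d.1 q) := by
        rw [g5]
      rw [g9]
      simp only
      omega
    · omega
    · omega
  exact actsAt_of_boundary hN hJ0 hJ hT hq (by omega) (by omega) h6.1 (by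
    have e1 : q - 1 + 1 = q := by ring
    omega) h6.2

/-- At the position where `f_i` changes the path, it acts on the particles as well. -/
theorem actsAt (hN : 0 < m - n) (d : DomainSeq m n) (q : ℤ)
    (h1 : onesRight m n (toPath d).1 i q < (letters m n (toPath d).1 i q).2)
    (h2 : zerosLeft m n (toPath d).1 i q ≤ (letters m n (toPath d).1 i q).1) : ActsAt i d q :=
  (Int.emod_two_eq_zero_or_one q).elim (fun hq => actsAt_even hN d hq h1 h2)
    fun hq => actsAt_odd hN d hq h1 h2

/-! ### The isomorphisms between paths, domains and particles -/

variable (h : 0 < n ∧ n < m)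

theorem toDomains_eq_iff {p : SpinPath m n} {d : DomainSeq m n} :
    toDomains h p = d ↔ p = toPath d :=
  (pathEquivDomains h).eq_symm_apply.symm

theorem domainCrystal_e_iff_f (b b' : DomainSeq m n) :
    (domainCrystal h).e i b = some b' ↔ (domainCrystal h).f i b' = some b := by
  show (pathE m n i (toPath b)).map (toDomains h) = some b' ↔
    (pathF m n i (toPath b')).map (toDomains h) = some b
  simp only [Option.map_eq_some_iff, toDomains_eq_iff, exists_eq_right]
  exact pathE_iff_pathF _ _

/-- If `pathF` is `none`, then there is no greatest position with a surviving `0`, so there are none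
of them or infinitely many. In both cases the sum is `0`, in the second one by the convention for
infinite supports. -/
theorem pathφ_eq_zero {p : SpinPath m n} (hf : pathF m n i p = none) : pathφ m n i p = 0 := by
  by_contra hc
  have hfin : {k | 0 < freeZeros m n p.1 i k}.Finite := by
    by_contra h
    refine hc (finsum_of_infinite_support ?_)
    have e : Function.support (fun k => freeZeros m n p.1 i k) = {k | 0 < freeZeros m n p.1 i k} :=
      Set.ext fun k => Nat.pos_iff_ne_zero.symm
    rw [e]
    exact h
  unfold pathF at hf
  split_ifs at hf with hg
  rcases Set.eq_empty_or_nonempty {k | 0 < freeZeros m n p.1 i k} with he | hne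
  · refine hc (finsum_eq_zero_of_forall_eq_zero fun k => ?_)
    by_contra hk
    exact (he ▸ Set.notMem_empty k : k ∉ {k | 0 < freeZeros m n p.1 i k}) (Nat.pos_of_ne_zero hk)
  · obtain ⟨k, h1, h2⟩ := Set.exists_max_image _ id hfin hne
    exact hg ⟨k, h1, fun j hj => h2 j hj⟩

/-- The bijection commutes with `f_i`: both sides vanish together, and otherwise `actsAt` applies.
-/
theorem domainsEquivNorm_f (d : DomainSeq m n) :
    (normCrystal m n).f i (domainsEquivNorm h d) =
      ((domainCrystal h).f i d).map (domainsEquivNorm h) := by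
  have hN : 0 < m - n := by omega
  show ((monoCrystal m n).f i (domainsEquivNorm h d).1).bind normalOrder =
    ((pathF m n i (toPath d)).map (toDomains h)).map (domainsEquivNorm h)
  cases hf : pathF m n i (toPath d) with
  | none =>
    have h1 := pathφ_eq_zero hf
    rw [pathφ_toPath hN] at h1
    have h2 : (monoCrystal m n).f i (domainsEquivNorm h d).1 = none :=
      ((monoCrystal_isCrystal m n).f_eq_none i _).2 h1
    rw [h2]
    rfl
  | some p =>
    obtain ⟨q, h1, h2, h3⟩ := pathF_eq_some.1 hf
    obtain ⟨d', w, g1, g2, g3, g4⟩ := actsAt hN d q h1 h2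
    obtain rfl : p = toPath d' := Subtype.ext (h3.trans g1.symm)
    have hv : Valid m n ((toState d).1, w) :=
      (stable_valid m n i _ (domainsEquivNorm h d).1.2 _).2 (stateCrystal_f_eq_some.2 ⟨rfl, g3⟩)
    have hz : (monoCrystal m n).f i (domainsEquivNorm h d).1 = some ⟨_, hv⟩ :=
      monoCrystal_f_eq_some.2 ⟨rfl, g3⟩
    have e : toDomains h (toPath d') = d' := (toDomains_eq_iff h).2 rfl
    rw [hz, Option.map_some, Option.map_some, e, Option.bind_some]
    exact normalOrder_eq (sepMono_eq_iff.2 ⟨g2.symm, g4⟩)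

theorem domainsEquivNorm_isIso :
    (domainCrystal h).IsIso (normCrystal m n) (domainsEquivNorm h) := by
  have hN : 0 < m - n := by omega
  have hε : ∀ i d, (normCrystal m n).ε i (domainsEquivNorm h d) = (domainCrystal h).ε i d :=
    fun i d => (pathε_toPath hN d).symm
  have hφ : ∀ i d, (normCrystal m n).φ i (domainsEquivNorm h d) = (domainCrystal h).φ i d :=
    fun i d => (pathφ_toPath hN d).symm
  refine .of_f (fun i => domainCrystal_e_iff_f h) (normCrystal_isCrystal m n).e_iff_f
    (fun d => ?_) hε hφ fun i d => domainsEquivNorm_f h d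
  have hp := (normCrystal_isCrystal m n).pairing_wt
  refine Prod.ext ?_ (Prod.ext ?_ ?_)
  · have := hp 0 (domainsEquivNorm h d)
    rw [hε, hφ] at this
    exact this
  · have := hp 1 (domainsEquivNorm h d)
    rw [hε, hφ] at this
    exact this
  · exact (wt_degree _).trans (domainDegree_eq d).symm

theorem domainCrystal_isCrystal : (domainCrystal h).IsCrystal :=
  (domainsEquivNorm_isIso h).isCrystal (normCrystal_isCrystal m n)

theorem toPath_toDomains (p : SpinPath m n) : toPath (toDomains h p) = p :=
  (pathEquivDomains h).symm_apply_apply p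

theorem pathEquivDomains_isIso :
    (pathCrystal m n).IsIso (domainCrystal h) (pathEquivDomains h) where
  wt p := by
    show (((pathCrystal m n).wt (toPath (toDomains h p))).1,
      ((pathCrystal m n).wt (toPath (toDomains h p))).2.1, _) = (pathCrystal m n).wt p
    rw [toPath_toDomains]
    rfl
  ε i p := congrArg (pathε m n i) (toPath_toDomains h p)
  φ i p := congrArg (pathφ m n i) (toPath_toDomains h p)
  e i p := congrArg (fun p => (pathE m n i p).map (toDomains h)) (toPath_toDomains h p)
  f i p := congrArg (fun p => (pathF m n i p).map (toDomains h)) (toPath_toDomains h p)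

theorem pathCrystal_isCrystal (h : 0 < n ∧ n < m) : (pathCrystal m n).IsCrystal :=
  (pathEquivDomains_isIso h).isCrystal (domainCrystal_isCrystal h)

end

section
/-! ### Strict morphisms of crystals -/

namespace CrystalData

variable {B₁ B₂ B₃ : Type} {C₁ : CrystalData B₁} {C₂ : CrystalData B₂} {C₃ : CrystalData B₃}

/-- A map that respects all the structure of a crystal. -/
structure IsMorphism (C₁ : CrystalData B₁) (C₂ : CrystalData B₂) (g : B₁ → B₂) : Prop where
  wt : ∀ b, C₂.wt (g b) = C₁.wt b
  ε : ∀ i b, C₂.ε i (g b) = C₁.ε i b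
  φ : ∀ i b, C₂.φ i (g b) = C₁.φ i b
  e : ∀ i b, C₂.e i (g b) = (C₁.e i b).map g
  f : ∀ i b, C₂.f i (g b) = (C₁.f i b).map g

theorem IsIso.isMorphism {g : B₁ ≃ B₂} (h : C₁.IsIso C₂ g) : C₁.IsMorphism C₂ g :=
  ⟨h.wt, h.ε, h.φ, h.e, h.f⟩

theorem Stable.isMorphism {S : Set B₁} (h : C₁.Stable S) :
    (C₁.restrict S).IsMorphism C₁ Subtype.val :=
  ⟨fun _ => rfl, fun _ _ => rfl, fun _ _ => rfl, fun i b => (h.restrict_e i b).symm,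
    fun i b => (h.restrict_f i b).symm⟩

namespace IsMorphism

theorem comp {g : B₁ → B₂} {g' : B₂ → B₃} (h' : C₂.IsMorphism C₃ g') (h : C₁.IsMorphism C₂ g) :
    C₁.IsMorphism C₃ (g' ∘ g) :=
  ⟨fun b => (h'.wt _).trans (h.wt b), fun i b => (h'.ε i _).trans (h.ε i b),
    fun i b => (h'.φ i _).trans (h.φ i b),
    fun i b => by rw [Function.comp_apply, h'.e, h.e, Option.map_map],
    fun i b => by rw [Function.comp_apply, h'.f, h.f, Option.map_map]⟩

theorem stable_preimage {g : B₁ → B₂} (h : C₁.IsMorphism C₂ g) {S : Set B₂} (hS : C₂.Stable S) :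
    C₁.Stable (g ⁻¹' S) := fun i b hb b' =>
  ⟨fun hb' => (hS i (g b) hb (g b')).1 (by rw [h.e, hb']; rfl),
    fun hb' => (hS i (g b) hb (g b')).2 (by rw [h.f, hb']; rfl)⟩

theorem stable_image {g : B₁ → B₂} (h : C₁.IsMorphism C₂ g) {A : Set B₁} (hA : C₁.Stable A) :
    C₂.Stable (g '' A) := by
  rintro i _ ⟨b, hb, rfl⟩ c
  rw [h.e, h.f, Option.map_eq_some_iff, Option.map_eq_some_iff]
  exact ⟨fun ⟨b', h1, h2⟩ => ⟨b', (hA i b hb b').1 h1, h2⟩,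
    fun ⟨b', h1, h2⟩ => ⟨b', (hA i b hb b').2 h1, h2⟩⟩

/-- A morphism that is injective on a subcrystal is an isomorphism onto its image. -/
theorem isIso_restrict {g : B₁ → B₂} (h : C₁.IsMorphism C₂ g) {A : Set B₁} (hA : C₁.Stable A)
    {S : Set B₂} (G : A ≃ S) (hG : ∀ b, (G b).1 = g b) :
    (C₁.restrict A).IsIso (C₂.restrict S) G where
  wt b := (congrArg C₂.wt (hG b)).trans (h.wt b)
  ε i b := (congrArg (C₂.ε i) (hG b)).trans (h.ε i b)
  φ i b := (congrArg (C₂.φ i) (hG b)).trans (h.φ i b)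
  e i b := by
    ext c
    rw [restrict_e_eq_some, hG, h.e, Option.map_eq_some_iff, Option.map_eq_some_iff]
    constructor
    · rintro ⟨b', h1, h2⟩
      exact ⟨⟨b', (hA i b b.2 b').1 h1⟩, restrict_e_eq_some.2 h1, Subtype.ext ((hG _).trans h2)⟩
    · rintro ⟨b', h1, rfl⟩
      exact ⟨b', restrict_e_eq_some.1 h1, (hG _).symm⟩
  f i b := by
    ext c
    rw [restrict_f_eq_some, hG, h.f, Option.map_eq_some_iff, Option.map_eq_some_iff]
    constructor
    · rintro ⟨b', h1, h2⟩
      exact ⟨⟨b', (hA i b b.2 b').2 h1⟩, restrict_f_eq_some.2 h1, Subtype.ext ((hG _).trans h2)⟩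
    · rintro ⟨b', h1, rfl⟩
      exact ⟨b', restrict_f_eq_some.1 h1, (hG _).symm⟩

end IsMorphism

end CrystalData

/-! ### Tensor products of affine crystals -/

variable {m n : ℤ} {x : ℤ × ℤ} {i : Fin 2}

theorem affZero_sig (i : Fin 2) (v : List (Fin 1 × ℤ)) : affZero.sig i v = (0, 0) := by
  induction v with
  | nil => rfl
  | cons a v ih =>
    have h1 : affZero.ε i a = 0 := by fin_cases i <;> simp [affZero, CrystalData.aff, finCrystal]
    have h2 : affZero.φ i a = 0 := by fin_cases i <;> simp [affZero, CrystalData.aff, finCrystal]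
    rw [CrystalData.sig_cons, ih, h1, h2, cancel_zero_left]

theorem affZero_listF (i : Fin 2) (v : List (Fin 1 × ℤ)) : affZero.listF i v = none := by
  induction v with
  | nil => rfl
  | cons a v ih =>
    have h2 : affZero.φ i a = 0 := by fin_cases i <;> simp [affZero, CrystalData.aff, finCrystal]
    rw [CrystalData.listF, ih, affZero_sig, h2, if_neg (by simp), Option.map_none]

theorem affTensor_e (i : Fin 2) (w : List (Fin 2 × ℤ) × List (Fin 1 × ℤ)) :
    affTensor.e i w = (affHalf.listE i w.1).map fun u => (u, w.2) :=
  if_pos (by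
    show (affZero.sig i w.2).1 ≤ _
    rw [affZero_sig]
    exact Nat.zero_le _)

theorem affTensor_f (i : Fin 2) (w : List (Fin 2 × ℤ) × List (Fin 1 × ℤ)) :
    affTensor.f i w = if 0 < (affHalf.sig i w.1).2 then
      (affHalf.listF i w.1).map fun u => (u, w.2) else none := by
  show (if (affZero.sig i w.2).1 < (affHalf.sig i w.1).2 then
    (affHalf.listF i w.1).map fun u => (u, w.2) else
    (affZero.listF i w.2).map fun u => (w.1, u)) = _
  rw [affZero_sig, affZero_listF]
  rfl

theorem sig_coordinates (z : State) :
    affHalf.sig i (coordinates z).1 = particleCrystal.sig i z.2 := by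
  obtain ⟨x, w⟩ := z
  induction w with
  | nil => rfl
  | cons A w ih =>
    rw [CrystalData.sig_cons, ← ih]
    cases A with
    | half s j l => rfl
    | zero s t l => rw [particleCrystal_ε_zero, particleCrystal_φ_zero, cancel_zero_left]; rfl

theorem listF_coordinates (x : ℤ × ℤ) (w : List Particle) :
    affHalf.listF i (coordinates (x, w)).1 =
      (particleCrystal.listF i w).map fun w' => (coordinates (x, w')).1 := by
  induction w with
  | nil => rfl
  | cons A w ih =>
    rw [CrystalData.listF]
    cases A with
    | half s j l =>
      have e : (coordinates (x, half s j l :: w)).1 = (j, l) :: (coordinates (x, w)).1 := rfl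
      have e1 : particleCrystal.φ i (half s j l) = affHalf.φ i (j, l) := rfl
      rw [e, CrystalData.listF, sig_coordinates, e1, ih]
      split_ifs
      · show _ = (((affHalf.f i (j, l)).map fun x => half s x.1 x.2).map _).map _
        cases affHalf.f i (j, l) <;> rfl
      · cases particleCrystal.listF i w <;> rfl
    | zero s t l =>
      rw [particleCrystal_φ_zero, if_neg (by omega)]
      refine Eq.trans ih ?_
      cases particleCrystal.listF i w <;> rfl

theorem listE_coordinates (x : ℤ × ℤ) (w : List Particle) :
    affHalf.listE i (coordinates (x, w)).1 =
      (particleCrystal.listE i w).map fun w' => (coordinates (x, w')).1 := by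
  induction w with
  | nil => rfl
  | cons A w ih =>
    rw [CrystalData.listE]
    cases A with
    | half s j l =>
      have e : (coordinates (x, half s j l :: w)).1 = (j, l) :: (coordinates (x, w)).1 := rfl
      have e1 : particleCrystal.φ i (half s j l) = affHalf.φ i (j, l) := rfl
      rw [e, CrystalData.listE, sig_coordinates, e1, ih]
      split_ifs
      · show _ = (((affHalf.e i (j, l)).map fun x => half s x.1 x.2).map _).map _
        cases affHalf.e i (j, l) <;> rfl
      · cases particleCrystal.listE i w <;> rfl
    | zero s t l =>
      have h0 : particleCrystal.listE i w = none → (particleCrystal.sig i w).1 = 0 :=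
        (CrystalData.listE_eq_none particleCrystal_isCrystal i w).1
      rw [particleCrystal_φ_zero, particleCrystal_e_zero]
      refine Eq.trans ih ?_
      split_ifs with h
      · rw [(CrystalData.listE_eq_none particleCrystal_isCrystal i w).2 (by omega)]
        rfl
      · cases particleCrystal.listE i w <;> rfl

/-- The operators change neither the label nor the modes of the spin-0 particles. -/
theorem label_listF {w w' : List Particle} (h : particleCrystal.listF i w = some w') :
    label (x, w') = label (x, w) ∧ (coordinates (x, w')).2 = (coordinates (x, w)).2 := by
  induction w generalizing w' with
  | nil => simp [CrystalData.listF] at h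
  | cons A w ih =>
    rw [CrystalData.listF] at h
    split_ifs at h
    · obtain ⟨A', hA, rfl⟩ := Option.map_eq_some_iff.1 h
      cases A with
      | half s j l =>
        obtain ⟨a, -, rfl⟩ := Option.map_eq_some_iff.1
          (show (affHalf.f i (j, l)).map (fun x => half s x.1 x.2) = some A' from hA)
        exact ⟨rfl, rfl⟩
      | zero s t l => simp [particleCrystal_f_zero] at hA
    · obtain ⟨v, hv, rfl⟩ := Option.map_eq_some_iff.1 h
      obtain ⟨h1, h2⟩ := ih hv
      simp only [label, coordinates, Prod.mk.injEq, true_and] at h1 h2 ⊢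
      cases A <;> simp only [List.filterMap_cons, h1, h2, and_self]

theorem label_listE {w w' : List Particle} (h : particleCrystal.listE i w = some w') :
    label (x, w') = label (x, w) ∧ (coordinates (x, w')).2 = (coordinates (x, w)).2 := by
  obtain ⟨h1, h2⟩ := label_listF (x := x)
    ((CrystalData.listE_iff_listF particleCrystal_isCrystal i w w').1 h)
  exact ⟨h1.symm, h2.symm⟩

theorem stable_label (c : Label) : stateCrystal.Stable {z | label z = c} := by
  rintro i ⟨x, w⟩ hz ⟨x', w'⟩
  rw [stateCrystal_e_eq_some, stateCrystal_f_eq_some]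
  refine ⟨?_, ?_⟩ <;> rintro ⟨rfl, h⟩
  · exact (label_listE h).1.trans hz
  · exact (label_listF h).1.trans hz

/-- The spin-0 particles are trivial for the crystal structure, and therefore they can be split
off. -/
theorem coordinates_isMorphism : stateCrystal.IsMorphism affTensor coordinates where
  wt := by
    rintro ⟨x, w⟩
    show ((coordinates (x, w)).1.map affHalf.wt).sum + ((coordinates (x, w)).2.map affZero.wt).sum =
      (w.map particleCrystal.wt).sum
    induction w with
    | nil => rfl
    | cons A w ih =>
      rw [List.map_cons, List.sum_cons, ← ih]
      cases A with
      | half s j l => exact add_assoc _ _ _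
      | zero s t l => exact add_left_comm _ _ _
  ε i z := by
    show (cancel (affHalf.sig i (coordinates z).1) (affZero.sig i (coordinates z).2)).1 = _
    rw [affZero_sig, cancel_zero_right, sig_coordinates]
    rfl
  φ i z := by
    show (cancel (affHalf.sig i (coordinates z).1) (affZero.sig i (coordinates z).2)).2 = _
    rw [affZero_sig, cancel_zero_right, sig_coordinates]
    rfl
  e i z := by
    obtain ⟨x, w⟩ := z
    rw [affTensor_e, listE_coordinates]
    show _ = ((particleCrystal.listE i w).map _).map _
    cases h : particleCrystal.listE i w with
    | none => rfl
    | some w' => exact congrArg some (Prod.ext rfl (label_listE (x := x) h).2.symm)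
  f i z := by
    obtain ⟨x, w⟩ := z
    rw [affTensor_f, listF_coordinates, sig_coordinates]
    show _ = ((particleCrystal.listF i w).map _).map _
    cases h : particleCrystal.listF i w with
    | none => exact ite_self _
    | some w' =>
      rw [if_pos]
      · exact congrArg some (Prod.ext rfl (label_listF (x := x) h).2.symm)
      · rw [Nat.pos_iff_ne_zero, Ne, ← CrystalData.listF_eq_none particleCrystal_isCrystal, h]
        exact Option.some_ne_none _

theorem coordinates_mem_tensorPart (z : Mono m n) : coordinates z.1 ∈ tensorPart (label z.1) := by
  suffices key : ∀ w : List Particle, (∀ A ∈ w, A.Meaningful) →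
      coordinates (z.1.1, w) ∈ tensorPart (label (z.1.1, w)) from key z.1.2 z.2.meaningful
  intro w hm
  induction w with
  | nil => exact ⟨.nil, .nil⟩
  | cons A w ih =>
    obtain ⟨h1, h2⟩ := ih fun B hB => hm B (List.mem_cons_of_mem _ hB)
    have hA := hm A List.mem_cons_self
    cases A with
    | half s j l => exact ⟨.cons hA h1, h2⟩
    | zero s t l => exact ⟨h1, .cons hA h2⟩

/-- The operators keep the parities of the degrees, relative to the indices `j`. -/
theorem forall₂_listF {σ : List ℤˣ} {u u' : List (Fin 2 × ℤ)}
    (hu : List.Forall₂ (fun s x => s * (-1) ^ x.1.val = (-1) ^ x.2) σ u)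
    (h : affHalf.listF i u = some u') :
    List.Forall₂ (fun s x => s * (-1) ^ x.1.val = (-1) ^ x.2) σ u' := by
  induction hu generalizing u' with
  | nil => simp [CrystalData.listF] at h
  | @cons s a σ u ha hu ih =>
    rw [CrystalData.listF] at h
    split_ifs at h
    · obtain ⟨a', ha', rfl⟩ := Option.map_eq_some_iff.1 h
      exact .cons (meaningful_f (A := half s a.1 a.2) (A' := half s a'.1 a'.2)
        (by show (affHalf.f i a).map _ = _; rw [ha']; rfl) ha) hu
    · obtain ⟨v, hv, rfl⟩ := Option.map_eq_some_iff.1 h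
      exact .cons ha (ih hv)

theorem forall₂_listE {σ : List ℤˣ} {u u' : List (Fin 2 × ℤ)}
    (hu : List.Forall₂ (fun s x => s * (-1) ^ x.1.val = (-1) ^ x.2) σ u)
    (h : affHalf.listE i u = some u') :
    List.Forall₂ (fun s x => s * (-1) ^ x.1.val = (-1) ^ x.2) σ u' := by
  induction hu generalizing u' with
  | nil => simp [CrystalData.listE] at h
  | @cons s a σ u ha hu ih =>
    rw [CrystalData.listE] at h
    split_ifs at h
    · obtain ⟨a', ha', rfl⟩ := Option.map_eq_some_iff.1 h
      exact .cons (meaningful_e (A := half s a.1 a.2) (A' := half s a'.1 a'.2)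
        (by show (affHalf.e i a).map _ = _; rw [ha']; rfl) ha) hu
    · obtain ⟨v, hv, rfl⟩ := Option.map_eq_some_iff.1 h
      exact .cons ha (ih hv)

theorem stable_tensorPart (c : Label) : affTensor.Stable (tensorPart c) := by
  rintro i ⟨u, v⟩ ⟨h1, h2⟩ ⟨u', v'⟩
  rw [affTensor_e, affTensor_f]
  constructor
  · intro h
    obtain ⟨u₁, h3, h4⟩ := Option.map_eq_some_iff.1 h
    obtain ⟨rfl, rfl⟩ := Prod.mk.injEq .. ▸ h4
    exact ⟨forall₂_listE h1 h3, h2⟩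
  · intro h
    split_ifs at h
    obtain ⟨u₁, h3, h4⟩ := Option.map_eq_some_iff.1 h
    obtain ⟨rfl, rfl⟩ := Prod.mk.injEq .. ▸ h4
    exact ⟨forall₂_listF h1 h3, h2⟩

theorem coordinates_fst_of_isChain {s t : ℤˣ} {l : ℤ} {w : List Particle}
    (h : (zero s t l :: w).IsChain SepPair) : (coordinates (x, zero s t l :: w)).1 = [] := by
  induction w generalizing s t l with
  | nil => rfl
  | cons A w ih =>
    rw [List.isChain_cons_cons] at h
    cases A with
    | half => exact h.1.elim
    | zero => exact ih h.2

/-- A separately ordered product is determined by its label and its coordinates. -/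
theorem eq_of_coordinates {w w' : List Particle} (hw : w.IsChain SepPair) (hw' : w'.IsChain SepPair)
    (hl : label (x, w) = label (x, w')) (hc : coordinates (x, w) = coordinates (x, w')) :
    w = w' := by
  induction w generalizing w' with
  | nil =>
    rcases w' with - | ⟨_ | _, w'⟩
    · rfl
    · simp [coordinates] at hc
    · simp [coordinates] at hc
  | cons A w ih =>
    rcases w' with - | ⟨B, w'⟩
    · cases A <;> simp [coordinates] at hc
    · have ih := ih (w' := w') hw.tail hw'.tail
      cases A with
      | half s j l =>
        cases B with
        | half s' j' l' =>
          simp only [coordinates, label, List.filterMap_cons, Prod.mk.injEq, List.cons.injEq,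
            true_and] at hc hl ih
          obtain ⟨⟨⟨rfl, rfl⟩, h1⟩, h2⟩ := hc
          obtain ⟨⟨rfl, h3⟩, h4⟩ := hl
          rw [ih ⟨h3, h4⟩ ⟨h1, h2⟩]
        | zero s' t' l' =>
          have := congrArg Prod.fst hc
          rw [coordinates_fst_of_isChain hw'] at this
          simp [coordinates] at this
      | zero s t l =>
        cases B with
        | half s' j' l' =>
          have := congrArg Prod.fst hc
          rw [coordinates_fst_of_isChain hw] at this
          simp [coordinates] at this
        | zero s' t' l' =>
          simp only [coordinates, label, List.filterMap_cons, Prod.mk.injEq, List.cons.injEq,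
            true_and] at hc hl ih
          obtain ⟨h1, rfl, h2⟩ := hc
          obtain ⟨h3, ⟨rfl, rfl⟩, h4⟩ := hl
          rw [ih ⟨h3, h4⟩ ⟨h1, h2⟩]

theorem separatelyOrdered_ext {z z' : separatelyOrdered m n} (hl : label z.1.1 = label z'.1.1)
    (hc : coordinates z.1.1 = coordinates z'.1.1) : z = z' := by
  obtain ⟨⟨⟨x, w⟩, hv⟩, hz⟩ := z
  obtain ⟨⟨⟨x', w'⟩, hv'⟩, hz'⟩ := z'
  obtain rfl : x = x' := congrArg Prod.fst hl
  obtain rfl := eq_of_coordinates hz hz' hl hc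
  rfl

end

end AltSpin

end

theorem mainTheorem2 (m n : ℤ) (h : 0 < n ∧ n < m) :
    -- the five sets are crystals, and `𝒩` is a subcrystal of the crystal part of `𝒜`
    (AltSpin.pathCrystal m n).IsCrystal ∧
    (AltSpin.domainCrystal h).IsCrystal ∧
    (AltSpin.normCrystal m n).IsCrystal ∧
    (AltSpin.monoCrystal m n).IsCrystal ∧
    (AltSpin.sepCrystal m n).IsCrystal ∧
    AltSpin.stateCrystal.Stable {z | AltSpin.Valid m n z} ∧
    (AltSpin.monoCrystal m n).Stable (AltSpin.separatelyOrdered m n) ∧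
    -- both kinds of ordered products are bases of `𝒜/ℛ`
    LinearIndependent ℂ (fun z : AltSpin.separatelyOrdered m n => AltSpin.vec z.1) ∧
    Submodule.span ℂ (Set.range fun z : AltSpin.separatelyOrdered m n => AltSpin.vec z.1) = ⊤ ∧
    LinearIndependent ℂ (fun z : AltSpin.normallyOrdered m n => AltSpin.vec z.1) ∧
    Submodule.span ℂ (Set.range fun z : AltSpin.normallyOrdered m n => AltSpin.vec z.1) = ⊤ ∧
    ∃ (Φ : AltSpin.SpinPath m n ≃ AltSpin.DomainSeq m n)
      (Θ : AltSpin.DomainSeq m n ≃ AltSpin.normallyOrdered m n)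
      (Ξ : AltSpin.normallyOrdered m n ≃ AltSpin.separatelyOrdered m n),
      -- `𝒫 ≃ 𝒟`, by the domain wall description and its inverse
      (∀ p, Φ p = AltSpin.toDomains h p) ∧
      (∀ d, Φ.symm d = AltSpin.toPath d) ∧
      (AltSpin.pathCrystal m n).IsIso (AltSpin.domainCrystal h) Φ ∧
      -- `𝒟 ≃ 𝒩_o`, by replacing elementary walls by particles
      (∀ d, (Θ d).1.1 = AltSpin.toState d) ∧
      (AltSpin.domainCrystal h).IsIso (AltSpin.normCrystal m n) Θ ∧
      -- `𝒩_o ≃ 𝒩`, by reordering modulo sign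
      (∀ y, AltSpin.SameUpToSign y.1 (Ξ y).1) ∧
      (AltSpin.normCrystal m n).IsIso (AltSpin.sepCrystal m n) Ξ ∧
      -- `𝒫` is the disjoint union of the sets of paths with a given label, each of which is
      -- isomorphic to a subcrystal of a tensor product of affine crystals
      ∀ c : AltSpin.Label,
        (AltSpin.pathCrystal m n).Stable {p | AltSpin.label (Ξ (Θ (Φ p))).1.1 = c} ∧
        AltSpin.affTensor.Stable (AltSpin.tensorPart c) ∧
        ∃ S ⊆ AltSpin.tensorPart c, AltSpin.affTensor.Stable S ∧
          ∃ g : {p | AltSpin.label (Ξ (Θ (Φ p))).1.1 = c} ≃ S,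
            (∀ p, (g p).1 = AltSpin.coordinates (Ξ (Θ (Φ p.1))).1.1) ∧
            ((AltSpin.pathCrystal m n).restrict {p | AltSpin.label (Ξ (Θ (Φ p))).1.1 = c}).IsIso
              (AltSpin.affTensor.restrict S) g := by
  open AltSpin in
  refine ⟨pathCrystal_isCrystal h, domainCrystal_isCrystal h, normCrystal_isCrystal m n,
    monoCrystal_isCrystal m n, sepCrystal_isCrystal m n, stable_valid m n,
    stable_separatelyOrdered m n, linearIndependent_separatelyOrdered m n,
    span_separatelyOrdered m n, linearIndependent_normallyOrdered m n, span_normallyOrdered m n,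
    pathEquivDomains h, domainsEquivNorm h, normEquivSep m n, fun _ => rfl, fun _ => rfl,
    pathEquivDomains_isIso h, fun _ => rfl, domainsEquivNorm_isIso h,
    fun y => Or.inl (vec_normEquivSep y).symm, normEquivSep_isIso m n, fun c => ?_⟩
  -- the state of a path depends on it by a morphism of crystals
  have hT : (AltSpin.pathCrystal m n).IsMorphism AltSpin.stateCrystal
      (fun p => (AltSpin.normEquivSep m n
        (AltSpin.domainsEquivNorm h (AltSpin.pathEquivDomains h p))).1.1) :=
    (AltSpin.stable_valid m n).isMorphism.comp
      ((AltSpin.stable_separatelyOrdered m n).isMorphism.comp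
        ((AltSpin.normEquivSep_isIso m n).isMorphism.comp
          ((AltSpin.domainsEquivNorm_isIso h).isMorphism.comp
            (AltSpin.pathEquivDomains_isIso h).isMorphism)))
  have hA := hT.stable_preimage (AltSpin.stable_label c)
  have hC := AltSpin.coordinates_isMorphism.comp hT
  have hinj : Set.InjOn (AltSpin.coordinates ∘ fun p => (AltSpin.normEquivSep m n
      (AltSpin.domainsEquivNorm h (AltSpin.pathEquivDomains h p))).1.1) {p | AltSpin.label
        (AltSpin.normEquivSep m n (AltSpin.domainsEquivNorm h
          (AltSpin.pathEquivDomains h p))).1.1 = c} := fun p hp p' hp' hpp' =>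
    (AltSpin.pathEquivDomains h).injective ((AltSpin.domainsEquivNorm h).injective
      ((AltSpin.normEquivSep m n).injective
        (AltSpin.separatelyOrdered_ext (Eq.trans hp (Eq.symm hp')) hpp')))
  refine ⟨hA, AltSpin.stable_tensorPart c, _, ?_, hC.stable_image hA, hinj.bijOn_image.equiv, fun _ => rfl,
    hC.isIso_restrict hA _ fun _ => rfl⟩
  rintro _ ⟨p, hp, rfl⟩
  rw [← show AltSpin.label _ = c from hp]
  exact AltSpin.coordinates_mem_tensorPart _
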